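/- Let $\lambda(x)=\sum_{i\ge1}\lambda_i x^{i-1}$ and $\rho(x)=\sum_{i\ge1}\rho_i x^{i-1}$ be polynomials with nonnegative coefficients and $\lambda(1)=\rho(1)=1$ (edge-perspective degree distributions). Let $L(x)=\int_0^x\lambda/\int_0^1\lambda$ and $R(x)=\int_0^x\rho/\int_0^1\rho$ be the node-perspective distributions, so that $L_d$ (resp. $R_d$) is the fraction of variable (resp. check) nodes of degree $d$. Consider the ensemble $\mathrm{LDPC}(n,\lambda,\rho)$: there are $n$ variable nodes and some number of check nodes, the degrees are uniformly bounded in $n$, the two sides have the same number of sockets, the fractions of variable and check nodes of degree $d$ equal (or, as $n\to\infty$, converge to) $L_d$ and $R_d$, and the Tanner (multi)graph is given by a uniformly random bijection between variable sockets and check sockets. Transmit over the binary erasure channel with erasure probability $\epsilon\in[0,1]$ and run belief propagation, with all check-to-variable messages erased at time $0$. Let $\mu_i^{(\ell)}\in\{0,1\}$ indicate that the variable-to-check message on edge $i$ at iteration $\ell$ is an erasure; a variable-to-check message is an erasure iff the received symbol and all other incoming messages of the variable node are erased, and a check-to-variable message at time $\ell+1$ is an erasure iff some other variable-to-check message entering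 the check node at time $\ell$ is erased. Let $y_0=1$, $x_\ell=\epsilon\lambda(y_\ell)$, $y_{\ell+1}=1-\rho(1-x_\ell)$. The limits $x=\lim_\ell x_\ell$ and $y=\lim_\ell y_\ell=\inf_\ell y_\ell$ exist, with $x=\epsilon\lambda(y)$. Put $\bar x=1-x$ and $\delta(\epsilon)=1-\epsilon\lambda'(y)\rho'(\bar x)$. (a) For every $\ell\ge0$ the limit $$\mathcal V^{(\ell)}=\lim_{n\to\infty}\frac{\mathbb E[(\sum_i\mu_i^{(\ell)})^2]-\mathbb E[\sum_i\mu_i^{(\ell)}]^2}{nL'(1)}$$ exists, and if $\delta(\epsilon)\ne0$ then $\lim_{\ell\to\infty}\mathcal V^{(\ell)}=\mathcal V(\epsilon)$, where $$\begin{aligned}\mathcal V(\epsilon)={}&\frac{\epsilon^2\lambda'(y)^2\big(\rho(\bar x)^2-\rho(\bar x^2)+\rho'(\bar x)(1-2x\rho(\bar x))-\bar x^2\rho'(\bar x^2)\big)}{\delta(\epsilon)^2}\\&+\frac{\epsilon^2\lambda'(y)^2\rho'(\bar x)^2\big(\epsilon^2\lambda(y)^2-\epsilon^2\lambda(y^2)-y^2\epsilon^2\lambda'(y^2)\big)}{\delta(\epsilon)^2}\\&+\frac{\big(x-\epsilon^2\lambda(y^2)-y^2\epsilon^2\lambda'(y^2)\big)\big(1+\epsilon\lambda'(y)\rho'(\bar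 x)\big)+\epsilon y^2\lambda'(y)}{\delta(\epsilon)}.\end{aligned}$$ (b) Let $\epsilon^*$ be the supremum of the $\epsilon\in[0,1]$ such that $\epsilon\lambda(y)\,[y-1+\rho(1-\epsilon\lambda(y))]>0$ for all $y\in(0,1]$. Suppose that $\epsilon^*<1$, that $h(y)=y-1+\rho(1-\epsilon^*\lambda(y))$ has exactly one critical point in $[0,1]$, i.e. exactly one $y^*\in[0,1]$ with $h(y^*)=h'(y^*)=0$, that $y^*>0$, and that $h''(y^*)\neq0$. Then, as $\epsilon\downarrow\epsilon^*$, $\delta(\epsilon)$ is positive and tends to $0$, and $$\mathcal V(\epsilon)=\frac{\gamma}{\delta(\epsilon)^2}+O\big(\delta(\epsilon)^{-1}\big),$$ where, with $x^*=\epsilon^*\lambda(y^*)$ and $\bar x^*=1-x^*$, $$\gamma=\epsilon^{*2}\lambda'(y^*)^2\Big\{\rho(\bar x^*)^2-\rho(\bar x^{*2})+\rho'(\bar x^*)(1-2x^*\rho(\bar x^*))-\bar x^{*2}\rho'(\bar x^{*2})+\epsilon^{*2}\rho'(\bar x^*)^2\big[\lambda(y^*)^2-\lambda(y^{*2})-y^{*2}\lambda'(y^{*2})\big]\Big\}.$$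 -/

import Mathlib

open Filter Topology Polynomial

namespace LDPC

noncomputable section

/-! ### Degree distributions

An edge-perspective degree distribution is a real polynomial `∑ᵢ λᵢ x^(i-1)`: the coefficient of
`x^i` is the fraction of edges attached to nodes of degree `i + 1`. -/

/-- Edge-perspective degree distribution: nonnegative coefficients that sum to one. -/
def IsEdgeDist (p : ℝ[X]) : Prop :=
  (∀ i, 0 ≤ p.coeff i) ∧ p.eval 1 = 1

/-- The node-perspective polynomial `(∫₀ˣ p) / (∫₀¹ p)`; its coefficient at `x^d` is the fraction of
nodes of degree `d`. -/
def nodeDist (p : ℝ[X]) : ℝ[X] :=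
  C ((∑ i ∈ p.support, p.coeff i / ((i : ℝ) + 1))⁻¹) *
    ∑ i ∈ p.support, monomial (i + 1) (p.coeff i / ((i : ℝ) + 1))

/-- The average node degree, i.e. the derivative of the node-perspective polynomial at `1`. -/
def avgDegree (p : ℝ[X]) : ℝ := (derivative (nodeDist p)).eval 1

/-! ### Finite ensembles (configuration model) -/

/-- The degrees of the `n` variable nodes and of the `m` check nodes of a Tanner graph. -/
structure Degrees where
  n : ℕ
  m : ℕ
  dv : Fin n → ℕ
  dc : Fin m → ℕ
  balanced : ∑ v, dv v = ∑ c, dc c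

namespace Degrees

variable (T : Degrees)

/-- Sockets of the variable nodes. They also label the edges of the graph. -/
abbrev VSocket : Type := Σ v : Fin T.n, Fin (T.dv v)

/-- Sockets of the check nodes. -/
abbrev CSocket : Type := Σ c : Fin T.m, Fin (T.dc c)

/-- A Tanner (multi)graph with the given degrees: a matching of variable sockets with check
sockets. The ensemble is the uniform distribution on these. -/
abbrev Graph : Type := T.VSocket ≃ T.CSocket

/-- A realization of the erasure channel: `true` marks an erased variable node. -/
abbrev Channel : Type := Fin T.n → Bool

variable {T}

/-- One variable-to-check step: given which check-to-variable messages are erased, the message sent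
along edge `e` is erased iff the received symbol is erased and all messages that enter the variable
node along its other edges are erased. -/
def varStep (w : T.Channel) (inc : T.VSocket → Prop) (e : T.VSocket) : Prop :=
  w e.1 = true ∧ ∀ e' : T.VSocket, e' ≠ e → e'.1 = e.1 → inc e'

/-- One check-to-variable step: the message sent along edge `e` is erased iff some message that
enters the check node along another of its edges is erased. -/
def checkStep (G : T.Graph) (inc : T.VSocket → Prop) (e : T.VSocket) : Prop :=
  ∃ e' : T.VSocket, e' ≠ e ∧ (G e').1 = (G e).1 ∧ inc e'

/-- Erased check-to-variable messages at each iteration of belief propagation; all of them are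
erased at time `0`. -/
def checkErased (G : T.Graph) (w : T.Channel) : ℕ → T.VSocket → Prop
  | 0 => fun _ => True
  | i + 1 => checkStep G (varStep w (checkErased G w i))

/-- Erased variable-to-check messages at iteration `i`. -/
def varErased (G : T.Graph) (w : T.Channel) (i : ℕ) : T.VSocket → Prop :=
  varStep w (checkErased G w i)

open Classical in
/-- The indicator that the variable-to-check message along `e` at iteration `i` is erased. -/
def mu (G : T.Graph) (w : T.Channel) (i : ℕ) (e : T.VSocket) : ℝ :=
  if varErased G w i e then 1 else 0

/-- The number of erased variable-to-check messages at iteration `i`. -/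
def numErased (i : ℕ) (G : T.Graph) (w : T.Channel) : ℝ := ∑ e, mu G w i e

variable (T)

/-- Expectation over a uniformly random graph and independent erasures of probability `ε`. -/
def expect (ε : ℝ) (f : T.Graph → T.Channel → ℝ) : ℝ :=
  (∑ G : T.Graph, ∑ w : T.Channel, (∏ v, if w v = true then ε else 1 - ε) * f G w) /
    (Fintype.card T.Graph : ℝ)

/-- `E[(∑ μᵢ)²] - E[∑ μᵢ]²` after `i` iterations. -/
def messageVariance (ε : ℝ) (i : ℕ) : ℝ :=
  T.expect ε (fun G w => numErased i G w ^ 2) - T.expect ε (numErased i) ^ 2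

end Degrees

/-- A sequence of degree assignments that realizes the pair `(lam, rho)` in the limit of infinite
blocklength: bounded degrees, and the fractions of variable and of check nodes of each degree
converge to those prescribed by `lam` and `rho` (they may be equal to them). -/
structure Realizes (lam rho : ℝ[X]) (T : ℕ → Degrees) : Prop where
  blocklength : Tendsto (fun k => (T k).n) atTop atTop
  bounded : ∃ D : ℕ, ∀ k, (∀ v, (T k).dv v ≤ D) ∧ ∀ c, (T k).dc c ≤ D
  varFraction : ∀ d : ℕ, Tendsto
    (fun k => (Fintype.card {v // (T k).dv v = d} : ℝ) / ((T k).n : ℝ)) atTop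
    (𝓝 ((nodeDist lam).coeff d))
  checkFraction : ∀ d : ℕ, Tendsto
    (fun k => (Fintype.card {c // (T k).dc c = d} : ℝ) / ((T k).m : ℝ)) atTop
    (𝓝 ((nodeDist rho).coeff d))

/-! ### Density evolution -/

/-- Density evolution `y₀ = 1`, `yᵢ₊₁ = 1 - ρ(1 - ε λ(yᵢ))`. -/
def deY (lam rho : ℝ[X]) (ε : ℝ) : ℕ → ℝ
  | 0 => 1
  | i + 1 => 1 - rho.eval (1 - ε * lam.eval (deY lam rho ε i))

/-- `xᵢ = ε λ(yᵢ)`. -/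
def deX (lam rho : ℝ[X]) (ε : ℝ) (i : ℕ) : ℝ := ε * lam.eval (deY lam rho ε i)

/-- The limit `y` of the nonincreasing sequence `yᵢ`. -/
def limY (lam rho : ℝ[X]) (ε : ℝ) : ℝ := ⨅ i, deY lam rho ε i

/-- The limit `x = ε λ(y)` of `xᵢ`. -/
def limX (lam rho : ℝ[X]) (ε : ℝ) : ℝ := ε * lam.eval (limY lam rho ε)

/-- `1 - ε λ'(y) ρ'(1 - x)` at the limit point of density evolution. -/
def gap (lam rho : ℝ[X]) (ε : ℝ) : ℝ :=
  1 - ε * (derivative lam).eval (limY lam rho ε) * (derivative rho).eval (1 - limX lam rho ε)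

/-! ### The closed form of the limiting variance -/

/-- The numerator of the terms of second order in `1 / (1 - ε λ'(y) ρ'(1 - x))`. -/
def leadingCoeff (lam rho : ℝ[X]) (ε x y : ℝ) : ℝ :=
  ε ^ 2 * (derivative lam).eval y ^ 2 *
      (rho.eval (1 - x) ^ 2 - rho.eval ((1 - x) ^ 2)
        + (derivative rho).eval (1 - x) * (1 - 2 * x * rho.eval (1 - x))
        - (1 - x) ^ 2 * (derivative rho).eval ((1 - x) ^ 2))
    + ε ^ 2 * (derivative lam).eval y ^ 2 * (derivative rho).eval (1 - x) ^ 2 *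
      (ε ^ 2 * lam.eval y ^ 2 - ε ^ 2 * lam.eval (y ^ 2)
        - y ^ 2 * ε ^ 2 * (derivative lam).eval (y ^ 2))

/-- The limiting normalized variance as a function of `ε` and of the limit `(x, y)` of density
evolution. -/
def limitVariance (lam rho : ℝ[X]) (ε : ℝ) : ℝ :=
  let y := limY lam rho ε
  let x := limX lam rho ε
  leadingCoeff lam rho ε x y / gap lam rho ε ^ 2
    + ((x - ε ^ 2 * lam.eval (y ^ 2) - y ^ 2 * ε ^ 2 * (derivative lam).eval (y ^ 2))
          * (1 + ε * (derivative lam).eval y * (derivative rho).eval (1 - x))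
        + ε * y ^ 2 * (derivative lam).eval y) / gap lam rho ε

/-! ### Threshold and critical points -/

/-- `y - 1 + ρ(1 - ε λ(y))`. -/
def deGap (lam rho : ℝ[X]) (ε y : ℝ) : ℝ := y - 1 + rho.eval (1 - ε * lam.eval y)

/-- The fraction of degree-one check nodes, `r₁(y) = ε λ(y) (y - 1 + ρ(1 - ε λ(y)))`. -/
def rOne (lam rho : ℝ[X]) (ε y : ℝ) : ℝ := ε * lam.eval y * deGap lam rho ε y

/-- The threshold erasure probability. -/
def threshold (lam rho : ℝ[X]) : ℝ :=
  sSup {ε : ℝ | ε ∈ Set.Icc (0 : ℝ) 1 ∧ ∀ y ∈ Set.Ioc (0 : ℝ) 1, 0 < rOne lam rho ε y}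

/-- Critical points at the threshold: `y - 1 + ρ(1 - ε* λ(y))` vanishes with its derivative. -/
def IsCriticalPoint (lam rho : ℝ[X]) (y : ℝ) : Prop :=
  y ∈ Set.Icc (0 : ℝ) 1 ∧ deGap lam rho (threshold lam rho) y = 0 ∧
    deriv (deGap lam rho (threshold lam rho)) y = 0

end

end LDPC

namespace LDPC

noncomputable section

/-! ### Concentration for functions with bounded differences -/

/-! Let `N` be the number of edges. For fixed `l` the covariances of the sums of the messages at
iterations `t` and `l`, divided by `N`, satisfy a recursion in `t`; the variance is the diagonal
value `t = l`.

The engine is an exchange argument. The law of the matching is invariant when two edges `a`, `a'`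
exchange their partners. If `φ` looks only behind the variable end of an edge and `χ` only behind
its check end, the exchange turns `φ(a) χ(G a)` into `φ(a) χ(G a')`, except for `O(N)` pairs on
average that are close to each other or meet a short cycle. Summing over all pairs replaces `N ∑ φχ`
by `(∑ φ)(∑ χ)`. Tested against `1`, this says that the two ends of an edge are asymptotically
independent (`negl_glue`), so that edge averages follow density evolution. Tested against the
deviation of a sum `f`, it leaves one more term, the change of `f` under the exchange. If this
change is bilinear, `∑ (p(a) - p(a'))(q(G a) - q(G a'))`, a product rule results (`negl_cov_mul`):
`cov(φχ, f)` is `avg φ · cov(χ, f) + avg χ · cov(φ, f)` plus the products of the one-edge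
covariances of `φ, p` and of `χ, q`. The errors are controlled by fourth moments, from a Hoeffding
argument for bounded differences (`expect_fourth_le`), and by the bounded expected number of edges
on short cycles (`exists_expect_closed_le`).

For `f` the number of erased messages the change is computable exactly: away from short cycles at
most one input of each node is affected, so every node acts linearly, and the adjoint recursion
`Jr`, `Ir` carries the final count back to the exchanged edges (`hasResponse_muR`) or to one channel
output (`chan_response`). Since messages are zero-one valued and decrease in time, products of
messages at different times are again messages, and all averages that occur close up.

To apply the product rule to a whole message, the node sum is telescoped: `∑ᵢ ∏_{j≠i} ηⱼ - ∑ᵢ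
c^(d-1) = ∑ₖ κₖ (ηₖ - c)`, where `κₖ` does not involve `ηₖ` and is therefore local on the other side
of edge `k`. The mean of `κ` supplies the factors `ε λ'(y_t)` and `ρ'(1 - x_t)`. The remaining
correlation with the response is evaluated by reading the same telescoping backwards, because the
response is, up to harmless terms, a function of the node alone (`sum_resp_eq`, `sum_resp_eq'`).
This gives `covLim` (`tendsto_cov_muR`, `tendsto_cov_etaR`).

As the iterations grow, the responses behave like `(1 - δ)^n`. For `δ > 0` they are dominated by a
geometric series, so the sources sum to terms in `1/δ`, and the recursion, whose slope tends to `1 -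
δ`, contributes a second division by `δ`. A negative `δ` forces `y = 1`, hence `ε = 1` and `ρ(0) =
0`; then density evolution does not move and both the variances and the closed form vanish.

For the second claim, `h` is nonnegative at the threshold and has a double zero at `y*`, so `h(y) =
(y - y*)² Q(y)` with `Q(y*) > 0`. Comparing `h` at the parameters `ε` and `ε*` gives `ε - ε* = O((y
- y*)²)`, while `δ ≥ c (y - y*)`. Hence `(ε, y)` is within `O(δ)` of `(ε*, y*)`, and the smooth
numerator over `δ²` may be frozen at the critical point with an error `O(1/δ)`
(`eventually_le_gap`). -/

lemma exp_le_cosh_add {C x : ℝ} (hC : 0 < C) (hx : |x| ≤ C) :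
    Real.exp x ≤ Real.cosh C + x * (Real.sinh C / C) := by
  have h := abs_le.1 hx
  -- The chord of `exp` over `[-C, C]`: the weights `(C ± x)/(2C)` represent `x` as a convex
  -- combination of `±C`.
  have hc := convexOn_exp.2 (Set.mem_univ C) (Set.mem_univ (-C))
    (div_nonneg (by linarith) (by linarith) : 0 ≤ (C + x) / (2 * C))
    (div_nonneg (by linarith) (by linarith) : 0 ≤ (C - x) / (2 * C))
    (by field_simp; ring)
  have e : ((C + x) / (2 * C)) • C + ((C - x) / (2 * C)) • (-C) = x := by
    simp only [smul_eq_mul]; field_simp; ring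
  rw [e] at hc
  refine hc.trans (le_of_eq ?_)
  rw [Real.cosh_eq, Real.sinh_eq]
  simp only [smul_eq_mul]
  field_simp
  ring

/-- Hoeffding's lemma for a finite probability space. -/
lemma sum_mul_exp_le {ι : Type*} (s : Finset ι) (p x : ι → ℝ) {C : ℝ} (hC : 0 < C)
    (hp : ∀ i ∈ s, 0 ≤ p i) (hs : ∑ i ∈ s, p i = 1) (hx : ∀ i ∈ s, |x i| ≤ C)
    (hm : ∑ i ∈ s, p i * x i = 0) :
    ∑ i ∈ s, p i * Real.exp (x i) ≤ Real.exp (C ^ 2 / 2) := by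
  calc ∑ i ∈ s, p i * Real.exp (x i)
      ≤ ∑ i ∈ s, p i * (Real.cosh C + x i * (Real.sinh C / C)) :=
        Finset.sum_le_sum fun i hi =>
          mul_le_mul_of_nonneg_left (exp_le_cosh_add hC (hx i hi)) (hp i hi)
    _ = Real.cosh C := by
        simp only [mul_add, Finset.sum_add_distrib, ← Finset.sum_mul, hs, one_mul]
        simp only [← mul_assoc, ← Finset.sum_mul, hm, zero_mul, add_zero]
    _ ≤ _ := Real.cosh_le_exp_half_sq C

lemma abs_sub_wavg_le {ι : Type*} (s : Finset ι) (p m : ι → ℝ) {C : ℝ}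
    (hp : ∀ i ∈ s, 0 ≤ p i) (hs : ∑ i ∈ s, p i = 1)
    (hd : ∀ i ∈ s, ∀ j ∈ s, |m i - m j| ≤ C) {i : ι} (hi : i ∈ s) :
    |m i - ∑ j ∈ s, p j * m j| ≤ C := by
  have : m i - ∑ j ∈ s, p j * m j = ∑ j ∈ s, p j * (m i - m j) := by
    simp only [mul_sub, Finset.sum_sub_distrib, ← Finset.sum_mul, hs, one_mul]
  rw [this]
  calc _ ≤ ∑ j ∈ s, |p j * (m i - m j)| := Finset.abs_sum_le_sum_abs _ _
    _ ≤ ∑ j ∈ s, p j * C := Finset.sum_le_sum fun j hj => by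
        rw [abs_mul, abs_of_nonneg (hp j hj)]
        exact mul_le_mul_of_nonneg_left (hd i hi j hj) (hp j hj)
    _ = C := by rw [← Finset.sum_mul, hs, one_mul]

/-- Combination step: conditional exponential moments and Hoeffding's lemma for the conditional
means. -/
lemma sum_mul_le_exp_of_cond {ι : Type*} (s : Finset ι) (p m Z : ι → ℝ) {C K : ℝ} (hC : 0 < C)
    (hp : ∀ i ∈ s, 0 ≤ p i) (hs : ∑ i ∈ s, p i = 1)
    (hd : ∀ i ∈ s, ∀ j ∈ s, |m i - m j| ≤ C)
    (hZ : ∀ i ∈ s, Z i ≤ Real.exp (m i + K)) :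
    ∑ i ∈ s, p i * Z i ≤ Real.exp (∑ i ∈ s, p i * m i + (C ^ 2 / 2 + K)) := by
  set a := ∑ i ∈ s, p i * m i with ha
  have h1 := sum_mul_exp_le s p (fun i => m i - a) hC hp hs
    (fun i hi => abs_sub_wavg_le s p m hp hs hd hi)
    (by simp only [mul_sub, Finset.sum_sub_distrib, ← Finset.sum_mul, hs, one_mul, ← ha, sub_self])
  calc ∑ i ∈ s, p i * Z i ≤ ∑ i ∈ s, Real.exp (a + K) * (p i * Real.exp (m i - a)) :=
        Finset.sum_le_sum fun i hi => by
          have := mul_le_mul_of_nonneg_left (hZ i hi) (hp i hi)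
          refine this.trans (le_of_eq ?_)
          rw [mul_left_comm, ← Real.exp_add]; ring_nf
    _ ≤ Real.exp (a + K) * Real.exp (C ^ 2 / 2) := by
        rw [← Finset.mul_sum]
        exact mul_le_mul_of_nonneg_left h1 (Real.exp_nonneg _)
    _ = _ := by rw [← Real.exp_add]; ring_nf

/-- Right multiplication by a transposition preserves the image of `0`. Bounded differences on the
large symmetric group therefore restrict to each fibre over that image, which is what the induction
on `N` needs. -/
lemma decomposeFin_symm_mul_swap {N : ℕ} (p : Fin (N + 1)) (e : Equiv.Perm (Fin N)) (i j : Fin N) :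
    Equiv.Perm.decomposeFin.symm (p, e * Equiv.swap i j)
      = Equiv.Perm.decomposeFin.symm (p, e) * Equiv.swap i.succ j.succ := by
  ext k
  refine congrArg Fin.val ?_
  refine Fin.cases ?_ (fun k => ?_) k
  · rw [Equiv.Perm.mul_apply, Equiv.swap_apply_of_ne_of_ne (Fin.succ_ne_zero _).symm
      (Fin.succ_ne_zero _).symm]
    simp
  · rw [Equiv.Perm.mul_apply, ← (Fin.succ_injective N).map_swap]
    simp

/-- The extension `f` of `e` fixes `0`, so `swap 0 p * f = f * swap 0 (f⁻¹ p)`: corresponding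
elements of two fibres are compared through the fibre over `0` at the price of one transposition
each. -/
lemma decomposeFin_symm_eq_mul_swap {N : ℕ} (p : Fin (N + 1)) (e : Equiv.Perm (Fin N)) :
    ∃ i, Equiv.Perm.decomposeFin.symm (p, e)
      = Equiv.Perm.decomposeFin.symm (0, e) * Equiv.swap 0 i := by
  set f := Equiv.Perm.decomposeFin.symm (0, e) with hf
  have h0 : f 0 = 0 := by simp [hf]
  refine ⟨f.symm p, ?_⟩
  have h1 : f * Equiv.swap 0 (f.symm p) = Equiv.swap 0 p * f := by
    rw [Equiv.mul_swap_eq_swap_mul, h0, Equiv.apply_symm_apply]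
  rw [h1]
  ext k
  refine congrArg Fin.val ?_
  refine Fin.cases ?_ (fun k => ?_) k
  · simp [h0]
  · simp [hf]

/-- Exponential moments on the symmetric group. -/
lemma sum_perm_exp_le {c : ℝ} (hc : 0 < c) (N : ℕ) (H : Equiv.Perm (Fin N) → ℝ)
    (hH : ∀ σ i j, |H (σ * Equiv.swap i j) - H σ| ≤ c) :
    (∑ σ, Real.exp (H σ)) / (N.factorial : ℝ)
      ≤ Real.exp ((∑ σ, H σ) / (N.factorial : ℝ) + 2 * c ^ 2 * N) := by
  induction N with
  | zero => simp
  | succ N ih =>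
    have hN : (0 : ℝ) < N.factorial := by positivity
    -- Condition on the image of `0`. Two fibre means differ by at most `2c`, via the fibre over
    -- `0`, so Hoeffding's lemma adds `(2c)²/2 = 2c²` to the exponent at each stage.
    have key := sum_mul_le_exp_of_cond (Finset.univ : Finset (Fin (N + 1)))
      (fun _ => 1 / ((N : ℝ) + 1))
      (fun p => (∑ e, H (Equiv.Perm.decomposeFin.symm (p, e))) / (N.factorial : ℝ))
      (fun p => (∑ e, Real.exp (H (Equiv.Perm.decomposeFin.symm (p, e)))) / (N.factorial : ℝ))
      (C := 2 * c) (K := 2 * c ^ 2 * N) (by linarith) (fun _ _ => by positivity)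
      (by simp; field_simp)
      (by
        intro p _ p' _
        have h : ∀ e, |H (Equiv.Perm.decomposeFin.symm (p, e))
            - H (Equiv.Perm.decomposeFin.symm (p', e))| ≤ 2 * c := by
          intro e
          obtain ⟨i, hi⟩ := decomposeFin_symm_eq_mul_swap p e
          obtain ⟨j, hj⟩ := decomposeFin_symm_eq_mul_swap p' e
          rw [hi, hj]
          have a1 := abs_le.1 (hH (Equiv.Perm.decomposeFin.symm (0, e)) 0 i)
          have a2 := abs_le.1 (hH (Equiv.Perm.decomposeFin.symm (0, e)) 0 j)
          rw [abs_le]; constructor <;> linarith [a1.1, a1.2, a2.1, a2.2]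
        rw [← sub_div, abs_div, abs_of_pos hN, div_le_iff₀ hN, ← Finset.sum_sub_distrib]
        refine (Finset.abs_sum_le_sum_abs _ _).trans ?_
        refine (Finset.sum_le_sum fun e _ => h e).trans (le_of_eq ?_)
        simp [Finset.card_univ, Fintype.card_perm, mul_comm])
      (by
        intro p _
        exact ih (fun e => H (Equiv.Perm.decomposeFin.symm (p, e))) (fun σ i j => by
          rw [decomposeFin_symm_mul_swap]; exact hH _ _ _))
    have conv : ∀ f : Equiv.Perm (Fin (N + 1)) → ℝ,
        (∑ σ, f σ) / ((N + 1).factorial : ℝ)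
          = ∑ p : Fin (N + 1), 1 / ((N : ℝ) + 1) *
            ((∑ e, f (Equiv.Perm.decomposeFin.symm (p, e))) / (N.factorial : ℝ)) := by
      intro f
      rw [← Equiv.Perm.decomposeFin.symm.sum_comp, Fintype.sum_prod_type, ← Finset.mul_sum,
        ← Finset.sum_div, Nat.factorial_succ]
      push_cast
      field_simp
    rw [conv, conv]
    refine key.trans (le_of_eq (congrArg Real.exp (congrArg _ ?_)))
    push_cast
    ring

lemma sum_bernoulli (ε : ℝ) (n : ℕ) :
    ∑ w : Fin n → Bool, ∏ v, (if w v = true then ε else 1 - ε) = 1 := by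
  have := (Finset.prod_univ_sum (fun _ : Fin n => (Finset.univ : Finset Bool))
    (fun _ b => if b = true then ε else 1 - ε)).symm
  rw [Fintype.piFinset_univ] at this
  rw [this]
  simp

/-- Exponential moments for independent Bernoulli variables. -/
lemma sum_bernoulli_exp_le {c ε : ℝ} (hc : 0 < c) (h0 : 0 ≤ ε) (h1 : ε ≤ 1) (n : ℕ)
    (H : (Fin n → Bool) → ℝ) (hH : ∀ w v b, |H (Function.update w v b) - H w| ≤ c) :
    ∑ w, (∏ v, if w v = true then ε else 1 - ε) * Real.exp (H w)
      ≤ Real.exp (∑ w, (∏ v, if w v = true then ε else 1 - ε) * H w + 2 * c ^ 2 * n) := by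
  induction n with
  | zero => simp
  | succ n ih =>
    set P : (Fin n → Bool) → ℝ := fun w => ∏ v, if w v = true then ε else 1 - ε with hP
    -- Condition on the first bit. The conditional means differ by at most `c`; the weaker `2c` only
    -- makes the constant agree with the one for permutations.
    have key := sum_mul_le_exp_of_cond (Finset.univ : Finset Bool)
      (fun b => if b = true then ε else 1 - ε)
      (fun b => ∑ w : Fin n → Bool, P w * H (Fin.cons b w))
      (fun b => ∑ w : Fin n → Bool, P w * Real.exp (H (Fin.cons b w)))
      (C := 2 * c) (K := 2 * c ^ 2 * n) (by linarith)
      (fun b _ => by split_ifs <;> linarith) (by simp)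
      (by
        intro b _ b' _
        have h : ∀ w : Fin n → Bool, |H (Fin.cons b w) - H (Fin.cons b' w)| ≤ c := by
          intro w
          have := hH (Fin.cons b' w) 0 b
          rwa [Fin.update_cons_zero] at this
        have hPn : ∀ w, 0 ≤ P w := fun w => Finset.prod_nonneg fun v _ => by split_ifs <;> linarith
        have hP1 : ∑ w, P w = 1 := sum_bernoulli ε n
        rw [← Finset.sum_sub_distrib]
        refine (Finset.abs_sum_le_sum_abs _ _).trans ?_
        calc _ ≤ ∑ w, P w * c := Finset.sum_le_sum fun w _ => by
              rw [← mul_sub, abs_mul, abs_of_nonneg (hPn w)]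
              exact mul_le_mul_of_nonneg_left (h w) (hPn w)
          _ ≤ 2 * c := by rw [← Finset.sum_mul, hP1]; linarith)
      (by
        intro b _
        exact ih (fun w => H (Fin.cons b w)) (fun w v b' => by
          rw [Fin.cons_update]; exact hH _ _ _))
    have conv : ∀ f : (Fin (n + 1) → Bool) → ℝ,
        ∑ w : Fin (n + 1) → Bool, (∏ v, if w v = true then ε else 1 - ε) * f w
          = ∑ b : Bool, (if b = true then ε else 1 - ε) * ∑ w, P w * f (Fin.cons b w) := by
      intro f
      rw [← (Fin.consEquiv (fun _ : Fin (n + 1) => Bool)).sum_comp, Fintype.sum_prod_type]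
      refine Finset.sum_congr rfl fun b _ => ?_
      rw [Finset.mul_sum]
      refine Finset.sum_congr rfl fun w _ => ?_
      change (∏ v, if (Fin.cons b w : Fin (n + 1) → Bool) v = true then ε else 1 - ε)
        * f (Fin.cons b w) = _
      simp only [Fin.prod_univ_succ, Fin.cons_zero, Fin.cons_succ, hP]
      ring
    rw [conv, conv]
    refine key.trans (le_of_eq (congrArg Real.exp (congrArg _ ?_)))
    push_cast
    ring

end

end LDPC

/-! ### Ensemble averages and moment bounds -/

namespace LDPC

noncomputable section

namespace Degrees

variable {T : Degrees} {ε : ℝ}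

/-! ### Expectations over the ensemble -/

/-- The number of edges. -/
def numEdges (T : Degrees) : ℕ := Fintype.card T.VSocket

/-- The graph in which two variable sockets exchange their partners. -/
def swapG (G : T.Graph) (a a' : T.VSocket) : T.Graph := (Equiv.swap a a').trans G

lemma swapG_apply (G : T.Graph) (a a' e : T.VSocket) :
    swapG G a a' e = G (Equiv.swap a a' e) := rfl

lemma swapG_symm_apply (G : T.Graph) (a a' : T.VSocket) (b : T.CSocket) :
    (swapG G a a').symm b = Equiv.swap a a' (G.symm b) := rfl

lemma swapG_left (G : T.Graph) (a a' : T.VSocket) : swapG G a a' a = G a' := by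
  simp [swapG_apply]

lemma swapG_right (G : T.Graph) (a a' : T.VSocket) : swapG G a a' a' = G a := by
  simp [swapG_apply]

lemma swapG_of_ne (G : T.Graph) {a a' e : T.VSocket} (h : e ≠ a) (h' : e ≠ a') :
    swapG G a a' e = G e := by
  simp [swapG_apply, Equiv.swap_apply_of_ne_of_ne h h']

lemma swapG_swapG (G : T.Graph) (a a' : T.VSocket) : swapG (swapG G a a') a a' = G := by
  ext1 e; simp [swapG_apply]

lemma swapG_self (G : T.Graph) (a : T.VSocket) : swapG G a a = G := by
  ext1 e; simp [swapG_apply]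

/-- Exchange of partners as a permutation of the ensemble. -/
def swapEquiv (a a' : T.VSocket) : T.Graph ≃ T.Graph where
  toFun G := swapG G a a'
  invFun G := swapG G a a'
  left_inv G := swapG_swapG G a a'
  right_inv G := swapG_swapG G a a'

lemma card_CSocket (T : Degrees) : Fintype.card T.CSocket = T.numEdges := by
  simp [numEdges, Fintype.card_sigma, T.balanced]

instance : Nonempty T.Graph :=
  ⟨Fintype.equivOfCardEq (by rw [card_CSocket]; rfl)⟩

/-- The probability of a channel realization. -/
def chanProb (ε : ℝ) (w : T.Channel) : ℝ := ∏ v, if w v = true then ε else 1 - ε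

lemma chanProb_nonneg (hε : ε ∈ Set.Icc (0 : ℝ) 1) (w : T.Channel) : 0 ≤ chanProb ε w :=
  Finset.prod_nonneg fun v _ => by split_ifs <;> linarith [hε.1, hε.2]

lemma sum_chanProb : ∑ w : T.Channel, chanProb ε w = 1 := sum_bernoulli ε T.n

lemma expect_def (f : T.Graph → T.Channel → ℝ) :
    T.expect ε f = (∑ G : T.Graph, ∑ w : T.Channel, chanProb ε w * f G w) /
      (Fintype.card T.Graph : ℝ) := rfl

lemma expect_add (f g : T.Graph → T.Channel → ℝ) :
    T.expect ε (fun G w => f G w + g G w) = T.expect ε f + T.expect ε g := by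
  simp only [expect_def, mul_add, Finset.sum_add_distrib, add_div]

lemma expect_sub (f g : T.Graph → T.Channel → ℝ) :
    T.expect ε (fun G w => f G w - g G w) = T.expect ε f - T.expect ε g := by
  simp only [expect_def, mul_sub, Finset.sum_sub_distrib, sub_div]

lemma expect_const_mul (c : ℝ) (f : T.Graph → T.Channel → ℝ) :
    T.expect ε (fun G w => c * f G w) = c * T.expect ε f := by
  simp only [expect_def, mul_left_comm _ c, ← Finset.mul_sum, mul_div_assoc]

lemma expect_mul_const (c : ℝ) (f : T.Graph → T.Channel → ℝ) :
    T.expect ε (fun G w => f G w * c) = T.expect ε f * c := by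
  simp only [mul_comm _ c, expect_const_mul]

lemma card_graph_pos : (0 : ℝ) < Fintype.card T.Graph := by
  exact_mod_cast Fintype.card_pos

lemma expect_const (c : ℝ) : T.expect ε (fun _ _ => c) = c := by
  simp only [expect_def, ← Finset.sum_mul, sum_chanProb, one_mul, Finset.sum_const,
    Finset.card_univ, nsmul_eq_mul]
  field_simp [(card_graph_pos (T := T)).ne']

lemma expect_sum {ι : Type*} (s : Finset ι) (f : ι → T.Graph → T.Channel → ℝ) :
    T.expect ε (fun G w => ∑ i ∈ s, f i G w) = ∑ i ∈ s, T.expect ε (f i) := by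
  classical
  induction s using Finset.induction_on with
  | empty => simpa using expect_const (T := T) (ε := ε) 0
  | insert i s hi ih => simp only [Finset.sum_insert hi, expect_add, ih]

lemma expect_mono (hε : ε ∈ Set.Icc (0 : ℝ) 1) {f g : T.Graph → T.Channel → ℝ}
    (h : ∀ G w, f G w ≤ g G w) : T.expect ε f ≤ T.expect ε g := by
  simp only [expect_def]
  gcongr with G _ w _
  · exact chanProb_nonneg hε w
  · exact h G w

lemma abs_expect_le (hε : ε ∈ Set.Icc (0 : ℝ) 1) (f : T.Graph → T.Channel → ℝ) :
    |T.expect ε f| ≤ T.expect ε (fun G w => |f G w|) := by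
  rw [abs_le]
  constructor
  · have := expect_mono hε (f := fun G w => -1 * |f G w|) (g := f)
      fun G w => by linarith [neg_abs_le (f G w)]
    rw [expect_const_mul] at this
    linarith
  · exact expect_mono hε fun G w => le_abs_self _

lemma abs_expect_le_of_le (hε : ε ∈ Set.Icc (0 : ℝ) 1) {f g : T.Graph → T.Channel → ℝ}
    (h : ∀ G w, |f G w| ≤ g G w) : |T.expect ε f| ≤ T.expect ε g :=
  (abs_expect_le hε f).trans (expect_mono hε h)

/-- An exchange of partners is a bijection of the set of graphs. This invariance is the source of
every independence statement about the two ends of an edge. -/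
lemma expect_swap (f : T.Graph → T.Channel → ℝ) (a a' : T.VSocket) :
    T.expect ε (fun G w => f (swapG G a a') w) = T.expect ε f := by
  simp only [expect_def]
  congr 1
  exact (swapEquiv a a').sum_comp (fun G => ∑ w : T.Channel, chanProb ε w * f G w)

/-! ### Fourth moments under bounded differences -/

/-- Exchanging two partners, or changing one channel output, changes `Φ` by at most `c`. -/
structure BoundedDiff (c : ℝ) (Φ : T.Graph → T.Channel → ℝ) : Prop where
  graph : ∀ G w a a', |Φ (swapG G a a') w - Φ G w| ≤ c
  chan : ∀ G w v b, |Φ G (Function.update w v b) - Φ G w| ≤ c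

/-- Relative to a reference graph `G₀` the ensemble is a symmetric group, and right multiplication
by a transposition becomes an exchange of partners. -/
lemma sum_graph_exp_le {c : ℝ} (hc : 0 < c) (H : T.Graph → ℝ)
    (hH : ∀ G a a', |H (swapG G a a') - H G| ≤ c) :
    (∑ G, Real.exp (H G)) / (Fintype.card T.Graph : ℝ)
      ≤ Real.exp ((∑ G, H G) / (Fintype.card T.Graph : ℝ) + 2 * c ^ 2 * T.numEdges) := by
  obtain ⟨G₀⟩ := (inferInstance : Nonempty T.Graph)
  have e : T.VSocket ≃ Fin T.numEdges := Fintype.equivFin _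
  let F : Equiv.Perm (Fin T.numEdges) ≃ T.Graph :=
    (e.symm.permCongr).trans (Equiv.equivCongr (Equiv.refl _) G₀)
  have hF : ∀ σ x, F σ x = G₀ (e.symm (σ (e x))) := fun σ x => rfl
  have key := sum_perm_exp_le hc T.numEdges (fun σ => H (F σ)) (fun σ i j => by
    have : F (σ * Equiv.swap i j) = swapG (F σ) (e.symm i) (e.symm j) := by
      ext1 x
      rw [swapG_apply, hF, hF, Equiv.Perm.mul_apply]
      congr 3
      rw [e.injective.map_swap]
      simp
    simp only [this]
    exact hH _ _ _)
  have hcard : Fintype.card T.Graph = (T.numEdges).factorial := by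
    rw [← Fintype.card_congr F, Fintype.card_perm, Fintype.card_fin]
  rw [hcard, ← F.sum_comp, ← F.sum_comp]
  exact key

/-- Average over the channel first, with the graph fixed. The conditional mean inherits the constant
`c` under exchanges, so the two exponents add up. -/
lemma expect_exp_le (hε : ε ∈ Set.Icc (0 : ℝ) 1) {c : ℝ} (hc : 0 < c)
    {Φ : T.Graph → T.Channel → ℝ} (hΦ : BoundedDiff c Φ) :
    T.expect ε (fun G w => Real.exp (Φ G w))
      ≤ Real.exp (T.expect ε Φ + 2 * c ^ 2 * (T.numEdges + T.n)) := by
  set H : T.Graph → ℝ := fun G => ∑ w : T.Channel, chanProb ε w * Φ G w with hHdef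
  have h1 : ∀ G, ∑ w : T.Channel, chanProb ε w * Real.exp (Φ G w)
      ≤ Real.exp (H G + 2 * c ^ 2 * T.n) := fun G =>
    sum_bernoulli_exp_le hc hε.1 hε.2 T.n (Φ G) (hΦ.chan G)
  have h2 := sum_graph_exp_le hc H (fun G a a' => by
    simp only [hHdef, ← Finset.sum_sub_distrib, ← mul_sub]
    refine (Finset.abs_sum_le_sum_abs _ _).trans ?_
    calc _ ≤ ∑ w : T.Channel, chanProb ε w * c := Finset.sum_le_sum fun w _ => by
          rw [abs_mul, abs_of_nonneg (chanProb_nonneg hε w)]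
          exact mul_le_mul_of_nonneg_left (hΦ.graph G w a a') (chanProb_nonneg hε w)
      _ = c := by rw [← Finset.sum_mul, sum_chanProb, one_mul])
  rw [expect_def, expect_def]
  calc _ ≤ (∑ G, Real.exp (H G + 2 * c ^ 2 * T.n)) / (Fintype.card T.Graph : ℝ) := by
        gcongr with G _; exact h1 G
    _ = (∑ G, Real.exp (H G)) / (Fintype.card T.Graph : ℝ) * Real.exp (2 * c ^ 2 * T.n) := by
        simp only [Real.exp_add, ← Finset.sum_mul]; ring
    _ ≤ Real.exp ((∑ G, H G) / (Fintype.card T.Graph : ℝ) + 2 * c ^ 2 * T.numEdges)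
          * Real.exp (2 * c ^ 2 * T.n) := by gcongr
    _ = _ := by rw [← Real.exp_add, add_assoc, ← mul_add]

lemma BoundedDiff.const_mul {c : ℝ} {Φ : T.Graph → T.Channel → ℝ} (h : BoundedDiff c Φ) (θ : ℝ) :
    BoundedDiff (|θ| * c) (fun G w => θ * Φ G w) where
  graph G w a a' := by
    rw [← mul_sub, abs_mul]; exact mul_le_mul_of_nonneg_left (h.graph G w a a') (abs_nonneg _)
  chan G w v b := by
    rw [← mul_sub, abs_mul]; exact mul_le_mul_of_nonneg_left (h.chan G w v b) (abs_nonneg _)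

/-- Exponential moments are taken at scale `θ = M^(-1/2)`, `M` being the number of edges plus the
number of variable nodes; there the exponent `2 (θc)² M` is the constant `2c²`. Then `z⁴ = M² (θz)⁴
≤ 24 M² exp |θz|`, and both signs of `θ` cover the absolute value. -/
lemma expect_fourth_le (hε : ε ∈ Set.Icc (0 : ℝ) 1) {c : ℝ} (hc : 0 < c)
    {Φ : T.Graph → T.Channel → ℝ} (hΦ : BoundedDiff c Φ) (hN : 0 < T.numEdges) :
    T.expect ε (fun G w => (Φ G w - T.expect ε Φ) ^ 4)
      ≤ 48 * Real.exp (2 * c ^ 2) * ((T.numEdges : ℝ) + T.n) ^ 2 := by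
  set M : ℝ := (T.numEdges : ℝ) + T.n with hM
  have hM0 : 0 < M := by
    have : (0 : ℝ) < T.numEdges := by exact_mod_cast hN
    positivity
  set θ : ℝ := 1 / √M with hθ
  have hθ0 : 0 < θ := by positivity
  have hθ2 : θ ^ 2 * M = 1 := by
    rw [hθ, div_pow, Real.sq_sqrt hM0.le]; field_simp
  set m := T.expect ε Φ with hm
  have hs : ∀ s : ℝ, |s| = θ →
      T.expect ε (fun G w => Real.exp (s * (Φ G w - m))) ≤ Real.exp (2 * c ^ 2) := by
    intro s hs
    have h := expect_exp_le hε (c := |s| * c) (by rw [hs]; positivity) (hΦ.const_mul s)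
    rw [expect_const_mul, ← hm, ← hM] at h
    have e1 : 2 * (|s| * c) ^ 2 * M = 2 * c ^ 2 := by
      rw [hs, mul_pow]; linear_combination (2 * c ^ 2) * hθ2
    rw [e1] at h
    have e2 : ∀ G w, Real.exp (s * (Φ G w - m)) = Real.exp (-(s * m)) * Real.exp (s * Φ G w) :=
      fun G w => by rw [← Real.exp_add]; ring_nf
    simp only [e2, expect_const_mul]
    calc _ ≤ Real.exp (-(s * m)) * Real.exp (s * m + 2 * c ^ 2) := by gcongr
      _ = _ := by rw [← Real.exp_add]; ring_nf
  have hpt : ∀ G w, (Φ G w - m) ^ 4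
      ≤ 24 * M ^ 2 * (Real.exp (θ * (Φ G w - m)) + Real.exp (-θ * (Φ G w - m))) := by
    intro G w
    set z := Φ G w - m
    have h1 := Real.pow_div_factorial_le_exp _ (abs_nonneg (θ * z)) 4
    have h2 : Real.exp |θ * z| ≤ Real.exp (θ * z) + Real.exp (-θ * z) := by
      rcases abs_cases (θ * z) with ⟨h, _⟩ | ⟨h, _⟩ <;> rw [h]
      · linarith [Real.exp_pos (-θ * z)]
      · rw [neg_mul]; linarith [Real.exp_pos (θ * z)]
    have h3 : |θ * z| ^ 4 = θ ^ 4 * z ^ 4 := by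
      rw [← mul_pow, show (4 : ℕ) = 2 * 2 from rfl, pow_mul, sq_abs, ← pow_mul]
    have h4 : z ^ 4 = M ^ 2 * (θ ^ 4 * z ^ 4) := by
      linear_combination (-(θ ^ 2 * M + 1) * z ^ 4) * hθ2
    rw [h3, show ((Nat.factorial 4 : ℕ) : ℝ) = 24 by norm_num [Nat.factorial]] at h1
    rw [h4, mul_assoc 24, mul_comm 24, mul_assoc]
    refine mul_le_mul_of_nonneg_left ?_ (by positivity)
    linarith
  refine (expect_mono hε hpt).trans ?_
  rw [expect_const_mul, expect_add]
  have a1 := hs θ (abs_of_pos hθ0)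
  have a2 := hs (-θ) (by rw [abs_neg, abs_of_pos hθ0])
  calc _ ≤ 24 * M ^ 2 * (Real.exp (2 * c ^ 2) + Real.exp (2 * c ^ 2)) := by gcongr
    _ = _ := by ring

end Degrees

end

end LDPC

/-! ### Geometry of the Tanner graph and local functions -/

namespace LDPC

noncomputable section

namespace Degrees

variable {T : Degrees} {ε : ℝ}

/-! ### Non-backtracking walks -/

/-- The edges `e ≠ f` share their variable node (`s = false`) or their check node (`s = true`). -/
def Adj (G : T.Graph) (s : Bool) (e f : T.VSocket) : Prop :=
  e ≠ f ∧ (s = false → e.1 = f.1) ∧ (s = true → (G e).1 = (G f).1)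

/-- Non-backtracking walks of given length; the first step is on side `s`, and the sides
alternate. -/
def Walk (G : T.Graph) : ℕ → Bool → T.VSocket → T.VSocket → Prop
  | 0, _, e, f => e = f
  | k + 1, s, e, f => ∃ g, Adj G s e g ∧ Walk G k (!s) g f

lemma Adj.symm {G : T.Graph} {s : Bool} {e f : T.VSocket} (h : Adj G s e f) : Adj G s f e :=
  ⟨h.1.symm, fun hs => (h.2.1 hs).symm, fun hs => (h.2.2 hs).symm⟩

lemma Walk.trans {G : T.Graph} {k j : ℕ} {s : Bool} {e f g : T.VSocket}
    (h : Walk G k s e f) (h' : Walk G j (not^[k] s) f g) : Walk G (k + j) s e g := by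
  induction k generalizing s e with
  | zero => obtain rfl : e = f := h; simpa using h'
  | succ k ih =>
    obtain ⟨x, hx, hw⟩ := h
    rw [Nat.succ_add]
    exact ⟨x, hx, ih hw h'⟩

lemma not_iterate_not (k : ℕ) (s : Bool) : not^[k] (not^[k] s) = s := by
  rw [← Function.iterate_add_apply, ← two_mul, Function.iterate_mul]
  have : (not^[2]) = id := by funext b; cases b <;> rfl
  simp [this]

/-- The last step of a walk of length `k ≥ 1` is on side `not^[k-1] s`; it is written `not^[k] (!s)`
to avoid the subtraction. -/
lemma Walk.reverse {G : T.Graph} {k : ℕ} {s : Bool} {e f : T.VSocket}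
    (h : Walk G k s e f) : Walk G k (not^[k] (!s)) f e := by
  induction k generalizing s e with
  | zero => exact Eq.symm h
  | succ k ih =>
    obtain ⟨x, hx, hw⟩ := h
    have h1 := ih hw
    rw [Bool.not_not] at h1
    refine Walk.trans (j := 1) (by simpa [Function.iterate_succ_apply] using h1) ⟨e, ?_, rfl⟩
    rw [Function.iterate_succ_apply, Bool.not_not, not_iterate_not]
    exact hx.symm

/-- Bounded degrees. -/
def DegBound (D : ℕ) (T : Degrees) : Prop := (∀ v, T.dv v ≤ D) ∧ ∀ c, T.dc c ≤ D

open Classical in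
lemma card_adj_le {D : ℕ} (hD : DegBound D T) (G : T.Graph) (s : Bool) (e : T.VSocket) :
    (Finset.univ.filter fun f => Adj G s e f).card ≤ D := by
  cases s with
  | false =>
    refine le_trans ?_ (hD.1 e.1)
    rw [← Fintype.card_fin (T.dv e.1), ← Finset.card_univ,
      ← Finset.card_image_of_injective Finset.univ
        (f := fun i : Fin (T.dv e.1) => (⟨e.1, i⟩ : T.VSocket))
        (fun _ _ h => by simpa using h)]
    refine Finset.card_le_card fun f hf => ?_
    have h := (Finset.mem_filter.1 hf).2.2.1 rfl
    obtain ⟨v, i⟩ := f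
    simp only at h
    subst h
    exact Finset.mem_image_of_mem _ (Finset.mem_univ _)
  | true =>
    refine le_trans ?_ (hD.2 (G e).1)
    rw [← Fintype.card_fin (T.dc (G e).1), ← Finset.card_univ,
      ← Finset.card_image_of_injective Finset.univ
        (f := fun i : Fin (T.dc (G e).1) => G.symm (⟨(G e).1, i⟩ : T.CSocket))
        (fun _ _ h => by simpa using h)]
    refine Finset.card_le_card fun f hf => ?_
    have h := (Finset.mem_filter.1 hf).2.2.2 rfl
    refine Finset.mem_image.2 ⟨h ▸ (G f).2, Finset.mem_univ _, ?_⟩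
    rw [Equiv.symm_apply_eq]
    generalize G f = b at h
    obtain ⟨c, i⟩ := b
    simp only at h
    subst h
    rfl

open Classical in
lemma card_walk_le {D : ℕ} (hD : DegBound D T) (G : T.Graph) (k : ℕ) (s : Bool) (e : T.VSocket) :
    (Finset.univ.filter fun f => Walk G k s e f).card ≤ D ^ k := by
  induction k generalizing s e with
  | zero =>
    have : (Finset.univ.filter fun f => Walk G 0 s e f) = {e} := by
      ext f
      rw [Finset.mem_filter, Finset.mem_singleton]
      exact ⟨fun h => h.2.symm, fun h => ⟨Finset.mem_univ _, h.symm⟩⟩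
    simp [this]
  | succ k ih =>
    calc (Finset.univ.filter fun f => Walk G (k + 1) s e f).card
        ≤ ((Finset.univ.filter fun g => Adj G s e g).biUnion
            fun g => Finset.univ.filter fun f => Walk G k (!s) g f).card := by
          refine Finset.card_le_card fun f hf => ?_
          obtain ⟨g, hg, hw⟩ := (Finset.mem_filter.1 hf).2
          exact Finset.mem_biUnion.2 ⟨g, by simpa using hg, by simpa using hw⟩
      _ ≤ (Finset.univ.filter fun g => Adj G s e g).card * D ^ k :=
          Finset.card_biUnion_le_card_mul _ _ _ fun g _ => ih _ _
      _ ≤ D * D ^ k := Nat.mul_le_mul_right _ (card_adj_le hD G s e)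
      _ = D ^ (k + 1) := by ring

/-- There is a walk of length at most `R` from `e` to `f`. -/
def Near (R : ℕ) (G : T.Graph) (e f : T.VSocket) : Prop := ∃ k ≤ R, ∃ s, Walk G k s e f

/-- There is a closed walk of positive length at most `R` at `a`. -/
def Closed (R : ℕ) (G : T.Graph) (a : T.VSocket) : Prop :=
  ∃ k, 1 ≤ k ∧ k ≤ R ∧ ∃ s, Walk G k s a a

lemma Near.symm {R : ℕ} {G : T.Graph} {e f : T.VSocket} (h : Near R G e f) : Near R G f e := by
  obtain ⟨k, hk, s, hw⟩ := h
  exact ⟨k, hk, _, hw.reverse⟩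

lemma Near.mono {R R' : ℕ} (hR : R ≤ R') {G : T.Graph} {e f : T.VSocket} (h : Near R G e f) :
    Near R' G e f := by
  obtain ⟨k, hk, h⟩ := h
  exact ⟨k, hk.trans hR, h⟩

lemma Closed.mono {R R' : ℕ} (hR : R ≤ R') {G : T.Graph} {e : T.VSocket} (h : Closed R G e) :
    Closed R' G e := by
  obtain ⟨k, h1, hk, h⟩ := h
  exact ⟨k, h1, hk.trans hR, h⟩

/-- A bound for the number of edges near a given edge. -/
def ballBound (D R : ℕ) : ℕ := (R + 1) * (2 * (D + 1) ^ R)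

-- A union over the lengths and the two starting sides. `D + 1` replaces `D` so that the powers are
-- monotone in the length even when `D = 0`.
open Classical in
lemma card_near_le {D : ℕ} (hD : DegBound D T) (G : T.Graph) (R : ℕ) (e : T.VSocket) :
    (Finset.univ.filter fun f => Near R G e f).card ≤ ballBound D R := by
  calc _ ≤ ((Finset.range (R + 1)).biUnion fun k => (Finset.univ : Finset Bool).biUnion
          fun s => Finset.univ.filter fun f => Walk G k s e f).card := by
        refine Finset.card_le_card fun f hf => ?_
        obtain ⟨k, hk, s, hw⟩ := (Finset.mem_filter.1 hf).2
        exact Finset.mem_biUnion.2 ⟨k, by simpa [Nat.lt_succ_iff] using hk,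
          Finset.mem_biUnion.2 ⟨s, Finset.mem_univ _, by simpa using hw⟩⟩
    _ ≤ (Finset.range (R + 1)).card * (2 * (D + 1) ^ R) := by
        refine Finset.card_biUnion_le_card_mul _ _ _ fun k hk => ?_
        refine (Finset.card_biUnion_le_card_mul _ _ ((D + 1) ^ R) fun s _ => ?_).trans (by simp)
        refine (card_walk_le hD G k s e).trans ?_
        refine (Nat.pow_le_pow_left (Nat.le_succ D) k).trans ?_
        exact Nat.pow_le_pow_right (Nat.succ_pos D) (Nat.lt_succ_iff.1 (Finset.mem_range.1 hk))
    _ = _ := by simp [ballBound]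

open Classical in
lemma card_near_le' {D : ℕ} (hD : DegBound D T) (G : T.Graph) (R : ℕ) (e : T.VSocket) :
    (Finset.univ.filter fun f => Near R G f e).card ≤ ballBound D R := by
  simpa only [show ∀ f, Near R G f e ↔ Near R G e f from fun f => ⟨Near.symm, Near.symm⟩]
    using card_near_le hD G R e

/-! ### Short cycles are rare -/

lemma adj_of_adj_swapG {G : T.Graph} {a a' : T.VSocket} {s : Bool} {e g : T.VSocket}
    (hg : g ≠ a) (hg' : g ≠ a') (he : e ≠ a) (he' : e ≠ a') (h : Adj (swapG G a a') s e g) :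
    Adj G s e g := by
  refine ⟨h.1, h.2.1, fun hs => ?_⟩
  have := h.2.2 hs
  rwa [swapG_of_ne G hg hg', swapG_of_ne G he he'] at this

/-- A walk in the switched graph that ends at `a` through its variable node contains a walk in the
original graph from its last visit of `a` or `a'`. -/
lemma walk_swapG_aux (G : T.Graph) (a a' : T.VSocket) (k : ℕ) :
    (∀ s e, e ≠ a → e ≠ a' → not^[k] s = true → Walk (swapG G a a') k s e a →
      Walk G k s e a ∨ ∃ i, 1 ≤ i ∧ i + 1 ≤ k ∧ ∃ s, Walk G i s a' a ∨ Walk G i s a a) ∧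
    (∀ s e, e = a ∨ e = a' → 1 ≤ k → not^[k] s = true → Walk (swapG G a a') k s e a →
      ∃ i, 1 ≤ i ∧ i ≤ k ∧ ∃ s, Walk G i s a' a ∨ Walk G i s a a) := by
  -- Starts outside and inside `{a, a'}` are treated simultaneously, since a walk may pass from one
  -- situation to the other at each step. The condition `not^[k] s = true` says that the last step
  -- goes through the variable node, where the exchange is invisible.
  induction k with
  | zero => exact ⟨fun s e he _ _ h => absurd h he, fun s e _ h => absurd h (by omega)⟩
  | succ k ih =>
    have base : ∀ s e, k = 0 → not^[k + 1] s = true → Adj (swapG G a a') s e a →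
        Walk G (k + 1) s e a := by
      intro s e hk hs h
      subst hk
      refine ⟨a, ⟨h.1, h.2.1, fun h1 => ?_⟩, rfl⟩
      subst h1
      simp at hs
    refine ⟨fun s e he he' hs h => ?_, fun s e he hk hs h => ?_⟩
    · obtain ⟨g, hg, hw⟩ := h
      by_cases hga : g = a ∨ g = a'
      · rcases Nat.eq_zero_or_pos k with hk | hk
        · left
          have : g = a := by subst hk; exact hw
          subst this
          exact base s e hk hs hg
        · right
          obtain ⟨i, h1, h2, h3⟩ := ih.2 (!s) g hga hk hs hw
          exact ⟨i, h1, by omega, h3⟩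
      · push Not at hga
        rcases ih.1 (!s) g hga.1 hga.2 hs hw with h | ⟨i, h1, h2, h3⟩
        · exact Or.inl ⟨g, adj_of_adj_swapG hga.1 hga.2 he he' hg, h⟩
        · exact Or.inr ⟨i, h1, by omega, h3⟩
    · obtain ⟨g, hg, hw⟩ := h
      by_cases hga : g = a ∨ g = a'
      · rcases Nat.eq_zero_or_pos k with hk | hk
        · have hgg : g = a := by subst hk; exact hw
          subst hgg
          have := base s e hk hs hg
          rcases he with rfl | rfl
          · exact absurd rfl hg.1
          · exact ⟨k + 1, by omega, le_rfl, s, Or.inl this⟩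
        · obtain ⟨i, h1, h2, h3⟩ := ih.2 (!s) g hga hk hs hw
          exact ⟨i, h1, by omega, h3⟩
      · push Not at hga
        rcases ih.1 (!s) g hga.1 hga.2 hs hw with h | ⟨i, h1, h2, h3⟩
        · refine ⟨k + 1, by omega, le_rfl, s, ?_⟩
          cases s with
          | false =>
            have h1 : Walk G (k + 1) false e a :=
              ⟨g, ⟨hg.1, hg.2.1, fun h => by simp at h⟩, h⟩
            rcases he with rfl | rfl
            · exact Or.inr h1
            · exact Or.inl h1
          | true =>
            -- In the switched graph `a` sits at the old check of `a'` and conversely, so a check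
            -- step out of one of them is an original step out of the other.
            have h1 := hg.2.2 rfl
            rw [swapG_of_ne G hga.1 hga.2] at h1
            rcases he with rfl | rfl
            · rw [swapG_left] at h1
              exact Or.inl ⟨g, ⟨hga.2.symm, fun h => by simp at h, fun _ => h1⟩, h⟩
            · rw [swapG_right] at h1
              exact Or.inr ⟨g, ⟨hga.1.symm, fun h => by simp at h, fun _ => h1⟩, h⟩
        · exact ⟨i, h1, by omega, h3⟩

/-- After the exchange `a` sits at the old check of `a'`. Cutting the cycle at its last visit of `a`
or `a'` leaves a walk of the original graph that ends at `a`, so either `a'` was near `a` or `a`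
already lay on a shorter cycle. For given `a` only boundedly many `a'` are near, which makes cycles
rare on average. -/
lemma near_or_closed_of_walk_swapG (G : T.Graph) (a a' : T.VSocket) (k : ℕ)
    (hs : not^[k + 1] true = true) (h : Walk (swapG G a a') (k + 1) true a a) :
    Near (k + 1) G a' a ∨ Closed k G a := by
  have fin : ∀ j ≤ k, (∃ i, 1 ≤ i ∧ i ≤ j ∧ ∃ s, Walk G i s a' a ∨ Walk G i s a a) →
      Near (k + 1) G a' a ∨ Closed k G a := by
    rintro j hj ⟨i, h1, h2, s, h3 | h3⟩
    · exact Or.inl ⟨i, by omega, s, h3⟩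
    · exact Or.inr ⟨i, h1, by omega, s, h3⟩
  obtain ⟨g, hg, hw⟩ := h
  by_cases hga : g = a ∨ g = a'
  · rcases Nat.eq_zero_or_pos k with hk | hk
    · subst hk; simp at hs
    · exact fin k le_rfl ((walk_swapG_aux G a a' k).2 _ g hga hk hs hw)
  · push Not at hga
    rcases (walk_swapG_aux G a a' k).1 _ g hga.1 hga.2 hs hw with h | ⟨i, h1, h2, h3⟩
    · left
      have h1 := hg.2.2 rfl
      rw [swapG_of_ne G hga.1 hga.2, swapG_left] at h1
      exact ⟨k + 1, le_rfl, true, g, ⟨hga.2.symm, fun h => by simp at h, fun _ => h1⟩, h⟩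
    · exact fin (k - 1) (by omega) ⟨i, h1, by omega, h3⟩

/-- First and last steps on the same side mean that the second and the last but one edge `e`, `f`
share a node with `a`. Leaving out `a` closes the walk at `e`, by the single step between `e` and
`f` unless they coincide. -/
lemma closed_of_odd {G : T.Graph} {a : T.VSocket} {k : ℕ} {s : Bool}
    (hs : not^[k + 1] s = !s) (h : Walk G (k + 1) s a a) :
    ∃ e, Near 1 G a e ∧ Closed k G e := by
  obtain ⟨e, he, hw⟩ := h
  have hne : Near 1 G a e := ⟨1, le_rfl, s, e, he, rfl⟩
  refine ⟨e, hne, ?_⟩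
  have hr := hw.reverse
  rw [Bool.not_not] at hr
  rw [Function.iterate_succ_apply] at hs
  have hs' : not^[k] s = s := by
    have h2 : (!not^[k] s) = !s := (Function.iterate_succ_apply' not k s).symm.trans hs
    exact Bool.not_inj h2
  rw [hs'] at hr
  rcases k with _ | k
  · exact absurd hw.symm he.1
  · obtain ⟨f, hf, hwf⟩ := hr
    by_cases hfe : f = e
    · subst hfe
      rcases k with _ | k
      · simp at hs'
      · exact ⟨k + 1, by omega, by omega, _, hwf⟩
    · refine ⟨k + 1, by omega, by omega, s, f, ⟨Ne.symm hfe, fun h => ?_, fun h => ?_⟩, hwf⟩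
      · exact (he.2.1 h).symm.trans (hf.2.1 h)
      · exact (he.2.2 h).symm.trans (hf.2.2 h)

open Classical in
/-- The expected number of edges with a short closed walk is bounded. -/
lemma exists_expect_closed_le (D R : ℕ) : ∃ C : ℝ, 0 ≤ C ∧ ∀ (ε : ℝ) (_ : ε ∈ Set.Icc (0 : ℝ) 1)
    (T : Degrees) (_ : DegBound D T),
    T.expect ε (fun G _ => ∑ a, if Closed R G a then (1 : ℝ) else 0) ≤ C := by
  induction R with
  | zero =>
    refine ⟨0, le_rfl, fun ε hε T hD => le_of_eq ?_⟩
    have : ∀ (G : T.Graph) a, ¬ Closed 0 G a := by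
      rintro G a ⟨k, h1, h2, _⟩; omega
    simp [this, expect_const]
  | succ R ih =>
    obtain ⟨C, hC, h⟩ := ih
    -- Three sources: shorter closed walks, walks of length `R + 1` whose two ends are on opposite
    -- sides, and walks with ends on the same side, which are charged to a shorter closed walk at a
    -- neighbouring edge.
    refine ⟨C + (C + ballBound D (R + 1)) + ballBound D 1 * C, by positivity,
      fun ε hε T hD => ?_⟩
    have hh := h ε hε T hD
    set S : T.Graph → ℝ := fun G => ∑ a, if Closed R G a then (1 : ℝ) else 0 with hS
    -- closed walks of maximal length that start and end on different sides
    let P : T.Graph → T.VSocket → Prop := fun G a =>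
      not^[R + 1] true = true ∧ Walk G (R + 1) true a a
    have hP : T.expect ε (fun G _ => ∑ a, if P G a then (1 : ℝ) else 0)
        ≤ C + ballBound D (R + 1) := by
      rcases Nat.eq_zero_or_pos T.numEdges with h0 | hN
      · have : IsEmpty T.VSocket := Fintype.card_eq_zero_iff.1 h0
        simp only [Finset.univ_eq_empty, Finset.sum_empty, expect_const]
        positivity
      have hNr : (0 : ℝ) < T.numEdges := by exact_mod_cast hN
      -- By exchange invariance `N` times the expectation is a sum over pairs `(a, a')` in the
      -- switched graph; the pairs that count number at most `N` for each edge on a shorter cycle,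
      -- plus boundedly many per edge.
      have e1 : (T.numEdges : ℝ) * T.expect ε (fun G _ => ∑ a, if P G a then (1 : ℝ) else 0)
          = T.expect ε (fun G _ => ∑ a, ∑ a', if P (swapG G a a') a then (1 : ℝ) else 0) := by
        simp only [expect_sum]
        have : ∀ a a', T.expect ε (fun G _ => if P (swapG G a a') a then (1 : ℝ) else 0)
            = T.expect ε (fun G _ => if P G a then (1 : ℝ) else 0) := fun a a' =>
          expect_swap (fun G _ => if P G a then (1 : ℝ) else 0) a a'
        simp only [this, Finset.sum_const, Finset.card_univ, nsmul_eq_mul, ← Finset.mul_sum]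
        rfl
      have e2 : T.expect ε (fun G _ => ∑ a, ∑ a', if P (swapG G a a') a then (1 : ℝ) else 0)
          ≤ T.expect ε (fun G _ => T.numEdges * S G + T.numEdges * ballBound D (R + 1)) := by
        refine expect_mono hε fun G w => ?_
        calc _ ≤ ∑ a, ∑ a', ((if Closed R G a then (1 : ℝ) else 0)
                + if Near (R + 1) G a' a then (1 : ℝ) else 0) := by
              refine Finset.sum_le_sum fun a _ => Finset.sum_le_sum fun a' _ => ?_
              by_cases hp : P (swapG G a a') a
              · rcases near_or_closed_of_walk_swapG G a a' R hp.1 hp.2 with h | h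
                · simp only [hp, h, if_true]; split_ifs <;> norm_num
                · simp only [hp, h, if_true]; split_ifs <;> norm_num
              · simp only [hp, if_false]; split_ifs <;> norm_num
          _ = T.numEdges * S G + ∑ a, ((Finset.univ.filter fun a' => Near (R + 1) G a' a).card : ℝ)
              := by
              simp only [Finset.sum_add_distrib, Finset.sum_const, Finset.card_univ,
                nsmul_eq_mul, ← Finset.mul_sum, hS, Finset.sum_boole]
              rfl
          _ ≤ T.numEdges * S G + ∑ _a : T.VSocket, (ballBound D (R + 1) : ℝ) := by
              gcongr with a _
              exact_mod_cast card_near_le' hD G (R + 1) a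
          _ = _ := by simp [Finset.card_univ, numEdges]
      rw [expect_add, expect_const_mul, expect_const, ← mul_add] at e2
      rw [← e1] at e2
      exact (le_of_mul_le_mul_left e2 hNr).trans (by gcongr)
    have hQ : T.expect ε (fun G _ => ∑ a, if ∃ e, Near 1 G a e ∧ Closed R G e then (1 : ℝ) else 0)
        ≤ ballBound D 1 * C := by
      refine le_trans (expect_mono hε (g := fun G _ => ballBound D 1 * S G) fun G w => ?_) ?_
      · calc _ ≤ ∑ a, ∑ e, if Near 1 G a e ∧ Closed R G e then (1 : ℝ) else 0 := by
              refine Finset.sum_le_sum fun a _ => ?_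
              split_ifs with h
              · obtain ⟨e, he⟩ := h
                refine le_trans ?_ (Finset.single_le_sum (fun e _ => ?_) (Finset.mem_univ e))
                · rw [if_pos he]
                · split_ifs <;> norm_num
              · exact Finset.sum_nonneg fun e _ => by split_ifs <;> norm_num
          _ = ∑ e, ((Finset.univ.filter fun a => Near 1 G a e).card : ℝ)
                * (if Closed R G e then (1 : ℝ) else 0) := by
              rw [Finset.sum_comm]
              refine Finset.sum_congr rfl fun e _ => ?_
              by_cases hc : Closed R G e
              · simp [hc]
              · simp [hc]
          _ ≤ ∑ e, (ballBound D 1 : ℝ) * (if Closed R G e then (1 : ℝ) else 0) := by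
              gcongr with e _
              exact_mod_cast card_near_le' hD G 1 e
          _ = _ := by rw [← Finset.mul_sum]
      · rw [expect_const_mul]; gcongr
    have hfin : ∀ (G : T.Graph) (a : T.VSocket), (if Closed (R + 1) G a then (1 : ℝ) else 0)
        ≤ (if Closed R G a then (1 : ℝ) else 0) + (if P G a then (1 : ℝ) else 0)
          + (if ∃ e, Near 1 G a e ∧ Closed R G e then (1 : ℝ) else 0) := by
      intro G a
      have h1 : Closed (R + 1) G a →
          Closed R G a ∨ P G a ∨ ∃ e, Near 1 G a e ∧ Closed R G e := by
        rintro ⟨k, h1, h2, s, hw⟩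
        rcases Nat.lt_or_ge R k with hk | hk
        · obtain rfl : k = R + 1 := by omega
          right
          -- The two ends are on opposite sides exactly when the length is even. Such a walk,
          -- reversed if it starts on the variable side, is counted by `P`; an odd one is shortened.
          cases hs : (not^[R + 1] s == s) with
          | true =>
            left
            have hs1 : not^[R + 1] s = s := by simpa using hs
            cases s with
            | true => exact ⟨hs1, hw⟩
            | false =>
              have hr := hw.reverse
              have h3 : not^[R + 1] (!false) = true := by
                have hcomm : not^[R + 1] (!false) = !(not^[R + 1] false) := by
                  rw [← Function.iterate_succ_apply, Function.iterate_succ_apply']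
                rw [hcomm, hs1]; rfl
              rw [h3] at hr
              exact ⟨h3, hr⟩
          | false =>
            right
            refine closed_of_odd (s := s) ?_ hw
            have : not^[R + 1] s ≠ s := by simpa using hs
            revert this; cases not^[R + 1] s <;> cases s <;> simp
        · exact Or.inl ⟨k, h1, hk, s, hw⟩
      by_cases hc : Closed (R + 1) G a
      · rcases h1 hc with h | h | h <;> simp only [hc, h, if_true] <;> split_ifs <;> norm_num
      · simp only [hc, if_false]; split_ifs <;> norm_num
    calc _ ≤ T.expect ε (fun G _ => (S G + ∑ a, if P G a then (1 : ℝ) else 0)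
          + ∑ a, if ∃ e, Near 1 G a e ∧ Closed R G e then (1 : ℝ) else 0) := by
          refine expect_mono hε fun G w => ?_
          rw [hS, ← Finset.sum_add_distrib, ← Finset.sum_add_distrib]
          exact Finset.sum_le_sum fun a _ => hfin G a
      _ ≤ _ := by rw [expect_add, expect_add]; gcongr

end Degrees

end

end LDPC

namespace LDPC

noncomputable section

open Degrees

/-! ### Local families -/

/-- Real functions of the variable sockets (equivalently, of the edges). -/
abbrev VFam := ∀ T : Degrees, T.Graph → T.Channel → T.VSocket → ℝ

/-- Real functions of the check sockets. -/
abbrev CFam := ∀ T : Degrees, T.Graph → T.Channel → T.CSocket → ℝ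

/-- The value of a function of check sockets at the check end of an edge. -/
def onEdge (χ : CFam) : VFam := fun T G w a => χ T G w (G a)

/-- No walk of positive length at most `R` that starts on side `s` leads from `a` to `x`. -/
def Far {T : Degrees} (R : ℕ) (G : T.Graph) (s : Bool) (a x : T.VSocket) : Prop :=
  ∀ k, 1 ≤ k → k ≤ R → ¬ Walk G k s a x

/-- `φ a` depends on the part of the graph behind the variable node of `a`, up to distance `R`. -/
structure VLocal (R : ℕ) (φ : VFam) : Prop where
  graph : ∀ T (G : T.Graph) w a x x', Far R G false a x → Far R G false a x' →
    φ T (swapG G x x') w a = φ T G w a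
  chan : ∀ T (G : T.Graph) (w w' : T.Channel) a, w a.1 = w' a.1 →
    (∀ k f, 1 ≤ k → k ≤ R → Walk G k false a f → w f.1 = w' f.1) → φ T G w a = φ T G w' a

/-- `χ b` depends on the part of the graph behind the check node of `b`, up to distance `R`. -/
structure CLocal (R : ℕ) (χ : CFam) : Prop where
  graph : ∀ T (G : T.Graph) w b x x', Far R G true (G.symm b) x → Far R G true (G.symm b) x' →
    χ T (swapG G x x') w b = χ T G w b
  chan : ∀ T (G : T.Graph) (w w' : T.Channel) b,
    (∀ k f, 1 ≤ k → k ≤ R → Walk G k true (G.symm b) f → w f.1 = w' f.1) →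
      χ T G w b = χ T G w' b

/-- `ψ a` depends on the part of the graph near the edge `a`. -/
structure ELocal (R : ℕ) (ψ : VFam) : Prop where
  graph : ∀ T (G : T.Graph) w a x x', ¬ Near R G a x → ¬ Near R G a x' →
    ψ T (swapG G x x') w a = ψ T G w a
  chan : ∀ T (G : T.Graph) (w w' : T.Channel) a,
    (∀ f, Near R G a f → w f.1 = w' f.1) → ψ T G w a = ψ T G w' a

/-- Uniform boundedness for each bound on the degrees. -/
def UnifBdd {S : Degrees → Type} (φ : ∀ T : Degrees, T.Graph → T.Channel → S T → ℝ) : Prop :=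
  ∀ D, ∃ M, ∀ T, DegBound D T → ∀ G w a, |φ T G w a| ≤ M

/-- Bounded local functions on the variable side. -/
def IsV (φ : VFam) : Prop := (∃ R, VLocal R φ) ∧ UnifBdd (S := VSocket) φ

/-- Bounded local functions on the check side. -/
def IsC (χ : CFam) : Prop := (∃ R, CLocal R χ) ∧ UnifBdd (S := CSocket) χ

/-- Bounded local functions of edges. -/
def IsE (ψ : VFam) : Prop := (∃ R, ELocal R ψ) ∧ UnifBdd (S := VSocket) ψ

lemma Far.mono {T : Degrees} {R R' : ℕ} (h : R ≤ R') {G : T.Graph} {s : Bool} {a x : T.VSocket}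
    (hf : Far R' G s a x) : Far R G s a x := fun k h1 h2 => hf k h1 (h2.trans h)

lemma VLocal.mono {R R' : ℕ} (h : R ≤ R') {φ : VFam} (hφ : VLocal R φ) : VLocal R' φ where
  graph T G w a x x' hx hx' := hφ.graph T G w a x x' (hx.mono h) (hx'.mono h)
  chan T G w w' a h0 hw := hφ.chan T G w w' a h0 fun k f h1 h2 => hw k f h1 (h2.trans h)

lemma CLocal.mono {R R' : ℕ} (h : R ≤ R') {χ : CFam} (hχ : CLocal R χ) : CLocal R' χ where
  graph T G w a x x' hx hx' := hχ.graph T G w a x x' (hx.mono h) (hx'.mono h)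
  chan T G w w' a hw := hχ.chan T G w w' a fun k f h1 h2 => hw k f h1 (h2.trans h)

lemma ELocal.mono {R R' : ℕ} (h : R ≤ R') {φ : VFam} (hφ : ELocal R φ) : ELocal R' φ where
  graph T G w a x x' hx hx' :=
    hφ.graph T G w a x x' (fun hn => hx (hn.mono h)) (fun hn => hx' (hn.mono h))
  chan T G w w' a hw := hφ.chan T G w w' a fun f hf => hw f (hf.mono h)

lemma exists_bound_of_continuous {ι : Type} [Fintype ι]
    (Ψ : ∀ d, Fin d → Bool → (Fin d → ι → ℝ) → ℝ) (hc : ∀ d i b, Continuous (Ψ d i b))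
    (D : ℕ) (M : ℝ) : ∃ M', ∀ d ≤ D, ∀ i b ξ, (∀ j τ, |ξ j τ| ≤ M) → |Ψ d i b ξ| ≤ M' := by
  have h : ∀ d i b, ∃ M', ∀ ξ : Fin d → ι → ℝ, (∀ j τ, |ξ j τ| ≤ M) → |Ψ d i b ξ| ≤ M' := by
    intro d i b
    obtain ⟨K, hK⟩ := (isCompact_closedBall (0 : Fin d → ι → ℝ) (max M 0)).exists_bound_of_continuousOn
      (hc d i b).continuousOn
    refine ⟨K, fun ξ hξ => hK ξ ?_⟩
    rw [mem_closedBall_zero_iff, pi_norm_le_iff_of_nonneg (le_max_right _ _)]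
    intro j
    rw [pi_norm_le_iff_of_nonneg (le_max_right _ _)]
    exact fun τ => (hξ j τ).trans (le_max_left _ _)
  choose B hB using h
  refine ⟨∑ d ∈ Finset.range (D + 1), ∑ i, ∑ b, |B d i b|, fun d hd i b ξ hξ => ?_⟩
  calc |Ψ d i b ξ| ≤ |B d i b| := (hB d i b ξ hξ).trans (le_abs_self _)
    _ ≤ ∑ b, |B d i b| := Finset.single_le_sum (f := fun b => |B d i b|)
        (fun _ _ => abs_nonneg _) (Finset.mem_univ b)
    _ ≤ ∑ i, ∑ b, |B d i b| := Finset.single_le_sum (f := fun i => ∑ b, |B d i b|)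
        (fun _ _ => Finset.sum_nonneg fun _ _ => abs_nonneg _) (Finset.mem_univ i)
    _ ≤ _ := Finset.single_le_sum (f := fun d => ∑ i, ∑ b, |B d i b|)
        (fun _ _ => Finset.sum_nonneg fun _ _ => Finset.sum_nonneg fun _ _ => abs_nonneg _)
        (Finset.mem_range.2 (Nat.lt_succ_of_le hd))

/-- A continuous function of the channel output and of the local functions on the other edges of a
variable node is local. -/
lemma IsV.node {ι : Type} [Fintype ι] {χ : ι → CFam} (hχ : ∀ τ, IsC (χ τ))
    (Ψ : ∀ d, Fin d → Bool → (Fin d → ι → ℝ) → ℝ) (hc : ∀ d i b, Continuous (Ψ d i b))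
    (hi : ∀ d i b ξ ξ', (∀ j, j ≠ i → ξ j = ξ' j) → Ψ d i b ξ = Ψ d i b ξ') :
    IsV (fun T G w a => Ψ (T.dv a.1) a.2 (w a.1) (fun j τ => χ τ T G w (G ⟨a.1, j⟩))) := by
  choose R hR using fun τ => (hχ τ).1
  obtain ⟨R', hR'⟩ : ∃ R', ∀ τ, R τ ≤ R' :=
    ⟨Finset.univ.sup R, fun τ => Finset.le_sup (Finset.mem_univ τ)⟩
  have adj : ∀ {T : Degrees} (G : T.Graph) (a : T.VSocket) (j : Fin (T.dv a.1)), j ≠ a.2 →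
      Adj G false a ⟨a.1, j⟩ := by
    rintro T G ⟨v, i⟩ j hj
    exact ⟨fun h => hj (by simpa using h.symm), fun _ => rfl, fun h => by simp at h⟩
  refine ⟨⟨R' + 1, ⟨?_, ?_⟩⟩, ?_⟩
  · intro T G w a x x' hx hx'
    refine hi _ _ _ _ _ fun j hj => funext fun τ => ?_
    have hadj := adj G a j hj
    have h1 : (⟨a.1, j⟩ : T.VSocket) ≠ x := fun h =>
      hx 1 le_rfl (by omega) ⟨_, hadj, h⟩
    have h2 : (⟨a.1, j⟩ : T.VSocket) ≠ x' := fun h =>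
      hx' 1 le_rfl (by omega) ⟨_, hadj, h⟩
    rw [swapG_of_ne G h1 h2]
    refine ((hR τ).mono (hR' τ)).graph T G w _ x x' ?_ ?_
    · intro k _ hk hw
      rw [Equiv.symm_apply_apply] at hw
      exact hx (k + 1) (by omega) (by omega) ⟨_, hadj, hw⟩
    · intro k _ hk hw
      rw [Equiv.symm_apply_apply] at hw
      exact hx' (k + 1) (by omega) (by omega) ⟨_, hadj, hw⟩
  · intro T G w w' a h0 hw
    simp only [h0]
    refine hi _ _ _ _ _ fun j hj => funext fun τ => ?_
    refine ((hR τ).mono (hR' τ)).chan T G w w' _ fun k f h1 hk hwk => ?_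
    rw [Equiv.symm_apply_apply] at hwk
    exact hw (k + 1) f (by omega) (by omega) ⟨_, adj G a j hj, hwk⟩
  · intro D
    choose M hM using fun τ => (hχ τ).2 D
    obtain ⟨M', hM'⟩ := exists_bound_of_continuous Ψ hc D (∑ τ, |M τ|)
    refine ⟨M', fun T hD G w a => hM' _ (hD.1 _) _ _ _ fun j τ => ?_⟩
    exact ((hM τ T hD G w _).trans (le_abs_self _)).trans
      (Finset.single_le_sum (f := fun τ => |M τ|) (fun _ _ => abs_nonneg _) (Finset.mem_univ τ))

/-- A continuous function of the local functions on the other edges of a check node is local. -/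
lemma IsC.node {ι : Type} [Fintype ι] {φ : ι → VFam} (hφ : ∀ τ, IsV (φ τ))
    (Ψ : ∀ d, Fin d → Bool → (Fin d → ι → ℝ) → ℝ) (hc : ∀ d i b, Continuous (Ψ d i b))
    (hi : ∀ d i b ξ ξ', (∀ j, j ≠ i → ξ j = ξ' j) → Ψ d i b ξ = Ψ d i b ξ') :
    IsC (fun T G w a => Ψ (T.dc a.1) a.2 true (fun j τ => φ τ T G w (G.symm ⟨a.1, j⟩))) := by
  choose R hR using fun τ => (hφ τ).1
  obtain ⟨R', hR'⟩ : ∃ R', ∀ τ, R τ ≤ R' :=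
    ⟨Finset.univ.sup R, fun τ => Finset.le_sup (Finset.mem_univ τ)⟩
  have adj : ∀ {T : Degrees} (G : T.Graph) (b : T.CSocket) (j : Fin (T.dc b.1)), j ≠ b.2 →
      Adj G true (G.symm b) (G.symm ⟨b.1, j⟩) := by
    rintro T G ⟨v, i⟩ j hj
    exact ⟨fun h => hj (by simpa using h.symm), fun h => by simp at h, fun _ => by simp⟩
  refine ⟨⟨R' + 1, ⟨?_, ?_⟩⟩, ?_⟩
  · intro T G w b x x' hx hx'
    refine hi _ _ _ _ _ fun j hj => funext fun τ => ?_
    have hadj := adj G b j hj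
    have h1 : G.symm ⟨b.1, j⟩ ≠ x := fun h => hx 1 le_rfl (by omega) ⟨_, hadj, h⟩
    have h2 : G.symm ⟨b.1, j⟩ ≠ x' := fun h => hx' 1 le_rfl (by omega) ⟨_, hadj, h⟩
    rw [swapG_symm_apply, Equiv.swap_apply_of_ne_of_ne h1 h2]
    refine ((hR τ).mono (hR' τ)).graph T G w _ x x' ?_ ?_
    · intro k _ hk hw
      exact hx (k + 1) (by omega) (by omega) ⟨_, hadj, hw⟩
    · intro k _ hk hw
      exact hx' (k + 1) (by omega) (by omega) ⟨_, hadj, hw⟩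
  · intro T G w w' b hw
    refine hi _ _ _ _ _ fun j hj => funext fun τ => ?_
    refine ((hR τ).mono (hR' τ)).chan T G w w' _ ?_ fun k f h1 hk hwk => ?_
    · exact hw 1 _ le_rfl (by omega) ⟨_, adj G b j hj, rfl⟩
    · exact hw (k + 1) f (by omega) (by omega) ⟨_, adj G b j hj, hwk⟩
  · intro D
    choose M hM using fun τ => (hφ τ).2 D
    obtain ⟨M', hM'⟩ := exists_bound_of_continuous Ψ hc D (∑ τ, |M τ|)
    refine ⟨M', fun T hD G w a => hM' _ (hD.2 _) _ _ _ fun j τ => ?_⟩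
    exact ((hM τ T hD G w _).trans (le_abs_self _)).trans
      (Finset.single_le_sum (f := fun τ => |M τ|) (fun _ _ => abs_nonneg _) (Finset.mem_univ τ))

lemma UnifBdd.mul {S : Degrees → Type} {φ ψ : ∀ T : Degrees, T.Graph → T.Channel → S T → ℝ}
    (hφ : UnifBdd φ) (hψ : UnifBdd ψ) : UnifBdd (φ * ψ) := by
  intro D
  obtain ⟨M, hM⟩ := hφ D
  obtain ⟨M', hM'⟩ := hψ D
  refine ⟨|M| * |M'|, fun T hD G w a => ?_⟩
  simp only [Pi.mul_apply, abs_mul]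
  exact mul_le_mul ((hM T hD G w a).trans (le_abs_self _)) ((hM' T hD G w a).trans (le_abs_self _))
    (abs_nonneg _) (abs_nonneg _)

lemma UnifBdd.add {S : Degrees → Type} {φ ψ : ∀ T : Degrees, T.Graph → T.Channel → S T → ℝ}
    (hφ : UnifBdd φ) (hψ : UnifBdd ψ) : UnifBdd (φ + ψ) := by
  intro D
  obtain ⟨M, hM⟩ := hφ D
  obtain ⟨M', hM'⟩ := hψ D
  exact ⟨M + M', fun T hD G w a => (abs_add_le _ _).trans
    (add_le_add (hM T hD G w a) (hM' T hD G w a))⟩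

lemma IsV.mul {φ ψ : VFam} (hφ : IsV φ) (hψ : IsV ψ) : IsV (φ * ψ) := by
  obtain ⟨⟨R, h⟩, hb⟩ := hφ
  obtain ⟨⟨R', h'⟩, hb'⟩ := hψ
  replace h := h.mono (le_max_left R R')
  replace h' := h'.mono (le_max_right R R')
  refine ⟨⟨max R R', ⟨fun T G w a x x' hx hx' => ?_, fun T G w w' a h0 hw => ?_⟩⟩, hb.mul hb'⟩
  · simp only [Pi.mul_apply, h.graph T G w a x x' hx hx', h'.graph T G w a x x' hx hx']
  · simp only [Pi.mul_apply, h.chan T G w w' a h0 hw, h'.chan T G w w' a h0 hw]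

lemma IsV.add {φ ψ : VFam} (hφ : IsV φ) (hψ : IsV ψ) : IsV (φ + ψ) := by
  obtain ⟨⟨R, h⟩, hb⟩ := hφ
  obtain ⟨⟨R', h'⟩, hb'⟩ := hψ
  replace h := h.mono (le_max_left R R')
  replace h' := h'.mono (le_max_right R R')
  refine ⟨⟨max R R', ⟨fun T G w a x x' hx hx' => ?_, fun T G w w' a h0 hw => ?_⟩⟩, hb.add hb'⟩
  · simp only [Pi.add_apply, h.graph T G w a x x' hx hx', h'.graph T G w a x x' hx hx']
  · simp only [Pi.add_apply, h.chan T G w w' a h0 hw, h'.chan T G w w' a h0 hw]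

lemma IsC.mul {φ ψ : CFam} (hφ : IsC φ) (hψ : IsC ψ) : IsC (φ * ψ) := by
  obtain ⟨⟨R, h⟩, hb⟩ := hφ
  obtain ⟨⟨R', h'⟩, hb'⟩ := hψ
  replace h := h.mono (le_max_left R R')
  replace h' := h'.mono (le_max_right R R')
  refine ⟨⟨max R R', ⟨fun T G w a x x' hx hx' => ?_, fun T G w w' a hw => ?_⟩⟩, hb.mul hb'⟩
  · simp only [Pi.mul_apply, h.graph T G w a x x' hx hx', h'.graph T G w a x x' hx hx']
  · simp only [Pi.mul_apply, h.chan T G w w' a hw, h'.chan T G w w' a hw]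

lemma IsC.add {φ ψ : CFam} (hφ : IsC φ) (hψ : IsC ψ) : IsC (φ + ψ) := by
  obtain ⟨⟨R, h⟩, hb⟩ := hφ
  obtain ⟨⟨R', h'⟩, hb'⟩ := hψ
  replace h := h.mono (le_max_left R R')
  replace h' := h'.mono (le_max_right R R')
  refine ⟨⟨max R R', ⟨fun T G w a x x' hx hx' => ?_, fun T G w w' a hw => ?_⟩⟩, hb.add hb'⟩
  · simp only [Pi.add_apply, h.graph T G w a x x' hx hx', h'.graph T G w a x x' hx hx']
  · simp only [Pi.add_apply, h.chan T G w w' a hw, h'.chan T G w w' a hw]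

lemma IsE.mul {φ ψ : VFam} (hφ : IsE φ) (hψ : IsE ψ) : IsE (φ * ψ) := by
  obtain ⟨⟨R, h⟩, hb⟩ := hφ
  obtain ⟨⟨R', h'⟩, hb'⟩ := hψ
  replace h := h.mono (le_max_left R R')
  replace h' := h'.mono (le_max_right R R')
  refine ⟨⟨max R R', ⟨fun T G w a x x' hx hx' => ?_, fun T G w w' a hw => ?_⟩⟩, hb.mul hb'⟩
  · simp only [Pi.mul_apply, h.graph T G w a x x' hx hx', h'.graph T G w a x x' hx hx']
  · simp only [Pi.mul_apply, h.chan T G w w' a hw, h'.chan T G w w' a hw]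

/-- A constant function. -/
def constV (c : ℝ) : VFam := fun _ _ _ _ => c

/-- A constant function. -/
def constC (c : ℝ) : CFam := fun _ _ _ _ => c

lemma isV_const (c : ℝ) : IsV (constV c) :=
  ⟨⟨0, ⟨fun _ _ _ _ _ _ _ _ => rfl, fun _ _ _ _ _ _ _ => rfl⟩⟩,
    fun _ => ⟨|c|, fun _ _ _ _ _ => le_rfl⟩⟩

lemma isC_const (c : ℝ) : IsC (constC c) :=
  ⟨⟨0, ⟨fun _ _ _ _ _ _ _ _ => rfl, fun _ _ _ _ _ _ => rfl⟩⟩,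
    fun _ => ⟨|c|, fun _ _ _ _ _ => le_rfl⟩⟩

lemma IsV.isE {φ : VFam} (hφ : IsV φ) : IsE φ := by
  obtain ⟨⟨R, h⟩, hb⟩ := hφ
  refine ⟨⟨R, ⟨fun T G w a x x' hx hx' => h.graph T G w a x x' ?_ ?_,
    fun T G w w' a hw => h.chan T G w w' a ?_ ?_⟩⟩, hb⟩
  · exact fun k _ hk hw => hx ⟨k, hk, _, hw⟩
  · exact fun k _ hk hw => hx' ⟨k, hk, _, hw⟩
  · exact hw a ⟨0, Nat.zero_le _, false, rfl⟩
  · exact fun k f _ hk hwk => hw f ⟨k, hk, _, hwk⟩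

lemma IsC.isE {χ : CFam} (hχ : IsC χ) : IsE (onEdge χ) := by
  obtain ⟨⟨R, h⟩, hb⟩ := hχ
  refine ⟨⟨R, ⟨fun T G w a x x' hx hx' => ?_, fun T G w w' a hw => h.chan T G w w' _ ?_⟩⟩,
    fun D => ?_⟩
  · have h1 : a ≠ x := fun h => hx ⟨0, Nat.zero_le _, true, h⟩
    have h2 : a ≠ x' := fun h => hx' ⟨0, Nat.zero_le _, true, h⟩
    unfold onEdge
    rw [swapG_of_ne G h1 h2]
    refine h.graph T G w _ x x' ?_ ?_
    · intro k _ hk hw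
      rw [Equiv.symm_apply_apply] at hw
      exact hx ⟨k, hk, _, hw⟩
    · intro k _ hk hw
      rw [Equiv.symm_apply_apply] at hw
      exact hx' ⟨k, hk, _, hw⟩
  · intro k f _ hk hwk
    rw [Equiv.symm_apply_apply] at hwk
    exact hw f ⟨k, hk, _, hwk⟩
  · obtain ⟨M, hM⟩ := hb D
    exact ⟨M, fun T hD G w a => hM T hD G w _⟩

/-! ### Sums of local functions -/

/-- The sum over all edges. -/
def tot (ψ : VFam) (T : Degrees) (G : T.Graph) (w : T.Channel) : ℝ := ∑ a, ψ T G w a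

-- Only edges within distance `R` of `S` can contribute, and each of them contributes at most `2M`.
open Classical in
lemma sum_diff_le {T : Degrees} {D R : ℕ} (hD : DegBound D T) (G : T.Graph) (u u' : T.VSocket → ℝ)
    {M : ℝ} (hM : 0 ≤ M) (hu : ∀ a, |u a| ≤ M) (hu' : ∀ a, |u' a| ≤ M) (S : Finset T.VSocket)
    (hS : ∀ a, (∀ x ∈ S, ¬ Near R G a x) → u a = u' a) :
    |∑ a, u a - ∑ a, u' a| ≤ S.card * (ballBound D R * (2 * M)) := by
  rw [← Finset.sum_sub_distrib]
  calc _ ≤ ∑ a, |u a - u' a| := Finset.abs_sum_le_sum_abs _ _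
    _ ≤ ∑ a, ∑ x ∈ S, (if Near R G a x then 2 * M else 0) := by
        refine Finset.sum_le_sum fun a _ => ?_
        by_cases h : ∀ x ∈ S, ¬ Near R G a x
        · rw [hS a h, sub_self, abs_zero]
          exact Finset.sum_nonneg fun x _ => by split_ifs <;> linarith
        · push Not at h
          obtain ⟨x, hx, hn⟩ := h
          refine le_trans ?_ (Finset.single_le_sum (fun y _ => ?_) hx)
          · rw [if_pos hn]
            exact (abs_sub _ _).trans (by linarith [hu a, hu' a])
          · split_ifs <;> linarith
    _ = ∑ x ∈ S, ((Finset.univ.filter fun a => Near R G a x).card : ℝ) * (2 * M) := by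
        rw [Finset.sum_comm]
        refine Finset.sum_congr rfl fun x _ => ?_
        rw [← Finset.sum_filter, Finset.sum_const, nsmul_eq_mul]
    _ ≤ ∑ x ∈ S, (ballBound D R : ℝ) * (2 * M) := by
        gcongr with x _
        exact_mod_cast card_near_le' hD G R x
    _ = _ := by rw [Finset.sum_const, nsmul_eq_mul]

lemma card_var_sockets_le {T : Degrees} {D : ℕ} (hD : DegBound D T) (v : Fin T.n) :
    (Finset.univ.filter fun a : T.VSocket => a.1 = v).card ≤ D := by
  refine le_trans ?_ (hD.1 v)
  rw [← Fintype.card_fin (T.dv v), ← Finset.card_univ,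
    ← Finset.card_image_of_injective Finset.univ
      (f := fun i : Fin (T.dv v) => (⟨v, i⟩ : T.VSocket)) (fun _ _ h => by simpa using h)]
  refine Finset.card_le_card fun f hf => ?_
  have h := (Finset.mem_filter.1 hf).2
  obtain ⟨v', i⟩ := f
  simp only at h
  subst h
  exact Finset.mem_image_of_mem _ (Finset.mem_univ _)

/-- An exchange touches two edges and a channel output at most `D`; each lies in the neighbourhoods
of at most `ballBound D R` edges. The summand `1` keeps the constant positive. -/
lemma IsE.boundedDiff {ψ : VFam} (hψ : IsE ψ) (D : ℕ) :
    ∃ c : ℝ, 0 < c ∧ ∀ T, DegBound D T → BoundedDiff (T := T) c (tot ψ T) := by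
  classical
  obtain ⟨⟨R, h⟩, hb⟩ := hψ
  obtain ⟨M, hM⟩ := hb D
  refine ⟨(2 + D) * (ballBound D R * (2 * |M|)) + 1, by positivity, fun T hD => ⟨?_, ?_⟩⟩
  · intro G w x x'
    rw [abs_sub_comm]
    refine (sum_diff_le hD G _ _ (abs_nonneg M)
      (fun a => (hM T hD G w a).trans (le_abs_self _))
      (fun a => (hM T hD _ w a).trans (le_abs_self _)) {x, x'}
      (R := R) (fun a ha => (h.graph T G w a x x' (ha x (by simp)) (ha x' (by simp))).symm)).trans ?_
    have h2 : (({x, x'} : Finset T.VSocket).card : ℝ) ≤ 2 := by exact_mod_cast Finset.card_le_two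
    have : 0 ≤ (ballBound D R * (2 * |M|) : ℝ) := by positivity
    nlinarith [mul_le_mul_of_nonneg_right h2 this,
      mul_nonneg (Nat.cast_nonneg (α := ℝ) D) this]
  · intro G w v b
    rw [abs_sub_comm]
    refine (sum_diff_le hD G _ _ (abs_nonneg M)
      (fun a => (hM T hD G w a).trans (le_abs_self _))
      (fun a => (hM T hD _ _ a).trans (le_abs_self _))
      (Finset.univ.filter fun a : T.VSocket => a.1 = v)
      (R := R) (fun a ha => h.chan T G w _ a fun f hf => ?_)).trans ?_
    · have : f.1 ≠ v := fun hv => ha f (by simp [hv]) hf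
      rw [Function.update_of_ne this]
    have h2 : ((Finset.univ.filter fun a : T.VSocket => a.1 = v).card : ℝ) ≤ D := by
      exact_mod_cast card_var_sockets_le hD v
    have : 0 ≤ (ballBound D R * (2 * |M|) : ℝ) := by positivity
    nlinarith [mul_le_mul_of_nonneg_right h2 this]

end

end LDPC

/-! ### Covariance calculus by random exchanges -/

namespace LDPC

noncomputable section

open Degrees

/-! ### Asymptotically negligible quantities -/

/-- Degree assignments with bounded degrees, at least one edge and not too many nodes. -/
structure Adm (D : ℕ) (T : Degrees) : Prop where
  deg : DegBound D T
  pos : 0 < T.numEdges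
  nle : T.n ≤ D * T.numEdges

/-- The fourth root of the number of edges. -/
def root (T : Degrees) : ℝ := √(√(T.numEdges : ℝ))

lemma root_pow (T : Degrees) : root T ^ 4 = T.numEdges := by
  rw [root, show (4 : ℕ) = 2 * 2 from rfl, pow_mul, Real.sq_sqrt (Real.sqrt_nonneg _),
    Real.sq_sqrt (Nat.cast_nonneg _)]

lemma Adm.cast_pos {D : ℕ} {T : Degrees} (h : Adm D T) : (0 : ℝ) < T.numEdges := by
  exact_mod_cast h.pos

lemma Adm.one_le_root {D : ℕ} {T : Degrees} (h : Adm D T) : 1 ≤ root T := by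
  rw [root, Real.one_le_sqrt, Real.one_le_sqrt]
  exact_mod_cast h.pos

/-- Quantities of order `N ^ (-1/4)`, uniformly for bounded degrees. -/
def Negl (X : Degrees → ℝ) : Prop := ∀ D, ∃ C, ∀ T, Adm D T → |X T| ≤ C / root T

/-- Quantities that are uniformly bounded for bounded degrees. -/
def Bddd (X : Degrees → ℝ) : Prop := ∀ D, ∃ C, ∀ T, Adm D T → |X T| ≤ C

lemma Negl.add {X Y : Degrees → ℝ} (hX : Negl X) (hY : Negl Y) : Negl (fun T => X T + Y T) := by
  intro D
  obtain ⟨C, hC⟩ := hX D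
  obtain ⟨C', hC'⟩ := hY D
  exact ⟨C + C', fun T hT => (abs_add_le _ _).trans
    (by rw [add_div]; exact add_le_add (hC T hT) (hC' T hT))⟩

lemma Negl.neg {X : Degrees → ℝ} (hX : Negl X) : Negl (fun T => - X T) := by
  intro D
  obtain ⟨C, hC⟩ := hX D
  exact ⟨C, fun T hT => by rw [abs_neg]; exact hC T hT⟩

lemma Negl.sub {X Y : Degrees → ℝ} (hX : Negl X) (hY : Negl Y) : Negl (fun T => X T - Y T) := by
  simpa only [sub_eq_add_neg] using hX.add hY.neg

lemma Negl.sum {ι : Type*} (s : Finset ι) {X : ι → Degrees → ℝ} (hX : ∀ i ∈ s, Negl (X i)) :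
    Negl (fun T => ∑ i ∈ s, X i T) := by
  classical
  induction s using Finset.induction_on with
  | empty => exact fun D => ⟨0, fun T _ => by simp⟩
  | insert i s hi ih =>
    simp only [Finset.sum_insert hi]
    exact (hX i (Finset.mem_insert_self i s)).add
      (ih fun j hj => hX j (Finset.mem_insert_of_mem hj))

lemma Bddd.mul_negl {X Y : Degrees → ℝ} (hX : Bddd X) (hY : Negl Y) :
    Negl (fun T => X T * Y T) := by
  intro D
  obtain ⟨C, hC⟩ := hX D
  obtain ⟨C', hC'⟩ := hY D
  refine ⟨C * C', fun T hT => ?_⟩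
  rw [abs_mul, mul_div_assoc]
  exact mul_le_mul (hC T hT) (hC' T hT) (abs_nonneg _) ((abs_nonneg _).trans (hC T hT))

lemma Negl.congr {X Y : Degrees → ℝ} (hX : Negl X) (h : ∀ T, 0 < T.numEdges → X T = Y T) :
    Negl Y := by
  intro D
  obtain ⟨C, hC⟩ := hX D
  exact ⟨C, fun T hT => by rw [← h T hT.pos]; exact hC T hT⟩

lemma negl_of_le {X : Degrees → ℝ} (h : ∀ D, ∃ C, ∀ T, Adm D T → |X T| ≤ C / T.numEdges) :
    Negl X := by
  intro D
  obtain ⟨C, hC⟩ := h D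
  refine ⟨|C|, fun T hT => (hC T hT).trans ?_⟩
  have h1 := hT.one_le_root
  rw [← root_pow]
  have h2 : root T ≤ root T ^ 4 := le_self_pow₀ h1 (by norm_num)
  calc C / root T ^ 4 ≤ |C| / root T ^ 4 := by gcongr; exact le_abs_self C
    _ ≤ |C| / root T := by gcongr

/-! ### Moments of sums of local functions -/

variable {ε : ℝ}

/-- The expected average over the edges. -/
def avg (ε : ℝ) (ψ : VFam) (T : Degrees) : ℝ := T.expect ε (tot ψ T) / T.numEdges

lemma abs_avg_le (hε : ε ∈ Set.Icc (0 : ℝ) 1) {ψ : VFam} (hψ : UnifBdd (S := VSocket) ψ) :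
    Bddd (avg ε ψ) := by
  intro D
  obtain ⟨M, hM⟩ := hψ D
  refine ⟨M, fun T hT => ?_⟩
  have hN := hT.cast_pos
  rw [avg, abs_div, abs_of_pos hN, div_le_iff₀ hN]
  refine (abs_expect_le_of_le hε (g := fun _ _ => M * T.numEdges) fun G w => ?_).trans
    (le_of_eq (expect_const _))
  refine (Finset.abs_sum_le_sum_abs _ _).trans
    ((Finset.sum_le_sum fun a _ => hM T hT.deg G w a).trans (le_of_eq ?_))
  simp [Finset.card_univ, numEdges, mul_comm]

lemma avg_add (ψ ψ' : VFam) (T : Degrees) : avg ε (ψ + ψ') T = avg ε ψ T + avg ε ψ' T := by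
  unfold avg tot
  simp only [Pi.add_apply, Finset.sum_add_distrib, expect_add, add_div]

lemma avg_const_mul (c : ℝ) (ψ : VFam) (T : Degrees) :
    avg ε (constV c * ψ) T = c * avg ε ψ T := by
  unfold avg tot constV
  simp only [Pi.mul_apply, ← Finset.mul_sum, expect_const_mul, mul_div_assoc]

lemma avg_const (c : ℝ) {T : Degrees} (hT : 0 < T.numEdges) : avg ε (constV c) T = c := by
  have : (T.numEdges : ℝ) ≠ 0 := by exact_mod_cast hT.ne'
  unfold avg tot constV
  simp only [Finset.sum_const, Finset.card_univ, nsmul_eq_mul, expect_const]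
  change (T.numEdges : ℝ) * c / T.numEdges = c
  field_simp

/-- The deviation from the mean. -/
def dev (ε : ℝ) (ψ : VFam) (T : Degrees) (G : T.Graph) (w : T.Channel) : ℝ :=
  tot ψ T G w - T.expect ε (tot ψ T)

lemma expect_dev (ψ : VFam) (T : Degrees) : T.expect ε (dev ε ψ T) = 0 := by
  unfold dev
  rw [expect_sub, expect_const, sub_self]

/-- The number of nodes is at most `D N`, so the bounded difference estimate is of order `N²`. The
second moment follows from `z² ≤ z⁴/N + N`. -/
lemma moments (hε : ε ∈ Set.Icc (0 : ℝ) 1) {ψ : VFam} (hψ : IsE ψ) (D : ℕ) :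
    ∃ C : ℝ, 0 ≤ C ∧ ∀ T, Adm D T →
      T.expect ε (fun G w => dev ε ψ T G w ^ 4) ≤ C * (T.numEdges : ℝ) ^ 2 ∧
      T.expect ε (fun G w => dev ε ψ T G w ^ 2) ≤ C * T.numEdges := by
  obtain ⟨c, hc, h⟩ := hψ.boundedDiff D
  set K : ℝ := 48 * Real.exp (2 * c ^ 2) * (1 + D) ^ 2 with hK
  refine ⟨K + 1, by positivity, fun T hT => ?_⟩
  have hN := hT.cast_pos
  have h4 : T.expect ε (fun G w => dev ε ψ T G w ^ 4) ≤ K * (T.numEdges : ℝ) ^ 2 := by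
    refine (expect_fourth_le hε hc (h T hT.deg) hT.pos).trans ?_
    have : (T.n : ℝ) ≤ D * T.numEdges := by exact_mod_cast hT.nle
    calc 48 * Real.exp (2 * c ^ 2) * ((T.numEdges : ℝ) + T.n) ^ 2
        ≤ 48 * Real.exp (2 * c ^ 2) * ((T.numEdges : ℝ) + D * T.numEdges) ^ 2 := by gcongr
      _ = _ := by rw [hK]; ring
  refine ⟨h4.trans (by gcongr; linarith), ?_⟩
  have hp : ∀ G w, dev ε ψ T G w ^ 2
      ≤ 1 / T.numEdges * dev ε ψ T G w ^ 4 + T.numEdges := by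
    intro G w
    set z := dev ε ψ T G w
    have e : 1 / (T.numEdges : ℝ) * z ^ 4 + T.numEdges - z ^ 2
        = ((z ^ 2 - T.numEdges) ^ 2 + z ^ 2 * T.numEdges) / T.numEdges := by
      field_simp; ring
    have : 0 ≤ ((z ^ 2 - T.numEdges) ^ 2 + z ^ 2 * T.numEdges) / (T.numEdges : ℝ) := by positivity
    linarith
  refine (expect_mono hε hp).trans ?_
  rw [expect_add, expect_const_mul, expect_const]
  calc _ ≤ 1 / (T.numEdges : ℝ) * (K * (T.numEdges : ℝ) ^ 2) + T.numEdges := by gcongr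
    _ = (K + 1) * T.numEdges := by field_simp

lemma abs_expect_dev_mul_le (hε : ε ∈ Set.Icc (0 : ℝ) 1) {ψ ψ' : VFam} (hψ : IsE ψ)
    (hψ' : IsE ψ') (D : ℕ) : ∃ C : ℝ, 0 ≤ C ∧ ∀ T, Adm D T →
      |T.expect ε (fun G w => dev ε ψ T G w * dev ε ψ' T G w)| ≤ C * T.numEdges := by
  obtain ⟨C, hC, h⟩ := moments hε hψ D
  obtain ⟨C', hC', h'⟩ := moments hε hψ' D
  refine ⟨C + C', by positivity, fun T hT => ?_⟩
  refine (abs_expect_le_of_le hε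
    (g := fun G w => dev ε ψ T G w ^ 2 + dev ε ψ' T G w ^ 2) fun G w => ?_).trans ?_
  · rw [abs_le]
    constructor <;> nlinarith [sq_nonneg (dev ε ψ T G w + dev ε ψ' T G w),
      sq_nonneg (dev ε ψ T G w - dev ε ψ' T G w), sq_nonneg (dev ε ψ T G w),
      sq_nonneg (dev ε ψ' T G w)]
  · rw [expect_add, add_mul]
    exact add_le_add (h T hT).2 (h' T hT).2

lemma expect_tot_mul_tot (ψ ψ' : VFam) (T : Degrees) :
    T.expect ε (fun G w => tot ψ T G w * tot ψ' T G w)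
      = T.expect ε (tot ψ T) * T.expect ε (tot ψ' T)
        + T.expect ε (fun G w => dev ε ψ T G w * dev ε ψ' T G w) := by
  have : ∀ G w, dev ε ψ T G w * dev ε ψ' T G w = tot ψ T G w * tot ψ' T G w
      - tot ψ T G w * T.expect ε (tot ψ' T) - (T.expect ε (tot ψ T) * tot ψ' T G w
      - T.expect ε (tot ψ T) * T.expect ε (tot ψ' T)) := by
    intro G w; unfold dev; ring
  simp only [this, expect_sub, expect_mul_const, expect_const_mul, expect_const]
  ring

/-- Averages of local functions are asymptotically uncorrelated. -/
lemma negl_avg_mul (hε : ε ∈ Set.Icc (0 : ℝ) 1) {ψ ψ' : VFam} (hψ : IsE ψ) (hψ' : IsE ψ') :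
    Negl (fun T => T.expect ε (fun G w => tot ψ T G w * tot ψ' T G w) / (T.numEdges : ℝ) ^ 2
      - avg ε ψ T * avg ε ψ' T) := by
  refine negl_of_le fun D => ?_
  obtain ⟨C, hC, h⟩ := abs_expect_dev_mul_le hε hψ hψ' D
  refine ⟨C, fun T hT => ?_⟩
  have hN := hT.cast_pos
  rw [expect_tot_mul_tot, avg, avg]
  have e : (T.expect ε (tot ψ T) * T.expect ε (tot ψ' T)
      + T.expect ε (fun G w => dev ε ψ T G w * dev ε ψ' T G w)) / (T.numEdges : ℝ) ^ 2
      - T.expect ε (tot ψ T) / T.numEdges * (T.expect ε (tot ψ' T) / T.numEdges)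
      = T.expect ε (fun G w => dev ε ψ T G w * dev ε ψ' T G w) / (T.numEdges : ℝ) ^ 2 := by
    field_simp; ring
  rw [e, abs_div, abs_of_pos (by positivity : (0 : ℝ) < (T.numEdges : ℝ) ^ 2),
    div_le_div_iff₀ (by positivity) hN]
  nlinarith [h T hT]

/-! ### Exchanging the partners of two random edges -/

/-- The edges `a`, `a'` are close to each other or one of them is close to a short cycle. -/
def Bad {T : Degrees} (R : ℕ) (G : T.Graph) (a a' : T.VSocket) : Prop :=
  Near R G a a' ∨ Closed R G a ∨ Closed R G a'

lemma Bad.mono {T : Degrees} {R R' : ℕ} (h : R ≤ R') {G : T.Graph} {a a' : T.VSocket}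
    (hb : Bad R G a a') : Bad R' G a a' :=
  hb.imp (fun h1 => h1.mono h) (fun h1 => h1.imp (fun h2 => h2.mono h) (fun h2 => h2.mono h))

open Classical in
/-- The number of bad pairs of edges. -/
def badCount (R : ℕ) (T : Degrees) (G : T.Graph) : ℝ :=
  ∑ a, ∑ a', if Bad R G a a' then 1 else 0

lemma badCount_nonneg (R : ℕ) (T : Degrees) (G : T.Graph) : 0 ≤ badCount R T G :=
  Finset.sum_nonneg fun _ _ => Finset.sum_nonneg fun _ _ => by split_ifs <;> norm_num

lemma badCount_le (R : ℕ) (T : Degrees) (G : T.Graph) :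
    badCount R T G ≤ (T.numEdges : ℝ) ^ 2 := by
  calc badCount R T G ≤ ∑ _a : T.VSocket, ∑ _a' : T.VSocket, (1 : ℝ) :=
        Finset.sum_le_sum fun _ _ => Finset.sum_le_sum fun _ _ => by split_ifs <;> norm_num
    _ = _ := by simp [Finset.card_univ, numEdges, sq]

/-- Near pairs number at most `N` times the size of a ball. An edge on a short cycle spoils at most
`2N` pairs, but there are only boundedly many such edges on average. Hence `O(N)` of the `N²` pairs
are bad. -/
lemma expect_badCount_le (D R : ℕ) : ∃ C : ℝ, 0 ≤ C ∧ ∀ (ε : ℝ) (_ : ε ∈ Set.Icc (0 : ℝ) 1) T,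
    DegBound D T → T.expect ε (fun G _ => badCount R T G) ≤ C * T.numEdges := by
  classical
  obtain ⟨C, hC, h⟩ := exists_expect_closed_le D R
  refine ⟨ballBound D R + C + C, by positivity, fun ε hε T hD => ?_⟩
  have hh := h ε hε T hD
  set S : T.Graph → ℝ := fun G => ∑ a, if Closed R G a then (1 : ℝ) else 0 with hS
  have hp : ∀ G : T.Graph, badCount R T G
      ≤ ballBound D R * T.numEdges + T.numEdges * S G + T.numEdges * S G := by
    intro G
    calc badCount R T G ≤ ∑ a, ∑ a', ((if Near R G a a' then (1 : ℝ) else 0)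
          + (if Closed R G a then (1 : ℝ) else 0) + (if Closed R G a' then (1 : ℝ) else 0)) := by
          refine Finset.sum_le_sum fun a _ => Finset.sum_le_sum fun a' _ => ?_
          by_cases hb : Bad R G a a'
          · rcases hb with h | h | h <;> simp only [Bad, h, true_or, or_true, if_true] <;>
              split_ifs <;> norm_num
          · simp only [hb, if_false]; split_ifs <;> norm_num
      _ = ∑ a, ((Finset.univ.filter fun a' => Near R G a a').card : ℝ) + T.numEdges * S G
          + T.numEdges * S G := by
          simp only [Finset.sum_add_distrib, Finset.sum_const, Finset.card_univ, nsmul_eq_mul,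
            ← Finset.mul_sum, Finset.sum_boole, hS]
          rfl
      _ ≤ ∑ _a : T.VSocket, (ballBound D R : ℝ) + T.numEdges * S G + T.numEdges * S G := by
          gcongr with a _
          exact_mod_cast card_near_le hD G R a
      _ = _ := by simp [Finset.card_univ, numEdges, mul_comm]
  refine (expect_mono hε fun G w => hp G).trans ?_
  rw [expect_add, expect_add, expect_const, expect_const_mul]
  have hN : (0 : ℝ) ≤ T.numEdges := Nat.cast_nonneg _
  nlinarith [mul_le_mul_of_nonneg_left hh hN]

/-- What lies behind the variable node of `a` does not see how `a` itself is matched. It changes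
only if a short walk returns to `a` or reaches `a'`, which makes the pair bad. -/
lemma VLocal.swap_eq {R : ℕ} {φ : VFam} (h : VLocal R φ) {T : Degrees} {G : T.Graph}
    (w : T.Channel) {a a' : T.VSocket} (hb : ¬ Bad R G a a') :
    φ T (swapG G a a') w a = φ T G w a := by
  refine h.graph T G w a a a' ?_ ?_
  · exact fun k h1 hk hw => hb (Or.inr (Or.inl ⟨k, h1, hk, _, hw⟩))
  · exact fun k h1 hk hw => hb (Or.inl ⟨k, hk, _, hw⟩)

lemma CLocal.swap_eq {R : ℕ} {χ : CFam} (h : CLocal R χ) {T : Degrees} {G : T.Graph}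
    (w : T.Channel) {a a' : T.VSocket} (hb : ¬ Bad R G a a') :
    χ T (swapG G a a') w (G a') = χ T G w (G a') := by
  refine h.graph T G w _ a a' ?_ ?_
  · intro k h1 hk hw
    rw [Equiv.symm_apply_apply] at hw
    exact hb (Or.inl ⟨k, hk, _, hw.reverse⟩)
  · intro k h1 hk hw
    rw [Equiv.symm_apply_apply] at hw
    exact hb (Or.inr (Or.inr ⟨k, h1, hk, _, hw⟩))

/-- After the exchange, the two sides of an edge are paired independently, up to bad pairs. -/
lemma abs_swap_sum_sub_le (hε : ε ∈ Set.Icc (0 : ℝ) 1) {φ : VFam} {χ : CFam} {R : ℕ}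
    (hφ : VLocal R φ) (hχ : CLocal R χ) {T : Degrees} {M M' : ℝ}
    (hM : ∀ G w a, |φ T G w a| ≤ M) (hM' : ∀ G w b, |χ T G w b| ≤ M')
    (Z : T.Graph → T.Channel → ℝ) :
    |T.expect ε (fun G w => (∑ a, ∑ a', φ T (swapG G a a') w a * onEdge χ T (swapG G a a') w a)
        * Z G w)
      - T.expect ε (fun G w => tot φ T G w * tot (onEdge χ) T G w * Z G w)|
      ≤ 2 * (M * M') * T.expect ε (fun G w => badCount R T G * |Z G w|) := by
  classical
  rw [← expect_sub, ← expect_const_mul]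
  refine abs_expect_le_of_le hε fun G w => ?_
  rw [← sub_mul, abs_mul, ← mul_assoc]
  refine mul_le_mul_of_nonneg_right ?_ (abs_nonneg _)
  unfold tot
  rw [Finset.sum_mul_sum, ← Finset.sum_sub_distrib, badCount, Finset.mul_sum]
  refine (Finset.abs_sum_le_sum_abs _ _).trans (Finset.sum_le_sum fun a _ => ?_)
  rw [← Finset.sum_sub_distrib, Finset.mul_sum]
  refine (Finset.abs_sum_le_sum_abs _ _).trans (Finset.sum_le_sum fun a' _ => ?_)
  unfold onEdge
  rw [swapG_left]
  split_ifs with hb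
  · have a1 : |φ T (swapG G a a') w a * χ T (swapG G a a') w (G a')| ≤ M * M' := by
      rw [abs_mul]
      exact mul_le_mul (hM _ _ _) (hM' _ _ _) (abs_nonneg _) ((abs_nonneg _).trans (hM G w a))
    have a2 : |φ T G w a * χ T G w (G a')| ≤ M * M' := by
      rw [abs_mul]
      exact mul_le_mul (hM _ _ _) (hM' _ _ _) (abs_nonneg _) ((abs_nonneg _).trans (hM G w a))
    refine (abs_sub _ _).trans ?_
    linarith
  · rw [hφ.swap_eq w hb, hχ.swap_eq w hb, sub_self, abs_zero, mul_zero]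

/-- For each pair the exchange is an involution of the ensemble, so it may be moved from the summand
onto the test function `Z`. -/
lemma expect_sum_swap {T : Degrees} (f : T.Graph → T.Channel → T.VSocket → ℝ) (Z : T.Graph → T.Channel → ℝ) :
    T.expect ε (fun G w => (∑ a, ∑ a', f (swapG G a a') w a) * Z G w)
      = T.expect ε (fun G w => ∑ a, ∑ a', f G w a * Z (swapG G a a') w) := by
  simp only [Finset.sum_mul, expect_sum]
  refine Finset.sum_congr rfl fun a _ => Finset.sum_congr rfl fun a' _ => ?_
  rw [← expect_swap _ a a']
  simp only [swapG_swapG]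

/-- The two sides of an edge are asymptotically independent. -/
lemma negl_glue (hε : ε ∈ Set.Icc (0 : ℝ) 1) {φ : VFam} {χ : CFam} (hφ : IsV φ) (hχ : IsC χ) :
    Negl (fun T => avg ε (φ * onEdge χ) T - avg ε φ T * avg ε (onEdge χ) T) := by
  have h2 := negl_avg_mul hε hφ.isE hχ.isE
  have h1 : Negl (fun T => avg ε (φ * onEdge χ) T
      - T.expect ε (fun G w => tot φ T G w * tot (onEdge χ) T G w) / (T.numEdges : ℝ) ^ 2) := by
    obtain ⟨⟨R, hR⟩, hb⟩ := hφ
    obtain ⟨⟨R', hR'⟩, hb'⟩ := hχ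
    replace hR := hR.mono (le_max_left R R')
    replace hR' := hR'.mono (le_max_right R R')
    refine negl_of_le fun D => ?_
    obtain ⟨M, hM⟩ := hb D
    obtain ⟨M', hM'⟩ := hb' D
    obtain ⟨C, hC, hbad⟩ := expect_badCount_le D (max R R')
    refine ⟨2 * (|M| * |M'|) * C, fun T hT => ?_⟩
    have hN := hT.cast_pos
    -- With `Z = 1` the exchange identity reads `N · E[∑ φχ] = E[(∑ φ)(∑ χ)] + O(N)`.
    have key := abs_swap_sum_sub_le hε hR hR' (M := |M|) (M' := |M'|)
      (fun G w a => (hM T hT.deg G w a).trans (le_abs_self _))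
      (fun G w a => (hM' T hT.deg G w a).trans (le_abs_self _)) (fun _ _ => 1)
    rw [expect_sum_swap (fun G w a => φ T G w a * onEdge χ T G w a)] at key
    simp only [mul_one, abs_one, Finset.sum_const, Finset.card_univ, nsmul_eq_mul,
      ← Finset.mul_sum, expect_const_mul] at key
    have e : avg ε (φ * onEdge χ) T
        - T.expect ε (fun G w => tot φ T G w * tot (onEdge χ) T G w) / (T.numEdges : ℝ) ^ 2
        = ((T.numEdges : ℝ) * T.expect ε (fun G w => ∑ a, φ T G w a * onEdge χ T G w a)
          - T.expect ε (fun G w => tot φ T G w * tot (onEdge χ) T G w))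
          / (T.numEdges : ℝ) ^ 2 := by
      have : tot (φ * onEdge χ) T = fun G w => ∑ a, φ T G w a * onEdge χ T G w a := rfl
      rw [avg, this]
      field_simp
    rw [e, abs_div, abs_of_pos (by positivity : (0 : ℝ) < (T.numEdges : ℝ) ^ 2),
      div_le_div_iff₀ (by positivity) hN]
    have k2 : _ ≤ 2 * (|M| * |M'|) * (C * T.numEdges) :=
      key.trans (mul_le_mul_of_nonneg_left (hbad ε hε T hT.deg) (by positivity))
    calc _ ≤ 2 * (|M| * |M'|) * (C * T.numEdges) * T.numEdges :=
          mul_le_mul_of_nonneg_right k2 hN.le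
      _ = _ := by ring
  exact (h1.add h2).congr fun T _ => by ring

end

end LDPC

namespace LDPC

noncomputable section

open Degrees

variable {ε : ℝ}

/-! ### Covariances with a sum of local functions -/

lemma Negl.mul_sub_mul {X X' Y Y' : Degrees → ℝ} (hX : Negl (fun T => X T - X' T))
    (hY : Negl (fun T => Y T - Y' T)) (bX : Bddd X) (bY : Bddd Y') :
    Negl (fun T => X T * Y T - X' T * Y' T) :=
  ((bX.mul_negl hY).add (bY.mul_negl hX)).congr fun T _ => by ring

/-- The normalized covariance of the sums of two functions of the edges. -/
def cov (ε : ℝ) (ψ f : VFam) (T : Degrees) : ℝ :=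
  T.expect ε (fun G w => tot ψ T G w * dev ε f T G w) / T.numEdges

lemma expect_dev_mul_dev (ψ f : VFam) (T : Degrees) :
    T.expect ε (fun G w => dev ε ψ T G w * dev ε f T G w)
      = T.expect ε (fun G w => tot ψ T G w * dev ε f T G w) := by
  have h : ∀ G w, dev ε ψ T G w * dev ε f T G w
      = tot ψ T G w * dev ε f T G w - T.expect ε (tot ψ T) * dev ε f T G w := by
    intro G w; unfold dev; ring
  have h0 : T.expect ε (fun G w => dev ε f T G w) = 0 := expect_dev f T
  simp only [h, expect_sub, expect_const_mul, h0, mul_zero, sub_zero]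

lemma bddd_cov (hε : ε ∈ Set.Icc (0 : ℝ) 1) {ψ f : VFam} (hψ : IsE ψ) (hf : IsE f) :
    Bddd (cov ε ψ f) := by
  intro D
  obtain ⟨C, hC, h⟩ := abs_expect_dev_mul_le hε hψ hf D
  refine ⟨C, fun T hT => ?_⟩
  have := h T hT
  rw [expect_dev_mul_dev] at this
  rw [cov, abs_div, abs_of_pos hT.cast_pos, div_le_iff₀ hT.cast_pos]
  exact this

/-- Three fluctuations of order `√N` multiply to `N^(3/2)`, below the normalization `N²`. With `r⁴ =
N`, the bound `|xyz| ≤ (x⁴ + y⁴)/r² + r² z²` needs only the available moments and yields `O(r⁶)`. -/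
lemma negl_three_dev (hε : ε ∈ Set.Icc (0 : ℝ) 1) {ψ ψ' f : VFam} (hψ : IsE ψ) (hψ' : IsE ψ')
    (hf : IsE f) : Negl (fun T => T.expect ε
      (fun G w => dev ε ψ T G w * dev ε ψ' T G w * dev ε f T G w) / (T.numEdges : ℝ) ^ 2) := by
  intro D
  obtain ⟨C, hC, h⟩ := moments hε hψ D
  obtain ⟨C', hC', h'⟩ := moments hε hψ' D
  obtain ⟨C'', hC'', h''⟩ := moments hε hf D
  refine ⟨C + C' + C'', fun T hT => ?_⟩
  have hr := hT.one_le_root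
  have hr0 : 0 < root T := by linarith
  have hN := hT.cast_pos
  set r := root T with hrdef
  have hNr : (T.numEdges : ℝ) = r ^ 4 := (root_pow T).symm
  have hp : ∀ G w, |dev ε ψ T G w * dev ε ψ' T G w * dev ε f T G w|
      ≤ 1 / r ^ 2 * dev ε ψ T G w ^ 4 + 1 / r ^ 2 * dev ε ψ' T G w ^ 4
        + r ^ 2 * dev ε f T G w ^ 2 := by
    intro G w
    generalize dev ε ψ T G w = x
    generalize dev ε ψ' T G w = y
    generalize dev ε f T G w = z
    have e : 1 / r ^ 2 * x ^ 4 + 1 / r ^ 2 * y ^ 4 + r ^ 2 * z ^ 2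
        = (x ^ 4 + y ^ 4 + (r ^ 2 * z) ^ 2) / r ^ 2 := by field_simp
    rw [e, le_div_iff₀ (by positivity), ← abs_of_pos (by positivity : 0 < r ^ 2), ← abs_mul,
      abs_of_pos (by positivity : 0 < r ^ 2), abs_le]
    constructor <;> nlinarith [sq_nonneg (x * y + r ^ 2 * z), sq_nonneg (x * y - r ^ 2 * z),
      sq_nonneg (x ^ 2 - y ^ 2), sq_nonneg (x ^ 2 + y ^ 2), sq_nonneg (r ^ 2 * z)]
  have hE := abs_expect_le_of_le hε hp
  simp only [expect_add, expect_const_mul] at hE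
  have a1 := (h T hT).1
  have a2 := (h' T hT).1
  have a3 := (h'' T hT).2
  rw [abs_div, abs_of_pos (by positivity : (0 : ℝ) < (T.numEdges : ℝ) ^ 2),
    div_le_div_iff₀ (by positivity) hr0]
  rw [hNr] at a1 a2 a3 ⊢
  have b : |T.expect ε (fun G w => dev ε ψ T G w * dev ε ψ' T G w * dev ε f T G w)|
      ≤ (C + C' + C'') * r ^ 6 := by
    refine hE.trans ?_
    calc _ ≤ 1 / r ^ 2 * (C * (r ^ 4) ^ 2) + 1 / r ^ 2 * (C' * (r ^ 4) ^ 2)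
          + r ^ 2 * (C'' * r ^ 4) := by gcongr
      _ = _ := by field_simp
  calc _ ≤ (C + C' + C'') * r ^ 6 * r := by gcongr
    _ = (C + C' + C'') * r ^ 7 := by ring
    _ ≤ (C + C' + C'') * r ^ 8 := by gcongr; norm_num
    _ = _ := by ring

/-- The number of bad pairs is controlled only in mean, so the deviation `z` is truncated: `|z| ≤ r³
+ z⁴/r⁹` with `r⁴ = N`. The first part uses the mean `O(r⁴)`, the second the trivial bound `r⁸` for
the count and the fourth moment. Both give `r⁷`, which determines the rate `N^(-1/4)`. -/
lemma expect_badCount_mul_abs_le (hε : ε ∈ Set.Icc (0 : ℝ) 1) {f : VFam} (hf : IsE f) (R D : ℕ) :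
    ∃ C : ℝ, 0 ≤ C ∧ ∀ T, Adm D T →
      T.expect ε (fun G w => badCount R T G * |dev ε f T G w|) ≤ C * root T ^ 7 := by
  obtain ⟨C, hC, h⟩ := expect_badCount_le D R
  obtain ⟨C', hC', h'⟩ := moments hε hf D
  refine ⟨C + C', by positivity, fun T hT => ?_⟩
  have hr := hT.one_le_root
  have hr0 : 0 < root T := by linarith
  set r := root T with hrdef
  have hNr : (T.numEdges : ℝ) = r ^ 4 := (root_pow T).symm
  have hp : ∀ G w, badCount R T G * |dev ε f T G w|
      ≤ r ^ 3 * badCount R T G + 1 / r * dev ε f T G w ^ 4 := by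
    intro G w
    have b0 := badCount_nonneg R T G
    have b1 := badCount_le R T G
    rw [hNr] at b1
    generalize dev ε f T G w = z
    have hz : |z| ≤ r ^ 3 + 1 / r ^ 9 * z ^ 4 := by
      rcases le_or_gt |z| (r ^ 3) with hc | hc
      · have : 0 ≤ 1 / r ^ 9 * z ^ 4 := by positivity
        linarith
      · have e1 : |z| ^ 4 = z ^ 4 := by rw [← abs_pow, abs_of_nonneg (by positivity)]
        have e2 : |z| ≤ 1 / r ^ 9 * |z| ^ 4 := by
          rw [one_div, ← div_eq_inv_mul, le_div_iff₀ (by positivity)]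
          calc |z| * r ^ 9 = |z| * (r ^ 3) ^ 3 := by ring
            _ ≤ |z| * |z| ^ 3 := by gcongr
            _ = |z| ^ 4 := by ring
        have : 0 ≤ r ^ 3 := by positivity
        rw [← e1]; linarith
    calc _ ≤ badCount R T G * (r ^ 3 + 1 / r ^ 9 * z ^ 4) := by gcongr
      _ = r ^ 3 * badCount R T G + badCount R T G * (1 / r ^ 9 * z ^ 4) := by ring
      _ ≤ r ^ 3 * badCount R T G + (r ^ 4) ^ 2 * (1 / r ^ 9 * z ^ 4) := by gcongr
      _ = _ := by field_simp
  refine (expect_mono hε hp).trans ?_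
  rw [expect_add, expect_const_mul, expect_const_mul]
  have a1 := h ε hε T hT.deg
  have a2 := (h' T hT).1
  rw [hNr] at a1 a2
  calc _ ≤ r ^ 3 * (C * r ^ 4) + 1 / r * (C' * (r ^ 4) ^ 2) := by gcongr
    _ = _ := by field_simp

/-- When the partners of two edges in general position are exchanged, the change of the sum of `f`
is a bilinear expression in `p` and `q`. -/
def HasResponse {ι : Type} [Fintype ι] (f : VFam) (p : ι → VFam) (q : ι → CFam) : Prop :=
  ∃ R, ∀ (T : Degrees) (G : T.Graph) (w : T.Channel) (a a' : T.VSocket), ¬ Bad R G a a' →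
    tot f T G w - tot f T (swapG G a a') w
      = ∑ k, (p k T G w a - p k T G w a') * (q k T G w (G a) - q k T G w (G a'))

/-- The covariance of two functions at a random edge. -/
def ecov (ε : ℝ) (φ ψ : VFam) (T : Degrees) : ℝ := avg ε (φ * ψ) T - avg ε φ T * avg ε ψ T

/-- Expanding `(p(a) - p(a'))(q(G a) - q(G a'))` gives four double sums. Averages decorrelate and
the ends of an edge are independent in the limit, so they tend to `E[φp]E[χq] - E[φp]E[χ]E[q] -
E[φ]E[χq]E[p] + E[φ]E[χ]E[p]E[q]`, which factors. -/
lemma negl_expect_response (hε : ε ∈ Set.Icc (0 : ℝ) 1) {φ p : VFam} {χ q : CFam}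
    (hφ : IsV φ) (hp : IsV p) (hχ : IsC χ) (hq : IsC q) :
    Negl (fun T => T.expect ε (fun G w => ∑ a, ∑ a', φ T G w a * onEdge χ T G w a *
        ((p T G w a - p T G w a') * (q T G w (G a) - q T G w (G a')))) / (T.numEdges : ℝ) ^ 2
      - ecov ε φ p T * ecov ε (onEdge χ) (onEdge q) T) := by
  have e : ∀ T, 0 < T.numEdges →
      T.expect ε (fun G w => ∑ a, ∑ a', φ T G w a * onEdge χ T G w a *
        ((p T G w a - p T G w a') * (q T G w (G a) - q T G w (G a')))) / (T.numEdges : ℝ) ^ 2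
      = avg ε ((φ * p) * onEdge (χ * q)) T
        - T.expect ε (fun G w => tot ((φ * p) * onEdge χ) T G w * tot (onEdge q) T G w)
          / (T.numEdges : ℝ) ^ 2
        - T.expect ε (fun G w => tot (φ * onEdge (χ * q)) T G w * tot p T G w)
          / (T.numEdges : ℝ) ^ 2
        + T.expect ε (fun G w => tot (φ * onEdge χ) T G w * tot (p * onEdge q) T G w)
          / (T.numEdges : ℝ) ^ 2 := by
    intro T hT
    have hN : (T.numEdges : ℝ) ≠ 0 := by exact_mod_cast hT.ne'
    have e1 : ∀ (G : T.Graph) (w : T.Channel), ∑ a, ∑ a', φ T G w a * onEdge χ T G w a *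
        ((p T G w a - p T G w a') * (q T G w (G a) - q T G w (G a')))
        = T.numEdges * tot ((φ * p) * onEdge (χ * q)) T G w
          - tot ((φ * p) * onEdge χ) T G w * tot (onEdge q) T G w
          - tot (φ * onEdge (χ * q)) T G w * tot p T G w
          + tot (φ * onEdge χ) T G w * tot (p * onEdge q) T G w := by
      intro G w
      unfold tot
      rw [Finset.sum_mul_sum, Finset.sum_mul_sum, Finset.sum_mul_sum, Finset.mul_sum,
        ← Finset.sum_sub_distrib, ← Finset.sum_sub_distrib, ← Finset.sum_add_distrib]
      refine Finset.sum_congr rfl fun a _ => ?_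
      rw [show (T.numEdges : ℝ) * ((φ * p) * onEdge (χ * q)) T G w a
        = ∑ _a' : T.VSocket, ((φ * p) * onEdge (χ * q)) T G w a by
          rw [Finset.sum_const, Finset.card_univ, nsmul_eq_mul]; rfl,
        ← Finset.sum_sub_distrib, ← Finset.sum_sub_distrib, ← Finset.sum_add_distrib]
      refine Finset.sum_congr rfl fun a' _ => ?_
      simp only [Pi.mul_apply, onEdge]
      ring
    simp only [e1, expect_add, expect_sub, expect_const_mul, avg]
    have : T.expect ε (tot ((φ * p) * onEdge (χ * q)) T)
      = T.expect ε (fun G w => tot ((φ * p) * onEdge (χ * q)) T G w) := rfl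
    rw [this]
    field_simp
  have bd : ∀ {ψ : VFam}, IsE ψ → Bddd (avg ε ψ) := fun h => abs_avg_le hε h.2
  have g1 := negl_glue hε (hφ.mul hp) (hχ.mul hq)
  have g2 := negl_glue hε (hφ.mul hp) hχ
  have g3 := negl_glue hε hφ (hχ.mul hq)
  have g4 := negl_glue hε hφ hχ
  have g5 := negl_glue hε hp hq
  have m2 := negl_avg_mul hε ((hφ.mul hp).isE.mul hχ.isE) hq.isE
  have m3 := negl_avg_mul hε (hφ.isE.mul (hχ.mul hq).isE) hp.isE
  have m4 := negl_avg_mul hε (hφ.isE.mul hχ.isE) (hp.isE.mul hq.isE)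
  have h2 := (bd hq.isE).mul_negl g2
  have h3 := (bd hp.isE).mul_negl g3
  have bb : Bddd (fun T => avg ε p T * avg ε (onEdge q) T) := by
    intro D
    obtain ⟨C, hC⟩ := bd hp.isE D
    obtain ⟨C', hC'⟩ := bd hq.isE D
    refine ⟨C * C', fun T hT => ?_⟩
    rw [abs_mul]
    exact mul_le_mul (hC T hT) (hC' T hT) (abs_nonneg _) ((abs_nonneg _).trans (hC T hT))
  have h4 := g4.mul_sub_mul g5 (bd (hφ.isE.mul hχ.isE)) bb
  refine (((g1.sub (m2.add h2)).sub (m3.add h3)).add (m4.add h4)).congr fun T hT => ?_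
  rw [e T hT]
  unfold ecov
  have : onEdge χ * onEdge q = onEdge (χ * q) := rfl
  rw [this]
  ring

/-- The covariance of a product of functions of the two ends of an edge. -/
lemma negl_cov_mul (hε : ε ∈ Set.Icc (0 : ℝ) 1) {ι : Type} [Fintype ι] {φ f : VFam} {χ : CFam}
    {p : ι → VFam} {q : ι → CFam} (hφ : IsV φ) (hχ : IsC χ) (hf : IsE f) (hp : ∀ k, IsV (p k))
    (hq : ∀ k, IsC (q k)) (hr : HasResponse f p q) :
    Negl (fun T => cov ε (φ * onEdge χ) f T - (avg ε φ T * cov ε (onEdge χ) f T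
      + avg ε (onEdge χ) T * cov ε φ f T
      + ∑ k, ecov ε φ (p k) T * ecov ε (onEdge χ) (onEdge (q k)) T)) := by
  classical
  have hE := Negl.sum Finset.univ fun k _ => negl_expect_response hε hφ (hp k) hχ (hq k)
  have h3 := negl_three_dev hε hφ.isE hχ.isE hf
  -- the exchange identity
  have hA : Negl (fun T => cov ε (φ * onEdge χ) f T
      - T.expect ε (fun G w => ∑ a, ∑ a', φ T G w a * onEdge χ T G w a *
        (tot f T G w - tot f T (swapG G a a') w)) / (T.numEdges : ℝ) ^ 2
      - T.expect ε (fun G w => tot φ T G w * tot (onEdge χ) T G w * dev ε f T G w)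
        / (T.numEdges : ℝ) ^ 2) := by
    intro D
    obtain ⟨⟨R, hR⟩, hb⟩ := hφ
    obtain ⟨⟨R', hR'⟩, hb'⟩ := hχ
    replace hR := hR.mono (le_max_left R R')
    replace hR' := hR'.mono (le_max_right R R')
    obtain ⟨M, hM⟩ := hb D
    obtain ⟨M', hM'⟩ := hb' D
    obtain ⟨C, hC, hbad⟩ := expect_badCount_mul_abs_le hε hf (max R R') D
    refine ⟨2 * (|M| * |M'|) * C, fun T hT => ?_⟩
    have hN := hT.cast_pos
    have hr0 : 0 < root T := by linarith [hT.one_le_root]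
    have key := abs_swap_sum_sub_le hε hR hR' (M := |M|) (M' := |M'|)
      (fun G w a => (hM T hT.deg G w a).trans (le_abs_self _))
      (fun G w a => (hM' T hT.deg G w a).trans (le_abs_self _)) (dev ε f T)
    rw [expect_sum_swap (fun G w a => φ T G w a * onEdge χ T G w a)] at key
    have k2 := key.trans (mul_le_mul_of_nonneg_left (hbad T hT) (by positivity))
    have e : (T.numEdges : ℝ) * T.expect ε (fun G w => tot (φ * onEdge χ) T G w * dev ε f T G w)
        - T.expect ε (fun G w => ∑ a, ∑ a', φ T G w a * onEdge χ T G w a *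
          (tot f T G w - tot f T (swapG G a a') w))
        = T.expect ε (fun G w => ∑ a, ∑ a', φ T G w a * onEdge χ T G w a *
          dev ε f T (swapG G a a') w) := by
      rw [← expect_const_mul, ← expect_sub]
      congr 1
      funext G w
      have : (T.numEdges : ℝ) * (tot (φ * onEdge χ) T G w * dev ε f T G w)
          = ∑ a, ∑ _a' : T.VSocket, φ T G w a * onEdge χ T G w a * dev ε f T G w := by
        simp only [Finset.sum_const, Finset.card_univ, nsmul_eq_mul, ← Finset.mul_sum,
          ← Finset.sum_mul]
        rfl
      rw [this, ← Finset.sum_sub_distrib]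
      refine Finset.sum_congr rfl fun a _ => ?_
      rw [← Finset.sum_sub_distrib]
      refine Finset.sum_congr rfl fun a' _ => ?_
      unfold dev
      ring
    rw [← e] at k2
    have e2 : ∀ x y z : ℝ, x / T.numEdges - y / (T.numEdges : ℝ) ^ 2 - z / (T.numEdges : ℝ) ^ 2
        = (T.numEdges * x - y - z) / (T.numEdges : ℝ) ^ 2 := by
      intro x y z; field_simp
    beta_reduce
    rw [cov, e2, abs_div, abs_of_pos (by positivity : (0 : ℝ) < (T.numEdges : ℝ) ^ 2),
      div_le_div_iff₀ (by positivity) hr0]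
    calc _ ≤ 2 * (|M| * |M'|) * (C * root T ^ 7) * root T := by gcongr
      _ = 2 * (|M| * |M'|) * C * (root T ^ 4) ^ 2 := by ring
      _ = _ := by rw [root_pow]
  -- the response
  have hB : Negl (fun T => T.expect ε (fun G w => ∑ a, ∑ a', φ T G w a * onEdge χ T G w a *
        (tot f T G w - tot f T (swapG G a a') w)) / (T.numEdges : ℝ) ^ 2
      - ∑ k, T.expect ε (fun G w => ∑ a, ∑ a', φ T G w a * onEdge χ T G w a *
        ((p k T G w a - p k T G w a') * (q k T G w (G a) - q k T G w (G a'))))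
          / (T.numEdges : ℝ) ^ 2) := by
    refine negl_of_le fun D => ?_
    obtain ⟨R, hR⟩ := hr
    obtain ⟨M, hM⟩ := hφ.2 D
    obtain ⟨M', hM'⟩ := hχ.2 D
    choose P hP using fun k => (hp k).2 D
    choose Q hQ using fun k => (hq k).2 D
    obtain ⟨c, hc, hd⟩ := hf.boundedDiff D
    obtain ⟨C, hC, hbad⟩ := expect_badCount_le D R
    set K : ℝ := |M| * |M'| * (c + ∑ k, (2 * |P k|) * (2 * |Q k|)) with hK
    refine ⟨K * C, fun T hT => ?_⟩
    have hN := hT.cast_pos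
    have hK0 : 0 ≤ K := by positivity
    have b : |T.expect ε (fun G w => ∑ a, ∑ a', φ T G w a * onEdge χ T G w a *
        (tot f T G w - tot f T (swapG G a a') w))
        - ∑ k, T.expect ε (fun G w => ∑ a, ∑ a', φ T G w a * onEdge χ T G w a *
        ((p k T G w a - p k T G w a') * (q k T G w (G a) - q k T G w (G a'))))|
        ≤ K * (C * T.numEdges) := by
      rw [← expect_sum, ← expect_sub]
      refine le_trans ?_ (mul_le_mul_of_nonneg_left (hbad ε hε T hT.deg) hK0)
      rw [← expect_const_mul]
      refine abs_expect_le_of_le hε fun G w => ?_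
      rw [Finset.sum_comm (γ := ι), ← Finset.sum_sub_distrib, badCount, Finset.mul_sum]
      refine (Finset.abs_sum_le_sum_abs _ _).trans (Finset.sum_le_sum fun a _ => ?_)
      rw [Finset.sum_comm (γ := ι), ← Finset.sum_sub_distrib, Finset.mul_sum]
      refine (Finset.abs_sum_le_sum_abs _ _).trans (Finset.sum_le_sum fun a' _ => ?_)
      rw [← Finset.mul_sum, ← mul_sub]
      split_ifs with hbd
      · rw [mul_one, abs_mul, abs_mul]
        have c1 := (hM T hT.deg G w a).trans (le_abs_self _)
        have c2 : |onEdge χ T G w a| ≤ |M'| := (hM' T hT.deg G w (G a)).trans (le_abs_self _)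
        have c3 : |tot f T G w - tot f T (swapG G a a') w| ≤ c := by
          have := (hd T hT.deg).graph G w a a'
          rwa [abs_sub_comm] at this
        have c4 : |∑ k, (p k T G w a - p k T G w a') * (q k T G w (G a) - q k T G w (G a'))|
            ≤ ∑ k, (2 * |P k|) * (2 * |Q k|) := by
          refine (Finset.abs_sum_le_sum_abs _ _).trans (Finset.sum_le_sum fun k _ => ?_)
          rw [abs_mul]
          have p1 := fun a => (hP k T hT.deg G w a).trans (le_abs_self _)
          have q1 := fun a => (hQ k T hT.deg G w a).trans (le_abs_self _)
          refine mul_le_mul ((abs_sub _ _).trans ?_) ((abs_sub _ _).trans ?_) (abs_nonneg _)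
            (by positivity)
          · linarith [p1 a, p1 a']
          · linarith [q1 (G a), q1 (G a')]
        rw [hK]
        gcongr
        exact (abs_sub _ _).trans (add_le_add c3 c4)
      · rw [hR T G w a a' hbd, sub_self, mul_zero, abs_zero, mul_zero]
    rw [← Finset.sum_div, ← sub_div, abs_div,
      abs_of_pos (by positivity : (0 : ℝ) < (T.numEdges : ℝ) ^ 2),
      div_le_div_iff₀ (by positivity) hN]
    calc _ ≤ K * (C * T.numEdges) * T.numEdges := by gcongr
      _ = _ := by ring
  refine (((hA.add hB).add hE).add h3).congr fun T hT => ?_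
  have hN : (T.numEdges : ℝ) ≠ 0 := by exact_mod_cast hT.ne'
  -- Write each of the two sums as mean plus deviation. The product of the means drops out because
  -- `dev f` is centred; the triple product of deviations is negligible.
  have e3 : T.expect ε (fun G w => tot φ T G w * tot (onEdge χ) T G w * dev ε f T G w)
      = T.expect ε (tot φ T) * T.expect ε (fun G w => tot (onEdge χ) T G w * dev ε f T G w)
      + T.expect ε (tot (onEdge χ) T) * T.expect ε (fun G w => tot φ T G w * dev ε f T G w)
      + T.expect ε (fun G w => dev ε φ T G w * dev ε (onEdge χ) T G w * dev ε f T G w) := by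
    rw [← expect_const_mul, ← expect_const_mul, ← expect_add, ← expect_add]
    have h0 : T.expect ε (fun G w => T.expect ε (tot φ T) * T.expect ε (tot (onEdge χ) T)
        * dev ε f T G w) = 0 := by
      rw [expect_const_mul]
      have : T.expect ε (fun G w => dev ε f T G w) = 0 := expect_dev f T
      rw [this, mul_zero]
    rw [← sub_eq_zero, ← expect_sub, ← neg_eq_zero, ← h0, ← sub_eq_zero, ← neg_one_mul,
      ← expect_const_mul, ← expect_sub, ← expect_const (ε := ε) (T := T) 0]
    congr 1
    funext G w
    unfold dev
    ring
  rw [e3, Finset.sum_sub_distrib]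
  unfold cov avg
  field_simp
  ring

end

end LDPC

/-! ### Messages and their discrete derivatives -/

namespace LDPC

noncomputable section

open Degrees

/-! ### Messages and their linear responses -/

/-- The indicator of an erasure. -/
def ind (b : Bool) : ℝ := if b = true then 1 else 0

/-- The product of the incoming messages at a variable node. -/
def vStep (χ : CFam) : VFam := fun T G w a =>
  ind (w a.1) * ∏ j ∈ Finset.univ.erase a.2, χ T G w (G ⟨a.1, j⟩)

/-- The complementary product of the incoming messages at a check node. -/
def cStep (φ : VFam) : CFam := fun T G w b =>
  1 - ∏ j ∈ Finset.univ.erase b.2, (1 - φ T G w (G.symm ⟨b.1, j⟩))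

/-- The derivative of the variable node operation in the direction `κ`. -/
def vDeriv (κ χ : CFam) : VFam := fun T G w a =>
  ind (w a.1) * ∑ s ∈ Finset.univ.erase a.2, κ T G w (G ⟨a.1, s⟩) *
    ∏ j ∈ (Finset.univ.erase a.2).erase s, χ T G w (G ⟨a.1, j⟩)

/-- The derivative of the check node operation in the direction `κ`. -/
def cDeriv (κ φ : VFam) : CFam := fun T G w b =>
  ∑ s ∈ Finset.univ.erase b.2, κ T G w (G.symm ⟨b.1, s⟩) *
    ∏ j ∈ (Finset.univ.erase b.2).erase s, (1 - φ T G w (G.symm ⟨b.1, j⟩))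

lemma isV_vStep {χ : CFam} (h : IsC χ) : IsV (vStep χ) := by
  refine IsV.node (ι := Unit) (χ := fun _ => χ) (fun _ => h)
    (fun d i b ξ => ind b * ∏ j ∈ Finset.univ.erase i, ξ j ()) (fun d i b => by fun_prop) ?_
  intro d i b ξ ξ' hξ
  congr 1
  exact Finset.prod_congr rfl fun j hj => by rw [hξ j (Finset.ne_of_mem_erase hj)]

lemma isC_cStep {φ : VFam} (h : IsV φ) : IsC (cStep φ) := by
  refine IsC.node (ι := Unit) (φ := fun _ => φ) (fun _ => h)
    (fun d i b ξ => 1 - ∏ j ∈ Finset.univ.erase i, (1 - ξ j ())) (fun d i b => by fun_prop) ?_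
  intro d i b ξ ξ' hξ
  congr 1
  exact Finset.prod_congr rfl fun j hj => by rw [hξ j (Finset.ne_of_mem_erase hj)]

lemma isV_vDeriv {κ χ : CFam} (hκ : IsC κ) (h : IsC χ) : IsV (vDeriv κ χ) := by
  refine IsV.node (ι := Bool) (χ := fun τ => if τ then κ else χ) (fun τ => by cases τ <;> simpa)
    (fun d i b ξ => ind b * ∑ s ∈ Finset.univ.erase i, ξ s true *
      ∏ j ∈ (Finset.univ.erase i).erase s, ξ j false) (fun d i b => by fun_prop) ?_
  intro d i b ξ ξ' hξ
  congr 1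
  refine Finset.sum_congr rfl fun s hs => ?_
  rw [hξ s (Finset.ne_of_mem_erase hs)]
  congr 1
  exact Finset.prod_congr rfl fun j hj => by
    rw [hξ j (Finset.ne_of_mem_erase (Finset.mem_of_mem_erase hj))]

lemma isC_cDeriv {κ φ : VFam} (hκ : IsV κ) (h : IsV φ) : IsC (cDeriv κ φ) := by
  refine IsC.node (ι := Bool) (φ := fun τ => if τ then κ else φ) (fun τ => by cases τ <;> simpa)
    (fun d i b ξ => ∑ s ∈ Finset.univ.erase i, ξ s true *
      ∏ j ∈ (Finset.univ.erase i).erase s, (1 - ξ j false)) (fun d i b => by fun_prop) ?_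
  intro d i b ξ ξ' hξ
  refine Finset.sum_congr rfl fun s hs => ?_
  rw [hξ s (Finset.ne_of_mem_erase hs)]
  congr 1
  exact Finset.prod_congr rfl fun j hj => by
    rw [hξ j (Finset.ne_of_mem_erase (Finset.mem_of_mem_erase hj))]

/-- The check-to-variable messages. -/
def etaR : ℕ → CFam
  | 0 => constC 1
  | t + 1 => cStep (vStep (etaR t))

/-- The variable-to-check messages. -/
def muR (t : ℕ) : VFam := vStep (etaR t)

lemma isC_etaR (t : ℕ) : IsC (etaR t) := by
  induction t with
  | zero => exact isC_const 1
  | succ t ih => exact isC_cStep (isV_vStep ih)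

lemma isV_muR (t : ℕ) : IsV (muR t) := isV_vStep (isC_etaR t)

lemma ind_eq (b : Bool) : ind b = 0 ∨ ind b = 1 := by
  cases b <;> simp [ind]

open Classical in
lemma muR_eq_ite_of {T : Degrees} {G : T.Graph} {w : T.Channel} {t : ℕ}
    (h : ∀ e : T.VSocket, etaR t T G w (G e) = if checkErased G w t e then (1 : ℝ) else 0)
    (e : T.VSocket) : muR t T G w e = if varErased G w t e then (1 : ℝ) else 0 := by
  unfold muR vStep
  obtain ⟨v, i⟩ := e
  simp only [h]
  rw [Finset.prod_ite_zero, ind, ite_zero_mul_ite_zero]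
  simp only [Finset.prod_const_one, mul_one]
  refine if_congr ?_ rfl rfl
  unfold varErased varStep
  refine and_congr Iff.rfl ⟨fun h e' hne he' => ?_, fun h j hj => h _ ?_ rfl⟩
  · obtain ⟨v', j⟩ := e'
    obtain rfl : v' = v := he'
    refine h j (Finset.mem_erase.2 ⟨fun hj => hne (by rw [hj]), Finset.mem_univ _⟩)
  · intro hj'
    exact Finset.ne_of_mem_erase hj (by simpa using hj')

open Classical in
lemma etaR_eq_ite {T : Degrees} (G : T.Graph) (w : T.Channel) (t : ℕ) :
    ∀ e : T.VSocket, etaR t T G w (G e) = if checkErased G w t e then (1 : ℝ) else 0 := by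
  induction t with
  | zero => intro e; simp [etaR, constC, checkErased]
  | succ t ih =>
    intro e
    have hv := muR_eq_ite_of ih
    have hs : ∀ b : T.CSocket, muR t T G w (G.symm b)
        = if varErased G w t (G.symm b) then (1 : ℝ) else 0 := fun b => hv _
    change cStep (muR t) T G w (G e) = _
    unfold cStep
    simp only [hs]
    have h1 : ∀ b : T.CSocket, (1 : ℝ) - (if varErased G w t (G.symm b) then (1 : ℝ) else 0)
        = if ¬ varErased G w t (G.symm b) then (1 : ℝ) else 0 := by
      intro b; split_ifs <;> simp_all
    simp only [h1]
    rw [Finset.prod_ite_zero]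
    simp only [Finset.prod_const_one]
    have h2 : checkErased G w (t + 1) e ↔ ¬ ∀ j ∈ Finset.univ.erase (G e).2,
        ¬ varErased G w t (G.symm ⟨(G e).1, j⟩) := by
      push Not
      constructor
      · rintro ⟨e', hne, hc, he'⟩
        have : (⟨(G e).1, hc ▸ (G e').2⟩ : T.CSocket) = G e' := by
          generalize G e' = x at hc
          obtain ⟨c, j⟩ := x
          simp only at hc
          subst hc
          rfl
        refine ⟨hc ▸ (G e').2, Finset.mem_erase.2 ⟨fun h => hne ?_, Finset.mem_univ _⟩, ?_⟩
        · apply G.injective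
          rw [← this, h]
        · rw [this, Equiv.symm_apply_apply]; exact he'
      · rintro ⟨j, hj, he'⟩
        refine ⟨_, fun h => Finset.ne_of_mem_erase hj ?_, ?_, he'⟩
        · rw [Equiv.symm_apply_eq] at h
          have h3 : (⟨(G e).1, j⟩ : T.CSocket) = ⟨(G e).1, (G e).2⟩ := h
          rw [Sigma.mk.injEq] at h3
          exact eq_of_heq h3.2
        · simp
    by_cases h : ∀ j ∈ Finset.univ.erase (G e).2, ¬ varErased G w t (G.symm ⟨(G e).1, j⟩)
    · rw [if_pos h, if_neg (by rw [h2]; exact not_not.2 h), sub_self]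
    · rw [if_neg h, if_pos (by rw [h2]; exact h), sub_zero]

lemma mu_eq_muR {T : Degrees} (G : T.Graph) (w : T.Channel) (t : ℕ) (a : T.VSocket) :
    mu G w t a = muR t T G w a := by
  classical
  rw [muR_eq_ite_of (etaR_eq_ite G w t) a, mu]

lemma numErased_eq_tot (t : ℕ) (T : Degrees) : numErased (T := T) t = tot (muR t) T := by
  funext G w
  exact Finset.sum_congr rfl fun a _ => mu_eq_muR G w t a

section Monotonicity

variable {T : Degrees} (G : T.Graph) (w : T.Channel)

lemma etaR_eq (t : ℕ) (b : T.CSocket) : etaR t T G w b = 0 ∨ etaR t T G w b = 1 := by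
  classical
  have := etaR_eq_ite G w t (G.symm b)
  rw [Equiv.apply_symm_apply] at this
  rw [this]
  split_ifs <;> simp

lemma muR_eq (t : ℕ) (a : T.VSocket) : muR t T G w a = 0 ∨ muR t T G w a = 1 := by
  classical
  rw [muR_eq_ite_of (etaR_eq_ite G w t) a]
  split_ifs <;> simp

lemma etaR_mem (t : ℕ) (b : T.CSocket) : etaR t T G w b ∈ Set.Icc (0 : ℝ) 1 := by
  rcases etaR_eq G w t b with h | h <;> simp [h]

lemma muR_mem (t : ℕ) (a : T.VSocket) : muR t T G w a ∈ Set.Icc (0 : ℝ) 1 := by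
  rcases muR_eq G w t a with h | h <;> simp [h]

lemma ind_nonneg (b : Bool) : 0 ≤ ind b := by
  rcases ind_eq b with h | h <;> simp [h]

lemma muR_le_of_etaR_le {t t' : ℕ} (h : ∀ b, etaR t T G w b ≤ etaR t' T G w b) (a : T.VSocket) :
    muR t T G w a ≤ muR t' T G w a :=
  mul_le_mul_of_nonneg_left
    (Finset.prod_le_prod (fun _ _ => (etaR_mem G w t _).1) fun _ _ => h _) (ind_nonneg _)

lemma etaR_succ_le (t : ℕ) (b : T.CSocket) : etaR (t + 1) T G w b ≤ etaR t T G w b := by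
  induction t generalizing b with
  | zero => exact (etaR_mem G w 1 b).2
  | succ t ih =>
    refine sub_le_sub_left (Finset.prod_le_prod (fun _ _ => ?_) fun j _ => ?_) 1
    · exact sub_nonneg.2 (muR_mem G w t _).2
    · exact sub_le_sub_left (muR_le_of_etaR_le G w ih _) 1

lemma etaR_antitone (b : T.CSocket) : Antitone (fun t => etaR t T G w b) :=
  antitone_nat_of_succ_le fun t => etaR_succ_le G w t b

lemma muR_antitone (a : T.VSocket) : Antitone (fun t => muR t T G w a) :=
  fun _ _ h => muR_le_of_etaR_le G w (fun b => etaR_antitone G w b h) a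

/-- Messages are zero-one valued and decrease in time, so of two times the later decides. Second
moments across iterations thereby reduce to first moments; the next lemma is the complementary form
at the check nodes. -/
lemma etaR_mul_etaR (t t' : ℕ) (b : T.CSocket) :
    etaR t T G w b * etaR t' T G w b = etaR (max t t') T G w b := by
  rcases le_total t t' with h | h
  · rw [max_eq_right h]
    have := etaR_antitone G w b h
    simp only at this
    rcases etaR_eq G w t b with h1 | h1 <;> rcases etaR_eq G w t' b with h2 | h2 <;>
      first | (rw [h1, h2]; norm_num; done) | (exfalso; linarith)
  · rw [max_eq_left h]
    have := etaR_antitone G w b h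
    simp only at this
    rcases etaR_eq G w t b with h1 | h1 <;> rcases etaR_eq G w t' b with h2 | h2 <;>
      first | (rw [h1, h2]; norm_num; done) | (exfalso; linarith)

lemma one_sub_muR_mul (t t' : ℕ) (a : T.VSocket) :
    (1 - muR t T G w a) * (1 - muR t' T G w a) = 1 - muR (min t t') T G w a := by
  rcases le_total t t' with h | h
  · rw [min_eq_left h]
    have := muR_antitone G w a h
    simp only at this
    rcases muR_eq G w t a with h1 | h1 <;> rcases muR_eq G w t' a with h2 | h2 <;>
      first | (rw [h1, h2]; norm_num; done) | (exfalso; linarith)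
  · rw [min_eq_right h]
    have := muR_antitone G w a h
    simp only at this
    rcases muR_eq G w t a with h1 | h1 <;> rcases muR_eq G w t' a with h2 | h2 <;>
      first | (rw [h1, h2]; norm_num; done) | (exfalso; linarith)

end Monotonicity

/-! ### Linear response -/

/-- The response of the number of erased messages at iteration `l` to a variable-to-check message
at iteration `l - n`. -/
def Jr (l : ℕ) : ℕ → CFam
  | 0 => constC 0
  | n + 1 => cDeriv (vDeriv (constC (if n = 0 then 1 else 0) + Jr l n) (etaR (l - n)))
      (muR (l - n - 1))

/-- The response that includes the message itself. -/
def Jh (l n : ℕ) : CFam := constC (if n = 0 then 1 else 0) + Jr l n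

/-- The response to a check-to-variable message at iteration `l - n`. -/
def Ir (l n : ℕ) : VFam := vDeriv (Jh l n) (etaR (l - n))

lemma Jr_succ (l n : ℕ) : Jr l (n + 1) = cDeriv (Ir l n) (muR (l - n - 1)) := by
  rw [Jr]; rfl

lemma isC_Jr (l n : ℕ) : IsC (Jr l n) := by
  induction n with
  | zero => rw [Jr]; exact isC_const 0
  | succ n ih =>
    rw [Jr]
    exact isC_cDeriv (isV_vDeriv ((isC_const _).add ih) (isC_etaR _)) (isV_muR _)

lemma isC_Jh (l n : ℕ) : IsC (Jh l n) := (isC_const _).add (isC_Jr l n)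

lemma isV_Ir (l n : ℕ) : IsV (Ir l n) := isV_vDeriv (isC_Jh l n) (isC_etaR _)

/-- When at most one factor changes there are no higher-order terms: the difference is exactly the
derivative, and it does not matter whether the remaining factors are taken before or after the
change. -/
lemma prod_sub_prod_of_unique {α : Type*} [DecidableEq α] (S : Finset α) (u u' : α → ℝ)
    (h : ∀ s ∈ S, ∀ r ∈ S, u s ≠ u' s → u r ≠ u' r → s = r) :
    ∏ s ∈ S, u s - ∏ s ∈ S, u' s = ∑ s ∈ S, (u s - u' s) * ∏ j ∈ S.erase s, u j := by
  by_cases h0 : ∃ s ∈ S, u s ≠ u' s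
  · obtain ⟨s, hs, hne⟩ := h0
    have he : ∀ j ∈ S, j ≠ s → u j = u' j := fun j hj hjs => by
      by_contra hc
      exact hjs (h j hj s hs hc hne)
    rw [Finset.sum_eq_single_of_mem s hs (fun j hj hjs => by rw [he j hj hjs]; ring),
      ← Finset.mul_prod_erase S u hs, ← Finset.mul_prod_erase S u' hs,
      Finset.prod_congr rfl fun j hj => (he j (Finset.mem_of_mem_erase hj)
        (Finset.ne_of_mem_erase hj)).symm]
    ring
  · push Not at h0
    rw [Finset.prod_congr rfl h0, sub_self]
    exact (Finset.sum_eq_zero fun s hs => by rw [h0 s hs]; ring).symm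

section Adjoint

variable {T : Degrees}

/-- Sums over pairs of distinct sockets of the same variable node. -/
lemma sum_sigma_erase_comm {n : ℕ} {d : Fin n → ℕ}
    (f : (v : Fin n) → Fin (d v) → Fin (d v) → ℝ) :
    ∑ a : (Σ v, Fin (d v)), ∑ s ∈ Finset.univ.erase a.2, f a.1 a.2 s
      = ∑ a : (Σ v, Fin (d v)), ∑ s ∈ Finset.univ.erase a.2, f a.1 s a.2 := by
  rw [Fintype.sum_sigma, Fintype.sum_sigma]
  refine Finset.sum_congr rfl fun v _ => ?_
  exact Finset.sum_comm' (s := Finset.univ) (t := fun i => Finset.univ.erase i)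
    (t' := Finset.univ) (s' := fun i => Finset.univ.erase i) (fun x y => by simp [eq_comm])

/-- If every message changes by the linear response to the changes of its inputs, the change of the
output is obtained from the sources and the adjoint responses. -/
lemma sum_change_eq (G : T.Graph) (w : T.Channel) (l : ℕ)
    (Δμ σw : ℕ → T.VSocket → ℝ) (σc : ℕ → T.VSocket → ℝ) (Δη σv : ℕ → T.CSocket → ℝ)
    (h0 : ∀ b, Δη 0 b = 0)
    (hv : ∀ t ≤ l, ∀ a : T.VSocket, Δμ t a = ind (w a.1) * ∑ s ∈ Finset.univ.erase a.2,
      (Δη t (G ⟨a.1, s⟩) + σc t ⟨a.1, s⟩) *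
        ∏ j ∈ (Finset.univ.erase a.2).erase s, etaR t T G w (G ⟨a.1, j⟩) + σw t a)
    (hc : ∀ t < l, ∀ b : T.CSocket, Δη (t + 1) b = ∑ s ∈ Finset.univ.erase b.2,
      (Δμ t (G.symm ⟨b.1, s⟩) + σv t ⟨b.1, s⟩) *
        ∏ j ∈ (Finset.univ.erase b.2).erase s, (1 - muR t T G w (G.symm ⟨b.1, j⟩))) :
    ∑ a, Δμ l a = ∑ n ∈ Finset.range (l + 1), (∑ a, Ir l n T G w a * σc (l - n) a
      + ∑ b, Jr l n T G w b * σv (l - n) b + ∑ a, Jh l n T G w (G a) * σw (l - n) a) := by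
  -- The adjoint of the variable node operation: interchanging the outgoing and the incoming socket
  -- moves the operator from `Δη` to the weight `Jh`, producing `Ir`. The next step does the same at
  -- the checks and produces `Jr`.
  have hV : ∀ n ≤ l, ∑ a, Δμ (l - n) a * Jh l n T G w (G a)
      = ∑ a, Ir l n T G w a * (Δη (l - n) (G a) + σc (l - n) a)
        + ∑ a, Jh l n T G w (G a) * σw (l - n) a := by
    intro n hn
    have := sum_sigma_erase_comm (d := T.dv) (fun v i s => ind (w v) *
      ((Δη (l - n) (G ⟨v, s⟩) + σc (l - n) ⟨v, s⟩) *
      ∏ j ∈ (Finset.univ.erase i).erase s, etaR (l - n) T G w (G ⟨v, j⟩))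
        * Jh l n T G w (G ⟨v, i⟩))
    simp only [← Finset.sum_mul, ← Finset.mul_sum] at this
    have e : ∑ a, Ir l n T G w a * (Δη (l - n) (G a) + σc (l - n) a) = _ :=
      (Finset.sum_congr rfl fun a _ => ?_).trans this.symm
    · rw [e, ← Finset.sum_add_distrib]
      refine Finset.sum_congr rfl fun a _ => ?_
      rw [hv (l - n) (Nat.sub_le _ _)]
      ring
    · unfold Ir vDeriv
      rw [mul_assoc, Finset.sum_mul, Finset.mul_sum]
      refine Finset.sum_congr rfl fun s _ => ?_
      rw [Finset.erase_right_comm]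
      ring
  have hC : ∀ n < l, ∑ a, Ir l n T G w a * Δη (l - n) (G a)
      = ∑ a, Δμ (l - (n + 1)) a * Jh l (n + 1) T G w (G a)
        + ∑ b, Jr l (n + 1) T G w b * σv (l - (n + 1)) b := by
    intro n hn
    have hJ : Jh l (n + 1) = Jr l (n + 1) := by
      funext T G w b; simp [Jh, constC]
    rw [← Equiv.sum_comp G.symm, ← Equiv.sum_comp G.symm (fun a => _ * Jh _ _ _ _ _ _), hJ]
    simp only [Equiv.apply_symm_apply]
    obtain ⟨t, ht⟩ : ∃ t, l - n = t + 1 := ⟨l - n - 1, by omega⟩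
    have ht' : l - (n + 1) = t := by omega
    have ht'' : l - n - 1 = t := by omega
    rw [ht, ht', Jr_succ, ht'']
    simp only [hc t (by omega)]
    have := sum_sigma_erase_comm (d := T.dc) (fun c i s => Ir l n T G w (G.symm ⟨c, i⟩) *
        ((Δμ t (G.symm ⟨c, s⟩) + σv t ⟨c, s⟩) *
        ∏ j ∈ (Finset.univ.erase i).erase s, (1 - muR t T G w (G.symm ⟨c, j⟩))))
    simp only [← Finset.mul_sum] at this
    refine this.trans ?_
    rw [← Finset.sum_add_distrib]
    refine Finset.sum_congr rfl fun b _ => ?_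
    unfold cDeriv
    rw [mul_comm (Δμ t _), ← mul_add, Finset.sum_mul]
    refine Finset.sum_congr rfl fun s _ => ?_
    rw [Finset.erase_right_comm]
    ring
  -- Pull the final sum back by `n` iterations, leaving behind the source terms met on the way. At
  -- the last stage the initial messages agree by `h0`.
  have hn : ∀ n ≤ l, ∑ a, Δμ l a = ∑ a, Δμ (l - n) a * Jh l n T G w (G a)
      + ∑ b, Jr l n T G w b * σv (l - n) b
      + ∑ n ∈ Finset.range n, (∑ a, Ir l n T G w a * σc (l - n) a
      + ∑ b, Jr l n T G w b * σv (l - n) b + ∑ a, Jh l n T G w (G a) * σw (l - n) a) := by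
    intro n
    induction n with
    | zero => intro _; simp [Jh, Jr, constC]
    | succ n ih =>
      intro hn
      rw [ih (by omega), hV n (by omega), Finset.sum_range_succ]
      have := hC n (by omega)
      simp only [mul_add, Finset.sum_add_distrib]
      linarith
  rw [hn l le_rfl, hV l le_rfl, Finset.sum_range_succ, Nat.sub_self]
  simp only [h0, zero_add]
  ring

end Adjoint

end

end LDPC

namespace LDPC

noncomputable section

open Degrees

/-! ### Response to an exchange of two edges -/

lemma exists_radius (l : ℕ) : ∃ R, ∀ t ≤ l, CLocal R (etaR t) ∧ VLocal R (muR t) := by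
  choose R hR using fun t => (isC_etaR t).1
  choose R' hR' using fun t => (isV_muR t).1
  refine ⟨(Finset.range (l + 1)).sup R + (Finset.range (l + 1)).sup R', fun t ht => ⟨?_, ?_⟩⟩
  · exact (hR t).mono ((Finset.le_sup (f := R) (Finset.mem_range.2 (Nat.lt_succ_of_le ht))).trans
      (Nat.le_add_right _ _))
  · exact (hR' t).mono ((Finset.le_sup (f := R') (Finset.mem_range.2 (Nat.lt_succ_of_le ht))).trans
      (Nat.le_add_left _ _))

lemma adj_var {T : Degrees} (G : T.Graph) {v : Fin T.n} {s r : Fin (T.dv v)} (h : s ≠ r) :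
    Adj G false ⟨v, s⟩ ⟨v, r⟩ :=
  ⟨fun h' => h (by simpa using h'), fun _ => rfl, fun h => by simp at h⟩

lemma adj_check {T : Degrees} (G : T.Graph) {c : Fin T.m} {s r : Fin (T.dc c)} (h : s ≠ r) :
    Adj G true (G.symm ⟨c, s⟩) (G.symm ⟨c, r⟩) :=
  ⟨fun h' => h (by simpa using h'), fun h => by simp at h, fun _ => by simp⟩

lemma Degrees.Walk.join {T : Degrees} {G : T.Graph} {s : Bool} {e₁ e₂ x₁ x₂ : T.VSocket} {k₁ k₂ : ℕ}
    (h₁ : Walk G k₁ s e₁ x₁) (h₂ : Walk G k₂ s e₂ x₂) (h : Adj G (!s) e₁ e₂) :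
    Walk G (k₁ + (k₂ + 1)) (not^[k₁] (!s)) x₁ x₂ := by
  refine h₁.reverse.trans ?_
  rw [not_iterate_not]
  exact ⟨e₂, h, by rwa [Bool.not_not]⟩

/-- If two inputs of one node both see `a` or `a'`, the two walks join at that node into a short
cycle or a short connection. For good pairs at most one input of a node can change. -/
lemma bad_of_walks {T : Degrees} {G : T.Graph} {R : ℕ} {s : Bool} {a a' e₁ e₂ x₁ x₂ : T.VSocket}
    {k₁ k₂ : ℕ} (h₁ : Walk G k₁ s e₁ x₁) (h₂ : Walk G k₂ s e₂ x₂) (h : Adj G (!s) e₁ e₂)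
    (hk₁ : k₁ ≤ R) (hk₂ : k₂ ≤ R) (hx₁ : x₁ = a ∨ x₁ = a') (hx₂ : x₂ = a ∨ x₂ = a') :
    Bad (2 * R + 1) G a a' := by
  have hw := h₁.join h₂ h
  have hn : Near (2 * R + 1) G x₁ x₂ := ⟨_, by omega, _, hw⟩
  rcases hx₁ with rfl | rfl <;> rcases hx₂ with rfl | rfl
  · exact Or.inr (Or.inl ⟨_, by omega, by omega, _, hw⟩)
  · exact Or.inl hn
  · exact Or.inl hn.symm
  · exact Or.inr (Or.inr ⟨_, by omega, by omega, _, hw⟩)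

lemma prod_one_sub_sub_of_unique {α : Type*} [DecidableEq α] (S : Finset α) (u u' : α → ℝ)
    (h : ∀ s ∈ S, ∀ r ∈ S, u s ≠ u' s → u r ≠ u' r → s = r) :
    (1 - ∏ s ∈ S, (1 - u s)) - (1 - ∏ s ∈ S, (1 - u' s))
      = ∑ s ∈ S, (u s - u' s) * ∏ j ∈ S.erase s, (1 - u j) := by
  have := prod_sub_prod_of_unique S (fun s => 1 - u s) (fun s => 1 - u' s)
    (fun s hs r hr h1 h2 => h s hs r hr (fun h3 => h1 (by rw [h3])) (fun h3 => h2 (by rw [h3])))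
  rw [sub_sub_sub_cancel_left, ← neg_sub, this, ← Finset.sum_neg_distrib]
  exact Finset.sum_congr rfl fun s _ => by ring

/-- The left factors of the response. -/
def respP (l : ℕ) (k : Fin (l + 1) × Bool) : VFam := if k.2 then muR (l - k.1) else Ir l k.1

/-- The right factors of the response. -/
def respQ (l : ℕ) (k : Fin (l + 1) × Bool) : CFam := if k.2 then Jr l k.1 else etaR (l - k.1)

lemma isV_respP (l : ℕ) (k : Fin (l + 1) × Bool) : IsV (respP l k) := by
  unfold respP
  split_ifs
  exacts [isV_muR _, isV_Ir _ _]

lemma isC_respQ (l : ℕ) (k : Fin (l + 1) × Bool) : IsC (respQ l k) := by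
  unfold respQ
  split_ifs
  exacts [isC_Jr _ _, isC_etaR _]

/-- For a good pair at most one input of each node changes, so the propagation of the change is
exactly linear and the adjoint formula applies. Its sources live only on the two exchanged edges:
`Ir` meets the difference of the two check messages and `Jr` the difference of the two variable
messages. The contributions of `a` and `a'` have opposite signs and combine into a product of
differences. -/
lemma hasResponse_muR (l : ℕ) : HasResponse (muR l) (respP l) (respQ l) := by
  obtain ⟨R, hR⟩ := exists_radius l
  refine ⟨2 * R + 1, fun T G w a a' hb => ?_⟩
  set G' := swapG G a a' with hG'
  by_cases haa : a = a'
  · subst haa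
    rw [hG', swapG_self]
    simp
  have inη : ∀ t ≤ l, ∀ s : T.VSocket, etaR t T G w (G s) ≠ etaR t T G' w (G' s) →
      ∃ k ≤ R, ∃ x, (x = a ∨ x = a') ∧ Walk G k true s x := by
    intro t ht s hs
    by_contra hcon
    push Not at hcon
    have h1 : s ≠ a := fun h => hcon 0 (Nat.zero_le _) a (Or.inl rfl) h
    have h2 : s ≠ a' := fun h => hcon 0 (Nat.zero_le _) a' (Or.inr rfl) h
    apply hs
    rw [hG', swapG_of_ne G h1 h2]
    refine ((hR t ht).1.graph T G w _ a a' ?_ ?_).symm <;> rw [Equiv.symm_apply_apply]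
    · exact fun k _ hk => hcon k hk a (Or.inl rfl)
    · exact fun k _ hk => hcon k hk a' (Or.inr rfl)
  have inμ : ∀ t ≤ l, ∀ b : T.CSocket, muR t T G w (G.symm b) ≠ muR t T G' w (G'.symm b) →
      ∃ k ≤ R, ∃ x, (x = a ∨ x = a') ∧ Walk G k false (G.symm b) x := by
    intro t ht b hs
    by_contra hcon
    push Not at hcon
    have h1 : G.symm b ≠ a := fun h => hcon 0 (Nat.zero_le _) a (Or.inl rfl) h
    have h2 : G.symm b ≠ a' := fun h => hcon 0 (Nat.zero_le _) a' (Or.inr rfl) h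
    apply hs
    rw [hG', swapG_symm_apply, Equiv.swap_apply_of_ne_of_ne h1 h2]
    refine ((hR t ht).2.graph T G w _ a a' ?_ ?_).symm
    · exact fun k _ hk => hcon k hk a (Or.inl rfl)
    · exact fun k _ hk => hcon k hk a' (Or.inr rfl)
  have hb' : ¬ Bad R G a a' := fun h => hb (h.mono (by omega))
  have hb'' : ¬ Bad R G a' a := fun h => hb' (by
    rcases h with h | h | h
    exacts [Or.inl h.symm, Or.inr (Or.inr h), Or.inr (Or.inl h)])
  have hG'2 : swapG G a' a = G' := by rw [hG']; unfold swapG; rw [Equiv.swap_comm]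
  -- `Δη` compares the same check socket in the two graphs. The source `σc` accounts for a variable
  -- socket being attached elsewhere in `G'`, and `σv` does so for a check socket; the variable
  -- operation itself has no source, whence the zero function for `σw`.
  have key := sum_change_eq G w l (fun t e => muR t T G w e - muR t T G' w e) (fun _ _ => 0)
    (fun t e => etaR t T G' w (G e) - etaR t T G' w (G' e))
    (fun t b => etaR t T G w b - etaR t T G' w b)
    (fun t b => muR t T G' w (G.symm b) - muR t T G' w (G'.symm b))
    (fun b => by simp [etaR, constC]) ?_ ?_
  · unfold tot
    rw [← Finset.sum_sub_distrib, key, Fintype.sum_prod_type, Finset.sum_range]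
    refine Finset.sum_congr rfl fun n _ => ?_
    have hn : l - (n : ℕ) ≤ l := Nat.sub_le _ _
    have g1 := fun t ht => (hR t ht).1.swap_eq w hb'
    have g2 := fun t ht => (hR t ht).1.swap_eq w hb''
    have g3 := fun t ht => (hR t ht).2.swap_eq w hb'
    have g4 := fun t ht => (hR t ht).2.swap_eq w hb''
    rw [hG'2] at g2 g4
    rw [Fintype.sum_bool, Finset.sum_eq_add_of_mem a a' (Finset.mem_univ _) (Finset.mem_univ _)
      haa, Finset.sum_eq_add_of_mem (G a) (G a') (Finset.mem_univ _) (Finset.mem_univ _)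
      (fun h => haa (G.injective h))]
    · have e1 : G'.symm (G a) = a' := by rw [hG', swapG_symm_apply]; simp
      have e2 : G'.symm (G a') = a := by rw [hG', swapG_symm_apply]; simp
      have e3 : G' a = G a' := swapG_left G a a'
      have e4 : G' a' = G a := swapG_right G a a'
      simp only [e1, e2, e3, e4, Equiv.symm_apply_apply, mul_zero, Finset.sum_const_zero,
        respP, respQ, if_true, if_false, Bool.false_eq_true]
      rw [g1 _ hn, g2 _ hn, g3 _ hn, g4 _ hn]
      ring
    · intro b _ hne
      have : G'.symm b = G.symm b := by
        rw [hG', swapG_symm_apply, Equiv.swap_apply_of_ne_of_ne]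
        · exact fun h => hne.1 (by rw [← h]; simp)
        · exact fun h => hne.2 (by rw [← h]; simp)
      rw [this]; ring
    · intro e _ hne
      rw [hG', swapG_of_ne G hne.1 hne.2]; ring
  · rintro t ht ⟨v, i⟩
    change ind (w v) * _ - ind (w v) * _ = _
    rw [← mul_sub, prod_sub_prod_of_unique (Finset.univ.erase i)
      (fun j => etaR t T G w (G ⟨v, j⟩)) (fun j => etaR t T G' w (G' ⟨v, j⟩))]
    · rw [add_zero]
      congr 1
      exact Finset.sum_congr rfl fun s _ => by ring
    · intro s _ r _ hs hr
      by_contra hne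
      obtain ⟨k₁, hk₁, x₁, hx₁, hw₁⟩ := inη t ht _ hs
      obtain ⟨k₂, hk₂, x₂, hx₂, hw₂⟩ := inη t ht _ hr
      exact hb (bad_of_walks hw₁ hw₂ (adj_var G hne) hk₁ hk₂ hx₁ hx₂)
  · rintro t ht ⟨c, i⟩
    change (1 - ∏ j ∈ Finset.univ.erase i, (1 - muR t T G w (G.symm ⟨c, j⟩)))
      - (1 - ∏ j ∈ Finset.univ.erase i, (1 - muR t T G' w (G'.symm ⟨c, j⟩))) = _
    rw [prod_one_sub_sub_of_unique (Finset.univ.erase i)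
      (fun j => muR t T G w (G.symm ⟨c, j⟩)) (fun j => muR t T G' w (G'.symm ⟨c, j⟩))]
    · exact Finset.sum_congr rfl fun s _ => by ring
    · intro s _ r _ hs hr
      by_contra hne
      obtain ⟨k₁, hk₁, x₁, hx₁, hw₁⟩ := inμ t ht.le _ hs
      obtain ⟨k₂, hk₂, x₂, hx₂, hw₂⟩ := inμ t ht.le _ hr
      exact hb (bad_of_walks hw₁ hw₂ (adj_check G hne) hk₁ hk₂ hx₁ hx₂)

/-! ### Response to the channel -/

/-- A walk that ends at the variable node `v` can be cut so that it enters `v` from a check. -/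
lemma Degrees.Walk.cut {T : Degrees} {G : T.Graph} {v : Fin T.n} {k : ℕ} {s : Bool} {e x : T.VSocket}
    (hw : Walk G k s e x) (hx : x.1 = v) (hk : s = true → 1 ≤ k) :
    ∃ k' ≤ k, ∃ x' : T.VSocket, x'.1 = v ∧ Walk G k' s e x' ∧ not^[k'] s = false := by
  induction k generalizing s e with
  | zero =>
    cases s with
    | false => exact ⟨0, le_rfl, x, hx, hw, rfl⟩
    | true => exact absurd (hk rfl) (by norm_num)
  | succ k ih =>
    obtain ⟨g, hg, hw'⟩ := hw
    cases s with
    | false =>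
      rcases k with _ | k
      · obtain rfl : g = x := hw'
        exact ⟨0, Nat.zero_le _, e, by rw [hg.2.1 rfl, hx], rfl, rfl⟩
      · obtain ⟨k', hk', x', hx', hwk, hs⟩ := ih hw' (fun _ => by omega)
        exact ⟨k' + 1, by omega, x', hx', ⟨g, hg, hwk⟩, hs⟩
    | true =>
      obtain ⟨k', hk', x', hx', hwk, hs⟩ := ih hw' (fun h => by simp at h)
      exact ⟨k' + 1, by omega, x', hx', ⟨g, hg, hwk⟩, hs⟩

/-- A closed walk passes through the variable node `v`. -/
def ClosedAt {T : Degrees} (R : ℕ) (G : T.Graph) (v : Fin T.n) : Prop :=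
  ∃ x : T.VSocket, x.1 = v ∧ Closed R G x

/-- The walk leaves `v` through a check and re-enters it from a check. If it does not come back to
`x` itself, one step inside the variable node closes it. -/
lemma closedAt_of_walk {T : Degrees} {G : T.Graph} {v : Fin T.n} {k R : ℕ} {x x' : T.VSocket}
    (hw : Walk G k true x x') (hx : x.1 = v) (hx' : x'.1 = v) (hs : not^[k] true = false)
    (hk : k + 1 ≤ R) : ClosedAt R G v := by
  have hk1 : 1 ≤ k := by
    rcases k with _ | k
    · simp at hs
    · omega
  refine ⟨x, hx, ?_⟩
  by_cases h : x' = x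
  · subst h; exact ⟨k, hk1, by omega, _, hw⟩
  · refine ⟨k + 1, by omega, hk, _, hw.trans ?_⟩
    rw [hs]
    exact ⟨x, ⟨h, fun _ => by rw [hx, hx'], fun h => by simp at h⟩, rfl⟩

lemma closedAt_of_walks {T : Degrees} {G : T.Graph} {v : Fin T.n} {R : ℕ} {s : Bool}
    {e₁ e₂ x₁ x₂ : T.VSocket} {k₁ k₂ : ℕ} (h₁ : Walk G k₁ s e₁ x₁) (h₂ : Walk G k₂ s e₂ x₂)
    (h : Adj G (!s) e₁ e₂) (hk₁ : k₁ ≤ R) (hk₂ : k₂ ≤ R) (hx₁ : x₁.1 = v) (hx₂ : x₂.1 = v)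
    (hs₁ : s = true → 1 ≤ k₁) (hs₂ : s = true → 1 ≤ k₂) : ClosedAt (2 * R + 2) G v := by
  obtain ⟨m₁, hm₁, y₁, hy₁, hw₁, hn₁⟩ := h₁.cut hx₁ hs₁
  obtain ⟨m₂, hm₂, y₂, hy₂, hw₂, hn₂⟩ := h₂.cut hx₂ hs₂
  have comm : ∀ (m : ℕ) (b : Bool), not^[m] (!b) = !(not^[m] b) := fun m b =>
    (Function.iterate_succ_apply not m b).symm.trans (Function.iterate_succ_apply' not m b)
  have hw := hw₁.join hw₂ h
  have hs : not^[m₁] (!s) = true := by rw [comm, hn₁]; rfl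
  rw [hs] at hw
  refine closedAt_of_walk hw hy₁ hy₂ ?_ (by omega)
  rw [Nat.add_comm, Function.iterate_add_apply, ← hs, not_iterate_not, Function.iterate_succ_apply,
    Bool.not_not, hn₂]

/-- The total response to the channel output at the variable node of an edge. -/
def Lv (l : ℕ) : VFam := fun T G w a => ∑ n ∈ Finset.range (l + 1), ∑ s : Fin (T.dv a.1),
  muR (l - n) T G w ⟨a.1, s⟩ * Jh l n T G w (G ⟨a.1, s⟩)

/-- Without the erasure every message out of `v` vanishes, so the sources are the full messages
`muR` on the sockets of `v`. If no short cycle passes through `v`, they reach every node through at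
most one input and spread linearly. -/
lemma chan_response (l : ℕ) : ∃ R, ∀ (T : Degrees) (G : T.Graph) (w : T.Channel) (a : T.VSocket),
    ¬ ClosedAt R G a.1 → w a.1 = true →
      tot (muR l) T G w - tot (muR l) T G (Function.update w a.1 false) = Lv l T G w a := by
  obtain ⟨R, hR⟩ := exists_radius l
  refine ⟨2 * R + 2, fun T G w ⟨v, i₀⟩ hb hwv => ?_⟩
  simp only at hb hwv ⊢
  set w' := Function.update w v false with hw'
  have hne : ∀ u, u ≠ v → w u = w' u := fun u hu => by rw [hw', Function.update_of_ne hu]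
  have inη : ∀ t ≤ l, ∀ s : T.VSocket, etaR t T G w (G s) ≠ etaR t T G w' (G s) →
      ∃ k ≤ R, 1 ≤ k ∧ ∃ x : T.VSocket, x.1 = v ∧ Walk G k true s x := by
    intro t ht s hs
    by_contra hcon
    push Not at hcon
    refine hs ((hR t ht).1.chan T G w w' _ fun k f h1 hk hwk => hne _ fun hf => ?_)
    rw [Equiv.symm_apply_apply] at hwk
    exact hcon k hk h1 f hf hwk
  have inμ : ∀ t ≤ l, ∀ e : T.VSocket, muR t T G w e ≠ muR t T G w' e →
      ∃ k ≤ R, ∃ x : T.VSocket, x.1 = v ∧ Walk G k false e x := by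
    intro t ht e hs
    by_contra hcon
    push Not at hcon
    refine hs ((hR t ht).2.chan T G w w' _ (hne _ fun hf => ?_)
      fun k f h1 hk hwk => hne _ fun hf => ?_)
    · exact hcon 0 (Nat.zero_le _) e hf rfl
    · exact hcon k hk f hf hwk
  have key := sum_change_eq G w l (fun t e => muR t T G w e - muR t T G w' e)
    (fun t e => if e.1 = v then muR t T G w e else 0) (fun _ _ => 0)
    (fun t b => etaR t T G w b - etaR t T G w' b) (fun _ _ => 0)
    (fun b => by simp [etaR, constC]) ?_ ?_
  · unfold tot
    rw [← Finset.sum_sub_distrib, key]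
    unfold Lv
    refine Finset.sum_congr rfl fun n _ => ?_
    simp only [mul_zero, Finset.sum_const_zero, zero_add]
    rw [Fintype.sum_sigma, Finset.sum_eq_single_of_mem v (Finset.mem_univ _)]
    · exact Finset.sum_congr rfl fun s _ => by rw [if_pos rfl]; ring
    · intro u _ hu
      exact Finset.sum_eq_zero fun s _ => by rw [if_neg hu]; ring
  · rintro t ht ⟨u, i⟩
    by_cases hu : u = v
    · subst hu
      -- Messages entering `v` cannot depend on its own channel output: such a dependence would
      -- trace a short cycle through `v`.
      have h0 : ∀ s : Fin (T.dv u), etaR t T G w (G ⟨u, s⟩) - etaR t T G w' (G ⟨u, s⟩) = 0 := by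
        intro s
        by_contra hc
        obtain ⟨k, hk, hk1, x, hx, hwk⟩ := inη t ht _ (fun h => hc (by rw [h, sub_self]))
        obtain ⟨k', hk', x', hx', hwk', hn⟩ := hwk.cut hx (fun _ => hk1)
        exact hb (closedAt_of_walk hwk' rfl hx' hn (by omega))
      simp only [h0, if_true, add_zero, zero_mul, Finset.sum_const_zero, mul_zero, zero_add]
      have : muR t T G w' ⟨u, i⟩ = 0 := by
        unfold muR vStep
        simp [hw', ind]
      rw [this, sub_zero]
    · simp only [if_neg hu, add_zero]
      change ind (w u) * _ - ind (w' u) * _ = _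
      rw [← hne u hu, ← mul_sub, prod_sub_prod_of_unique (Finset.univ.erase i)
        (fun j => etaR t T G w (G ⟨u, j⟩)) (fun j => etaR t T G w' (G ⟨u, j⟩))]
      intro s _ r _ hs hr
      by_contra hsr
      obtain ⟨k₁, hk₁, h1₁, x₁, hx₁, hw₁⟩ := inη t ht _ hs
      obtain ⟨k₂, hk₂, h1₂, x₂, hx₂, hw₂⟩ := inη t ht _ hr
      exact hb (closedAt_of_walks hw₁ hw₂ (adj_var G hsr) hk₁ hk₂ hx₁ hx₂ (fun _ => h1₁)
        (fun _ => h1₂))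
  · rintro t ht ⟨c, i⟩
    simp only [add_zero]
    change (1 - ∏ j ∈ Finset.univ.erase i, (1 - muR t T G w (G.symm ⟨c, j⟩)))
      - (1 - ∏ j ∈ Finset.univ.erase i, (1 - muR t T G w' (G.symm ⟨c, j⟩))) = _
    rw [prod_one_sub_sub_of_unique (Finset.univ.erase i)
      (fun j => muR t T G w (G.symm ⟨c, j⟩)) (fun j => muR t T G w' (G.symm ⟨c, j⟩))]
    intro s _ r _ hs hr
    by_contra hne
    obtain ⟨k₁, hk₁, x₁, hx₁, hw₁⟩ := inμ t ht.le _ hs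
    obtain ⟨k₂, hk₂, x₂, hx₂, hw₂⟩ := inμ t ht.le _ hr
    exact hb (closedAt_of_walks hw₁ hw₂ (adj_check G hne) hk₁ hk₂ hx₁ hx₂ (fun h => by simp at h)
      (fun h => by simp at h))

end

end LDPC

/-! ### Evaluation of edge averages by density evolution -/

namespace LDPC

noncomputable section

open Degrees

/-! ### Degree averages along a realizing sequence -/

/-- The average of `g` over the degree of a random node, with the weights that turn sums over nodes
into averages over edges. -/
def degAvg (p : ℝ[X]) (g : ℕ → ℝ) : ℝ := ∑ i ∈ p.support, p.coeff i * (g (i + 1) / ((i : ℝ) + 1))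

/-- The properties of a realizing sequence that are used for the limits. -/
structure GoodSeq (lam rho : ℝ[X]) (D : ℕ) (T : ℕ → Degrees) : Prop where
  adm : ∀ᶠ k in atTop, Adm D (T k)
  edges : Tendsto (fun k => ((T k).numEdges : ℝ)) atTop atTop
  var : ∀ g : ℕ → ℝ, Tendsto (fun k => (∑ v, g ((T k).dv v)) / ((T k).numEdges : ℝ)) atTop
    (𝓝 (degAvg lam g))
  check : ∀ g : ℕ → ℝ, Tendsto (fun k => (∑ c, g ((T k).dc c)) / ((T k).numEdges : ℝ)) atTop
    (𝓝 (degAvg rho g))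

/-- The number of nodes per edge. -/
def nodeRatio (p : ℝ[X]) : ℝ := ∑ i ∈ p.support, p.coeff i / ((i : ℝ) + 1)

lemma coeff_nodeDist_succ (p : ℝ[X]) (i : ℕ) :
    (nodeDist p).coeff (i + 1) = (nodeRatio p)⁻¹ * (p.coeff i / ((i : ℝ) + 1)) := by
  unfold nodeDist nodeRatio
  rw [coeff_C_mul, finsetSum_coeff]
  congr 1
  simp only [coeff_monomial, add_left_inj]
  rw [Finset.sum_ite_eq']
  split_ifs with h
  · rfl
  · rw [notMem_support_iff.1 h, zero_div]

lemma coeff_nodeDist_zero (p : ℝ[X]) : (nodeDist p).coeff 0 = 0 := by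
  unfold nodeDist
  rw [coeff_C_mul, finsetSum_coeff]
  refine mul_eq_zero_of_right _ (Finset.sum_eq_zero fun i _ => ?_)
  rw [coeff_monomial, if_neg (Nat.succ_ne_zero i)]

lemma IsEdgeDist.sum_coeff {p : ℝ[X]} (hp : IsEdgeDist p) : ∑ i ∈ p.support, p.coeff i = 1 := by
  have h := hp.2
  rw [eval_eq_sum, Polynomial.sum] at h
  simpa using h

lemma nodeRatio_pos {p : ℝ[X]} (hp : IsEdgeDist p) : 0 < nodeRatio p := by
  refine Finset.sum_pos (fun i hi => ?_) ?_
  · have : 0 < p.coeff i := lt_of_le_of_ne (hp.1 i) (mem_support_iff.1 hi).symm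
    positivity
  · by_contra h
    rw [Finset.not_nonempty_iff_eq_empty] at h
    have := hp.sum_coeff
    rw [h] at this
    simp at this

lemma nodeRatio_le_one {p : ℝ[X]} (hp : IsEdgeDist p) : nodeRatio p ≤ 1 := by
  rw [← hp.sum_coeff]
  refine Finset.sum_le_sum fun i _ => div_le_self (hp.1 i) ?_
  have : (0 : ℝ) ≤ i := Nat.cast_nonneg i
  linarith

lemma avgDegree_eq {p : ℝ[X]} (hp : IsEdgeDist p) : avgDegree p = (nodeRatio p)⁻¹ := by
  unfold avgDegree nodeDist
  rw [derivative_mul, derivative_C, zero_mul, zero_add, eval_mul, eval_C, derivative_sum,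
    eval_finsetSum]
  simp only [derivative_monomial, eval_monomial, one_pow, mul_one]
  have h : ∑ i ∈ p.support, p.coeff i / ((i : ℝ) + 1) * ((i + 1 : ℕ) : ℝ) = 1 := by
    refine (Finset.sum_congr rfl fun i _ => ?_).trans hp.sum_coeff
    have : (i : ℝ) + 1 ≠ 0 := by positivity
    push_cast
    field_simp
  rw [h, mul_one]
  rfl

lemma sum_degree_eq {n D : ℕ} (d : Fin n → ℕ) (hd : ∀ v, d v ≤ D) (g : ℕ → ℝ) :
    ∑ v, g (d v) = ∑ j ∈ Finset.range (D + 1), (Fintype.card {v // d v = j} : ℝ) * g j := by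
  rw [← Finset.sum_fiberwise_of_maps_to (s := Finset.univ) (t := Finset.range (D + 1)) (g := d)
    (fun v _ => Finset.mem_range.2 (Nat.lt_succ_of_le (hd v)))]
  refine Finset.sum_congr rfl fun j _ => ?_
  rw [Finset.sum_congr rfl (g := fun _ => g j) (fun v hv => by rw [(Finset.mem_filter.1 hv).2]),
    Finset.sum_const, nsmul_eq_mul, Fintype.card_subtype]

/-- Averages over the nodes converge. -/
lemma tendsto_node_avg {p : ℝ[X]} {n : ℕ → ℕ} {d : ∀ k, Fin (n k) → ℕ} {D : ℕ}
    (hd : ∀ k v, d k v ≤ D)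
    (h : ∀ j : ℕ, Tendsto (fun k => (Fintype.card {v // d k v = j} : ℝ) / (n k : ℝ)) atTop
      (𝓝 ((nodeDist p).coeff j))) (g : ℕ → ℝ) :
    Tendsto (fun k => (∑ v, g (d k v)) / (n k : ℝ)) atTop
      (𝓝 ((nodeRatio p)⁻¹ * degAvg p g)) := by
  set D' := max D (p.natDegree + 1) with hD'
  have e : ∀ k, (∑ v, g (d k v)) / (n k : ℝ) = ∑ j ∈ Finset.range (D' + 1),
      (Fintype.card {v // d k v = j} : ℝ) / (n k : ℝ) * g j := by
    intro k
    rw [sum_degree_eq (d k) (fun v => (hd k v).trans (le_max_left _ _ : D ≤ D')) g,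
      Finset.sum_div]
    exact Finset.sum_congr rfl fun j _ => by ring
  simp only [e]
  have hl : (nodeRatio p)⁻¹ * degAvg p g
      = ∑ j ∈ Finset.range (D' + 1), (nodeDist p).coeff j * g j := by
    rw [Finset.sum_range_succ', coeff_nodeDist_zero, zero_mul, add_zero, degAvg, Finset.mul_sum]
    have hsub : p.support ⊆ Finset.range D' := fun i hi => Finset.mem_range.2
      (lt_of_le_of_lt (le_natDegree_of_mem_supp i hi)
        (lt_of_lt_of_le (Nat.lt_succ_self _) (le_max_right D (p.natDegree + 1))))
    rw [Finset.sum_subset hsub]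
    · exact Finset.sum_congr rfl fun i _ => by rw [coeff_nodeDist_succ]; ring
    · intro i _ hi
      rw [notMem_support_iff.1 hi]; ring
  rw [hl]
  exact tendsto_finsetSum _ fun j _ => (h j).mul_const _

lemma degAvg_cast {p : ℝ[X]} (hp : IsEdgeDist p) : degAvg p (fun d => (d : ℝ)) = 1 := by
  rw [← hp.sum_coeff]
  refine Finset.sum_congr rfl fun i _ => ?_
  have : (i : ℝ) + 1 ≠ 0 := by positivity
  push_cast
  field_simp

lemma numEdges_eq_sum_dv (T : Degrees) : (T.numEdges : ℝ) = ∑ v, (T.dv v : ℝ) := by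
  rw [numEdges, Fintype.card_sigma]
  simp

lemma numEdges_eq_sum_dc (T : Degrees) : (T.numEdges : ℝ) = ∑ c, (T.dc c : ℝ) := by
  rw [numEdges_eq_sum_dv]
  exact_mod_cast T.balanced

lemma Realizes.goodSeq {lam rho : ℝ[X]} (hlam : IsEdgeDist lam) (hrho : IsEdgeDist rho)
    {T : ℕ → Degrees} (hT : Realizes lam rho T) : (∃ D, GoodSeq lam rho D T) ∧
      Tendsto (fun k => ((T k).numEdges : ℝ) / ((T k).n * avgDegree lam)) atTop (𝓝 1) := by
  obtain ⟨D, hD⟩ := hT.bounded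
  have hn : Tendsto (fun k => ((T k).n : ℝ)) atTop atTop :=
    tendsto_natCast_atTop_atTop.comp hT.blocklength
  have hS := nodeRatio_pos hlam
  have hR := nodeRatio_pos hrho
  have hv := tendsto_node_avg (fun k => (hD k).1) hT.varFraction
  have hc := tendsto_node_avg (fun k => (hD k).2) hT.checkFraction
  have hNn : Tendsto (fun k => ((T k).numEdges : ℝ) / (T k).n) atTop (𝓝 (nodeRatio lam)⁻¹) := by
    have := hv (fun d => (d : ℝ))
    rw [degAvg_cast hlam, mul_one] at this
    simpa only [numEdges_eq_sum_dv] using this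
  have hNm : Tendsto (fun k => ((T k).numEdges : ℝ) / (T k).m) atTop (𝓝 (nodeRatio rho)⁻¹) := by
    have := hc (fun d => (d : ℝ))
    rw [degAvg_cast hrho, mul_one] at this
    simpa only [numEdges_eq_sum_dc] using this
  have hn0 : ∀ᶠ k in atTop, (0 : ℝ) < (T k).n := hn.eventually_gt_atTop 0
  -- Every node counted in the limiting distribution has degree at least one, so the limiting mean
  -- degree is at least one, and eventually there are more than `n/2` edges.
  have hlow : ∀ᶠ k in atTop, (1 / 2 : ℝ) < ((T k).numEdges : ℝ) / (T k).n := by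
    refine hNn.eventually (lt_mem_nhds ?_)
    have := (one_le_inv₀ hS).2 (nodeRatio_le_one hlam)
    linarith
  have hN : Tendsto (fun k => ((T k).numEdges : ℝ)) atTop atTop := by
    refine tendsto_atTop_mono' _ ?_ (hn.const_mul_atTop (by norm_num : (0 : ℝ) < 1 / 2))
    filter_upwards [hn0, hlow] with k h0 h1
    rw [lt_div_iff₀ h0] at h1
    exact h1.le
  have hN0 : ∀ᶠ k in atTop, (0 : ℝ) < (T k).numEdges := hN.eventually_gt_atTop 0
  -- `D` bounds the degrees; `2` is for the requirement `n ≤ 2N`.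
  refine ⟨⟨max D 2, ⟨?_, hN, fun g => ?_, fun g => ?_⟩⟩, ?_⟩
  · filter_upwards [hn0, hlow, hN0] with k h0 h1 h2
    refine ⟨⟨fun v => ((hD k).1 v).trans (le_max_left _ _),
      fun c => ((hD k).2 c).trans (le_max_left _ _)⟩, by exact_mod_cast h2, ?_⟩
    rw [lt_div_iff₀ h0] at h1
    have h3 : ((T k).n : ℝ) ≤ 2 * (T k).numEdges := by linarith
    have h4 : (T k).n ≤ 2 * (T k).numEdges := by exact_mod_cast h3
    exact h4.trans (Nat.mul_le_mul_right _ (le_max_right _ _))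
  · have := (hv g).div hNn (inv_ne_zero hS.ne')
    rw [mul_div_cancel_left₀ _ (inv_ne_zero hS.ne')] at this
    refine this.congr' ?_
    filter_upwards [hn0, hN0] with k h0 h1
    simp only [Pi.div_apply]
    field_simp
  · have := (hc g).div hNm (inv_ne_zero hR.ne')
    rw [mul_div_cancel_left₀ _ (inv_ne_zero hR.ne')] at this
    refine this.congr' ?_
    filter_upwards [hN0] with k h1
    have h0 : ((T k).m : ℝ) ≠ 0 := by
      intro h
      have hm : (T k).m = 0 := by exact_mod_cast h
      rw [numEdges_eq_sum_dc] at h1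
      have : IsEmpty (Fin (T k).m) := by rw [hm]; infer_instance
      simp at h1
    simp only [Pi.div_apply]
    field_simp
  · rw [avgDegree_eq hlam]
    have := hNn.mul_const (nodeRatio lam)
    rw [inv_mul_cancel₀ hS.ne'] at this
    refine this.congr fun k => ?_
    rw [div_mul_eq_div_div, div_inv_eq_mul]

lemma GoodSeq.root_tendsto {lam rho : ℝ[X]} {D : ℕ} {T : ℕ → Degrees}
    (h : GoodSeq lam rho D T) : Tendsto (fun k => root (T k)) atTop atTop :=
  Real.tendsto_sqrt_atTop.comp (Real.tendsto_sqrt_atTop.comp h.edges)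

lemma Negl.tendsto {X : Degrees → ℝ} (hX : Negl X) {lam rho : ℝ[X]} {D : ℕ} {T : ℕ → Degrees}
    (h : GoodSeq lam rho D T) : Tendsto (fun k => X (T k)) atTop (𝓝 0) := by
  obtain ⟨C, hC⟩ := hX D
  refine squeeze_zero_norm' ?_ (h.root_tendsto.const_div_atTop C)
  filter_upwards [h.adm] with k hk
  exact hC _ hk

lemma Bddd.mul_tendsto {X Y : Degrees → ℝ} (hX : Bddd X) {lam rho : ℝ[X]} {D : ℕ}
    {T : ℕ → Degrees} (h : GoodSeq lam rho D T) (hY : Tendsto (fun k => Y (T k)) atTop (𝓝 0)) :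
    Tendsto (fun k => X (T k) * Y (T k)) atTop (𝓝 0) := by
  obtain ⟨C, hC⟩ := hX D
  refine squeeze_zero_norm' ?_ (by simpa using hY.abs.const_mul C)
  filter_upwards [h.adm] with k hk
  rw [Real.norm_eq_abs, abs_mul]
  exact mul_le_mul_of_nonneg_right (hC _ hk) (abs_nonneg _)

end

end LDPC

namespace LDPC

noncomputable section

open Degrees

variable {ε : ℝ}

/-! ### Averages of products over the edges of a node -/

/-- Replace the factors one at a time in the order of the sockets. The coefficient of `ξ k - c k`
contains `ξ j` only for `j < k`, never `ξ k`; it is therefore local on the side of the edge opposite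
to `ξ k`, and the two can be averaged independently. -/
lemma prod_sub_prod_telescope {d : ℕ} (S : Finset (Fin d)) (ξ c : Fin d → ℝ) :
    ∏ j ∈ S, ξ j - ∏ j ∈ S, c j
      = ∑ k ∈ S, (∏ j ∈ S.erase k, if j < k then ξ j else c j) * (ξ k - c k) := by
  have h := Finset.prod_add_ordered S c (fun j => ξ j - c j)
  simp only [add_sub_cancel] at h
  rw [h, add_sub_cancel_left]
  refine Finset.sum_congr rfl fun k _ => ?_
  rw [Finset.prod_ite, mul_comm]
  have e1 : (S.erase k).filter (fun j => j < k) = S.filter (fun j => j < k) := by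
    ext j
    simp only [Finset.mem_filter, Finset.mem_erase]
    exact ⟨fun h => ⟨h.1.2, h.2⟩, fun h => ⟨⟨h.2.ne, h.1⟩, h.2⟩⟩
  have e2 : (S.erase k).filter (fun j => ¬ j < k) = S.filter (fun j => k < j) := by
    ext j
    simp only [Finset.mem_filter, Finset.mem_erase, not_lt]
    exact ⟨fun h => ⟨h.1.2, lt_of_le_of_ne h.2 (Ne.symm h.1.1)⟩,
      fun h => ⟨⟨h.2.ne', h.1⟩, h.2.le⟩⟩
  rw [e1, e2]
  ring

/-- The value at one socket of a multilinear form in quantities on all the sockets of a node. -/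
def formVal {ι : Type} (ψ : ∀ d, Fin d → Fin d → ℝ) (τ : ∀ d, Fin d → Fin d → Fin d → ι)
    (d : ℕ) (i : Fin d) (ξ : Fin d → ι → ℝ) : ℝ := ∑ s, ψ d i s * ∏ j, ξ j (τ d i s j)

open Classical in
/-- The coefficients in the telescoping expansion of a form. -/
def formCoef {ι : Type} (ψ : ∀ d, Fin d → Fin d → ℝ) (τ : ∀ d, Fin d → Fin d → Fin d → ι)
    (c : ι → ℝ) (θ : ι) (d : ℕ) (k : Fin d) (ξ : Fin d → ι → ℝ) : ℝ :=
  ∑ i, ∑ s, if τ d i s k = θ then ψ d i s *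
    ∏ j ∈ Finset.univ.erase k, (if j < k then ξ j (τ d i s j) else c (τ d i s j)) else 0

lemma sum_formVal_sub {ι : Type} [Fintype ι] (ψ : ∀ d, Fin d → Fin d → ℝ)
    (τ : ∀ d, Fin d → Fin d → Fin d → ι) (c : ι → ℝ) (d : ℕ) (ξ : Fin d → ι → ℝ) :
    ∑ i, formVal ψ τ d i ξ - ∑ i, formVal ψ τ d i (fun _ => c)
      = ∑ k, ∑ θ, formCoef ψ τ c θ d k ξ * (ξ k θ - c θ) := by
  classical
  have h1 : ∀ k, ∑ θ, formCoef ψ τ c θ d k ξ * (ξ k θ - c θ) = ∑ i, ∑ s, ψ d i s *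
      ((∏ j ∈ Finset.univ.erase k, (if j < k then ξ j (τ d i s j) else c (τ d i s j))) *
        (ξ k (τ d i s k) - c (τ d i s k))) := by
    intro k
    unfold formCoef
    simp only [Finset.sum_mul]
    rw [Finset.sum_comm]
    refine Finset.sum_congr rfl fun i _ => ?_
    rw [Finset.sum_comm]
    refine Finset.sum_congr rfl fun s _ => ?_
    simp only [ite_mul, zero_mul]
    rw [Finset.sum_ite_eq, if_pos (Finset.mem_univ _)]
    ring
  simp only [h1]
  rw [Finset.sum_comm, ← Finset.sum_sub_distrib]
  refine Finset.sum_congr rfl fun i _ => ?_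
  rw [Finset.sum_comm, formVal, formVal, ← Finset.sum_sub_distrib]
  refine Finset.sum_congr rfl fun s _ => ?_
  rw [← mul_sub, prod_sub_prod_telescope Finset.univ (fun j => ξ j (τ d i s j)) (fun j => c (τ d i s j)),
    Finset.mul_sum]

lemma continuous_formCoef {ι : Type} (ψ : ∀ d, Fin d → Fin d → ℝ)
    (τ : ∀ d, Fin d → Fin d → Fin d → ι) (c : ι → ℝ) (θ : ι) (d : ℕ) (k : Fin d) :
    Continuous (formCoef ψ τ c θ d k) := by
  unfold formCoef
  refine continuous_finsetSum _ fun i _ => continuous_finsetSum _ fun s _ => ?_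
  split_ifs
  · refine continuous_const.mul (continuous_finsetProd _ fun j _ => ?_)
    split_ifs <;> fun_prop
  · exact continuous_const

lemma formCoef_congr {ι : Type} (ψ : ∀ d, Fin d → Fin d → ℝ)
    (τ : ∀ d, Fin d → Fin d → Fin d → ι) (c : ι → ℝ) (θ : ι) (d : ℕ) (k : Fin d)
    (ξ ξ' : Fin d → ι → ℝ) (h : ∀ j, j ≠ k → ξ j = ξ' j) :
    formCoef ψ τ c θ d k ξ = formCoef ψ τ c θ d k ξ' := by
  unfold formCoef
  refine Finset.sum_congr rfl fun i _ => Finset.sum_congr rfl fun s _ => ?_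
  split_ifs
  · congr 1
    exact Finset.prod_congr rfl fun j hj => by rw [h j (Finset.ne_of_mem_erase hj)]
  · rfl

/-- A form at the variable nodes. -/
def vForm {ι : Type} (ψ : ∀ d, Fin d → Fin d → ℝ) (τ : ∀ d, Fin d → Fin d → Fin d → ι)
    (χ : ι → CFam) : VFam := fun T G w a =>
  ind (w a.1) * formVal ψ τ (T.dv a.1) a.2 (fun j θ => χ θ T G w (G ⟨a.1, j⟩))

/-- A form at the check nodes. -/
def cForm {ι : Type} (ψ : ∀ d, Fin d → Fin d → ℝ) (τ : ∀ d, Fin d → Fin d → Fin d → ι)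
    (φ : ι → VFam) : CFam := fun T G w b =>
  formVal ψ τ (T.dc b.1) b.2 (fun j θ => φ θ T G w (G.symm ⟨b.1, j⟩))

/-- Pair each channel word with the one in which bit `v` is flipped: the weights `ε (1 - ε)` and `(1
- ε)(-ε)` cancel. -/
lemma expect_ind_sub_mul {T : Degrees} (v : Fin T.n) (h : T.Graph → T.Channel → ℝ)
    (hh : ∀ G w b, h G (Function.update w v b) = h G w) :
    T.expect ε (fun G w => (ind (w v) - ε) * h G w) = 0 := by
  rw [expect_def]
  rw [div_eq_zero_iff]
  left
  refine Finset.sum_eq_zero fun G _ => ?_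
  refine Finset.sum_involution (fun w _ => Function.update w v (!w v)) ?_ ?_ ?_ ?_
  · intro w _
    rw [hh]
    unfold chanProb
    rw [← Finset.mul_prod_erase _ _ (Finset.mem_univ v),
      ← Finset.mul_prod_erase _ _ (Finset.mem_univ v)]
    have : ∏ u ∈ Finset.univ.erase v, (if Function.update w v (!w v) u = true then ε else 1 - ε)
        = ∏ u ∈ Finset.univ.erase v, (if w u = true then ε else 1 - ε) :=
      Finset.prod_congr rfl fun u hu => by rw [Function.update_of_ne (Finset.ne_of_mem_erase hu)]
    rw [this, Function.update_self]
    cases hw : w v <;> simp [ind] <;> ring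
  · intro w _ _ hcon
    have := congrFun hcon v
    rw [Function.update_self] at this
    cases hw : w v <;> simp [hw] at this
  · intro w _; exact Finset.mem_univ _
  · intro w _
    rw [Function.update_self, Bool.not_not, Function.update_idem, Function.update_eq_self]

lemma expect_ind {T : Degrees} (v : Fin T.n) : T.expect ε (fun _ w => ind (w v)) = ε := by
  have := expect_ind_sub_mul (ε := ε) v (fun _ _ => 1) (fun _ _ _ => rfl)
  simp only [mul_one] at this
  rw [expect_sub, expect_const] at this
  linarith

variable {lam rho : ℝ[X]} {D : ℕ} {T : ℕ → Degrees}

/-- The telescoped form is its value at the constants `c` plus terms `κ (χ - c)`, with `κ` on the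
variable side. These vanish in the limit by `negl_glue`, so incoming messages may be treated as
independent. -/
lemma tendsto_avg_vForm (hε : ε ∈ Set.Icc (0 : ℝ) 1) (hT : GoodSeq lam rho D T) {ι : Type}
    [Fintype ι] (ψ : ∀ d, Fin d → Fin d → ℝ) (τ : ∀ d, Fin d → Fin d → Fin d → ι)
    {χ : ι → CFam} (hχ : ∀ θ, IsC (χ θ)) {c : ι → ℝ}
    (hc : ∀ θ, Tendsto (fun k => avg ε (onEdge (χ θ)) (T k)) atTop (𝓝 (c θ))) :
    Tendsto (fun k => avg ε (vForm ψ τ χ) (T k)) atTop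
      (𝓝 (ε * degAvg lam (fun d => ∑ i, formVal ψ τ d i (fun _ => c)))) := by
  set κ : ι → VFam := fun θ T G w a => ind (w a.1) *
    formCoef ψ τ c θ (T.dv a.1) a.2 (fun j θ => χ θ T G w (G ⟨a.1, j⟩)) with hκdef
  have hκ : ∀ θ, IsV (κ θ) := fun θ =>
    IsV.node hχ (fun d i b ξ => ind b * formCoef ψ τ c θ d i ξ)
      (fun d i b => continuous_const.mul (continuous_formCoef ψ τ c θ d i))
      (fun d i b ξ ξ' h => by rw [formCoef_congr ψ τ c θ d i ξ ξ' h])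
  have h1 : ∀ θ, Tendsto (fun k => avg ε (κ θ * onEdge (χ θ)) (T k) - avg ε (κ θ) (T k) * c θ)
      atTop (𝓝 0) := by
    intro θ
    have a1 := (negl_glue hε (hκ θ) (hχ θ)).tendsto hT
    have a2 := (abs_avg_le hε (hκ θ).2).mul_tendsto (Y := fun T => avg ε (onEdge (χ θ)) T - c θ) hT
      (by simpa using (hc θ).sub_const (c θ))
    have := a1.add a2
    rw [add_zero] at this
    exact this.congr fun k => by ring
  have h2 := tendsto_finsetSum Finset.univ fun θ _ => h1 θ
  have h3 := (hT.var (fun d => ∑ i, formVal ψ τ d i (fun _ => c))).const_mul ε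
  have h4 := h2.add h3
  rw [Finset.sum_const_zero, zero_add] at h4
  refine h4.congr fun k => ?_
  have e1 : ∀ G w, tot (vForm ψ τ χ) (T k) G w = ∑ θ, (tot (κ θ * onEdge (χ θ)) (T k) G w
      - tot (κ θ) (T k) G w * c θ) + ∑ v, ind (w v) * ∑ i, formVal ψ τ ((T k).dv v) i (fun _ => c)
      := by
    intro G w
    unfold tot
    simp only [Finset.sum_mul, ← Finset.sum_sub_distrib]
    rw [Finset.sum_comm, Fintype.sum_sigma, Fintype.sum_sigma, ← Finset.sum_add_distrib]
    refine Finset.sum_congr rfl fun v _ => ?_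
    have := sum_formVal_sub ψ τ c ((T k).dv v) (fun j θ => χ θ (T k) G w (G ⟨v, j⟩))
    rw [sub_eq_iff_eq_add] at this
    unfold vForm
    simp only
    rw [← Finset.mul_sum, this, mul_add, Finset.mul_sum]
    congr 1
    refine Finset.sum_congr rfl fun i _ => ?_
    rw [Finset.mul_sum]
    refine Finset.sum_congr rfl fun θ _ => ?_
    simp only [hκdef, Pi.mul_apply, onEdge]
    ring
  have e2 : (T k).expect ε (tot (vForm ψ τ χ) (T k)) = ∑ θ,
      ((T k).expect ε (tot (κ θ * onEdge (χ θ)) (T k)) - (T k).expect ε (tot (κ θ) (T k)) * c θ)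
      + ε * ∑ v, ∑ i, formVal ψ τ ((T k).dv v) i (fun _ => c) := by
    have : tot (vForm ψ τ χ) (T k) = fun G w => _ := funext fun G => funext fun w => e1 G w
    rw [this, expect_add, expect_sum, expect_sum]
    simp only [expect_sub, expect_mul_const, expect_ind]
    rw [Finset.mul_sum]
  simp only [avg]
  rw [e2, add_div, mul_div_assoc]
  congr 1
  rw [Finset.sum_div]
  exact Finset.sum_congr rfl fun θ _ => by ring

lemma tot_onEdge (χ : CFam) (T : Degrees) (G : T.Graph) (w : T.Channel) :
    tot (onEdge χ) T G w = ∑ b, χ T G w b := Equiv.sum_comp G _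

lemma tot_mul_onEdge (φ : VFam) (χ : CFam) (T : Degrees) (G : T.Graph) (w : T.Channel) :
    tot (φ * onEdge χ) T G w = ∑ b, φ T G w (G.symm b) * χ T G w b := by
  rw [← Equiv.sum_comp G]
  simp [tot, onEdge]

lemma tendsto_avg_cForm (hε : ε ∈ Set.Icc (0 : ℝ) 1) (hT : GoodSeq lam rho D T) {ι : Type}
    [Fintype ι] (ψ : ∀ d, Fin d → Fin d → ℝ) (τ : ∀ d, Fin d → Fin d → Fin d → ι)
    {φ : ι → VFam} (hφ : ∀ θ, IsV (φ θ)) {c : ι → ℝ}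
    (hc : ∀ θ, Tendsto (fun k => avg ε (φ θ) (T k)) atTop (𝓝 (c θ))) :
    Tendsto (fun k => avg ε (onEdge (cForm ψ τ φ)) (T k)) atTop
      (𝓝 (degAvg rho (fun d => ∑ i, formVal ψ τ d i (fun _ => c)))) := by
  set κ : ι → CFam := fun θ T G w b =>
    formCoef ψ τ c θ (T.dc b.1) b.2 (fun j θ => φ θ T G w (G.symm ⟨b.1, j⟩)) with hκdef
  have hκ : ∀ θ, IsC (κ θ) := fun θ =>
    IsC.node hφ (fun d i b ξ => formCoef ψ τ c θ d i ξ)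
      (fun d i b => continuous_formCoef ψ τ c θ d i)
      (fun d i b ξ ξ' h => by rw [formCoef_congr ψ τ c θ d i ξ ξ' h])
  have h1 : ∀ θ, Tendsto (fun k => avg ε (φ θ * onEdge (κ θ)) (T k)
      - avg ε (onEdge (κ θ)) (T k) * c θ) atTop (𝓝 0) := by
    intro θ
    have a1 := (negl_glue hε (hφ θ) (hκ θ)).tendsto hT
    have a2 := (abs_avg_le hε (hκ θ).isE.2).mul_tendsto (Y := fun T => avg ε (φ θ) T - c θ) hT
      (by simpa using (hc θ).sub_const (c θ))
    have := a1.add a2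
    rw [add_zero] at this
    exact this.congr fun k => by ring
  have h2 := tendsto_finsetSum Finset.univ fun θ _ => h1 θ
  have h3 := hT.check (fun d => ∑ i, formVal ψ τ d i (fun _ => c))
  have h4 := h2.add h3
  rw [Finset.sum_const_zero, zero_add] at h4
  refine h4.congr fun k => ?_
  have e1 : ∀ G w, tot (onEdge (cForm ψ τ φ)) (T k) G w = ∑ θ, (tot (φ θ * onEdge (κ θ)) (T k) G w
      - tot (onEdge (κ θ)) (T k) G w * c θ)
      + ∑ v, ∑ i, formVal ψ τ ((T k).dc v) i (fun _ => c) := by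
    intro G w
    simp only [tot_mul_onEdge, tot_onEdge]
    simp only [Finset.sum_mul, ← Finset.sum_sub_distrib]
    rw [Finset.sum_comm, Fintype.sum_sigma, Fintype.sum_sigma, ← Finset.sum_add_distrib]
    refine Finset.sum_congr rfl fun v _ => ?_
    have := sum_formVal_sub ψ τ c ((T k).dc v) (fun j θ => φ θ (T k) G w (G.symm ⟨v, j⟩))
    rw [sub_eq_iff_eq_add] at this
    unfold cForm
    simp only
    rw [this]
    congr 1
    refine Finset.sum_congr rfl fun i _ => Finset.sum_congr rfl fun θ _ => ?_
    simp only [hκdef]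
    ring
  have e2 : (T k).expect ε (tot (onEdge (cForm ψ τ φ)) (T k)) = ∑ θ,
      ((T k).expect ε (tot (φ θ * onEdge (κ θ)) (T k))
        - (T k).expect ε (tot (onEdge (κ θ)) (T k)) * c θ)
      + ∑ v, ∑ i, formVal ψ τ ((T k).dc v) i (fun _ => c) := by
    have : tot (onEdge (cForm ψ τ φ)) (T k) = fun G w => _ :=
      funext fun G => funext fun w => e1 G w
    rw [this, expect_add, expect_sum, expect_const]
    simp only [expect_sub, expect_mul_const]
  simp only [avg]
  rw [e2, add_div]
  congr 1
  rw [Finset.sum_div]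
  exact Finset.sum_congr rfl fun θ _ => by ring

end

end LDPC

namespace LDPC

noncomputable section

open Degrees

variable {ε : ℝ}

/-! ### Pair forms -/

/-- Sum over a marked edge `i` and another edge `s` of a node. -/
def pairVal (g : ℕ → ℝ) (p q : ℝ) (d : ℕ) (i : Fin d) (α β γ χ : Fin d → ℝ) : ℝ :=
  g d * (p * (α i * ∏ j ∈ Finset.univ.erase i, χ j) + q * ∑ s ∈ Finset.univ.erase i,
    β i * (γ s * ∏ j ∈ (Finset.univ.erase i).erase s, χ j))

/-- Types of the edges in a pair form. -/
def pairTau (d : ℕ) (i s j : Fin d) : Fin 4 :=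
  if j = i then (if s = i then 0 else 1) else if j = s then 2 else 3

/-- Weights in a pair form. -/
def pairPsi (g : ℕ → ℝ) (p q : ℝ) (d : ℕ) (i s : Fin d) : ℝ := g d * if s = i then p else q

lemma formVal_pair (g : ℕ → ℝ) (p q : ℝ) (d : ℕ) (i : Fin d) (ξ : Fin d → Fin 4 → ℝ) :
    formVal (pairPsi g p q) pairTau d i ξ
      = pairVal g p q d i (fun j => ξ j 0) (fun j => ξ j 1) (fun j => ξ j 2) (fun j => ξ j 3) := by
  unfold formVal pairVal
  rw [← Finset.add_sum_erase _ _ (Finset.mem_univ i), mul_add, Finset.mul_sum, Finset.mul_sum]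
  congr 1
  · rw [← Finset.mul_prod_erase _ _ (Finset.mem_univ i)]
    have : ∏ j ∈ Finset.univ.erase i, ξ j (pairTau d i i j) = ∏ j ∈ Finset.univ.erase i, ξ j 3 := by
      refine Finset.prod_congr rfl fun j hj => ?_
      have := Finset.ne_of_mem_erase hj
      simp [pairTau, this]
    rw [this]
    simp [pairTau, pairPsi]
    ring
  · refine Finset.sum_congr rfl fun s hs => ?_
    have hsi := Finset.ne_of_mem_erase hs
    rw [← Finset.mul_prod_erase _ _ (Finset.mem_univ i), ← Finset.mul_prod_erase _ _ hs]
    have : ∏ j ∈ (Finset.univ.erase i).erase s, ξ j (pairTau d i s j)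
        = ∏ j ∈ (Finset.univ.erase i).erase s, ξ j 3 := by
      refine Finset.prod_congr rfl fun j hj => ?_
      have h1 := Finset.ne_of_mem_erase hj
      have h2 := Finset.ne_of_mem_erase (Finset.mem_of_mem_erase hj)
      simp [pairTau, h1, h2]
    rw [this]
    simp [pairTau, pairPsi, hsi]
    ring

lemma sum_pairVal_const (g : ℕ → ℝ) (p q a b c x : ℝ) (m : ℕ) :
    ∑ i, pairVal g p q (m + 1) i (fun _ => a) (fun _ => b) (fun _ => c) (fun _ => x)
      = ((m : ℝ) + 1) * (g (m + 1) * (p * a * x ^ m + q * (b * c * (m * x ^ (m - 1))))) := by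
  have h : ∀ i : Fin (m + 1), pairVal g p q (m + 1) i (fun _ => a) (fun _ => b) (fun _ => c)
      (fun _ => x) = g (m + 1) * (p * a * x ^ m + q * (b * c * (m * x ^ (m - 1)))) := by
    intro i
    unfold pairVal
    have h1 : ∀ s ∈ Finset.univ.erase i, b * (c * ∏ _j ∈ (Finset.univ.erase i).erase s, x)
        = b * (c * x ^ (m - 1)) := by
      intro s hs
      rw [Finset.prod_const, Finset.card_erase_of_mem hs, Finset.card_erase_of_mem
        (Finset.mem_univ i), Finset.card_univ, Fintype.card_fin, Nat.add_sub_cancel]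
    rw [Finset.sum_congr rfl h1, Finset.sum_const, Finset.prod_const, Finset.card_erase_of_mem
      (Finset.mem_univ i), Finset.card_univ, Fintype.card_fin, Nat.add_sub_cancel, nsmul_eq_mul]
    ring
  rw [Finset.sum_congr rfl fun i _ => h i, Finset.sum_const, Finset.card_univ, Fintype.card_fin,
    nsmul_eq_mul]
  push_cast
  rfl

/-- The limit of a pair form. -/
def pairLim (P : ℝ[X]) (g : ℕ → ℝ) (p q a b c x : ℝ) : ℝ :=
  ∑ m ∈ P.support, P.coeff m * (g (m + 1) * (p * a * x ^ m + q * (b * c * (m * x ^ (m - 1)))))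

lemma pairLim_one (P : ℝ[X]) (p q a b c x : ℝ) : pairLim P (fun _ => 1) p q a b c x
    = p * a * P.eval x + q * (b * c * (derivative P).eval x) := by
  rw [derivative_eval, eval_eq_sum, Polynomial.sum, Polynomial.sum, Finset.mul_sum, Finset.mul_sum,
    Finset.mul_sum, ← Finset.sum_add_distrib]
  exact Finset.sum_congr rfl fun m _ => by ring

lemma pairLim_pow (P : ℝ[X]) (a x z : ℝ) : pairLim P (fun d => z ^ (d - 1)) 1 1 a x a x
    = a * (P.eval (z * x) + z * x * (derivative P).eval (z * x)) := by
  rw [derivative_eval, eval_eq_sum, Polynomial.sum, Polynomial.sum, Finset.mul_sum,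
    ← Finset.sum_add_distrib, Finset.mul_sum]
  refine Finset.sum_congr rfl fun m _ => ?_
  rcases m with _ | m
  · simp [mul_comm]
  · simp only [Nat.add_sub_cancel, mul_pow]
    ring

lemma degAvg_pair (P : ℝ[X]) (g : ℕ → ℝ) (p q : ℝ) (c : Fin 4 → ℝ) :
    degAvg P (fun d => ∑ i, formVal (pairPsi g p q) pairTau d i (fun _ => c))
      = pairLim P g p q (c 0) (c 1) (c 2) (c 3) := by
  refine Finset.sum_congr rfl fun m _ => ?_
  simp only [formVal_pair]
  rw [sum_pairVal_const]
  have : (m : ℝ) + 1 ≠ 0 := by positivity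
  field_simp

/-- Pair forms at the variable nodes. -/
def vPair (g : ℕ → ℝ) (p q : ℝ) (α β γ χ : CFam) : VFam := fun T G w a => ind (w a.1) *
  pairVal g p q (T.dv a.1) a.2 (fun j => α T G w (G ⟨a.1, j⟩)) (fun j => β T G w (G ⟨a.1, j⟩))
    (fun j => γ T G w (G ⟨a.1, j⟩)) (fun j => χ T G w (G ⟨a.1, j⟩))

/-- Pair forms at the check nodes. -/
def cPair (g : ℕ → ℝ) (p q : ℝ) (α β γ χ : VFam) : CFam := fun T G w b =>
  pairVal g p q (T.dc b.1) b.2 (fun j => α T G w (G.symm ⟨b.1, j⟩))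
    (fun j => β T G w (G.symm ⟨b.1, j⟩)) (fun j => γ T G w (G.symm ⟨b.1, j⟩))
    (fun j => χ T G w (G.symm ⟨b.1, j⟩))

section Limits

variable {lam rho : ℝ[X]} {D : ℕ} {T : ℕ → Degrees}

/-- The average of `φ` over the edges tends to `c`. -/
def Lim (ε : ℝ) (T : ℕ → Degrees) (φ : VFam) (c : ℝ) : Prop :=
  Tendsto (fun k => avg ε φ (T k)) atTop (𝓝 c)

lemma lim_vPair (hε : ε ∈ Set.Icc (0 : ℝ) 1) (hT : GoodSeq lam rho D T) (g : ℕ → ℝ) (p q : ℝ)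
    {α β γ χ : CFam} {a b c x : ℝ} (hα : IsC α) (hβ : IsC β) (hγ : IsC γ) (hχ : IsC χ)
    (la : Lim ε T (onEdge α) a) (lb : Lim ε T (onEdge β) b) (lc : Lim ε T (onEdge γ) c)
    (lx : Lim ε T (onEdge χ) x) :
    Lim ε T (vPair g p q α β γ χ) (ε * pairLim lam g p q a b c x) := by
  have h := tendsto_avg_vForm hε hT (ι := Fin 4) (pairPsi g p q) pairTau
    (χ := fun θ => ![α, β, γ, χ] θ) (c := ![a, b, c, x])
    (fun θ => by fin_cases θ <;> assumption) (fun θ => by fin_cases θ <;> assumption)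
  rw [degAvg_pair] at h
  have e : vForm (pairPsi g p q) pairTau (fun θ => ![α, β, γ, χ] θ) = vPair g p q α β γ χ := by
    funext T G w e
    unfold vForm vPair
    rw [formVal_pair]
    rfl
  rw [e] at h
  exact h

lemma lim_cPair (hε : ε ∈ Set.Icc (0 : ℝ) 1) (hT : GoodSeq lam rho D T) (g : ℕ → ℝ) (p q : ℝ)
    {α β γ χ : VFam} {a b c x : ℝ} (hα : IsV α) (hβ : IsV β) (hγ : IsV γ) (hχ : IsV χ)
    (la : Lim ε T α a) (lb : Lim ε T β b) (lc : Lim ε T γ c) (lx : Lim ε T χ x) :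
    Lim ε T (onEdge (cPair g p q α β γ χ)) (pairLim rho g p q a b c x) := by
  have h := tendsto_avg_cForm hε hT (ι := Fin 4) (pairPsi g p q) pairTau
    (φ := fun θ => ![α, β, γ, χ] θ) (c := ![a, b, c, x])
    (fun θ => by fin_cases θ <;> assumption) (fun θ => by fin_cases θ <;> assumption)
  rw [degAvg_pair] at h
  have e : cForm (pairPsi g p q) pairTau (fun θ => ![α, β, γ, χ] θ) = cPair g p q α β γ χ := by
    funext T G w e
    unfold cForm cPair
    rw [formVal_pair]
    rfl
  rw [e] at h
  exact h

lemma Lim.const (hT : GoodSeq lam rho D T) (c : ℝ) : Lim ε T (constV c) c := by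
  refine tendsto_const_nhds.congr' ?_
  filter_upwards [hT.adm] with k hk
  exact (avg_const c hk.pos).symm

lemma Lim.add {φ ψ : VFam} {a b : ℝ} (h : Lim ε T φ a) (h' : Lim ε T ψ b) :
    Lim ε T (φ + ψ) (a + b) :=
  (Tendsto.add h h').congr fun k => (avg_add φ ψ (T k)).symm

lemma Lim.const_mul {φ : VFam} {a : ℝ} (c : ℝ) (h : Lim ε T φ a) :
    Lim ε T (constV c * φ) (c * a) :=
  (Tendsto.const_mul c h).congr fun k => (avg_const_mul c φ (T k)).symm

lemma Lim.neg {φ : VFam} {a : ℝ} (h : Lim ε T φ a) : Lim ε T (-φ) (-a) := by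
  have := h.const_mul (-1)
  rw [neg_one_mul] at this
  convert this using 1
  funext T G w e
  simp [constV]

lemma Lim.sub {φ ψ : VFam} {a b : ℝ} (h : Lim ε T φ a) (h' : Lim ε T ψ b) :
    Lim ε T (φ - ψ) (a - b) := by
  rw [sub_eq_add_neg, sub_eq_add_neg]
  exact h.add h'.neg

lemma Lim.sum {ι : Type*} (s : Finset ι) {φ : ι → VFam} {a : ι → ℝ}
    (h : ∀ i ∈ s, Lim ε T (φ i) (a i)) (hT : GoodSeq lam rho D T) :
    Lim ε T (∑ i ∈ s, φ i) (∑ i ∈ s, a i) := by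
  classical
  induction s using Finset.induction_on with
  | empty =>
    rw [Finset.sum_empty, Finset.sum_empty]
    exact Lim.const hT 0
  | insert i s hi ih =>
    rw [Finset.sum_insert hi, Finset.sum_insert hi]
    exact (h i (Finset.mem_insert_self _ _)).add (ih fun j hj => h j (Finset.mem_insert_of_mem hj))

end Limits

lemma isV_sub {φ ψ : VFam} (h : IsV φ) (h' : IsV ψ) : IsV (φ - ψ) := by
  have : φ - ψ = φ + constV (-1) * ψ := by funext T G w a; simp [constV]; ring
  rw [this]
  exact h.add ((isV_const _).mul h')

lemma isC_sub {φ ψ : CFam} (h : IsC φ) (h' : IsC ψ) : IsC (φ - ψ) := by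
  have : φ - ψ = φ + constC (-1) * ψ := by funext T G w a; simp [constC]; ring
  rw [this]
  exact h.add ((isC_const _).mul h')

/-! ### First and second moments of messages and responses -/

section Moments

variable (lam rho : ℝ[X]) (ε)

/-- Derivative of the variable node operation. -/
def aa (t : ℕ) : ℝ := ε * (derivative lam).eval (deY lam rho ε t)

/-- Derivative of the check node operation. -/
def rr (t : ℕ) : ℝ := (derivative rho).eval (1 - deX lam rho ε t)

/-- One at `0`, zero elsewhere. -/
def unit0 (n : ℕ) : ℝ := if n = 0 then 1 else 0

/-- The average response `⟨J⟩`. -/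
def jj (l : ℕ) : ℕ → ℝ
  | 0 => 0
  | n + 1 => rr ε lam rho (l - n - 1) * (aa ε lam rho (l - n) * (unit0 n + jj l n))

/-- The average response `⟨I⟩`. -/
def ii (l n : ℕ) : ℝ := aa ε lam rho (l - n) * (unit0 n + jj ε lam rho l n)

/-- The average `⟨η J⟩`. -/
def hh (l : ℕ) : ℕ → ℕ → ℝ
  | 0, _ => 0
  | n + 1, 0 => jj ε lam rho l (n + 1)
  | n + 1, t + 1 => jj ε lam rho l (n + 1) - rr ε lam rho (min t (l - n - 1)) *
      (ii ε lam rho l n - aa ε lam rho (max t (l - n)) *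
        (unit0 n * deY lam rho ε t + hh l n t))

/-- The average `⟨μ I⟩`. -/
def gg (l n t : ℕ) : ℝ := aa ε lam rho (max t (l - n)) *
  (unit0 n * deY lam rho ε t + hh ε lam rho l n t)

end Moments

lemma jj_succ (lam rho : ℝ[X]) (l n : ℕ) :
    jj ε lam rho l (n + 1) = rr ε lam rho (l - n - 1) * ii ε lam rho l n := rfl

lemma hh_succ_succ (lam rho : ℝ[X]) (l n t : ℕ) : hh ε lam rho l (n + 1) (t + 1)
    = jj ε lam rho l (n + 1) - rr ε lam rho (min t (l - n - 1)) *
      (ii ε lam rho l n - gg ε lam rho l n t) := rfl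

lemma vStep_eq (χ : CFam) :
    vStep χ = vPair (fun _ => 1) 1 0 (constC 1) (constC 1) (constC 1) χ := by
  funext T G w a; simp [vStep, vPair, pairVal, constC]

lemma cStep_eq (φ : VFam) : cStep φ
    = constC 1 - cPair (fun _ => 1) 1 0 (constV 1) (constV 1) (constV 1) (constV 1 - φ) := by
  funext T G w a; simp [cStep, cPair, pairVal, constC, constV]

lemma vDeriv_eq (κ χ : CFam) :
    vDeriv κ χ = vPair (fun _ => 1) 0 1 (constC 1) (constC 1) κ χ := by
  funext T G w a; simp [vDeriv, vPair, pairVal, constC]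

lemma cDeriv_eq (κ φ : VFam) :
    cDeriv κ φ = cPair (fun _ => 1) 0 1 (constV 1) (constV 1) κ (constV 1 - φ) := by
  funext T G w a; simp [cDeriv, cPair, pairVal, constV]

lemma ind_mul_self (b : Bool) : ind b * ind b = ind b := by
  cases b <;> simp [ind]

/-- The factor `etaR t` at the marked socket stays with the response; at every other socket two
messages multiply to the later one. -/
lemma muR_mul_Ir (l n t : ℕ) : muR t * Ir l n
    = vPair (fun _ => 1) 0 1 (constC 1) (constC 1) (etaR t * Jh l n) (etaR (max t (l - n))) := by
  funext T G w a
  have h : ∀ s ∈ Finset.univ.erase a.2, (∏ j ∈ Finset.univ.erase a.2, etaR t T G w (G ⟨a.1, j⟩))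
      * (Jh l n T G w (G ⟨a.1, s⟩) *
        ∏ j ∈ (Finset.univ.erase a.2).erase s, etaR (l - n) T G w (G ⟨a.1, j⟩))
      = (etaR t T G w (G ⟨a.1, s⟩) * Jh l n T G w (G ⟨a.1, s⟩)) *
        ∏ j ∈ (Finset.univ.erase a.2).erase s, etaR (max t (l - n)) T G w (G ⟨a.1, j⟩) := by
    intro s hs
    rw [← Finset.mul_prod_erase _ _ hs]
    simp only [← etaR_mul_etaR, Finset.prod_mul_distrib]
    ring
  simp only [muR, Ir, vStep, vDeriv, vPair, pairVal, constC, Pi.mul_apply, one_mul, zero_mul,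
    zero_add]
  rw [mul_mul_mul_comm, ind_mul_self, Finset.mul_sum, Finset.sum_congr rfl h]

/-- From `η = 1 - ∏ (1 - μ)`. In the subtracted product the complementary messages multiply to the
earlier one, hence `min`. -/
lemma etaR_mul_Jr (l n t : ℕ) : etaR (t + 1) * Jr l (n + 1)
    = Jr l (n + 1) - cPair (fun _ => 1) 0 1 (constV 1) (constV 1) ((constV 1 - muR t) * Ir l n)
      (constV 1 - muR (min t (l - n - 1))) := by
  funext T G w b
  have h : ∀ s ∈ Finset.univ.erase b.2,
      (∏ j ∈ Finset.univ.erase b.2, (1 - muR t T G w (G.symm ⟨b.1, j⟩)))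
      * (Ir l n T G w (G.symm ⟨b.1, s⟩) *
        ∏ j ∈ (Finset.univ.erase b.2).erase s, (1 - muR (l - n - 1) T G w (G.symm ⟨b.1, j⟩)))
      = ((1 - muR t T G w (G.symm ⟨b.1, s⟩)) * Ir l n T G w (G.symm ⟨b.1, s⟩)) *
        ∏ j ∈ (Finset.univ.erase b.2).erase s,
          (1 - muR (min t (l - n - 1)) T G w (G.symm ⟨b.1, j⟩)) := by
    intro s hs
    rw [← Finset.mul_prod_erase _ _ hs]
    simp only [← one_sub_muR_mul, Finset.prod_mul_distrib]
    ring
  rw [Jr_succ]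
  change cStep (muR t) T G w b * cDeriv _ _ T G w b = cDeriv _ _ T G w b - _
  simp only [cStep, cDeriv, cPair, pairVal, constV, Pi.mul_apply, Pi.sub_apply, one_mul, zero_mul,
    zero_add]
  rw [sub_mul, one_mul, Finset.mul_sum, Finset.sum_congr rfl h]

section MomentLimits

variable {lam rho : ℝ[X]} {D : ℕ} {T : ℕ → Degrees}

lemma lim_etaR_muR (hε : ε ∈ Set.Icc (0 : ℝ) 1) (hT : GoodSeq lam rho D T) (t : ℕ) :
    Lim ε T (onEdge (etaR t)) (deY lam rho ε t) ∧ Lim ε T (muR t) (deX lam rho ε t) := by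
  have step : ∀ t, Lim ε T (onEdge (etaR t)) (deY lam rho ε t) →
      Lim ε T (muR t) (deX lam rho ε t) := by
    intro t h
    have := lim_vPair hε hT (fun _ => 1) 1 0 (isC_const 1) (isC_const 1) (isC_const 1) (isC_etaR t)
      (Lim.const hT 1) (Lim.const hT 1) (Lim.const hT 1) h
    rw [pairLim_one, ← vStep_eq] at this
    simpa [deX, muR] using this
  have key : Lim ε T (onEdge (etaR t)) (deY lam rho ε t) := by
    induction t with
    | zero => exact Lim.const hT 1
    | succ t ih =>
      have := lim_cPair hε hT (fun _ => 1) 1 0 (isV_const 1) (isV_const 1) (isV_const 1)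
        (isV_sub (isV_const 1) (isV_muR t))
        (Lim.const hT 1) (Lim.const hT 1) (Lim.const hT 1) ((Lim.const hT 1).sub (step t ih))
      rw [pairLim_one] at this
      have h2 := (Lim.const hT 1).sub this
      have e : onEdge (etaR (t + 1)) = constV 1 - onEdge (cPair (fun _ => 1) 1 0 (constV 1)
          (constV 1) (constV 1) (constV 1 - muR t)) := by
        rw [etaR, cStep_eq]; rfl
      rw [e]
      simpa [deY, deX] using h2
  exact ⟨key, step t key⟩

lemma lim_Jh (hT : GoodSeq lam rho D T) {l n : ℕ} {c : ℝ} (h : Lim ε T (onEdge (Jr l n)) c) :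
    Lim ε T (onEdge (Jh l n)) (unit0 n + c) := (Lim.const hT (unit0 n)).add h

lemma lim_Jr (hε : ε ∈ Set.Icc (0 : ℝ) 1) (hT : GoodSeq lam rho D T) (l n : ℕ) :
    Lim ε T (onEdge (Jr l n)) (jj ε lam rho l n) ∧ Lim ε T (Ir l n) (ii ε lam rho l n) := by
  have step : ∀ n, Lim ε T (onEdge (Jr l n)) (jj ε lam rho l n) →
      Lim ε T (Ir l n) (ii ε lam rho l n) := by
    intro n h
    have := lim_vPair hε hT (fun _ => 1) 0 1 (isC_const 1) (isC_const 1) (isC_Jh l n)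
      (isC_etaR (l - n)) (Lim.const hT 1) (Lim.const hT 1) (lim_Jh hT h)
      (lim_etaR_muR hε hT (l - n)).1
    rw [pairLim_one, ← vDeriv_eq] at this
    refine this.trans (le_of_eq ?_)
    congr 1
    unfold ii aa
    ring
  have key : Lim ε T (onEdge (Jr l n)) (jj ε lam rho l n) := by
    induction n with
    | zero => exact Lim.const hT 0
    | succ n ih =>
      have := lim_cPair hε hT (fun _ => 1) 0 1 (isV_const 1) (isV_const 1) (isV_Ir l n)
        (isV_sub (isV_const 1) (isV_muR (l - n - 1)))
        (Lim.const hT 1) (Lim.const hT 1) (step n ih)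
        ((Lim.const hT 1).sub (lim_etaR_muR hε hT (l - n - 1)).2)
      rw [pairLim_one, ← cDeriv_eq, ← Jr_succ] at this
      refine this.trans (le_of_eq ?_)
      congr 1
      rw [jj_succ, rr]
      ring
  exact ⟨key, step n key⟩

lemma Jh_eq (l n : ℕ) : Jh l n = constC (unit0 n) + Jr l n := rfl

/-- The two product formulas express the correlation of a message with a response `n + 1` steps back
by the one at `n` steps and the preceding time. The recursion stops at `t = 0`, where the message is
constant, or at `n = 0`, where `Jr` vanishes. -/
lemma lim_etaR_mul_Jr (hε : ε ∈ Set.Icc (0 : ℝ) 1) (hT : GoodSeq lam rho D T) (l n t : ℕ) :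
    Lim ε T (onEdge (etaR t * Jr l n)) (hh ε lam rho l n t) ∧
      Lim ε T (onEdge (etaR t * Jh l n)) (unit0 n * deY lam rho ε t + hh ε lam rho l n t) ∧
      Lim ε T (muR t * Ir l n) (gg ε lam rho l n t) := by
  have step0 : ∀ n t, Lim ε T (onEdge (etaR t * Jr l n)) (hh ε lam rho l n t) →
      Lim ε T (onEdge (etaR t * Jh l n)) (unit0 n * deY lam rho ε t + hh ε lam rho l n t) := by
    intro n t h
    have h2 := ((lim_etaR_muR hε hT t).1.const_mul (unit0 n)).add h
    have e : onEdge (etaR t * Jh l n) = constV (unit0 n) * onEdge (etaR t)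
        + onEdge (etaR t * Jr l n) := by
      funext T G w a
      simp only [onEdge, Jh_eq, Pi.mul_apply, Pi.add_apply, constC, constV]
      ring
    rw [e]
    exact h2
  have step : ∀ n t, Lim ε T (onEdge (etaR t * Jr l n)) (hh ε lam rho l n t) →
      Lim ε T (muR t * Ir l n) (gg ε lam rho l n t) := by
    intro n t h
    have := lim_vPair hε hT (fun _ => 1) 0 1 (isC_const 1) (isC_const 1)
      ((isC_etaR t).mul (isC_Jh l n)) (isC_etaR (max t (l - n))) (Lim.const hT 1)
      (Lim.const hT 1) (step0 n t h) (lim_etaR_muR hε hT (max t (l - n))).1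
    rw [pairLim_one, ← muR_mul_Ir] at this
    refine this.trans (le_of_eq ?_)
    congr 1
    unfold gg aa
    ring
  have key : Lim ε T (onEdge (etaR t * Jr l n)) (hh ε lam rho l n t) := by
    induction n generalizing t with
    | zero =>
      have e : onEdge (etaR t * Jr l 0) = constV 0 := by
        funext T G w a; simp [onEdge, Jr, constC, constV]
      rw [e, hh]
      exact Lim.const hT 0
    | succ n ih =>
      rcases t with _ | t
      · have e : onEdge (etaR 0 * Jr l (n + 1)) = onEdge (Jr l (n + 1)) := by
          funext T G w a; simp [onEdge, etaR, constC]
        rw [e, hh]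
        exact (lim_Jr hε hT l (n + 1)).1
      · have hγ : Lim ε T ((constV 1 - muR t) * Ir l n) (ii ε lam rho l n - gg ε lam rho l n t) := by
          have := (lim_Jr hε hT l n).2.sub (step n t (ih t))
          convert this using 1
          funext T G w a
          simp only [Pi.mul_apply, Pi.sub_apply, constV]
          ring
        have := lim_cPair hε hT (fun _ => 1) 0 1 (isV_const 1) (isV_const 1)
          ((isV_sub (isV_const 1) (isV_muR t)).mul (isV_Ir l n))
          (isV_sub (isV_const 1) (isV_muR (min t (l - n - 1))))
          (Lim.const hT 1) (Lim.const hT 1) hγ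
          ((Lim.const hT 1).sub (lim_etaR_muR hε hT (min t (l - n - 1))).2)
        rw [pairLim_one] at this
        have h2 := (lim_Jr hε hT l (n + 1)).1.sub this
        have e : onEdge (etaR (t + 1) * Jr l (n + 1)) = onEdge (Jr l (n + 1))
            - onEdge (cPair (fun _ => 1) 0 1 (constV 1) (constV 1) ((constV 1 - muR t) * Ir l n)
              (constV 1 - muR (min t (l - n - 1)))) := by
          rw [etaR_mul_Jr]; rfl
        rw [e]
        refine h2.trans (le_of_eq ?_)
        congr 1
        rw [hh_succ_succ, rr]
        ring
  exact ⟨key, step0 n t key, step n t key⟩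

end MomentLimits

end

end LDPC

/-! ### The recursion for the limiting covariances -/

namespace LDPC

noncomputable section

open Degrees

variable {ε : ℝ}

/-! ### Linearization of the node operations -/

/-- Coefficients of the expansion of `∑ i, ∏ j ≠ i, ξ j` around a constant. -/
def kap (c : ℝ) (d : ℕ) (k : Fin d) (ξ : Fin d → ℝ) : ℝ :=
  ∑ i ∈ Finset.univ.erase k, ∏ j ∈ (Finset.univ.erase k).erase i, if j < k then ξ j else c

/-- Telescope the product for each outgoing socket `i` and collect the coefficients of `ξ k - c`.
Every outgoing socket `i ≠ k` contributes, and no coefficient contains `ξ k`. -/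
lemma sum_prod_erase_sub (c : ℝ) (d : ℕ) (ξ : Fin d → ℝ) :
    ∑ i, ∏ j ∈ Finset.univ.erase i, ξ j - ∑ _i : Fin d, c ^ (d - 1)
      = ∑ k, kap c d k ξ * (ξ k - c) := by
  have hc : ∀ i : Fin d, c ^ (d - 1) = ∏ _j ∈ Finset.univ.erase i, c := by
    intro i
    rw [Finset.prod_const, Finset.card_erase_of_mem (Finset.mem_univ i), Finset.card_univ,
      Fintype.card_fin]
  rw [← Finset.sum_sub_distrib]
  have h : ∀ i ∈ (Finset.univ : Finset (Fin d)), ∏ j ∈ Finset.univ.erase i, ξ j - c ^ (d - 1)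
      = ∑ k ∈ Finset.univ.erase i, (∏ j ∈ (Finset.univ.erase i).erase k,
        if j < k then ξ j else c) * (ξ k - c) := by
    intro i _
    rw [hc i]
    exact prod_sub_prod_telescope (Finset.univ.erase i) ξ (fun _ => c)
  rw [Finset.sum_congr rfl h]
  unfold kap
  simp only [Finset.sum_mul]
  rw [Finset.sum_comm' (s := Finset.univ) (t := fun i => Finset.univ.erase i)
    (t' := Finset.univ) (s' := fun i => Finset.univ.erase i) (fun x y => by simp [eq_comm])]
  refine Finset.sum_congr rfl fun k _ => Finset.sum_congr rfl fun i _ => ?_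
  rw [Finset.erase_right_comm]

lemma continuous_kap (c : ℝ) (d : ℕ) (k : Fin d) : Continuous (kap c d k) := by
  unfold kap
  refine continuous_finsetSum _ fun i _ => continuous_finsetProd _ fun j _ => ?_
  split_ifs <;> fun_prop

lemma kap_congr (c : ℝ) (d : ℕ) (k : Fin d) (ξ ξ' : Fin d → ℝ) (h : ∀ j, j ≠ k → ξ j = ξ' j) :
    kap c d k ξ = kap c d k ξ' := by
  unfold kap
  refine Finset.sum_congr rfl fun i _ => Finset.prod_congr rfl fun j hj => ?_
  rw [h j (Finset.ne_of_mem_erase (Finset.mem_of_mem_erase hj))]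

/-- Weights of the form `kap`. -/
def kapPsi (d : ℕ) (k i : Fin d) : ℝ := if i = k then 0 else 1

/-- Types of the form `kap`. -/
def kapTau (d : ℕ) (k i j : Fin d) : Fin 3 := if j = k ∨ j = i then 0 else if j < k then 1 else 2

lemma formVal_kap (c : ℝ) (d : ℕ) (k : Fin d) (ξ : Fin d → Fin 3 → ℝ) (h0 : ∀ j, ξ j 0 = 1)
    (h2 : ∀ j, ξ j 2 = c) : formVal kapPsi kapTau d k ξ = kap c d k (fun j => ξ j 1) := by
  unfold formVal kap
  rw [← Finset.add_sum_erase _ _ (Finset.mem_univ k)]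
  simp only [kapPsi, if_true, zero_mul, zero_add]
  refine Finset.sum_congr rfl fun i hi => ?_
  rw [if_neg (Finset.ne_of_mem_erase hi), one_mul, ← Finset.mul_prod_erase _ _ (Finset.mem_univ k),
    ← Finset.mul_prod_erase _ _ hi]
  have a1 : ξ k (kapTau d k i k) = 1 := by simp [kapTau, h0]
  have a2 : ξ i (kapTau d k i i) = 1 := by simp [kapTau, h0]
  rw [a1, a2, one_mul, one_mul]
  refine Finset.prod_congr rfl fun j hj => ?_
  have h1 := Finset.ne_of_mem_erase hj
  have h3 := Finset.ne_of_mem_erase (Finset.mem_of_mem_erase hj)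
  by_cases hjk : j < k <;> simp [kapTau, h1, h3, hjk, h2]

/-- At constant arguments `kap` is `(d - 1) c^(d-2)`, the same as a pair form with one edge marked;
this is how the derivative of the degree polynomial enters. -/
lemma degAvg_kap (P : ℝ[X]) (c : ℝ) :
    degAvg P (fun d => ∑ i, formVal kapPsi kapTau d i (fun _ => ![1, c, c]))
      = (derivative P).eval c := by
  have h := pairLim_one P 0 1 1 1 1 c
  simp only [zero_mul, zero_add, one_mul] at h
  rw [← h]
  refine Eq.trans ?_ (degAvg_pair P (fun _ => 1) 0 1 ![1, 1, 1, c])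
  unfold degAvg
  refine Finset.sum_congr rfl fun m _ => ?_
  congr 2
  refine Finset.sum_congr rfl fun i _ => ?_
  rw [formVal_pair, formVal_kap c _ _ _ (fun _ => rfl) (fun _ => rfl)]
  simp [kap, pairVal]

/-- The linearization coefficients at the variable nodes. -/
def kapV (c : ℝ) (χ : CFam) : VFam := fun T G w a =>
  ind (w a.1) * kap c (T.dv a.1) a.2 (fun j => χ T G w (G ⟨a.1, j⟩))

/-- The linearization coefficients at the check nodes. -/
def kapC (c : ℝ) (φ : VFam) : CFam := fun T G w b =>
  kap c (T.dc b.1) b.2 (fun j => φ T G w (G.symm ⟨b.1, j⟩))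

lemma isV_kapV (c : ℝ) {χ : CFam} (h : IsC χ) : IsV (kapV c χ) :=
  IsV.node (ι := Unit) (fun _ => h) (fun d i b ξ => ind b * kap c d i (fun j => ξ j ()))
    (fun d i _ => continuous_const.mul ((continuous_kap c d i).comp (by fun_prop)))
    (fun d i b ξ ξ' h => by rw [kap_congr c d i _ _ fun j hj => congrFun (h j hj) ()])

lemma isC_kapC (c : ℝ) {φ : VFam} (h : IsV φ) : IsC (kapC c φ) :=
  IsC.node (ι := Unit) (fun _ => h) (fun d i _ ξ => kap c d i (fun j => ξ j ()))
    (fun d i _ => (continuous_kap c d i).comp (by fun_prop))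
    (fun d i b ξ ξ' h => by rw [kap_congr c d i _ _ fun j hj => congrFun (h j hj) ()])

section

variable {lam rho : ℝ[X]} {D : ℕ} {T : ℕ → Degrees}

lemma lim_kapV (hε : ε ∈ Set.Icc (0 : ℝ) 1) (hT : GoodSeq lam rho D T) {χ : CFam} {c : ℝ}
    (h : IsC χ) (hc : Lim ε T (onEdge χ) c) :
    Lim ε T (kapV c χ) (ε * (derivative lam).eval c) := by
  have h := tendsto_avg_vForm hε hT (ι := Fin 3) kapPsi kapTau
    (χ := fun θ => ![constC 1, χ, constC c] θ) (c := ![1, c, c])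
    (fun θ => by fin_cases θ <;> first | exact h | exact isC_const _)
    (fun θ => by fin_cases θ <;> first | exact hc | exact Lim.const hT _)
  rw [degAvg_kap] at h
  have e : vForm kapPsi kapTau (fun θ => ![constC 1, χ, constC c] θ) = kapV c χ := by
    funext T G w e
    unfold vForm kapV
    rw [formVal_kap c _ _ _ (fun _ => rfl) (fun _ => rfl)]
    rfl
  rw [e] at h
  exact h

lemma lim_kapC (hε : ε ∈ Set.Icc (0 : ℝ) 1) (hT : GoodSeq lam rho D T) {φ : VFam} {c : ℝ}
    (h : IsV φ) (hc : Lim ε T φ c) :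
    Lim ε T (onEdge (kapC c φ)) ((derivative rho).eval c) := by
  have h := tendsto_avg_cForm hε hT (ι := Fin 3) kapPsi kapTau
    (φ := fun θ => ![constV 1, φ, constV c] θ) (c := ![1, c, c])
    (fun θ => by fin_cases θ <;> first | exact h | exact isV_const _)
    (fun θ => by fin_cases θ <;> first | exact hc | exact Lim.const hT _)
  rw [degAvg_kap] at h
  have e : cForm kapPsi kapTau (fun θ => ![constV 1, φ, constV c] θ) = kapC c φ := by
    funext T G w e
    unfold cForm kapC
    rw [formVal_kap c _ _ _ (fun _ => rfl) (fun _ => rfl)]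
    rfl
  rw [e] at h
  exact h

end

/-- A weight that is constant on each node passes through the linearization. Besides the weight `1`,
the identity is used with the node response as weight, which undoes the linearization in the
correlation term. -/
lemma sum_vStep_mul (c : ℝ) (χ : CFam) {T : Degrees} (G : T.Graph) (w : T.Channel)
    (Θ : Fin T.n → ℝ) : ∑ a : T.VSocket, vStep χ T G w a * Θ a.1
      = ∑ a : T.VSocket, ind (w a.1) * c ^ (T.dv a.1 - 1) * Θ a.1
        + ∑ a : T.VSocket, kapV c χ T G w a * (χ T G w (G a) - c) * Θ a.1 := by
  rw [Fintype.sum_sigma, Fintype.sum_sigma, Fintype.sum_sigma, ← Finset.sum_add_distrib]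
  refine Finset.sum_congr rfl fun v _ => ?_
  have h := sum_prod_erase_sub c (T.dv v) (fun j => χ T G w (G ⟨v, j⟩))
  have h' := congrArg (fun z => ind (w v) * Θ v * z) h
  simp only [mul_sub, Finset.mul_sum] at h'
  rw [← sub_eq_iff_eq_add']
  refine Eq.trans ?_ (h'.trans ?_)
  · congr 1 <;> refine Finset.sum_congr rfl fun i _ => ?_
    · unfold vStep; ring
    · ring
  · refine Finset.sum_congr rfl fun i _ => ?_
    unfold kapV; ring

lemma sum_cStep_mul (c : ℝ) (φ : VFam) {T : Degrees} (G : T.Graph) (w : T.Channel)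
    (Θ : Fin T.m → ℝ) :
    ∑ b : T.CSocket, (∏ j ∈ Finset.univ.erase b.2, φ T G w (G.symm ⟨b.1, j⟩)) * Θ b.1
      = ∑ b : T.CSocket, c ^ (T.dc b.1 - 1) * Θ b.1
        + ∑ b : T.CSocket, kapC c φ T G w b * (φ T G w (G.symm b) - c) * Θ b.1 := by
  rw [Fintype.sum_sigma, Fintype.sum_sigma, Fintype.sum_sigma, ← Finset.sum_add_distrib]
  refine Finset.sum_congr rfl fun v _ => ?_
  have h := sum_prod_erase_sub c (T.dc v) (fun j => φ T G w (G.symm ⟨v, j⟩))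
  have h' := congrArg (fun z => Θ v * z) h
  simp only [mul_sub, Finset.mul_sum] at h'
  rw [← sub_eq_iff_eq_add']
  refine Eq.trans ?_ (h'.trans ?_)
  · congr 1 <;> exact Finset.sum_congr rfl fun i _ => mul_comm _ _
  · refine Finset.sum_congr rfl fun i _ => ?_
    unfold kapC; ring

/-! ### Covariances of linearized sums -/

section

variable {lam rho : ℝ[X]} {D : ℕ} {T : ℕ → Degrees}

/-- `negl_glue` read backwards: `avg(φp) · ecov(χ, q)` is the single edge average of `φ (χ - c) p
q`. In this form the terms of the response can be summed before averaging. -/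
lemma tendsto_ecov_mul (hε : ε ∈ Set.Icc (0 : ℝ) 1) (hT : GoodSeq lam rho D T) {φ p : VFam}
    {χ q : CFam} {c : ℝ} (hφ : IsV φ) (hp : IsV p) (hχ : IsC χ) (hq : IsC q)
    (hc : Lim ε T (onEdge χ) c) :
    Tendsto (fun k => ecov ε φ p (T k) * ecov ε (onEdge χ) (onEdge q) (T k)
      - (avg ε (φ * (onEdge χ - constV c) * (p * onEdge q)) (T k)
        - avg ε φ (T k) * (avg ε p (T k) * ecov ε (onEdge χ) (onEdge q) (T k)))) atTop (𝓝 0) := by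
  have g1 := (negl_glue hε (hφ.mul hp) (hχ.mul hq)).tendsto hT
  have g2 := ((negl_glue hε (hφ.mul hp) hq).tendsto hT).const_mul c
  have b : Bddd (fun T => avg ε (φ * p) T * avg ε (onEdge q) T) := by
    intro D
    obtain ⟨C, hC⟩ := abs_avg_le hε (hφ.mul hp).2 D
    obtain ⟨C', hC'⟩ := abs_avg_le hε hq.isE.2 D
    refine ⟨C * C', fun T hT => ?_⟩
    rw [abs_mul]
    exact mul_le_mul (hC T hT) (hC' T hT) (abs_nonneg _) ((abs_nonneg _).trans (hC T hT))
  have g3 := b.mul_tendsto (Y := fun T => avg ε (onEdge χ) T - c) hT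
    (by simpa using Tendsto.sub_const hc c)
  have := (g2.sub g1).sub g3
  rw [mul_zero, sub_zero, sub_zero] at this
  refine this.congr fun k => ?_
  have e : φ * (onEdge χ - constV c) * (p * onEdge q)
      = (φ * p) * onEdge (χ * q) + constV (-c) * ((φ * p) * onEdge q) := by
    funext T G w a
    simp only [Pi.mul_apply, Pi.sub_apply, Pi.add_apply, constV, onEdge]
    ring
  rw [e, avg_add, avg_const_mul]
  unfold ecov
  have e2 : onEdge χ * onEdge q = onEdge (χ * q) := rfl
  rw [e2]
  ring

lemma tendsto_ecov_mul' (hε : ε ∈ Set.Icc (0 : ℝ) 1) (hT : GoodSeq lam rho D T) {φ p : VFam}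
    {χ q : CFam} {c : ℝ} (hφ : IsV φ) (hp : IsV p) (hχ : IsC χ) (hq : IsC q)
    (hc : Lim ε T φ c) :
    Tendsto (fun k => ecov ε φ p (T k) * ecov ε (onEdge χ) (onEdge q) (T k)
      - (avg ε (onEdge χ * (φ - constV c) * (p * onEdge q)) (T k)
        - avg ε (onEdge χ) (T k) * (ecov ε φ p (T k) * avg ε (onEdge q) (T k)))) atTop (𝓝 0) := by
  have g1 := (negl_glue hε (hφ.mul hp) (hχ.mul hq)).tendsto hT
  have g2 := ((negl_glue hε hp (hχ.mul hq)).tendsto hT).const_mul c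
  have b : Bddd (fun T => avg ε p T * avg ε (onEdge (χ * q)) T) := by
    intro D
    obtain ⟨C, hC⟩ := abs_avg_le hε hp.2 D
    obtain ⟨C', hC'⟩ := abs_avg_le hε (hχ.mul hq).isE.2 D
    refine ⟨C * C', fun T hT => ?_⟩
    rw [abs_mul]
    exact mul_le_mul (hC T hT) (hC' T hT) (abs_nonneg _) ((abs_nonneg _).trans (hC T hT))
  have g3 := b.mul_tendsto (Y := fun T => avg ε φ T - c) hT
    (by simpa using Tendsto.sub_const hc c)
  have := (g2.sub g1).sub g3
  rw [mul_zero, sub_zero, sub_zero] at this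
  refine this.congr fun k => ?_
  have e : onEdge χ * (φ - constV c) * (p * onEdge q)
      = (φ * p) * onEdge (χ * q) + constV (-c) * (p * onEdge (χ * q)) := by
    funext T G w a
    simp only [Pi.mul_apply, Pi.sub_apply, Pi.add_apply, constV, onEdge]
    ring
  rw [e, avg_add, avg_const_mul]
  unfold ecov
  have e2 : onEdge χ * onEdge q = onEdge (χ * q) := rfl
  rw [e2]
  ring

lemma avg_sum {ι : Type*} (s : Finset ι) (φ : ι → VFam) (T : Degrees) :
    avg ε (∑ i ∈ s, φ i) T = ∑ i ∈ s, avg ε (φ i) T := by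
  classical
  induction s using Finset.induction_on with
  | empty =>
    rw [Finset.sum_empty, Finset.sum_empty]
    have : avg ε (0 : VFam) T = T.expect ε (fun _ _ => 0) / T.numEdges := by
      unfold avg; congr 2; funext G w; simp [tot]
    rw [this, expect_const, zero_div]
  | insert i s hi ih => rw [Finset.sum_insert hi, Finset.sum_insert hi, avg_add, ih]

/-- Linearization on the variable side. -/
lemma tendsto_cov_linear (hε : ε ∈ Set.Icc (0 : ℝ) 1) (hT : GoodSeq lam rho D T) {ι : Type}
    [Fintype ι] {φ f : VFam} {χ : CFam} {p : ι → VFam} {q : ι → CFam} {c : ℝ} (hφ : IsV φ)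
    (hχ : IsC χ) (hf : IsE f) (hp : ∀ k, IsV (p k)) (hq : ∀ k, IsC (q k))
    (hr : HasResponse f p q) (hc : Lim ε T (onEdge χ) c) :
    Tendsto (fun k => cov ε (φ * onEdge χ) f (T k) - c * cov ε φ f (T k)
      - (avg ε φ (T k) * (cov ε (onEdge χ) f (T k)
          - ∑ i, avg ε (p i) (T k) * ecov ε (onEdge χ) (onEdge (q i)) (T k))
        + avg ε (φ * (onEdge χ - constV c) * ∑ i, p i * onEdge (q i)) (T k))) atTop (𝓝 0) := by
  have h1 := (negl_cov_mul hε hφ hχ hf hp hq hr).tendsto hT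
  have h2 := tendsto_finsetSum Finset.univ fun i _ =>
    tendsto_ecov_mul hε hT hφ (hp i) hχ (hq i) hc
  have h3 := (bddd_cov hε hφ.isE hf).mul_tendsto (Y := fun T => avg ε (onEdge χ) T - c) hT
    (by simpa using Tendsto.sub_const hc c)
  have := (h1.add h2).add h3
  rw [Finset.sum_const_zero, add_zero, add_zero] at this
  refine this.congr fun k => ?_
  rw [Finset.mul_sum, avg_sum]
  simp only [Finset.sum_sub_distrib, ← Finset.mul_sum]
  ring

/-- Linearization on the check side. -/
lemma tendsto_cov_linear' (hε : ε ∈ Set.Icc (0 : ℝ) 1) (hT : GoodSeq lam rho D T) {ι : Type}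
    [Fintype ι] {φ f : VFam} {χ : CFam} {p : ι → VFam} {q : ι → CFam} {c : ℝ} (hφ : IsV φ)
    (hχ : IsC χ) (hf : IsE f) (hp : ∀ k, IsV (p k)) (hq : ∀ k, IsC (q k))
    (hr : HasResponse f p q) (hc : Lim ε T φ c) :
    Tendsto (fun k => cov ε (φ * onEdge χ) f (T k) - c * cov ε (onEdge χ) f (T k)
      - (avg ε (onEdge χ) (T k) * (cov ε φ f (T k)
          - ∑ i, ecov ε φ (p i) (T k) * avg ε (onEdge (q i)) (T k))
        + avg ε (onEdge χ * (φ - constV c) * ∑ i, p i * onEdge (q i)) (T k))) atTop (𝓝 0) := by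
  have h1 := (negl_cov_mul hε hφ hχ hf hp hq hr).tendsto hT
  have h2 := tendsto_finsetSum Finset.univ fun i _ =>
    tendsto_ecov_mul' hε hT hφ (hp i) hχ (hq i) hc
  have h3 := (bddd_cov hε hχ.isE hf).mul_tendsto (Y := fun T => avg ε φ T - c) hT
    (by simpa using Tendsto.sub_const hc c)
  have := (h1.add h2).add h3
  rw [Finset.sum_const_zero, add_zero, add_zero] at this
  refine this.congr fun k => ?_
  rw [Finset.mul_sum, avg_sum]
  simp only [Finset.sum_sub_distrib, ← Finset.mul_sum]
  ring

end

end

end LDPC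

namespace LDPC

noncomputable section

open Degrees

variable {ε : ℝ}

/-! ### Covariance with the channel -/

lemma unifBdd_Lv (l : ℕ) : UnifBdd (S := VSocket) (Lv l) := by
  intro D
  choose M hM using fun n => (isC_Jh l n).2 D
  refine ⟨∑ n ∈ Finset.range (l + 1), D * |M n|, fun T hD G w a => ?_⟩
  refine (Finset.abs_sum_le_sum_abs _ _).trans (Finset.sum_le_sum fun n _ => ?_)
  refine (Finset.abs_sum_le_sum_abs _ _).trans ?_
  have h : ∀ s ∈ (Finset.univ : Finset (Fin (T.dv a.1))),
      |muR (l - n) T G w ⟨a.1, s⟩ * Jh l n T G w (G ⟨a.1, s⟩)| ≤ |M n| := by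
    intro s _
    rw [abs_mul, ← one_mul |M n|]
    have h1 := muR_mem G w (l - n) ⟨a.1, s⟩
    refine mul_le_mul ?_ ((hM n T hD G w _).trans (le_abs_self _)) (abs_nonneg _) zero_le_one
    rw [abs_of_nonneg h1.1]
    exact h1.2
  refine (Finset.sum_le_sum h).trans ?_
  rw [Finset.sum_const, Finset.card_univ, Fintype.card_fin, nsmul_eq_mul]
  have : (T.dv a.1 : ℝ) ≤ D := by exact_mod_cast hD.1 a.1
  gcongr

lemma Lv_eq_zero (l : ℕ) {T : Degrees} (G : T.Graph) {w : T.Channel} {a : T.VSocket}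
    (h : w a.1 = false) : Lv l T G w a = 0 := by
  refine Finset.sum_eq_zero fun n _ => Finset.sum_eq_zero fun s _ => ?_
  simp [muR, vStep, h, ind]

/-- Let `f₀` be `f` with symbol `v` received, so that it does not depend on `w v`. Then `ind · dev f
- (1 - ε) · ind · (f - f₀)` equals `(ind - ε)(f₀ - E f) + ε · dev f`, and both terms have mean zero.
-/
lemma expect_ind_mul_dev (f : VFam) {T : Degrees} (v : Fin T.n) :
    T.expect ε (fun G w => ind (w v) * dev ε f T G w) = (1 - ε) * T.expect ε (fun G w =>
      ind (w v) * (tot f T G w - tot f T G (Function.update w v false))) := by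
  have h1 := expect_ind_sub_mul (ε := ε) v (fun G w => tot f T G (Function.update w v false)
    - T.expect ε (tot f T)) (fun G w b => by rw [Function.update_idem])
  have h2 : T.expect ε (fun G w => ε * dev ε f T G w) = 0 := by
    rw [expect_const_mul]
    have : T.expect ε (fun G w => dev ε f T G w) = 0 := expect_dev f T
    rw [this, mul_zero]
  rw [← expect_const_mul, ← sub_eq_zero, ← expect_sub]
  have h3 : T.expect ε (fun G w => (ind (w v) - ε) * (tot f T G (Function.update w v false)
    - T.expect ε (tot f T)) + ε * dev ε f T G w) = 0 := by rw [expect_add, h1, h2, add_zero]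
  rw [← h3]
  congr 1
  funext G w
  unfold dev
  cases hw : w v
  · have : Function.update w v false = w := by rw [← hw, Function.update_eq_self]
    rw [this]
    simp [ind]
  · simp [ind]; ring

open Classical in
lemma sum_closedAt_le {T : Degrees} {D : ℕ} (hD : DegBound D T) (G : T.Graph) (R : ℕ) :
    ∑ a : T.VSocket, (if ClosedAt R G a.1 then (1 : ℝ) else 0)
      ≤ D * ∑ x, if Closed R G x then (1 : ℝ) else 0 := by
  calc _ ≤ ∑ a : T.VSocket, ∑ x : T.VSocket,
        (if a.1 = x.1 then (1 : ℝ) else 0) * (if Closed R G x then (1 : ℝ) else 0) := by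
        refine Finset.sum_le_sum fun a _ => ?_
        have h0 : ∀ x ∈ (Finset.univ : Finset T.VSocket), 0 ≤ (if a.1 = x.1 then (1 : ℝ) else 0)
            * (if Closed R G x then (1 : ℝ) else 0) := fun x _ => by split_ifs <;> norm_num
        split_ifs with h
        · obtain ⟨x, hx, hc⟩ := h
          refine le_trans ?_ (Finset.single_le_sum h0 (Finset.mem_univ x))
          rw [if_pos hx.symm, if_pos hc, one_mul]
        · exact Finset.sum_nonneg h0
    _ = ∑ x : T.VSocket, ((Finset.univ.filter fun a : T.VSocket => a.1 = x.1).card : ℝ)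
          * (if Closed R G x then (1 : ℝ) else 0) := by
        rw [Finset.sum_comm]
        refine Finset.sum_congr rfl fun x _ => ?_
        rw [← Finset.sum_mul, Finset.sum_boole]
    _ ≤ _ := by
        rw [Finset.mul_sum]
        refine Finset.sum_le_sum fun x _ => mul_le_mul_of_nonneg_right ?_ (by split_ifs <;> norm_num)
        exact_mod_cast card_var_sockets_le hD x.1

/-- The erasures weighted by a function of the degree. -/
def chanV (g : ℕ → ℝ) : VFam := fun T _ w a => ind (w a.1) * g (T.dv a.1)

/-- A function of the degree of the variable node. -/
def degV (g : ℕ → ℝ) : VFam := fun T _ _ a => g (T.dv a.1)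

/-- The covariance with one erasure is `1 - ε` times the mean effect of removing it. This effect is
`Lv` unless the node lies on a short cycle, and the expected number of edges at such nodes is
bounded. -/
lemma negl_cov_chanV (hε : ε ∈ Set.Icc (0 : ℝ) 1) (l : ℕ) (g : ℕ → ℝ) :
    Negl (fun T => cov ε (chanV g) (muR l) T - (1 - ε) * avg ε (degV g * Lv l) T) := by
  classical
  obtain ⟨R, hR⟩ := chan_response l
  refine negl_of_le fun D => ?_
  obtain ⟨c, hc, hbd⟩ := (isV_muR l).isE.boundedDiff D
  obtain ⟨M, hM⟩ := unifBdd_Lv l D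
  obtain ⟨C, hC, hcl⟩ := exists_expect_closed_le D R
  set Mg : ℝ := ∑ d ∈ Finset.range (D + 1), |g d| with hMg
  have hg : ∀ d ≤ D, |g d| ≤ Mg := fun d hd => Finset.single_le_sum (f := fun d => |g d|)
    (fun _ _ => abs_nonneg _) (Finset.mem_range.2 (Nat.lt_succ_of_le hd))
  have hMg0 : 0 ≤ Mg := Finset.sum_nonneg fun _ _ => abs_nonneg _
  refine ⟨Mg * (c + |M|) * (D * C), fun T hT => ?_⟩
  have hN := hT.cast_pos
  have e1 : T.expect ε (fun G w => tot (chanV g) T G w * dev ε (muR l) T G w)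
      = (1 - ε) * T.expect ε (fun G w => ∑ a : T.VSocket, g (T.dv a.1) * (ind (w a.1) *
        (tot (muR l) T G w - tot (muR l) T G (Function.update w a.1 false)))) := by
    have : ∀ G w, tot (chanV g) T G w * dev ε (muR l) T G w
        = ∑ a : T.VSocket, g (T.dv a.1) * (ind (w a.1) * dev ε (muR l) T G w) := by
      intro G w
      rw [tot, Finset.sum_mul]
      exact Finset.sum_congr rfl fun a _ => by unfold chanV; ring
    simp only [this, expect_sum, expect_const_mul, expect_ind_mul_dev]
    rw [Finset.mul_sum]
    exact Finset.sum_congr rfl fun a _ => by ring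
  have e2 : cov ε (chanV g) (muR l) T - (1 - ε) * avg ε (degV g * Lv l) T
      = (1 - ε) * T.expect ε (fun G w => ∑ a : T.VSocket, g (T.dv a.1) * (ind (w a.1) *
        (tot (muR l) T G w - tot (muR l) T G (Function.update w a.1 false)) - Lv l T G w a))
        / T.numEdges := by
    have : ∀ (G : T.Graph) (w : T.Channel), ∑ a : T.VSocket, g (T.dv a.1) * (ind (w a.1) *
        (tot (muR l) T G w - tot (muR l) T G (Function.update w a.1 false)) - Lv l T G w a)
        = ∑ a : T.VSocket, g (T.dv a.1) * (ind (w a.1) *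
        (tot (muR l) T G w - tot (muR l) T G (Function.update w a.1 false)))
        - tot (degV g * Lv l) T G w := by
      intro G w
      rw [show tot (degV g * Lv l) T G w = ∑ a, (degV g * Lv l) T G w a from rfl,
        ← Finset.sum_sub_distrib]
      exact Finset.sum_congr rfl fun a _ => by
        simp only [Pi.mul_apply, degV]; ring
    rw [cov, e1, avg]
    simp only [this, expect_sub]
    have h2 : T.expect ε (fun G w => tot (degV g * Lv l) T G w)
      = T.expect ε (tot (degV g * Lv l) T) := rfl
    rw [h2]
    ring
  rw [e2, abs_div, abs_of_pos hN]
  gcongr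
  rw [abs_mul]
  have h1 : |1 - ε| ≤ 1 := by rw [abs_le]; constructor <;> linarith [hε.1, hε.2]
  refine (mul_le_mul_of_nonneg_right h1 (abs_nonneg _)).trans ?_
  rw [one_mul]
  have hp : ∀ (G : T.Graph) (w : T.Channel), |∑ a : T.VSocket, g (T.dv a.1) * (ind (w a.1) *
        (tot (muR l) T G w - tot (muR l) T G (Function.update w a.1 false)) - Lv l T G w a)|
      ≤ Mg * (c + |M|) * (D * ∑ x, if Closed R G x then (1 : ℝ) else 0) := by
    intro G w
    refine le_trans ?_ (mul_le_mul_of_nonneg_left (sum_closedAt_le hT.deg G R) (by positivity))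
    rw [Finset.mul_sum]
    refine (Finset.abs_sum_le_sum_abs _ _).trans (Finset.sum_le_sum fun a _ => ?_)
    split_ifs with hca
    · rw [mul_one, abs_mul]
      refine mul_le_mul (hg _ (hT.deg.1 _)) ?_ (abs_nonneg _) hMg0
      refine (abs_sub _ _).trans (add_le_add ?_ ((hM T hT.deg G w a).trans (le_abs_self _)))
      rw [abs_mul, ← one_mul c]
      refine mul_le_mul ?_ ?_ (abs_nonneg _) zero_le_one
      · rcases ind_eq (w a.1) with h | h <;> simp [h]
      · rw [abs_sub_comm]
        exact (hbd T hT.deg).chan G w a.1 false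
    · rw [mul_zero]
      cases hw : w a.1
      · rw [Lv_eq_zero l G hw]; simp [ind]
      · rw [hR T G w a hca hw]; simp [ind]
  refine (abs_expect_le_of_le hε hp).trans ?_
  rw [expect_const_mul, expect_const_mul]
  have := hcl ε hε T hT.deg
  gcongr

/-! ### Covariance of the variable-to-check messages -/

/-- One term of the response to the channel. -/
def LvN (l n : ℕ) : VFam := fun T G w a =>
  ∑ s : Fin (T.dv a.1), muR (l - n) T G w ⟨a.1, s⟩ * Jh l n T G w (G ⟨a.1, s⟩)

lemma Lv_eq_sum (l : ℕ) : Lv l = ∑ n ∈ Finset.range (l + 1), LvN l n := by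
  funext T G w a
  simp only [Finset.sum_apply]
  rfl

lemma muR_mul_LvN (l n t : ℕ) : muR t * LvN l n
    = vPair (fun _ => 1) 1 1 (Jh l n) (etaR (l - n)) (etaR t * Jh l n) (etaR (max t (l - n))) := by
  funext T G w ⟨v, i⟩
  simp only [Pi.mul_apply, LvN, muR, vStep, vPair, pairVal, one_mul]
  rw [mul_assoc, Finset.mul_sum, ← Finset.add_sum_erase _ _ (Finset.mem_univ i)]
  simp only [← etaR_mul_etaR, Finset.prod_mul_distrib]
  rw [mul_add, mul_add]
  congr 1
  · rcases ind_eq (w v) with h | h <;> rw [h] <;> ring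
  · rw [Finset.mul_sum, Finset.mul_sum]
    refine Finset.sum_congr rfl fun s hs => ?_
    have hi : i ∈ Finset.univ.erase s :=
      Finset.mem_erase.2 ⟨(Finset.ne_of_mem_erase hs).symm, Finset.mem_univ _⟩
    rw [← Finset.mul_prod_erase _ (fun j => etaR t T G w (G ⟨v, j⟩)) hs,
      ← Finset.mul_prod_erase _ (fun j => etaR (l - n) T G w (G ⟨v, j⟩)) hi,
      Finset.erase_right_comm (a := s)]
    rcases ind_eq (w v) with h | h <;> rw [h] <;> ring

lemma degV_mul_LvN (g : ℕ → ℝ) (l n : ℕ) : degV g * LvN l n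
    = vPair g 1 1 (Jh l n) (etaR (l - n)) (Jh l n) (etaR (l - n)) := by
  funext T G w ⟨v, i⟩
  simp only [Pi.mul_apply, degV, LvN, muR, vStep, vPair, pairVal, one_mul]
  rw [← Finset.add_sum_erase _ _ (Finset.mem_univ i), mul_left_comm (ind (w v))]
  congr 1
  rw [mul_add]
  congr 1
  · ring
  · rw [Finset.mul_sum]
    refine Finset.sum_congr rfl fun s hs => ?_
    have hi : i ∈ Finset.univ.erase s :=
      Finset.mem_erase.2 ⟨(Finset.ne_of_mem_erase hs).symm, Finset.mem_univ _⟩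
    rw [← Finset.mul_prod_erase _ (fun j => etaR (l - n) T G w (G ⟨v, j⟩)) hi,
      Finset.erase_right_comm (a := s)]
    ring

/-- Multiplying `Ir` at `a` by the missing message at `a` gives the terms of the node sum of `muR ·
Jh` over the sockets other than `a`; `muR · Jr` adds the term of `a`, except for its unit part at `n
= 0`. Thus the response is a function of the node, less the message itself. -/
lemma sum_resp_eq (l : ℕ) :
    ∑ k, respP l k * onEdge (respQ l k) = Lv l - muR l := by
  funext T G w ⟨v, i⟩
  simp only [Finset.sum_apply, Fintype.sum_prod_type, Fintype.sum_bool, Pi.mul_apply, Pi.sub_apply,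
    respP, respQ, if_true, if_false, Bool.false_eq_true, onEdge]
  unfold Lv
  rw [Finset.sum_range, Fin.sum_univ_succ, Fin.sum_univ_succ]
  have h : ∀ n, Ir l n T G w ⟨v, i⟩ * etaR (l - n) T G w (G ⟨v, i⟩)
      = ∑ s ∈ Finset.univ.erase i, muR (l - n) T G w ⟨v, s⟩ * Jh l n T G w (G ⟨v, s⟩) := by
    intro n
    simp only [Ir, vDeriv, muR, vStep]
    rw [mul_assoc, Finset.sum_mul, Finset.mul_sum]
    refine Finset.sum_congr rfl fun s hs => ?_
    have hi : i ∈ Finset.univ.erase s :=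
      Finset.mem_erase.2 ⟨(Finset.ne_of_mem_erase hs).symm, Finset.mem_univ _⟩
    rw [← Finset.mul_prod_erase _ (fun j => etaR (l - n) T G w (G ⟨v, j⟩)) hi,
      Finset.erase_right_comm (a := s)]
    ring
  have h2 : ∀ n, muR (l - n) T G w ⟨v, i⟩ * Jr l n T G w (G ⟨v, i⟩)
      + Ir l n T G w ⟨v, i⟩ * etaR (l - n) T G w (G ⟨v, i⟩)
      = ∑ s, muR (l - n) T G w ⟨v, s⟩ * Jh l n T G w (G ⟨v, s⟩)
        - unit0 n * muR (l - n) T G w ⟨v, i⟩ := by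
    intro n
    rw [h, ← Finset.add_sum_erase _ _ (Finset.mem_univ i)]
    have : Jh l n T G w (G ⟨v, i⟩) = unit0 n + Jr l n T G w (G ⟨v, i⟩) := rfl
    rw [this]
    ring
  simp only [h2]
  simp [unit0]
  ring

section

variable {lam rho : ℝ[X]} {D : ℕ} {T : ℕ → Degrees}

/-- The source term in the covariance of the variable-to-check messages. -/
def Gv (ε : ℝ) (lam rho : ℝ[X]) (l t n : ℕ) : ℝ :=
  let m := max t (l - n)
  let y := deY lam rho ε
  let z := y t * y (l - n)
  let j := unit0 n + jj ε lam rho l n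
  ε * (1 * j * lam.eval (y m) + 1 * (y (l - n) * (unit0 n * y t + hh ε lam rho l n t) *
      (derivative lam).eval (y m)))
    - ε * (ε * (j * (lam.eval z + z * (derivative lam).eval z)))
    - aa ε lam rho t * (ii ε lam rho l n * (y m - y t * y (l - n))
      + deX lam rho ε (l - n) * (hh ε lam rho l n t - y t * jj ε lam rho l n))

lemma lim_mul_Lv (hε : ε ∈ Set.Icc (0 : ℝ) 1) (hT : GoodSeq lam rho D T) (l t : ℕ) :
    Lim ε T (muR t * Lv l) (∑ n ∈ Finset.range (l + 1), ε *
      (1 * (unit0 n + jj ε lam rho l n) * lam.eval (deY lam rho ε (max t (l - n)))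
        + 1 * (deY lam rho ε (l - n) * (unit0 n * deY lam rho ε t + hh ε lam rho l n t) *
          (derivative lam).eval (deY lam rho ε (max t (l - n)))))) := by
  rw [Lv_eq_sum, Finset.mul_sum]
  refine Lim.sum _ (fun n _ => ?_) hT
  rw [muR_mul_LvN, ← pairLim_one]
  exact lim_vPair hε hT _ _ _ (isC_Jh l n) (isC_etaR _) ((isC_etaR t).mul (isC_Jh l n))
    (isC_etaR _) (lim_Jh hT (lim_Jr hε hT l n).1) (lim_etaR_muR hε hT _).1
    (lim_etaR_mul_Jr hε hT l n t).2.1 (lim_etaR_muR hε hT _).1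

lemma lim_deg_mul_Lv (hε : ε ∈ Set.Icc (0 : ℝ) 1) (hT : GoodSeq lam rho D T) (l : ℕ) (z : ℝ) :
    Lim ε T (degV (fun d => z ^ (d - 1)) * Lv l) (∑ n ∈ Finset.range (l + 1), ε *
      ((unit0 n + jj ε lam rho l n) * (lam.eval (z * deY lam rho ε (l - n))
        + z * deY lam rho ε (l - n) *
          (derivative lam).eval (z * deY lam rho ε (l - n))))) := by
  rw [Lv_eq_sum, Finset.mul_sum]
  refine Lim.sum _ (fun n _ => ?_) hT
  rw [degV_mul_LvN, ← pairLim_pow]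
  have hJ := lim_Jh hT (lim_Jr hε hT l n).1
  have hη := (lim_etaR_muR hε hT (l - n)).1
  exact lim_vPair hε hT _ _ _ (isC_Jh l n) (isC_etaR _) (isC_Jh l n) (isC_etaR _) hJ hη hJ hη

lemma muR_mul_muR (t t' : ℕ) : muR t * muR t' = muR (max t t') := by
  funext T G w a
  simp only [Pi.mul_apply]
  have h := one_sub_muR_mul G w t t' a
  rcases le_total t t' with h1 | h1
  · rw [min_eq_left h1] at h; rw [max_eq_right h1]; linarith
  · rw [min_eq_right h1] at h; rw [max_eq_left h1]; linarith

lemma tendsto_ecov {φ ψ : VFam} {a b c : ℝ} (h : Lim ε T (φ * ψ) c) (ha : Lim ε T φ a)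
    (hb : Lim ε T ψ b) : Tendsto (fun k => ecov ε φ ψ (T k)) atTop (𝓝 (c - a * b)) :=
  Tendsto.sub h (Tendsto.mul ha hb)

/-- Linearize the sum of messages around `y_t`. The constant part is a weighted sum of erasures and
gives `(1 - ε)` times the average of `y_t^(d-1) Lv`. The rest is `kapV · (η - y_t)`, to which the
product rule applies; its correlation with the response is unlinearized to the average of `muR · Lv`
minus that of `y_t^(d-1) Lv`. Together the degree-weighted average keeps the factor `-ε`. -/
lemma tendsto_cov_muR (hε : ε ∈ Set.Icc (0 : ℝ) 1) (hT : GoodSeq lam rho D T) (l t : ℕ) {c : ℝ}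
    (hc : Tendsto (fun k => cov ε (onEdge (etaR t)) (muR l) (T k)) atTop (𝓝 c)) :
    Tendsto (fun k => cov ε (muR t) (muR l) (T k)) atTop
      (𝓝 (aa ε lam rho t * c + ∑ n ∈ Finset.range (l + 1), Gv ε lam rho l t n)) := by
  set y := deY lam rho ε t with hy
  have lη := (lim_etaR_muR hε hT t).1
  have hκ := isV_kapV y (isC_etaR t)
  have h1 := tendsto_cov_linear hε hT hκ (isC_etaR t) (isV_muR l).isE (isV_respP l) (isC_respQ l)
    (hasResponse_muR l) lη
  have h2 := (negl_cov_chanV hε l (fun d => y ^ (d - 1))).tendsto hT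
  have lκ := lim_kapV hε hT (isC_etaR t) lη
  have lL := lim_mul_Lv hε hT l t
  have lD := lim_deg_mul_Lv hε hT l y
  -- the response of the message itself is negligible
  have h3 : Tendsto (fun k => avg ε (kapV y (etaR t) * (onEdge (etaR t) - constV y) * muR l) (T k))
      atTop (𝓝 0) := by
    have g1 := (negl_glue hε (hκ.mul (isV_muR l)) (isC_etaR t)).tendsto hT
    have g2 := (abs_avg_le hε (hκ.mul (isV_muR l)).2).mul_tendsto
      (Y := fun T => avg ε (onEdge (etaR t)) T - y) hT (by
        have : Tendsto _ _ (𝓝 (y - y)) := Tendsto.sub_const lη y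
        rwa [sub_self] at this)
    have := g1.add g2
    rw [add_zero] at this
    refine this.congr fun k => ?_
    have e : kapV y (etaR t) * (onEdge (etaR t) - constV y) * muR l
        = kapV y (etaR t) * muR l * onEdge (etaR t) + constV (-y) * (kapV y (etaR t) * muR l) := by
      funext T G w a
      simp only [Pi.mul_apply, Pi.sub_apply, Pi.add_apply, constV]
      ring
    rw [e, avg_add, avg_const_mul]
    ring
  have hsum : Tendsto (fun k => ∑ i, avg ε (respP l i) (T k)
      * ecov ε (onEdge (etaR t)) (onEdge (respQ l i)) (T k)) atTop
      (𝓝 (∑ n ∈ Finset.range (l + 1), (ii ε lam rho l n * (deY lam rho ε (max t (l - n))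
        - y * deY lam rho ε (l - n))
        + deX lam rho ε (l - n) * (hh ε lam rho l n t - y * jj ε lam rho l n)))) := by
    simp only [Fintype.sum_prod_type, Fintype.sum_bool]
    rw [Finset.sum_range]
    refine tendsto_finsetSum _ fun n _ => ?_
    rw [add_comm (ii ε lam rho l n * _)]
    refine Tendsto.add (Tendsto.mul ?_ ?_) (Tendsto.mul ?_ ?_)
    · exact (lim_etaR_muR hε hT _).2
    · exact tendsto_ecov (lim_etaR_mul_Jr hε hT l n t).1 lη (lim_Jr hε hT l n).1
    · exact (lim_Jr hε hT l n).2
    · refine tendsto_ecov ?_ lη (lim_etaR_muR hε hT _).1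
      have e : onEdge (etaR t) * onEdge (respQ l (n, false)) = onEdge (etaR (max t (l - n))) := by
        funext T G w a
        simp only [respQ, onEdge, Pi.mul_apply, if_false, Bool.false_eq_true]
        exact etaR_mul_etaR G w t (l - n) _
      rw [e]
      exact (lim_etaR_muR hε hT _).1
  have hmain := (((h1.add h2).sub h3).add ((Tendsto.mul lκ (hc.sub hsum)).add
    (Tendsto.sub lL (Tendsto.const_mul ε lD))))
  rw [show (0 : ℝ) + 0 - 0 = 0 by norm_num, zero_add] at hmain
  have elim : aa ε lam rho t * c + ∑ n ∈ Finset.range (l + 1), Gv ε lam rho l t n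
      = ε * (derivative lam).eval y * (c - (∑ n ∈ Finset.range (l + 1), (ii ε lam rho l n *
        (deY lam rho ε (max t (l - n)) - y * deY lam rho ε (l - n))
        + deX lam rho ε (l - n) * (hh ε lam rho l n t - y * jj ε lam rho l n)))) +
        ((∑ n ∈ Finset.range (l + 1), ε *
      (1 * (unit0 n + jj ε lam rho l n) * lam.eval (deY lam rho ε (max t (l - n)))
        + 1 * (deY lam rho ε (l - n) * (unit0 n * deY lam rho ε t + hh ε lam rho l n t) *
          (derivative lam).eval (deY lam rho ε (max t (l - n)))))) - ε *
          (∑ n ∈ Finset.range (l + 1), ε *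
      ((unit0 n + jj ε lam rho l n) * (lam.eval (y * deY lam rho ε (l - n))
        + y * deY lam rho ε (l - n) *
          (derivative lam).eval (y * deY lam rho ε (l - n)))))) := by
    unfold Gv aa
    simp only [Finset.sum_sub_distrib, ← Finset.mul_sum, ← hy]
    ring
  rw [elim]
  refine hmain.congr fun k => ?_
  have t1 : ∀ G w, tot (muR t) (T k) G w = tot (chanV (fun d => y ^ (d - 1))) (T k) G w
      + tot (kapV y (etaR t) * onEdge (etaR t)) (T k) G w
      - y * tot (kapV y (etaR t)) (T k) G w := by
    intro G w
    have := sum_vStep_mul y (etaR t) G w (fun _ => 1)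
    simp only [mul_one, mul_sub, Finset.sum_sub_distrib, ← Finset.sum_mul] at this
    unfold tot muR chanV
    simp only [Pi.mul_apply, onEdge]
    linarith
  have c1 : cov ε (muR t) (muR l) (T k) = cov ε (chanV (fun d => y ^ (d - 1))) (muR l) (T k)
      + cov ε (kapV y (etaR t) * onEdge (etaR t)) (muR l) (T k)
      - y * cov ε (kapV y (etaR t)) (muR l) (T k) := by
    unfold cov
    simp only [t1, sub_mul, add_mul, expect_sub, expect_add, mul_assoc, expect_const_mul]
    ring
  -- The linearization identity once more, now with the node response `Lv` as weight.
  have c2 : avg ε (kapV y (etaR t) * (onEdge (etaR t) - constV y)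
      * ∑ i, respP l i * onEdge (respQ l i)) (T k)
      = avg ε (muR t * Lv l) (T k) - avg ε (degV (fun d => y ^ (d - 1)) * Lv l) (T k)
        - avg ε (kapV y (etaR t) * (onEdge (etaR t) - constV y) * muR l) (T k) := by
    rw [sum_resp_eq]
    unfold avg
    rw [← sub_div, ← sub_div, ← expect_sub, ← expect_sub]
    congr 2
    funext G w
    have := sum_vStep_mul y (etaR t) G w (fun v => ∑ n ∈ Finset.range (l + 1),
      ∑ s : Fin ((T k).dv v), muR (l - n) (T k) G w ⟨v, s⟩ * Jh l n (T k) G w (G ⟨v, s⟩))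
    have e1 : tot (muR t * Lv l) (T k) G w = ∑ a : (T k).VSocket, vStep (etaR t) (T k) G w a *
      ∑ n ∈ Finset.range (l + 1), ∑ s : Fin ((T k).dv a.1),
        muR (l - n) (T k) G w ⟨a.1, s⟩ * Jh l n (T k) G w (G ⟨a.1, s⟩) := rfl
    have e2 : tot (degV (fun d => y ^ (d - 1)) * Lv l) (T k) G w
        = ∑ a : (T k).VSocket, ind (w a.1) * y ^ ((T k).dv a.1 - 1) *
          ∑ n ∈ Finset.range (l + 1), ∑ s : Fin ((T k).dv a.1),
            muR (l - n) (T k) G w ⟨a.1, s⟩ * Jh l n (T k) G w (G ⟨a.1, s⟩) := by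
      refine Finset.sum_congr rfl fun a _ => ?_
      change y ^ ((T k).dv a.1 - 1) * Lv l (T k) G w a
        = ind (w a.1) * y ^ ((T k).dv a.1 - 1) * Lv l (T k) G w a
      -- `Lv` vanishes when the symbol is received, so the erasure indicator may be dropped in front
      -- of it.
      cases hw : w a.1
      · rw [Lv_eq_zero l G hw]; ring
      · simp [ind]
    rw [e1, this, e2, add_sub_cancel_left]
    unfold tot
    rw [← Finset.sum_sub_distrib]
    refine Finset.sum_congr rfl fun a _ => ?_
    simp only [Pi.mul_apply, Pi.sub_apply, constV, onEdge, Lv]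
    ring
  rw [c1, c2]
  ring

end

end

end LDPC

namespace LDPC

noncomputable section

open Degrees

variable {ε : ℝ}

/-! ### Covariance of the check-to-variable messages -/

/-- The product of the complementary messages that enter a check node along the other edges. -/
def cProd (φ : VFam) : CFam := fun T G w b =>
  ∏ j ∈ Finset.univ.erase b.2, (1 - φ T G w (G.symm ⟨b.1, j⟩))

/-- A function of the degree of the check node. -/
def degC (g : ℕ → ℝ) : CFam := fun T _ _ b => g (T.dc b.1)

/-- The sum over a check node of the responses. -/
def nodeI (l n : ℕ) : CFam := fun T G w b => ∑ s : Fin (T.dc b.1), Ir l n T G w (G.symm ⟨b.1, s⟩)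

/-- The sum over a check node of the responses weighted with complementary messages. -/
def nodeK (l n t : ℕ) : CFam := fun T G w b => ∑ s : Fin (T.dc b.1),
  cProd (muR t) T G w ⟨b.1, s⟩ * Ir l n T G w (G.symm ⟨b.1, s⟩)

/-- The sum over a check node of the responses weighted with the messages. -/
def LcN (l n : ℕ) : CFam := fun T G w b => ∑ s : Fin (T.dc b.1),
  etaR (l - n) T G w ⟨b.1, s⟩ * Ir l n T G w (G.symm ⟨b.1, s⟩)

/-- The part of the response that depends on the other side of the edge only. -/
def Uc (l : ℕ) : CFam :=
  ∑ n ∈ Finset.range l, Jr l (n + 1) - ∑ n ∈ Finset.range (l + 1), cDeriv (Ir l n) (constV 0)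

lemma isC_sum {ι : Type*} (s : Finset ι) {χ : ι → CFam} (h : ∀ i ∈ s, IsC (χ i)) :
    IsC (∑ i ∈ s, χ i) := by
  classical
  induction s using Finset.induction_on with
  | empty => rw [Finset.sum_empty]; exact isC_const 0
  | insert i s hi ih =>
    rw [Finset.sum_insert hi]
    exact (h i (Finset.mem_insert_self _ _)).add (ih fun j hj => h j (Finset.mem_insert_of_mem hj))

lemma isC_Uc (l : ℕ) : IsC (Uc l) :=
  isC_sub (isC_sum _ fun _ _ => isC_Jr _ _)
    (isC_sum _ fun _ _ => isC_cDeriv (isV_Ir _ _) (isV_const 0))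

/-- At `n = l` the message is the initial erasure, the constant `1`, and not `1` minus a product.
This is why `Gk` distinguishes two cases. -/
lemma LcN_zero {l n : ℕ} (h : l - n = 0) : LcN l n = nodeI l n := by
  funext T G w b
  simp [LcN, nodeI, h, etaR, constC]

lemma LcN_succ {l n t : ℕ} (h : l - n = t + 1) : LcN l n = nodeI l n - nodeK l n t := by
  funext T G w b
  simp only [LcN, nodeI, nodeK, h, Pi.sub_apply]
  rw [← Finset.sum_sub_distrib]
  refine Finset.sum_congr rfl fun s _ => ?_
  change cStep (muR t) T G w _ * _ = _
  unfold cStep cProd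
  ring

lemma cProd_mul_nodeI (l n t : ℕ) : cProd (muR t) * nodeI l n
    = cPair (fun _ => 1) 1 1 (Ir l n) (constV 1) ((constV 1 - muR t) * Ir l n)
      (constV 1 - muR t) := by
  funext T G w ⟨c, i⟩
  simp only [Pi.mul_apply, cProd, nodeI, cPair, pairVal, one_mul, constV, Pi.sub_apply]
  rw [Finset.mul_sum, ← Finset.add_sum_erase _ _ (Finset.mem_univ i)]
  congr 1
  · ring
  · refine Finset.sum_congr rfl fun s hs => ?_
    rw [← Finset.mul_prod_erase _ (fun j => 1 - muR t T G w (G.symm ⟨c, j⟩)) hs]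
    ring

lemma cProd_mul_nodeK (l n t t' : ℕ) : cProd (muR t) * nodeK l n t'
    = cPair (fun _ => 1) 1 1 (Ir l n) (constV 1 - muR t') ((constV 1 - muR t) * Ir l n)
      (constV 1 - muR (min t t')) := by
  funext T G w ⟨c, i⟩
  simp only [Pi.mul_apply, cProd, nodeK, cPair, pairVal, one_mul, constV, Pi.sub_apply]
  rw [Finset.mul_sum, ← Finset.add_sum_erase _ _ (Finset.mem_univ i)]
  simp only [← one_sub_muR_mul, Finset.prod_mul_distrib]
  congr 1
  · ring
  · refine Finset.sum_congr rfl fun s hs => ?_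
    have hi : i ∈ Finset.univ.erase s :=
      Finset.mem_erase.2 ⟨(Finset.ne_of_mem_erase hs).symm, Finset.mem_univ _⟩
    rw [← Finset.mul_prod_erase _ (fun j => 1 - muR t T G w (G.symm ⟨c, j⟩)) hs,
      ← Finset.mul_prod_erase _ (fun j => 1 - muR t' T G w (G.symm ⟨c, j⟩)) hi,
      Finset.erase_right_comm (a := s)]
    ring

lemma degC_mul_nodeI (g : ℕ → ℝ) (l n : ℕ) : degC g * nodeI l n
    = cPair g 1 1 (Ir l n) (constV 1) (Ir l n) (constV 1) := by
  funext T G w ⟨c, i⟩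
  simp only [Pi.mul_apply, degC, nodeI, cPair, pairVal, one_mul, constV, Finset.prod_const_one,
    mul_one]
  rw [← Finset.add_sum_erase _ _ (Finset.mem_univ i)]

lemma degC_mul_nodeK (g : ℕ → ℝ) (l n t : ℕ) : degC g * nodeK l n t
    = cPair g 1 1 (Ir l n) (constV 1 - muR t) (Ir l n) (constV 1 - muR t) := by
  funext T G w ⟨c, i⟩
  simp only [Pi.mul_apply, degC, nodeK, cProd, cPair, pairVal, one_mul, constV, Pi.sub_apply]
  rw [← Finset.add_sum_erase _ _ (Finset.mem_univ i)]
  congr 1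
  congr 1
  · ring
  · refine Finset.sum_congr rfl fun s hs => ?_
    have hi : i ∈ Finset.univ.erase s :=
      Finset.mem_erase.2 ⟨(Finset.ne_of_mem_erase hs).symm, Finset.mem_univ _⟩
    rw [← Finset.mul_prod_erase _ (fun j => 1 - muR t T G w (G.symm ⟨c, j⟩)) hi,
      Finset.erase_right_comm (a := s)]
    ring

/-- On the check side the response is the node sum of `etaR · Ir` plus `Uc`. The latter does not
involve the message arriving along the edge itself, so it is asymptotically uncorrelated with it;
only the node sum matters. -/
lemma sum_resp_eq' (l : ℕ) : ∑ k, respP l k * onEdge (respQ l k)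
    = onEdge (∑ n ∈ Finset.range (l + 1), LcN l n) + onEdge (Uc l) := by
  funext T G w a
  obtain ⟨b, rfl⟩ := G.symm.surjective a
  obtain ⟨c, i⟩ := b
  simp only [Finset.sum_apply, Fintype.sum_prod_type, Fintype.sum_bool, Pi.mul_apply, Pi.add_apply,
    respP, respQ, if_true, if_false, Bool.false_eq_true, onEdge, Equiv.apply_symm_apply, Uc,
    Pi.sub_apply]
  have hL : ∀ n, LcN l n T G w ⟨c, i⟩
      = etaR (l - n) T G w ⟨c, i⟩ * Ir l n T G w (G.symm ⟨c, i⟩)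
        + ∑ s ∈ Finset.univ.erase i, etaR (l - n) T G w ⟨c, s⟩ * Ir l n T G w (G.symm ⟨c, s⟩) :=
    fun n => (Finset.add_sum_erase _ _ (Finset.mem_univ i)).symm
  have hU : ∀ n, cDeriv (Ir l n) (constV 0) T G w ⟨c, i⟩
      = ∑ s ∈ Finset.univ.erase i, Ir l n T G w (G.symm ⟨c, s⟩) := by
    intro n
    simp [cDeriv, constV]
  -- The factor `1 - μ` at socket `i` completes each product in `Jr` to `1 - η` at socket `s`, so
  -- `(1 - μ) · Jr` is the sum of `(1 - η) · Ir` over the other sockets.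
  have hJ : ∀ n < l, muR (l - (n + 1)) T G w (G.symm ⟨c, i⟩) * Jr l (n + 1) T G w ⟨c, i⟩
      = Jr l (n + 1) T G w ⟨c, i⟩ - ∑ s ∈ Finset.univ.erase i, Ir l n T G w (G.symm ⟨c, s⟩)
        + ∑ s ∈ Finset.univ.erase i, etaR (l - n) T G w ⟨c, s⟩ * Ir l n T G w (G.symm ⟨c, s⟩) := by
    intro n hn
    obtain ⟨t, ht⟩ : ∃ t, l - n = t + 1 := ⟨l - n - 1, by omega⟩
    have ht' : l - (n + 1) = t := by omega
    have ht'' : l - n - 1 = t := by omega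
    rw [Jr_succ, ht', ht'', ht, ← sub_eq_zero]
    unfold cDeriv
    rw [Finset.mul_sum, ← Finset.sum_sub_distrib, ← Finset.sum_add_distrib,
      ← Finset.sum_sub_distrib]
    refine Finset.sum_eq_zero fun s hs => ?_
    change _ - (_ - _ + cStep (muR t) T G w _ * _) = 0
    have hi : i ∈ Finset.univ.erase s :=
      Finset.mem_erase.2 ⟨(Finset.ne_of_mem_erase hs).symm, Finset.mem_univ _⟩
    unfold cStep
    simp only
    rw [← Finset.mul_prod_erase _ (fun j => 1 - muR t T G w (G.symm ⟨c, j⟩)) hi,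
      Finset.erase_right_comm (a := s)]
    ring
  have hS : ∑ n : Fin (l + 1), (muR (l - n) T G w (G.symm ⟨c, i⟩) * Jr l n T G w ⟨c, i⟩
      + Ir l n T G w (G.symm ⟨c, i⟩) * etaR (l - n) T G w ⟨c, i⟩)
      = ∑ n ∈ Finset.range (l + 1), muR (l - n) T G w (G.symm ⟨c, i⟩) * Jr l n T G w ⟨c, i⟩
        + ∑ n ∈ Finset.range (l + 1),
          Ir l n T G w (G.symm ⟨c, i⟩) * etaR (l - n) T G w ⟨c, i⟩ := by
    rw [← Finset.sum_add_distrib]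
    exact Fin.sum_univ_eq_sum_range (fun n => muR (l - n) T G w (G.symm ⟨c, i⟩)
      * Jr l n T G w ⟨c, i⟩ + Ir l n T G w (G.symm ⟨c, i⟩) * etaR (l - n) T G w ⟨c, i⟩) (l + 1)
  rw [hS, Finset.sum_range_succ']
  rw [Finset.sum_congr rfl fun n hn => hJ n (Finset.mem_range.1 hn)]
  simp only [hL, hU, Finset.sum_add_distrib, Finset.sum_sub_distrib]
  rw [Finset.sum_range_succ (fun n => ∑ s ∈ Finset.univ.erase i,
      etaR (l - n) T G w ⟨c, s⟩ * Ir l n T G w (G.symm ⟨c, s⟩)) l,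
    Finset.sum_range_succ (fun n => ∑ s ∈ Finset.univ.erase i, Ir l n T G w (G.symm ⟨c, s⟩)) l]
  have h0 : Jr l 0 T G w ⟨c, i⟩ = 0 := rfl
  have h1 : ∀ b, etaR (l - l) T G w b = 1 := fun b => by rw [Nat.sub_self]; rfl
  rw [h0]
  simp only [h1, one_mul, mul_zero, add_zero]
  rw [Finset.sum_congr rfl fun n _ => mul_comm (Ir l n T G w (G.symm ⟨c, i⟩)) _]
  ring

section

variable {lam rho : ℝ[X]} {D : ℕ} {T : ℕ → Degrees}

/-- The limit of the correlation with the responses at a check node, less the uncorrelated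
contribution. -/
def Gk (ε : ℝ) (lam rho : ℝ[X]) (l t n : ℕ) : ℝ :=
  let x := deX lam rho ε
  let i := ii ε lam rho l n
  let e := ii ε lam rho l n - gg ε lam rho l n t
  let A := 1 * i * rho.eval (1 - x t) + 1 * (1 * e * (derivative rho).eval (1 - x t))
  let A' := i * (rho.eval ((1 - x t) * 1) + (1 - x t) * 1 * (derivative rho).eval ((1 - x t) * 1))
  match l - n with
  | 0 => A - A'
  | s + 1 =>
    let z := (1 - x t) * (1 - x s)
    (A - (1 * i * rho.eval (1 - x (min t s))
        + 1 * ((1 - x s) * e * (derivative rho).eval (1 - x (min t s)))))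
      - (A' - i * (rho.eval z + z * (derivative rho).eval z))

lemma lim_Gk (hε : ε ∈ Set.Icc (0 : ℝ) 1) (hT : GoodSeq lam rho D T) (l t n : ℕ) :
    Lim ε T (onEdge (cProd (muR t) * LcN l n)
      - onEdge (degC (fun d => (1 - deX lam rho ε t) ^ (d - 1)) * LcN l n))
      (Gk ε lam rho l t n) := by
  have lI := (lim_Jr hε hT l n).2
  have hI := isV_Ir l n
  have l1 := Lim.const (ε := ε) hT 1
  have lm := fun s => l1.sub (lim_etaR_muR hε hT s).2
  have hm := fun s => isV_sub (isV_const 1) (isV_muR s)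
  have hγ : Lim ε T ((constV 1 - muR t) * Ir l n) (ii ε lam rho l n - gg ε lam rho l n t) := by
    have := lI.sub (lim_etaR_mul_Jr hε hT l n t).2.2
    convert this using 1
    funext T G w a
    simp only [Pi.mul_apply, Pi.sub_apply, constV]
    ring
  have a1 := lim_cPair hε hT (fun _ => 1) 1 1 hI (isV_const 1) ((hm t).mul hI) (hm t) lI l1 hγ
    (lm t)
  have a2 := lim_cPair hε hT (fun d => (1 - deX lam rho ε t) ^ (d - 1)) 1 1 hI (isV_const 1) hI
    (isV_const 1) lI l1 lI l1
  rw [← cProd_mul_nodeI, pairLim_one] at a1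
  rw [← degC_mul_nodeI, pairLim_pow] at a2
  unfold Gk
  rcases hs : l - n with _ | s
  · rw [LcN_zero hs]
    exact a1.sub a2
  · rw [LcN_succ hs]
    have b1 := lim_cPair hε hT (fun _ => 1) 1 1 hI (hm s) ((hm t).mul hI) (hm (min t s)) lI (lm s)
      hγ (lm (min t s))
    have b2 := lim_cPair hε hT (fun d => (1 - deX lam rho ε t) ^ (d - 1)) 1 1 hI (hm s) hI
      (hm s) lI (lm s) lI (lm s)
    rw [← cProd_mul_nodeK, pairLim_one] at b1
    rw [← degC_mul_nodeK, pairLim_pow] at b2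
    have := (a1.sub b1).sub (a2.sub b2)
    convert this using 1
    rw [mul_sub, mul_sub]
    rfl

/-- The source term in the covariance of the check-to-variable messages. -/
def Gc (ε : ℝ) (lam rho : ℝ[X]) (l t n : ℕ) : ℝ :=
  -Gk ε lam rho l t n - rr ε lam rho t *
    ((gg ε lam rho l n t - deX lam rho ε t * ii ε lam rho l n) * deY lam rho ε (l - n)
      + (deX lam rho ε (max t (l - n)) - deX lam rho ε t * deX lam rho ε (l - n))
        * jj ε lam rho l n)

lemma cov_deterministic (ψ f : VFam) (T : Degrees) (κ : ℝ) (h : ∀ G w, tot ψ T G w = κ) :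
    cov ε ψ f T = 0 := by
  unfold cov
  simp only [h, expect_const_mul]
  have : T.expect ε (fun G w => dev ε f T G w) = 0 := expect_dev f T
  rw [this, mul_zero, zero_div]

/-- The check analogue of the variable step. The constant part of the linearization depends on the
degrees alone, so it is deterministic and there is no channel term; the minus sign of `Gk` in `Gc`
comes from `η = 1 - ∏ (1 - μ)`. -/
lemma tendsto_cov_etaR (hε : ε ∈ Set.Icc (0 : ℝ) 1) (hT : GoodSeq lam rho D T) (l t : ℕ) {c : ℝ}
    (hc : Tendsto (fun k => cov ε (muR t) (muR l) (T k)) atTop (𝓝 c)) :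
    Tendsto (fun k => cov ε (onEdge (etaR (t + 1))) (muR l) (T k)) atTop
      (𝓝 (rr ε lam rho t * c + ∑ n ∈ Finset.range (l + 1), Gc ε lam rho l t n)) := by
  set x := deX lam rho ε t with hx
  set φ : VFam := constV 1 - muR t with hφ
  have hφV : IsV φ := isV_sub (isV_const 1) (isV_muR t)
  have lμ : Lim ε T (muR t) x := (lim_etaR_muR hε hT t).2
  have lφ : Lim ε T φ (1 - x) := (Lim.const hT 1).sub lμ
  have hκ := isC_kapC (1 - x) hφV
  have lκ := lim_kapC hε hT hφV lφ
  set κ := kapC (1 - x) φ with hκd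
  have h1 := tendsto_cov_linear' hε hT (isV_muR t) hκ (isV_muR l).isE (isV_respP l) (isC_respQ l)
    (hasResponse_muR l) lμ
  have h3 : Tendsto (fun k => avg ε (onEdge κ * (muR t - constV x) * onEdge (Uc l)) (T k))
      atTop (𝓝 0) := by
    have g1 := (negl_glue hε (isV_muR t) (hκ.mul (isC_Uc l))).tendsto hT
    have g2 := (abs_avg_le hε (hκ.mul (isC_Uc l)).isE.2).mul_tendsto
      (Y := fun T => avg ε (muR t) T - x) hT (by
        have : Tendsto _ _ (𝓝 (x - x)) := Tendsto.sub_const lμ x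
        rwa [sub_self] at this)
    have := g1.add g2
    rw [add_zero] at this
    refine this.congr fun k => ?_
    have e : onEdge κ * (muR t - constV x) * onEdge (Uc l)
        = muR t * onEdge (κ * Uc l) + constV (-x) * onEdge (κ * Uc l) := by
      funext T G w a
      simp only [Pi.mul_apply, Pi.sub_apply, Pi.add_apply, constV, onEdge]
      ring
    rw [e, avg_add, avg_const_mul]
    ring
  have hsum : Tendsto (fun k => ∑ i, ecov ε (muR t) (respP l i) (T k)
      * avg ε (onEdge (respQ l i)) (T k)) atTop
      (𝓝 (∑ n ∈ Finset.range (l + 1),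
        ((gg ε lam rho l n t - x * ii ε lam rho l n) * deY lam rho ε (l - n)
          + (deX lam rho ε (max t (l - n)) - x * deX lam rho ε (l - n)) * jj ε lam rho l n))) := by
    simp only [Fintype.sum_prod_type, Fintype.sum_bool]
    rw [Finset.sum_range]
    refine tendsto_finsetSum _ fun n _ => ?_
    rw [add_comm ((gg ε lam rho l n t - _) * _)]
    refine Tendsto.add (Tendsto.mul ?_ ?_) (Tendsto.mul ?_ ?_)
    · refine tendsto_ecov ?_ lμ (lim_etaR_muR hε hT _).2
      have e : muR t * respP l (n, true) = muR (max t (l - n)) := muR_mul_muR t (l - n)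
      rw [e]
      exact (lim_etaR_muR hε hT _).2
    · exact (lim_Jr hε hT l n).1
    · exact tendsto_ecov (lim_etaR_mul_Jr hε hT l n t).2.2 lμ (lim_Jr hε hT l n).2
    · exact (lim_etaR_muR hε hT _).1
  have lG := Lim.sum (Finset.range (l + 1)) (fun n _ => lim_Gk hε hT l t n) hT
  have hmain := ((h1.add h3).add ((Tendsto.mul lκ (hc.sub hsum)).sub lG))
  rw [add_zero, zero_add] at hmain
  have elim : rr ε lam rho t * c + ∑ n ∈ Finset.range (l + 1), Gc ε lam rho l t n
      = (derivative rho).eval (1 - x) * (c - ∑ n ∈ Finset.range (l + 1),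
        ((gg ε lam rho l n t - x * ii ε lam rho l n) * deY lam rho ε (l - n)
          + (deX lam rho ε (max t (l - n)) - x * deX lam rho ε (l - n)) * jj ε lam rho l n))
        - ∑ n ∈ Finset.range (l + 1), Gk ε lam rho l t n := by
    unfold Gc rr
    simp only [Finset.sum_sub_distrib, Finset.sum_neg_distrib, ← Finset.mul_sum, ← hx]
    ring
  rw [elim]
  refine hmain.congr fun k => ?_
  have key : ∀ (G : (T k).Graph) (w : (T k).Channel) (Θ : Fin (T k).m → ℝ),
      ∑ b : (T k).CSocket, cProd (muR t) (T k) G w b * Θ b.1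
      = ∑ b : (T k).CSocket, (1 - x) ^ ((T k).dc b.1 - 1) * Θ b.1
        + ∑ b : (T k).CSocket, κ (T k) G w b * (x - muR t (T k) G w (G.symm b)) * Θ b.1 := by
    intro G w Θ
    refine (sum_cStep_mul (1 - x) φ G w Θ).trans ?_
    congr 1
    refine Finset.sum_congr rfl fun b _ => ?_
    simp only [hφ, Pi.sub_apply, constV]
    ring
  have t1 : ∀ G w, tot (onEdge (etaR (t + 1))) (T k) G w
      = (∑ b : (T k).CSocket, (1 - (1 - x) ^ ((T k).dc b.1 - 1)))
      + tot (muR t * onEdge κ) (T k) G w - x * tot (onEdge κ) (T k) G w := by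
    intro G w
    have := key G w (fun _ => 1)
    simp only [mul_one] at this
    rw [tot_onEdge, tot_mul_onEdge, tot_onEdge, Finset.mul_sum, Finset.sum_sub_distrib]
    have e : ∑ b, etaR (t + 1) (T k) G w b = ∑ b : (T k).CSocket, (1 : ℝ)
        - ∑ b, cProd (muR t) (T k) G w b := by
      rw [← Finset.sum_sub_distrib]; rfl
    rw [e, this]
    have e2 : ∑ b, κ (T k) G w b * (x - muR t (T k) G w (G.symm b))
        = ∑ b, x * κ (T k) G w b - ∑ b, muR t (T k) G w (G.symm b) * κ (T k) G w b := by
      rw [← Finset.sum_sub_distrib]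
      exact Finset.sum_congr rfl fun b _ => by ring
    rw [e2]
    ring
  have c1 : cov ε (onEdge (etaR (t + 1))) (muR l) (T k)
      = cov ε (muR t * onEdge κ) (muR l) (T k) - x * cov ε (onEdge κ) (muR l) (T k) := by
    have hdev : (T k).expect ε (fun G w => dev ε (muR l) (T k) G w) = 0 := expect_dev _ _
    unfold cov
    simp only [t1, sub_mul, add_mul, expect_sub, expect_add, mul_assoc, expect_const_mul, hdev]
    ring
  have c2 : avg ε (onEdge κ * (muR t - constV x) * ∑ i, respP l i * onEdge (respQ l i)) (T k)
      = avg ε (onEdge κ * (muR t - constV x) * onEdge (Uc l)) (T k)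
        - avg ε (∑ n ∈ Finset.range (l + 1), (onEdge (cProd (muR t) * LcN l n)
          - onEdge (degC (fun d => (1 - deX lam rho ε t) ^ (d - 1)) * LcN l n))) (T k) := by
    rw [sum_resp_eq']
    unfold avg
    rw [← sub_div, ← expect_sub]
    congr 2
    funext G w
    set Θ : Fin (T k).m → ℝ := fun c => ∑ n ∈ Finset.range (l + 1), ∑ s : Fin ((T k).dc c),
      etaR (l - n) (T k) G w ⟨c, s⟩ * Ir l n (T k) G w (G.symm ⟨c, s⟩) with hΘ
    have hk := key G w Θ
    have hL : ∀ b : (T k).CSocket, (∑ n ∈ Finset.range (l + 1), LcN l n) (T k) G w b = Θ b.1 := by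
      intro b
      simp only [Finset.sum_apply]
      rfl
    have e1 : tot (∑ n ∈ Finset.range (l + 1), (onEdge (cProd (muR t) * LcN l n)
          - onEdge (degC (fun d => (1 - deX lam rho ε t) ^ (d - 1)) * LcN l n))) (T k) G w
        = ∑ b : (T k).CSocket, cProd (muR t) (T k) G w b * Θ b.1
          - ∑ b : (T k).CSocket, (1 - x) ^ ((T k).dc b.1 - 1) * Θ b.1 := by
      rw [← Finset.sum_sub_distrib, ← Equiv.sum_comp G]
      refine Finset.sum_congr rfl fun a _ => ?_
      rw [← sub_mul, ← hL]
      simp only [Finset.sum_apply, Pi.sub_apply, onEdge, Pi.mul_apply, degC, ← sub_mul, hx]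
      rw [← Finset.mul_sum]
    rw [e1, hk, add_sub_cancel_left, ← Equiv.sum_comp G]
    unfold tot
    rw [← Finset.sum_sub_distrib]
    refine Finset.sum_congr rfl fun a _ => ?_
    simp only [Pi.mul_apply, Pi.sub_apply, Pi.add_apply, constV, onEdge]
    rw [hL]
    simp only [Equiv.symm_apply_apply]
    ring
  rw [c1, c2]
  ring

/-! ### The limit of the variance -/

/-- The limits of the covariances of the messages at iteration `t` with those at iteration `l`. -/
def covLim (ε : ℝ) (lam rho : ℝ[X]) (l : ℕ) : ℕ → ℝ
  | 0 => ∑ n ∈ Finset.range (l + 1), Gv ε lam rho l 0 n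
  | t + 1 => aa ε lam rho (t + 1) * (rr ε lam rho t * covLim ε lam rho l t
      + ∑ n ∈ Finset.range (l + 1), Gc ε lam rho l t n)
      + ∑ n ∈ Finset.range (l + 1), Gv ε lam rho l (t + 1) n

lemma tendsto_cov (hε : ε ∈ Set.Icc (0 : ℝ) 1) (hT : GoodSeq lam rho D T) (l t : ℕ) :
    Tendsto (fun k => cov ε (muR t) (muR l) (T k)) atTop (𝓝 (covLim ε lam rho l t)) := by
  induction t with
  | zero =>
    have h0 : Tendsto (fun k => cov ε (onEdge (etaR 0)) (muR l) (T k)) atTop (𝓝 0) := by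
      refine tendsto_const_nhds.congr fun k => (cov_deterministic _ _ _ ((T k).numEdges : ℝ) ?_).symm
      intro G w
      simp [tot, onEdge, etaR, constC, numEdges]
    have := tendsto_cov_muR hε hT l 0 h0
    rwa [mul_zero, zero_add] at this
  | succ t ih => exact tendsto_cov_muR hε hT l (t + 1) (tendsto_cov_etaR hε hT l t ih)

lemma messageVariance_eq (l : ℕ) (T : Degrees) (hN : 0 < T.numEdges) :
    T.messageVariance ε l = cov ε (muR l) (muR l) T * T.numEdges := by
  have hN' : (T.numEdges : ℝ) ≠ 0 := by exact_mod_cast hN.ne'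
  unfold messageVariance cov
  rw [div_mul_cancel₀ _ hN', numErased_eq_tot]
  unfold dev
  simp only [mul_sub, expect_sub, expect_mul_const]
  have e : T.expect ε (fun G w => tot (muR l) T G w) = T.expect ε (tot (muR l) T) := rfl
  rw [e, sq]
  simp only [sq]

/-- The variance of the number of erased messages converges. -/
lemma tendsto_messageVariance (hlam : IsEdgeDist lam) (hrho : IsEdgeDist rho)
    (hε : ε ∈ Set.Icc (0 : ℝ) 1) (l : ℕ) (hT : Realizes lam rho T) :
    Tendsto (fun k => (T k).messageVariance ε l / ((T k).n * avgDegree lam)) atTop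
      (𝓝 (covLim ε lam rho l l)) := by
  obtain ⟨⟨D, hD⟩, hr⟩ := hT.goodSeq hlam hrho
  have := (tendsto_cov hε hD l l).mul hr
  rw [mul_one] at this
  refine this.congr' ?_
  filter_upwards [hD.adm] with k hk
  rw [messageVariance_eq l (T k) hk.pos, mul_div_assoc]

end

end

end LDPC

/-! ### The limit of many iterations -/

namespace LDPC

noncomputable section

variable {ε : ℝ} {lam rho p : ℝ[X]}

/-! ### Polynomials with nonnegative coefficients -/

lemma eval_nonneg_of_coeff (hp : ∀ i, 0 ≤ p.coeff i) {x : ℝ} (hx : 0 ≤ x) : 0 ≤ p.eval x := by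
  rw [eval_eq_sum]
  exact Finset.sum_nonneg fun i _ => mul_nonneg (hp i) (pow_nonneg hx i)

lemma eval_le_eval_of_coeff (hp : ∀ i, 0 ≤ p.coeff i) {x z : ℝ} (hx : 0 ≤ x) (hxz : x ≤ z) :
    p.eval x ≤ p.eval z := by
  rw [eval_eq_sum, eval_eq_sum]
  exact Finset.sum_le_sum fun i _ => mul_le_mul_of_nonneg_left (pow_le_pow_left₀ hx hxz i) (hp i)

lemma coeff_derivative_nonneg (hp : ∀ i, 0 ≤ p.coeff i) (i : ℕ) : 0 ≤ (derivative p).coeff i := by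
  rw [coeff_derivative]
  have := hp (i + 1)
  positivity

lemma IsEdgeDist.eval_mem (hp : IsEdgeDist p) {x : ℝ} (hx : x ∈ Set.Icc (0 : ℝ) 1) :
    p.eval x ∈ Set.Icc (0 : ℝ) 1 :=
  ⟨eval_nonneg_of_coeff hp.1 hx.1, (eval_le_eval_of_coeff hp.1 hx.1 hx.2).trans hp.2.le⟩

lemma IsEdgeDist.eval_pos (hp : IsEdgeDist p) {x : ℝ} (hx : 0 < x) : 0 < p.eval x := by
  refine lt_of_le_of_ne (eval_nonneg_of_coeff hp.1 hx.le) fun h => ?_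
  have h0 : ∀ i ∈ p.support, p.coeff i * x ^ i = 0 := by
    rw [eval_eq_sum, Polynomial.sum, eq_comm] at h
    exact (Finset.sum_eq_zero_iff_of_nonneg fun i _ => mul_nonneg (hp.1 i) (pow_nonneg hx.le i)).1 h
  have h1 := hp.2
  rw [eval_eq_sum, Polynomial.sum, Finset.sum_eq_zero] at h1
  · exact zero_ne_one h1
  · intro i hi
    rcases mul_eq_zero.1 (h0 i hi) with h | h
    · rw [h, zero_mul]
    · exact absurd h (pow_pos hx i).ne'

/-! ### Density evolution -/

lemma mul_eval_mem (hlam : IsEdgeDist lam) (hε : ε ∈ Set.Icc (0 : ℝ) 1) {y : ℝ}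
    (hy : y ∈ Set.Icc (0 : ℝ) 1) : ε * lam.eval y ∈ Set.Icc (0 : ℝ) 1 := by
  have := hlam.eval_mem hy
  exact ⟨mul_nonneg hε.1 this.1, mul_le_one₀ hε.2 this.1 this.2⟩

lemma one_sub_mem {x : ℝ} (hx : x ∈ Set.Icc (0 : ℝ) 1) : 1 - x ∈ Set.Icc (0 : ℝ) 1 :=
  ⟨by linarith [hx.2], by linarith [hx.1]⟩

/-- The density evolution map is monotone. -/
lemma deMap_mono (hlam : IsEdgeDist lam) (hrho : IsEdgeDist rho) (hε : ε ∈ Set.Icc (0 : ℝ) 1)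
    {y z : ℝ} (hy : 0 ≤ y) (hyz : y ≤ z) (hz : z ≤ 1) :
    1 - rho.eval (1 - ε * lam.eval y) ≤ 1 - rho.eval (1 - ε * lam.eval z) := by
  have h1 : ε * lam.eval y ≤ ε * lam.eval z :=
    mul_le_mul_of_nonneg_left (eval_le_eval_of_coeff hlam.1 hy hyz) hε.1
  have h2 := (mul_eval_mem hlam hε ⟨hy.trans hyz, hz⟩).2
  have := eval_le_eval_of_coeff hrho.1 (x := 1 - ε * lam.eval z) (z := 1 - ε * lam.eval y)
    (by linarith) (by linarith)
  linarith

lemma deY_mem (hlam : IsEdgeDist lam) (hrho : IsEdgeDist rho) (hε : ε ∈ Set.Icc (0 : ℝ) 1) (t : ℕ) :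
    deY lam rho ε t ∈ Set.Icc (0 : ℝ) 1 := by
  induction t with
  | zero => exact ⟨zero_le_one, le_rfl⟩
  | succ t ih => exact one_sub_mem (hrho.eval_mem (one_sub_mem (mul_eval_mem hlam hε ih)))

lemma deX_mem (hlam : IsEdgeDist lam) (hrho : IsEdgeDist rho) (hε : ε ∈ Set.Icc (0 : ℝ) 1) (t : ℕ) :
    deX lam rho ε t ∈ Set.Icc (0 : ℝ) 1 :=
  mul_eval_mem hlam hε (deY_mem hlam hrho hε t)

lemma deY_antitone (hlam : IsEdgeDist lam) (hrho : IsEdgeDist rho) (hε : ε ∈ Set.Icc (0 : ℝ) 1) :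
    Antitone (deY lam rho ε) := by
  refine antitone_nat_of_succ_le fun t => ?_
  induction t with
  | zero => exact (deY_mem hlam hrho hε 1).2
  | succ t ih =>
    exact deMap_mono hlam hrho hε (deY_mem hlam hrho hε _).1 ih (deY_mem hlam hrho hε _).2

lemma deX_antitone (hlam : IsEdgeDist lam) (hrho : IsEdgeDist rho) (hε : ε ∈ Set.Icc (0 : ℝ) 1) :
    Antitone (deX lam rho ε) := fun _ _ h =>
  mul_le_mul_of_nonneg_left (eval_le_eval_of_coeff hlam.1 (deY_mem hlam hrho hε _).1
    (deY_antitone hlam hrho hε h)) hε.1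

lemma tendsto_deY (hlam : IsEdgeDist lam) (hrho : IsEdgeDist rho) (hε : ε ∈ Set.Icc (0 : ℝ) 1) :
    Tendsto (deY lam rho ε) atTop (𝓝 (limY lam rho ε)) :=
  tendsto_atTop_ciInf (deY_antitone hlam hrho hε)
    ⟨0, by rintro _ ⟨t, rfl⟩; exact (deY_mem hlam hrho hε t).1⟩

lemma tendsto_deX (hlam : IsEdgeDist lam) (hrho : IsEdgeDist rho) (hε : ε ∈ Set.Icc (0 : ℝ) 1) :
    Tendsto (deX lam rho ε) atTop (𝓝 (limX lam rho ε)) :=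
  ((lam.continuous.tendsto _).comp (tendsto_deY hlam hrho hε)).const_mul ε

lemma limY_le_deY (hlam : IsEdgeDist lam) (hrho : IsEdgeDist rho) (hε : ε ∈ Set.Icc (0 : ℝ) 1)
    (t : ℕ) : limY lam rho ε ≤ deY lam rho ε t :=
  (deY_antitone hlam hrho hε).le_of_tendsto (tendsto_deY hlam hrho hε) t

lemma limY_mem (hlam : IsEdgeDist lam) (hrho : IsEdgeDist rho) (hε : ε ∈ Set.Icc (0 : ℝ) 1) :
    limY lam rho ε ∈ Set.Icc (0 : ℝ) 1 :=
  isClosed_Icc.mem_of_tendsto (tendsto_deY hlam hrho hε) (.of_forall (deY_mem hlam hrho hε))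

lemma limX_mem (hlam : IsEdgeDist lam) (hrho : IsEdgeDist rho) (hε : ε ∈ Set.Icc (0 : ℝ) 1) :
    limX lam rho ε ∈ Set.Icc (0 : ℝ) 1 := mul_eval_mem hlam hε (limY_mem hlam hrho hε)

/-- The limit of density evolution is a fixed point. -/
lemma limY_eq (hlam : IsEdgeDist lam) (hrho : IsEdgeDist rho) (hε : ε ∈ Set.Icc (0 : ℝ) 1) :
    limY lam rho ε = 1 - rho.eval (1 - limX lam rho ε) := by
  refine tendsto_nhds_unique ((tendsto_add_atTop_iff_nat 1).2 (tendsto_deY hlam hrho hε)) ?_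
  exact ((rho.continuous.tendsto _).comp ((tendsto_deX hlam hrho hε).const_sub 1)).const_sub 1

lemma deGap_limY (hlam : IsEdgeDist lam) (hrho : IsEdgeDist rho) (hε : ε ∈ Set.Icc (0 : ℝ) 1) :
    deGap lam rho ε (limY lam rho ε) = 0 := by
  have := limY_eq hlam hrho hε
  unfold limX at this
  unfold deGap
  linarith

/-- Above the limit of density evolution there is no fixed point. -/
lemma deGap_pos (hlam : IsEdgeDist lam) (hrho : IsEdgeDist rho) (hε : ε ∈ Set.Icc (0 : ℝ) 1) {z : ℝ}
    (hz : limY lam rho ε < z) (hz1 : z ≤ 1) : 0 < deGap lam rho ε z := by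
  classical
  have hex : ∃ t, deY lam rho ε t < z :=
    ((tendsto_deY hlam hrho hε).eventually_lt_const hz).exists
  obtain ⟨t, ht⟩ : ∃ t, Nat.find hex = t + 1 := by
    refine Nat.exists_eq_succ_of_ne_zero fun h => ?_
    have := Nat.find_spec hex
    rw [h] at this
    exact absurd this (not_lt.2 hz1)
  have h1 : deY lam rho ε (t + 1) < z := ht ▸ Nat.find_spec hex
  have h2 : z ≤ deY lam rho ε t := not_lt.1 (Nat.find_min hex (by omega))
  have h3 := deMap_mono hlam hrho hε ((limY_mem hlam hrho hε).1.trans hz.le) h2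
    (deY_mem hlam hrho hε t).2
  have h4 : 1 - rho.eval (1 - ε * lam.eval (deY lam rho ε t)) = deY lam rho ε (t + 1) := rfl
  unfold deGap
  linarith

/-- Every fixed point is below the limit of density evolution. -/
lemma le_limY (hlam : IsEdgeDist lam) (hrho : IsEdgeDist rho) (hε : ε ∈ Set.Icc (0 : ℝ) 1) {z : ℝ}
    (hz1 : z ≤ 1) (hz : deGap lam rho ε z ≤ 0) : z ≤ limY lam rho ε := by
  by_contra! h
  exact absurd (deGap_pos hlam hrho hε h hz1) (not_lt.2 hz)

lemma hasDerivAt_deGap (lam rho : ℝ[X]) (ε y : ℝ) : HasDerivAt (deGap lam rho ε)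
    (1 - ε * (derivative lam).eval y * (derivative rho).eval (1 - ε * lam.eval y)) y := by
  have h1 : HasDerivAt (fun y => 1 - ε * lam.eval y) (-(ε * (derivative lam).eval y)) y :=
    ((lam.hasDerivAt y).const_mul ε).const_sub 1
  have h2 := (rho.hasDerivAt (1 - ε * lam.eval y)).comp y h1
  have h3 := ((hasDerivAt_id y).sub_const 1).add h2
  refine h3.congr_deriv ?_
  ring

/-- `gap` is the derivative of `deGap` at its zero `y`, and `deGap` is positive to the right of `y`.
The assumption `y < 1` leaves room there. -/
lemma gap_nonneg (hlam : IsEdgeDist lam) (hrho : IsEdgeDist rho) (hε : ε ∈ Set.Icc (0 : ℝ) 1)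
    (h1 : limY lam rho ε < 1) : 0 ≤ gap lam rho ε := by
  have h := (hasDerivAt_deGap lam rho ε (limY lam rho ε)).tendsto_slope
  have h' := h.mono_left (nhdsGT_le_nhdsNE _)
  refine ge_of_tendsto h' ?_
  filter_upwards [Ioo_mem_nhdsGT h1] with z hz
  rw [slope_def_field, deGap_limY hlam hrho hε, sub_zero]
  exact div_nonneg (deGap_pos hlam hrho hε hz.1 hz.2.le).le (sub_nonneg.2 hz.1.le)

end

end LDPC

namespace LDPC

noncomputable section

variable {ε : ℝ} {lam rho : ℝ[X]}

/-! ### Bounds for the responses -/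

section Bounds

/-- The response of a message to a perturbation `n` steps before, with the unperturbed term. -/
def uu (ε : ℝ) (lam rho : ℝ[X]) (l n : ℕ) : ℝ := unit0 n + jj ε lam rho l n

lemma uu_zero (ε : ℝ) (lam rho : ℝ[X]) (l : ℕ) : uu ε lam rho l 0 = 1 := by simp [uu, unit0, jj]

lemma uu_succ (ε : ℝ) (lam rho : ℝ[X]) (l n : ℕ) : uu ε lam rho l (n + 1)
    = rr ε lam rho (l - n - 1) * aa ε lam rho (l - n) * uu ε lam rho l n := by
  simp [uu, unit0, jj, mul_assoc]

lemma unit0_nonneg (n : ℕ) : 0 ≤ unit0 n := by unfold unit0; split_ifs <;> norm_num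

lemma jj_le_uu (ε : ℝ) (lam rho : ℝ[X]) (l n : ℕ) : jj ε lam rho l n ≤ uu ε lam rho l n :=
  le_add_of_nonneg_left (unit0_nonneg n)

lemma aa_nonneg (hlam : IsEdgeDist lam) (hrho : IsEdgeDist rho) (hε : ε ∈ Set.Icc (0 : ℝ) 1)
    (t : ℕ) : 0 ≤ aa ε lam rho t :=
  mul_nonneg hε.1 (eval_nonneg_of_coeff (coeff_derivative_nonneg hlam.1) (deY_mem hlam hrho hε t).1)

lemma aa_antitone (hlam : IsEdgeDist lam) (hrho : IsEdgeDist rho) (hε : ε ∈ Set.Icc (0 : ℝ) 1) :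
    Antitone (aa ε lam rho) := fun _ _ h =>
  mul_le_mul_of_nonneg_left (eval_le_eval_of_coeff (coeff_derivative_nonneg hlam.1)
    (deY_mem hlam hrho hε _).1 (deY_antitone hlam hrho hε h)) hε.1

lemma rr_nonneg (hlam : IsEdgeDist lam) (hrho : IsEdgeDist rho) (hε : ε ∈ Set.Icc (0 : ℝ) 1)
    (t : ℕ) : 0 ≤ rr ε lam rho t :=
  eval_nonneg_of_coeff (coeff_derivative_nonneg hrho.1) (one_sub_mem (deX_mem hlam hrho hε t)).1

lemma rr_monotone (hlam : IsEdgeDist lam) (hrho : IsEdgeDist rho) (hε : ε ∈ Set.Icc (0 : ℝ) 1) :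
    Monotone (rr ε lam rho) := fun _ _ h =>
  eval_le_eval_of_coeff (coeff_derivative_nonneg hrho.1) (one_sub_mem (deX_mem hlam hrho hε _)).1
    (by linarith [deX_antitone hlam hrho hε h])

lemma tendsto_aa (hlam : IsEdgeDist lam) (hrho : IsEdgeDist rho) (hε : ε ∈ Set.Icc (0 : ℝ) 1) :
    Tendsto (aa ε lam rho) atTop (𝓝 (ε * (derivative lam).eval (limY lam rho ε))) :=
  (((derivative lam).continuous.tendsto _).comp (tendsto_deY hlam hrho hε)).const_mul ε

lemma tendsto_rr (hlam : IsEdgeDist lam) (hrho : IsEdgeDist rho) (hε : ε ∈ Set.Icc (0 : ℝ) 1) :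
    Tendsto (rr ε lam rho) atTop (𝓝 ((derivative rho).eval (1 - limX lam rho ε))) :=
  ((derivative rho).continuous.tendsto _).comp ((tendsto_deX hlam hrho hε).const_sub 1)

lemma rr_le (hlam : IsEdgeDist lam) (hrho : IsEdgeDist rho) (hε : ε ∈ Set.Icc (0 : ℝ) 1)
    (t : ℕ) : rr ε lam rho t ≤ (derivative rho).eval (1 - limX lam rho ε) :=
  (rr_monotone hlam hrho hε).ge_of_tendsto (tendsto_rr hlam hrho hε) t

lemma jj_nonneg (hlam : IsEdgeDist lam) (hrho : IsEdgeDist rho) (hε : ε ∈ Set.Icc (0 : ℝ) 1)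
    (l n : ℕ) : 0 ≤ jj ε lam rho l n := by
  induction n with
  | zero => exact le_rfl
  | succ n ih =>
    exact mul_nonneg (rr_nonneg hlam hrho hε _) (mul_nonneg (aa_nonneg hlam hrho hε _)
      (add_nonneg (unit0_nonneg n) ih))

lemma uu_nonneg (hlam : IsEdgeDist lam) (hrho : IsEdgeDist rho) (hε : ε ∈ Set.Icc (0 : ℝ) 1)
    (l n : ℕ) : 0 ≤ uu ε lam rho l n :=
  add_nonneg (unit0_nonneg n) (jj_nonneg hlam hrho hε l n)

lemma gg_mem_of_hh_mem (hlam : IsEdgeDist lam) (hrho : IsEdgeDist rho)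
    (hε : ε ∈ Set.Icc (0 : ℝ) 1) {l n t : ℕ} (h0 : 0 ≤ hh ε lam rho l n t)
    (h1 : hh ε lam rho l n t ≤ jj ε lam rho l n) :
    gg ε lam rho l n t ∈ Set.Icc 0 (ii ε lam rho l n) := by
  have hy := deY_mem hlam hrho hε t
  have hv : 0 ≤ unit0 n * deY lam rho ε t + hh ε lam rho l n t :=
    add_nonneg (mul_nonneg (unit0_nonneg n) hy.1) h0
  refine ⟨mul_nonneg (aa_nonneg hlam hrho hε _) hv, ?_⟩
  exact mul_le_mul (aa_antitone hlam hrho hε (le_max_right _ _))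
    (add_le_add (mul_le_of_le_one_right (unit0_nonneg n) hy.2) h1) hv (aa_nonneg hlam hrho hε _)

/-- These are the bounds for the mean of `η · J` with `0 ≤ η ≤ 1`, derived from the recursion itself
by the monotonicity of density evolution. -/
lemma hh_mem (hlam : IsEdgeDist lam) (hrho : IsEdgeDist rho) (hε : ε ∈ Set.Icc (0 : ℝ) 1)
    (l n t : ℕ) : hh ε lam rho l n t ∈ Set.Icc 0 (jj ε lam rho l n) := by
  induction n generalizing t with
  | zero => exact ⟨le_rfl, le_rfl⟩
  | succ n ih =>
    rcases t with _ | t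
    · exact ⟨jj_nonneg hlam hrho hε _ _, le_rfl⟩
    · have hg := gg_mem_of_hh_mem hlam hrho hε (ih t).1 (ih t).2
      rw [hh_succ_succ]
      constructor
      · rw [jj_succ, sub_nonneg]
        exact mul_le_mul (rr_monotone hlam hrho hε (min_le_right _ _)) (sub_le_self _ hg.1)
          (sub_nonneg.2 hg.2) (rr_nonneg hlam hrho hε _)
      · exact sub_le_self _ (mul_nonneg (rr_nonneg hlam hrho hε _) (sub_nonneg.2 hg.2))

lemma gg_mem (hlam : IsEdgeDist lam) (hrho : IsEdgeDist rho) (hε : ε ∈ Set.Icc (0 : ℝ) 1)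
    (l n t : ℕ) : gg ε lam rho l n t ∈ Set.Icc 0 (ii ε lam rho l n) :=
  gg_mem_of_hh_mem hlam hrho hε (hh_mem hlam hrho hε l n t).1 (hh_mem hlam hrho hε l n t).2

/-- The responses decay geometrically. -/
lemma uu_le (hlam : IsEdgeDist lam) (hrho : IsEdgeDist rho) (hε : ε ∈ Set.Icc (0 : ℝ) 1)
    (hgap : 0 < gap lam rho ε) : ∃ K q : ℝ, 0 ≤ K ∧ 0 ≤ q ∧ q < 1 ∧
    ∀ l n, n ≤ l → uu ε lam rho l n ≤ K * q ^ n := by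
  set a := ε * (derivative lam).eval (limY lam rho ε) with ha
  set r := (derivative rho).eval (1 - limX lam rho ε) with hr
  have hra : a * r < 1 := by unfold gap at hgap; linarith
  have hr0 : 0 ≤ r := (rr_nonneg hlam hrho hε 0).trans (rr_le hlam hrho hε 0)
  have ha0 : 0 ≤ a := ge_of_tendsto' (tendsto_aa hlam hrho hε) (aa_nonneg hlam hrho hε)
  have hra0 : 0 ≤ a * r := mul_nonneg ha0 hr0
  -- Halfway between the limiting factor `a r = 1 - gap` and `1`, so the factor per step is below
  -- `q` from some iteration `N` on.
  set q := (1 + a * r) / 2 with hq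
  have hq0 : 0 < q := by linarith
  have hq1 : q < 1 := by linarith
  obtain ⟨N, hN⟩ := eventually_atTop.1 (((tendsto_aa hlam hrho hε).mul_const r).eventually_lt_const
    (show a * r < q by linarith))
  -- `M q` bounds the factor of any step. The exponent `N - (l - n)`, a truncated difference, bounds
  -- the number of steps taken at iterations before `N`, so the loss is at most `M ^ N`.
  set M := aa ε lam rho 0 * r / q + 1 with hM
  have hM1 : 1 ≤ M :=
    le_add_of_nonneg_left (div_nonneg (mul_nonneg (aa_nonneg hlam hrho hε _) hr0) hq0.le)
  have hstep : ∀ l n, rr ε lam rho (l - n - 1) * aa ε lam rho (l - n) ≤ aa ε lam rho (l - n) * r :=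
    fun l n => by
      rw [mul_comm]
      exact mul_le_mul_of_nonneg_left (rr_le hlam hrho hε _) (aa_nonneg hlam hrho hε _)
  have key : ∀ l n, n ≤ l → uu ε lam rho l n ≤ M ^ (N - (l - n)) * q ^ n := by
    intro l n
    induction n with
    | zero =>
      intro _
      rw [uu_zero, pow_zero, mul_one]
      exact one_le_pow₀ hM1
    | succ n ih =>
      intro hn
      have ih := ih (by omega)
      rw [uu_succ]
      by_cases h : N ≤ l - n
      · have hA : rr ε lam rho (l - n - 1) * aa ε lam rho (l - n) ≤ q :=
          (hstep l n).trans (hN _ h).le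
        calc _ ≤ q * (M ^ (N - (l - n)) * q ^ n) :=
              mul_le_mul hA ih (uu_nonneg hlam hrho hε _ _) hq0.le
          _ = M ^ (N - (l - n)) * q ^ (n + 1) := by ring
          _ ≤ _ := mul_le_mul_of_nonneg_right (pow_le_pow_right₀ hM1 (by omega))
              (pow_nonneg hq0.le _)
      · have hA : rr ε lam rho (l - n - 1) * aa ε lam rho (l - n) ≤ M * q := by
          refine (hstep l n).trans ?_
          have h1 : aa ε lam rho (l - n) * r ≤ aa ε lam rho 0 * r :=
            mul_le_mul_of_nonneg_right (aa_antitone hlam hrho hε (Nat.zero_le _)) hr0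
          have h2 : M * q = aa ε lam rho 0 * r + q := by
            rw [hM, add_mul, div_mul_cancel₀ _ hq0.ne', one_mul]
          linarith
        calc _ ≤ M * q * (M ^ (N - (l - n)) * q ^ n) :=
              mul_le_mul hA ih (uu_nonneg hlam hrho hε _ _) (by positivity)
          _ = M ^ (N - (l - n) + 1) * q ^ (n + 1) := by ring
          _ = _ := by rw [show N - (l - (n + 1)) = N - (l - n) + 1 by omega]
  refine ⟨M ^ N, q, by positivity, hq0.le, hq1, fun l n h => (key l n h).trans ?_⟩
  exact mul_le_mul_of_nonneg_right (pow_le_pow_right₀ hM1 (Nat.sub_le _ _)) (pow_nonneg hq0.le _)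

end Bounds

/-! ### Limits of the responses -/

section Limits

lemma tendsto_fst_sub (n : ℕ) :
    Tendsto (fun p : ℕ × ℕ => p.1 - n) (atTop ×ˢ atTop) atTop :=
  (tendsto_sub_atTop_nat n).comp tendsto_fst

lemma tendsto_max_snd (n : ℕ) :
    Tendsto (fun p : ℕ × ℕ => max p.2 (p.1 - n)) (atTop ×ˢ atTop) atTop :=
  tendsto_atTop_mono (fun _ => le_max_left _ _) tendsto_snd

lemma tendsto_min_snd {f g : ℕ × ℕ → ℕ} (hf : Tendsto f (atTop ×ˢ atTop) atTop)
    (hg : Tendsto g (atTop ×ˢ atTop) atTop) :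
    Tendsto (fun p => min (f p) (g p)) (atTop ×ˢ atTop) atTop := by
  rw [tendsto_atTop]
  intro b
  filter_upwards [hf.eventually_ge_atTop b, hg.eventually_ge_atTop b] with p h1 h2
  exact le_min h1 h2

/-- With `n` fixed, all iterations involved tend to infinity, and each step back contributes the
fixed-point factor `ε λ'(y) ρ'(1 - x) = 1 - gap`. -/
lemma tendsto_uu (hlam : IsEdgeDist lam) (hrho : IsEdgeDist rho) (hε : ε ∈ Set.Icc (0 : ℝ) 1)
    (n : ℕ) : Tendsto (fun p : ℕ × ℕ => uu ε lam rho p.1 n) (atTop ×ˢ atTop)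
    (𝓝 ((1 - gap lam rho ε) ^ n)) := by
  induction n with
  | zero => simpa only [uu_zero, pow_zero] using tendsto_const_nhds
  | succ n ih =>
    simp only [uu_succ]
    have h := (((tendsto_rr hlam hrho hε).comp (tendsto_fst_sub (n + 1))).mul
      ((tendsto_aa hlam hrho hε).comp (tendsto_fst_sub n))).mul ih
    have e : (1 - gap lam rho ε) ^ (n + 1) = (derivative rho).eval (1 - limX lam rho ε) *
        (ε * (derivative lam).eval (limY lam rho ε)) * (1 - gap lam rho ε) ^ n := by
      unfold gap; ring
    rw [e]
    exact h

lemma tendsto_jj (hlam : IsEdgeDist lam) (hrho : IsEdgeDist rho) (hε : ε ∈ Set.Icc (0 : ℝ) 1)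
    (n : ℕ) : Tendsto (fun p : ℕ × ℕ => jj ε lam rho p.1 n) (atTop ×ˢ atTop)
    (𝓝 ((1 - gap lam rho ε) ^ n - unit0 n)) := by
  refine ((tendsto_uu hlam hrho hε n).sub_const (unit0 n)).congr fun p => ?_
  unfold uu; ring

lemma tendsto_ii (hlam : IsEdgeDist lam) (hrho : IsEdgeDist rho) (hε : ε ∈ Set.Icc (0 : ℝ) 1)
    (n : ℕ) : Tendsto (fun p : ℕ × ℕ => ii ε lam rho p.1 n) (atTop ×ˢ atTop)
    (𝓝 (ε * (derivative lam).eval (limY lam rho ε) * (1 - gap lam rho ε) ^ n)) :=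
  ((tendsto_aa hlam hrho hε).comp (tendsto_fst_sub n)).mul (tendsto_uu hlam hrho hε n)

lemma tendsto_gg_of_hh (hlam : IsEdgeDist lam) (hrho : IsEdgeDist rho)
    (hε : ε ∈ Set.Icc (0 : ℝ) 1) {n : ℕ} (h : Tendsto (fun p : ℕ × ℕ => hh ε lam rho p.1 n p.2)
      (atTop ×ˢ atTop) (𝓝 (limY lam rho ε * ((1 - gap lam rho ε) ^ n - unit0 n)))) :
    Tendsto (fun p : ℕ × ℕ => gg ε lam rho p.1 n p.2) (atTop ×ˢ atTop)
      (𝓝 (limY lam rho ε * (ε * (derivative lam).eval (limY lam rho ε)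
        * (1 - gap lam rho ε) ^ n))) := by
  have h1 := ((tendsto_aa hlam hrho hε).comp (tendsto_max_snd n)).mul
    ((((tendsto_deY hlam hrho hε).comp (tendsto_snd (f := atTop) (g := atTop))).const_mul
      (unit0 n)).add h)
  rw [show ∀ y a u v : ℝ, y * (a * u) = a * (v * y + y * (u - v)) by intros; ring]
  exact h1

/-- Messages and responses become uncorrelated: the mean product tends to `y` times the mean
response. This form is preserved by the recursion, since `r i - r (i - y i) = y r i`. -/
lemma tendsto_hh (hlam : IsEdgeDist lam) (hrho : IsEdgeDist rho) (hε : ε ∈ Set.Icc (0 : ℝ) 1)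
    (n : ℕ) : Tendsto (fun p : ℕ × ℕ => hh ε lam rho p.1 n p.2) (atTop ×ˢ atTop)
    (𝓝 (limY lam rho ε * ((1 - gap lam rho ε) ^ n - unit0 n))) := by
  induction n with
  | zero => simp [hh, unit0]
  | succ n ih =>
    have hs : Tendsto (fun p : ℕ × ℕ => (p.1, p.2 - 1)) (atTop ×ˢ atTop) (atTop ×ˢ atTop) :=
      tendsto_fst.prodMk ((tendsto_sub_atTop_nat 1).comp tendsto_snd)
    have hg := (tendsto_gg_of_hh hlam hrho hε ih).comp hs
    have h := (tendsto_jj hlam hrho hε (n + 1)).sub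
      (((tendsto_rr hlam hrho hε).comp (tendsto_min_snd ((tendsto_sub_atTop_nat 1).comp tendsto_snd)
        (tendsto_fst_sub (n + 1)))).mul ((tendsto_ii hlam hrho hε n).sub hg))
    have e : limY lam rho ε * ((1 - gap lam rho ε) ^ (n + 1) - unit0 (n + 1))
        = (1 - gap lam rho ε) ^ (n + 1) - unit0 (n + 1)
          - (derivative rho).eval (1 - limX lam rho ε) * (ε * (derivative lam).eval (limY lam rho ε)
          * (1 - gap lam rho ε) ^ n - limY lam rho ε * (ε * (derivative lam).eval (limY lam rho ε)
        * (1 - gap lam rho ε) ^ n)) := by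
      have h0 : unit0 (n + 1) = 0 := by simp [unit0]
      have h1 : (1 - gap lam rho ε) ^ (n + 1) = (derivative rho).eval (1 - limX lam rho ε) *
        (ε * (derivative lam).eval (limY lam rho ε)) * (1 - gap lam rho ε) ^ n := by
        unfold gap; ring
      rw [h0, h1]
      ring
    rw [e]
    refine h.congr' ?_
    filter_upwards [tendsto_snd.eventually_ge_atTop 1] with p hp
    obtain ⟨t, ht⟩ : ∃ t, p.2 = t + 1 := ⟨p.2 - 1, by omega⟩
    simp only [Function.comp_apply, ht, hh_succ_succ, Nat.add_sub_cancel, Nat.sub_sub]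

lemma tendsto_gg (hlam : IsEdgeDist lam) (hrho : IsEdgeDist rho) (hε : ε ∈ Set.Icc (0 : ℝ) 1)
    (n : ℕ) : Tendsto (fun p : ℕ × ℕ => gg ε lam rho p.1 n p.2) (atTop ×ˢ atTop)
    (𝓝 (limY lam rho ε * (ε * (derivative lam).eval (limY lam rho ε)
      * (1 - gap lam rho ε) ^ n))) :=
  tendsto_gg_of_hh hlam hrho hε (tendsto_hh hlam hrho hε n)

end Limits

end

end LDPC

namespace LDPC

noncomputable section

variable {ε : ℝ} {lam rho : ℝ[X]}

/-! ### Sums of the source terms -/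

lemma abs_mul_le_mul {a b A B : ℝ} (ha : |a| ≤ A) (hb : |b| ≤ B) : |a * b| ≤ A * B := by
  rw [abs_mul]
  exact mul_le_mul ha hb (abs_nonneg _) ((abs_nonneg _).trans ha)

lemma abs_add_le_add {a b A B : ℝ} (ha : |a| ≤ A) (hb : |b| ≤ B) : |a + b| ≤ A + B :=
  (abs_add_le a b).trans (add_le_add ha hb)

lemma abs_sub_le_add {a b A B : ℝ} (ha : |a| ≤ A) (hb : |b| ≤ B) : |a - b| ≤ A + B :=
  (abs_sub a b).trans (add_le_add ha hb)

lemma abs_le_of_mem {x : ℝ} (hx : x ∈ Set.Icc (0 : ℝ) 1) : |x| ≤ 1 := by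
  rw [abs_of_nonneg hx.1]; exact hx.2

lemma abs_eval_le {p : ℝ[X]} (hp : ∀ i, 0 ≤ p.coeff i) {C x : ℝ} (hC : p.eval 1 ≤ C)
    (hx : x ∈ Set.Icc (0 : ℝ) 1) : |p.eval x| ≤ C := by
  rw [abs_of_nonneg (eval_nonneg_of_coeff hp hx.1)]
  exact (eval_le_eval_of_coeff hp hx.1 hx.2).trans hC

lemma mul_mem_Icc {x z : ℝ} (hx : x ∈ Set.Icc (0 : ℝ) 1) (hz : z ∈ Set.Icc (0 : ℝ) 1) :
    x * z ∈ Set.Icc (0 : ℝ) 1 := ⟨mul_nonneg hx.1 hz.1, mul_le_one₀ hx.2 hz.1 hz.2⟩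

section

/-- Every summand of the source carries a response or a correlation bounded by one, uniformly in
`t`; all other factors are bounded on `[0, 1]`. With the geometric decay of `uu` this supplies the
dominating series. -/
lemma abs_Gv_le (hlam : IsEdgeDist lam) (hrho : IsEdgeDist rho) (hε : ε ∈ Set.Icc (0 : ℝ) 1) :
    ∃ K : ℝ, ∀ l t n, |Gv ε lam rho l t n| ≤ K * uu ε lam rho l n := by
  set C := 1 + (derivative lam).eval 1 with hC
  have hd := coeff_derivative_nonneg hlam.1
  have hd0 : 0 ≤ (derivative lam).eval 1 := eval_nonneg_of_coeff hd zero_le_one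
  have hl : ∀ z ∈ Set.Icc (0 : ℝ) 1, |lam.eval z| ≤ C := fun z hz =>
    abs_eval_le hlam.1 (by rw [hlam.2]; linarith) hz
  have hl' : ∀ z ∈ Set.Icc (0 : ℝ) 1, |(derivative lam).eval z| ≤ C := fun z hz =>
    abs_eval_le hd (by linarith) hz
  have hY := deY_mem hlam hrho hε
  have he := abs_le_of_mem hε
  have ha : ∀ t, |aa ε lam rho t| ≤ 1 * C := fun t => abs_mul_le_mul he (hl' _ (hY t))
  have hy : ∀ t, |deY lam rho ε t| ≤ 1 := fun t => abs_le_of_mem (hY t)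
  refine ⟨_, fun l t n => (?_ : _ ≤ (4 * C + 2 * C ^ 2 + 3 * C) * _)⟩
  set u := uu ε lam rho l n with hu
  have hj : |jj ε lam rho l n| ≤ u := by
    rw [abs_of_nonneg (jj_nonneg hlam hrho hε l n)]; exact jj_le_uu ε lam rho l n
  have hu' : |unit0 n + jj ε lam rho l n| ≤ u := (abs_of_nonneg (uu_nonneg hlam hrho hε l n)).le
  have hh' := hh_mem hlam hrho hε l n t
  have hhh : |hh ε lam rho l n t| ≤ u := by
    rw [abs_of_nonneg hh'.1]; exact hh'.2.trans (jj_le_uu ε lam rho l n)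
  have hv : |unit0 n * deY lam rho ε t + hh ε lam rho l n t| ≤ u := by
    rw [abs_of_nonneg (add_nonneg (mul_nonneg (unit0_nonneg n) (hY t).1) hh'.1)]
    exact add_le_add (mul_le_of_le_one_right (unit0_nonneg n) (hY t).2) hh'.2
  have hi : |ii ε lam rho l n| ≤ 1 * C * u := abs_mul_le_mul (ha _) hu'
  have hz := mul_mem_Icc (hY t) (hY (l - n))
  have h1 : |(1 : ℝ)| ≤ 1 := abs_one.le
  unfold Gv
  refine (abs_sub_le_add (abs_sub_le_add (abs_mul_le_mul he (abs_add_le_add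
    (abs_mul_le_mul (abs_mul_le_mul h1 hu') (hl _ (hY _))) (abs_mul_le_mul h1
    (abs_mul_le_mul (abs_mul_le_mul (hy _) hv) (hl' _ (hY _))))))
    (abs_mul_le_mul he (abs_mul_le_mul he (abs_mul_le_mul hu' (abs_add_le_add (hl _ hz)
      (abs_mul_le_mul (abs_le_of_mem hz) (hl' _ hz)))))))
    (abs_mul_le_mul (ha t) (abs_add_le_add (abs_mul_le_mul hi (abs_sub_le_add (hy _)
      (abs_le_of_mem hz))) (abs_mul_le_mul (abs_le_of_mem (deX_mem hlam hrho hε _))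
      (abs_sub_le_add hhh (abs_mul_le_mul (hy t) hj)))))).trans ?_
  have hu0 : 0 ≤ u := uu_nonneg hlam hrho hε l n
  have : 0 ≤ C * u := by positivity
  nlinarith

lemma abs_Gk_le (hlam : IsEdgeDist lam) (hrho : IsEdgeDist rho) (hε : ε ∈ Set.Icc (0 : ℝ) 1) :
    ∃ K : ℝ, ∀ l t n, |Gk ε lam rho l t n| ≤ K * ii ε lam rho l n := by
  set C := 1 + (derivative rho).eval 1 with hC
  have hd := coeff_derivative_nonneg hrho.1
  have hd0 : 0 ≤ (derivative rho).eval 1 := eval_nonneg_of_coeff hd zero_le_one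
  have hl : ∀ z ∈ Set.Icc (0 : ℝ) 1, |rho.eval z| ≤ C := fun z hz =>
    abs_eval_le hrho.1 (by rw [hrho.2]; linarith) hz
  have hl' : ∀ z ∈ Set.Icc (0 : ℝ) 1, |(derivative rho).eval z| ≤ C := fun z hz =>
    abs_eval_le hd (by linarith) hz
  have hX := fun t => one_sub_mem (deX_mem hlam hrho hε t)
  have h1 : |(1 : ℝ)| ≤ 1 := abs_one.le
  refine ⟨_, fun l t n => (?_ : _ ≤ (8 * C) * _)⟩
  have hi0 : 0 ≤ ii ε lam rho l n :=
    mul_nonneg (aa_nonneg hlam hrho hε _) (uu_nonneg hlam hrho hε l n)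
  set i := ii ε lam rho l n with hidef
  have hi : |i| ≤ i := (abs_of_nonneg hi0).le
  have hg := gg_mem hlam hrho hε l n t
  have he : |i - gg ε lam rho l n t| ≤ i := by
    rw [abs_of_nonneg (sub_nonneg.2 hg.2)]; exact sub_le_self _ hg.1
  have hz1 : (1 - deX lam rho ε t) * 1 ∈ Set.Icc (0 : ℝ) 1 := by rw [mul_one]; exact hX t
  have hA := abs_add_le_add (abs_mul_le_mul (abs_mul_le_mul h1 hi) (hl _ (hX t)))
    (abs_mul_le_mul h1 (abs_mul_le_mul (abs_mul_le_mul h1 he) (hl' _ (hX t))))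
  have hA' := abs_mul_le_mul hi (abs_add_le_add (hl _ hz1)
    (abs_mul_le_mul (abs_le_of_mem hz1) (hl' _ hz1)))
  have hiC : 0 ≤ C * i := by positivity
  unfold Gk
  rcases l - n with _ | s
  · refine (abs_sub_le_add hA hA').trans ?_
    nlinarith
  · have hz := mul_mem_Icc (hX t) (hX s)
    refine (abs_sub_le_add (abs_sub_le_add hA (abs_add_le_add (abs_mul_le_mul
      (abs_mul_le_mul h1 hi) (hl _ (hX _))) (abs_mul_le_mul h1 (abs_mul_le_mul
      (abs_mul_le_mul (abs_le_of_mem (hX s)) he) (hl' _ (hX _))))))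
      (abs_sub_le_add hA' (abs_mul_le_mul hi (abs_add_le_add (hl _ hz)
      (abs_mul_le_mul (abs_le_of_mem hz) (hl' _ hz)))))).trans ?_
    nlinarith

lemma abs_Gc_le (hlam : IsEdgeDist lam) (hrho : IsEdgeDist rho) (hε : ε ∈ Set.Icc (0 : ℝ) 1) :
    ∃ K : ℝ, ∀ l t n, |Gc ε lam rho l t n| ≤ K * uu ε lam rho l n := by
  obtain ⟨K, hK⟩ := abs_Gk_le hlam hrho hε
  set A := aa ε lam rho 0 with hA
  set r := (derivative rho).eval (1 - limX lam rho ε) with hr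
  refine ⟨_, fun l t n => (?_ : _ ≤ (|K| * A + r * (2 * A + 2)) * _)⟩
  have hA0 : 0 ≤ A := aa_nonneg hlam hrho hε 0
  have hu0 := uu_nonneg hlam hrho hε l n
  set u := uu ε lam rho l n with hu
  have hi0 : 0 ≤ ii ε lam rho l n := mul_nonneg (aa_nonneg hlam hrho hε _) hu0
  have hi : ii ε lam rho l n ≤ A * u :=
    mul_le_mul_of_nonneg_right (aa_antitone hlam hrho hε (Nat.zero_le _)) hu0
  have hi' : |ii ε lam rho l n| ≤ A * u := by rwa [abs_of_nonneg hi0]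
  have hg := gg_mem hlam hrho hε l n t
  have hg' : |gg ε lam rho l n t| ≤ A * u := by rw [abs_of_nonneg hg.1]; exact hg.2.trans hi
  have hj : |jj ε lam rho l n| ≤ u := by
    rw [abs_of_nonneg (jj_nonneg hlam hrho hε l n)]; exact jj_le_uu ε lam rho l n
  have hG : |-Gk ε lam rho l t n| ≤ |K| * (A * u) := by
    rw [abs_neg]
    exact ((hK l t n).trans (mul_le_mul_of_nonneg_right (le_abs_self K) hi0)).trans
      (mul_le_mul_of_nonneg_left hi (abs_nonneg K))
  have hx := fun t => abs_le_of_mem (deX_mem hlam hrho hε t)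
  have hrr : |rr ε lam rho t| ≤ r := by
    rw [abs_of_nonneg (rr_nonneg hlam hrho hε t)]; exact rr_le hlam hrho hε t
  unfold Gc
  refine (abs_sub_le_add hG (abs_mul_le_mul hrr (abs_add_le_add (abs_mul_le_mul
    (abs_sub_le_add hg' (abs_mul_le_mul (hx t) hi')) (abs_le_of_mem (deY_mem hlam hrho hε _)))
    (abs_mul_le_mul (abs_sub_le_add (hx _) (abs_mul_le_mul (hx t) (hx _))) hj)))).trans ?_
  apply le_of_eq
  ring

/-- The source term at the variable nodes, at the fixed point. -/
lemma tendsto_Gv (hlam : IsEdgeDist lam) (hrho : IsEdgeDist rho) (hε : ε ∈ Set.Icc (0 : ℝ) 1)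
    (n : ℕ) : Tendsto (fun p : ℕ × ℕ => Gv ε lam rho p.1 p.2 n) (atTop ×ˢ atTop)
    (𝓝 (let y := limY lam rho ε
      let a := ε * (derivative lam).eval y
      (limX lam rho ε - ε ^ 2 * (lam.eval (y ^ 2) + y ^ 2 * (derivative lam).eval (y ^ 2))
        + y ^ 2 * a - a ^ 2 * y * (1 - y)) * (1 - gap lam rho ε) ^ n)) := by
  have hY := tendsto_deY hlam hrho hε
  have y1 := hY.comp (tendsto_snd (f := (atTop : Filter ℕ)) (g := (atTop : Filter ℕ)))
  have y2 := hY.comp (tendsto_fst_sub n)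
  have ym := hY.comp (tendsto_max_snd n)
  have x2 := (tendsto_deX hlam hrho hε).comp (tendsto_fst_sub n)
  have a1 := (tendsto_aa hlam hrho hε).comp (tendsto_snd (f := (atTop : Filter ℕ))
    (g := (atTop : Filter ℕ)))
  have hu := tendsto_uu hlam hrho hε n
  have hj := tendsto_jj hlam hrho hε n
  have hi := tendsto_ii hlam hrho hε n
  have hh := tendsto_hh hlam hrho hε n
  have ev : ∀ (p : ℝ[X]) {f : ℕ × ℕ → ℝ} {c : ℝ}, Tendsto f (atTop ×ˢ atTop) (𝓝 c) →
      Tendsto (fun q => p.eval (f q)) (atTop ×ˢ atTop) (𝓝 (p.eval c)) :=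
    fun p f c h => (p.continuous.tendsto c).comp h
  have z := y1.mul y2
  have h := (((((hu.const_mul 1).mul (ev lam ym)).add ((((y2.mul ((y1.const_mul (unit0 n)).add
    hh)).mul (ev (derivative lam) ym))).const_mul 1)).const_mul ε).sub
    (((hu.mul ((ev lam z).add (z.mul (ev (derivative lam) z)))).const_mul ε).const_mul ε)).sub
    (a1.mul ((hi.mul (ym.sub z)).add (x2.mul (hh.sub (y1.mul hj)))))
  refine Tendsto.congr' (EventuallyEq.refl _ _) (h.trans_eq ?_)
  congr 1
  unfold limX
  simp only [← sq]
  ring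

end

end

end LDPC

namespace LDPC

noncomputable section

variable {ε : ℝ} {lam rho : ℝ[X]}

section

lemma tendsto_Gk (hlam : IsEdgeDist lam) (hrho : IsEdgeDist rho) (hε : ε ∈ Set.Icc (0 : ℝ) 1)
    (n : ℕ) : Tendsto (fun p : ℕ × ℕ => Gk ε lam rho p.1 p.2 n) (atTop ×ˢ atTop)
    (𝓝 (let x := limX lam rho ε
      let r := (derivative rho).eval (1 - x)
      ((1 - limY lam rho ε) * r * x - (rho.eval (1 - x) + (1 - x) * r - rho.eval ((1 - x) ^ 2)
        - (1 - x) ^ 2 * (derivative rho).eval ((1 - x) ^ 2)))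
        * (ε * (derivative lam).eval (limY lam rho ε) * (1 - gap lam rho ε) ^ n))) := by
  have hX := (tendsto_deX hlam hrho hε).const_sub 1
  have x1 := hX.comp (tendsto_snd (f := (atTop : Filter ℕ)) (g := (atTop : Filter ℕ)))
  have x2 := hX.comp (tendsto_fst_sub (n + 1))
  have xm := hX.comp (tendsto_min_snd tendsto_snd (tendsto_fst_sub (n + 1)))
  have hi := tendsto_ii hlam hrho hε n
  have he := hi.sub (tendsto_gg hlam hrho hε n)
  have ev : ∀ (p : ℝ[X]) {f : ℕ × ℕ → ℝ} {c : ℝ}, Tendsto f (atTop ×ˢ atTop) (𝓝 c) →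
      Tendsto (fun q => p.eval (f q)) (atTop ×ˢ atTop) (𝓝 (p.eval c)) :=
    fun p f c h => (p.continuous.tendsto c).comp h
  have hA := ((hi.const_mul 1).mul (ev rho x1)).add
    (((he.const_mul 1).mul (ev (derivative rho) x1)).const_mul 1)
  have hA' := hi.mul ((ev rho (x1.mul_const 1)).add
    ((x1.mul_const 1).mul (ev (derivative rho) (x1.mul_const 1))))
  have z := x1.mul x2
  have h := (hA.sub (((hi.const_mul 1).mul (ev rho xm)).add
      (((x2.mul he).mul (ev (derivative rho) xm)).const_mul 1))).sub
    (hA'.sub (hi.mul ((ev rho z).add (z.mul (ev (derivative rho) z)))))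
  refine Tendsto.congr' ?_ (h.trans_eq ?_)
  · filter_upwards [tendsto_fst.eventually_ge_atTop (n + 1)] with p hp
    obtain ⟨s, hs⟩ : ∃ s, p.1 - n = s + 1 := ⟨p.1 - n - 1, by omega⟩
    have hs' : p.1 - (n + 1) = s := by omega
    unfold Gk
    simp only [hs, Function.comp_apply, hs']
  · congr 1
    simp only [← sq, mul_one, one_mul]
    ring

lemma tendsto_Gc (hlam : IsEdgeDist lam) (hrho : IsEdgeDist rho) (hε : ε ∈ Set.Icc (0 : ℝ) 1)
    (n : ℕ) : Tendsto (fun p : ℕ × ℕ => Gc ε lam rho p.1 p.2 n) (atTop ×ˢ atTop)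
    (𝓝 (let x := limX lam rho ε
      let y := limY lam rho ε
      let r := (derivative rho).eval (1 - x)
      let a := ε * (derivative lam).eval y
      a * (rho.eval (1 - x) + (1 - x) * r - rho.eval ((1 - x) ^ 2)
        - (1 - x) ^ 2 * (derivative rho).eval ((1 - x) ^ 2) - (1 - y) * r * x - r * y * (y - x))
        * (1 - gap lam rho ε) ^ n
        - r * x * (1 - x) * ((1 - gap lam rho ε) ^ n - unit0 n))) := by
  have hY := tendsto_deY hlam hrho hε
  have hX := tendsto_deX hlam hrho hε
  have ts := tendsto_snd (f := (atTop : Filter ℕ)) (g := (atTop : Filter ℕ))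
  have h := (tendsto_Gk hlam hrho hε n).neg.sub (((tendsto_rr hlam hrho hε).comp ts).mul
    ((((tendsto_gg hlam hrho hε n).sub ((hX.comp ts).mul (tendsto_ii hlam hrho hε n))).mul
      (hY.comp (tendsto_fst_sub n))).add (((hX.comp (tendsto_max_snd n)).sub
      ((hX.comp ts).mul (hX.comp (tendsto_fst_sub n)))).mul (tendsto_jj hlam hrho hε n))))
  refine Tendsto.congr' (EventuallyEq.refl _ _) (h.trans_eq ?_)
  congr 1
  simp only
  ring

end

/-- Dominated convergence for sums of growing length. -/
lemma tendsto_sum_range {G : ℕ → ℕ → ℕ → ℝ} {c : ℕ → ℝ} {K q s : ℝ} (hq0 : 0 ≤ q) (hq1 : q < 1)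
    (hK : 0 ≤ K) (hG : ∀ l t n, n ≤ l → |G l t n| ≤ K * q ^ n)
    (hlim : ∀ n, Tendsto (fun p : ℕ × ℕ => G p.1 p.2 n) (atTop ×ˢ atTop) (𝓝 (c n)))
    (hs : HasSum c s) :
    Tendsto (fun p : ℕ × ℕ => ∑ n ∈ Finset.range (p.1 + 1), G p.1 p.2 n) (atTop ×ˢ atTop) (𝓝 s) ∧
      ∀ l t, |∑ n ∈ Finset.range (l + 1), G l t n| ≤ K / (1 - q) := by
  have hsum : HasSum (fun n => K * q ^ n) (K * (1 - q)⁻¹) :=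
    (hasSum_geometric_of_lt_one hq0 hq1).mul_left K
  constructor
  · have h := tendsto_tsum_of_dominated_convergence (𝓕 := (atTop ×ˢ atTop : Filter (ℕ × ℕ)))
      (f := fun p n => if n ≤ p.1 then G p.1 p.2 n else 0) hsum.summable (g := c)
      (fun n => (hlim n).congr' (by
        filter_upwards [tendsto_fst.eventually_ge_atTop n] with p hp
        rw [if_pos hp]))
      (Eventually.of_forall fun p n => by
        split_ifs with hn
        · exact hG _ _ _ hn
        · rw [norm_zero]; positivity)
    rw [hs.tsum_eq] at h
    refine h.congr fun p => ?_
    rw [tsum_eq_sum (s := Finset.range (p.1 + 1))]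
    · exact Finset.sum_congr rfl fun n hn => if_pos (Nat.lt_succ_iff.1 (Finset.mem_range.1 hn))
    · intro n hn
      exact if_neg fun h => hn (Finset.mem_range.2 (Nat.lt_succ_of_le h))
  · intro l t
    refine (Finset.abs_sum_le_sum_abs _ _).trans ((Finset.sum_le_sum fun n hn =>
      hG l t n (Nat.lt_succ_iff.1 (Finset.mem_range.1 hn))).trans ?_)
    rw [div_eq_mul_inv, ← hsum.tsum_eq]
    exact hsum.summable.sum_le_tsum _ fun n _ => by positivity

/-- The diagonal limit of a family of perturbed linear recursions that contract eventually. -/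
lemma tendsto_diag_of_contraction {c B : ℕ → ℕ → ℝ} {A : ℕ → ℝ} {a b M : ℝ}
    (hc : ∀ l t, c l (t + 1) = A t * c l t + B l t) (h0 : ∀ l, |c l 0| ≤ M)
    (hA : Tendsto A atTop (𝓝 a)) (ha : |a| < 1)
    (hB : Tendsto (fun p : ℕ × ℕ => B p.1 p.2) (atTop ×ˢ atTop) (𝓝 b)) (hM : ∀ l t, |B l t| ≤ M) :
    Tendsto (fun l => c l l) atTop (𝓝 (b / (1 - a))) := by
  have h1a : 1 - a ≠ 0 := by have := (abs_lt.1 ha).2; linarith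
  set s := b / (1 - a) with hs
  have hsb : a * s + b - s = 0 := by
    have : s * (1 - a) = b := div_mul_cancel₀ _ h1a
    linarith
  -- Each column is bounded uniformly in `l`. This is needed because the first `N` steps need not
  -- contract, while `l` is sent to infinity along the diagonal.
  have hbd : ∀ t, ∃ C, ∀ l, |c l t| ≤ C := by
    intro t
    induction t with
    | zero => exact ⟨M, h0⟩
    | succ t ih =>
      obtain ⟨C, hC⟩ := ih
      exact ⟨_, fun l => hc l t ▸ abs_add_le_add (abs_mul_le_mul le_rfl (hC l)) (hM l t)⟩
  set q := (1 + |a|) / 2 with hq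
  have hq0 : 0 ≤ q := by positivity
  have hq1 : q < 1 := by linarith
  have hB' : Tendsto (fun p : ℕ × ℕ => |A p.2 * s + B p.1 p.2 - s|) (atTop ×ˢ atTop) (𝓝 0) := by
    rw [← abs_zero, ← hsb]
    exact ((((hA.comp tendsto_snd).mul_const s).add hB).sub_const s).abs
  rw [Metric.tendsto_atTop]
  intro η hη
  have e1 : ∀ᶠ p : ℕ × ℕ in atTop ×ˢ atTop, |A p.2 * s + B p.1 p.2 - s| < η / 2 * (1 - q) :=
    hB'.eventually_lt_const (mul_pos (half_pos hη) (sub_pos.2 hq1))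
  have e2 : ∀ᶠ p : ℕ × ℕ in atTop ×ˢ atTop, |A p.2| < q :=
    (hA.abs.comp tendsto_snd).eventually_lt_const (show |a| < q by linarith)
  rw [prod_atTop_atTop_eq] at e1 e2
  obtain ⟨⟨N1, N2⟩, hN⟩ := eventually_atTop.1 (e1.and e2)
  set N := max N1 N2 with hNdef
  have hN' : ∀ l t, N ≤ l → N ≤ t → |A t * s + B l t - s| < η / 2 * (1 - q) ∧ |A t| < q :=
    fun l t hl ht => hN (l, t) ⟨(le_max_left _ _).trans hl, (le_max_right _ _).trans ht⟩
  obtain ⟨C, hC⟩ := hbd N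
  -- From column `N` on, the distance to the fixed point `s` shrinks by `q` per step, and errors
  -- below `(η/2)(1 - q)` accumulate to at most `η/2`.
  have key : ∀ l, N ≤ l → ∀ k, |c l (N + k) - s| ≤ q ^ k * (C + |s|) + η / 2 := by
    intro l hl k
    induction k with
    | zero =>
      have := abs_sub_le_add (hC l) (le_refl |s|)
      rw [add_zero, pow_zero, one_mul]
      linarith
    | succ k ih =>
      have h := hN' l (N + k) hl (Nat.le_add_right _ _)
      have e : c l (N + (k + 1)) - s
          = A (N + k) * (c l (N + k) - s) + (A (N + k) * s + B l (N + k) - s) := by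
        rw [← add_assoc, hc]; ring
      rw [e]
      refine (abs_add_le_add (abs_mul_le_mul h.2.le ih) h.1.le).trans (le_of_eq ?_)
      ring
  have hpow : Tendsto (fun k => q ^ k * (C + |s|)) atTop (𝓝 0) := by
    have := (tendsto_pow_atTop_nhds_zero_of_lt_one hq0 hq1).mul_const (C + |s|)
    rwa [zero_mul] at this
  obtain ⟨k₀, hk₀⟩ := eventually_atTop.1 (hpow.eventually_lt_const (half_pos hη))
  refine ⟨N + k₀, fun l hl => ?_⟩
  obtain ⟨k, rfl⟩ : ∃ k, l = N + k := ⟨l - N, by omega⟩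
  rw [Real.dist_eq]
  have := key (N + k) (Nat.le_add_right _ _) k
  have := hk₀ k (by omega)
  linarith

section

/-- Dominated convergence sums the sources, with `∑ (1 - δ)^n = 1/δ`. The recursion has limiting
slope `a r = 1 - δ`, so the diagonal limit divides by `δ` once more; the rest is algebra. -/
lemma tendsto_covLim_of_gap_pos (hlam : IsEdgeDist lam) (hrho : IsEdgeDist rho)
    (hε : ε ∈ Set.Icc (0 : ℝ) 1) (hgap : 0 < gap lam rho ε) :
    Tendsto (fun l => covLim ε lam rho l l) atTop (𝓝 (limitVariance lam rho ε)) := by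
  set y := limY lam rho ε with hy
  set x := limX lam rho ε with hx
  set a := ε * (derivative lam).eval y with ha
  set r := (derivative rho).eval (1 - x) with hr
  set δ := gap lam rho ε with hδ
  have hδ' : δ = 1 - a * r := rfl
  have ha0 : 0 ≤ a := ge_of_tendsto' (tendsto_aa hlam hrho hε) (aa_nonneg hlam hrho hε)
  have hr0 : 0 ≤ r := (rr_nonneg hlam hrho hε 0).trans (rr_le hlam hrho hε 0)
  have hra0 : 0 ≤ a * r := mul_nonneg ha0 hr0
  obtain ⟨K, q, hK, hq0, hq1, hu⟩ := uu_le hlam hrho hε hgap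
  obtain ⟨Kv, hKv⟩ := abs_Gv_le hlam hrho hε
  obtain ⟨Kc, hKc⟩ := abs_Gc_le hlam hrho hε
  have dom : ∀ {G : ℕ → ℕ → ℕ → ℝ} {L : ℝ}, (∀ l t n, |G l t n| ≤ L * uu ε lam rho l n) →
      ∀ l t n, n ≤ l → |G l t n| ≤ |L| * K * q ^ n := by
    intro G L h l t n hn
    rw [mul_assoc]
    exact (h l t n).trans (mul_le_mul (le_abs_self L) (hu l n hn) (uu_nonneg hlam hrho hε l n)
      (abs_nonneg L))
  have geo : HasSum (fun n => (1 - δ) ^ n) δ⁻¹ := by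
    have := hasSum_geometric_of_lt_one (r := 1 - δ) (by linarith) (by linarith)
    rwa [sub_sub_cancel] at this
  have hone : HasSum unit0 1 := hasSum_ite_eq 0 1
  obtain ⟨sv, bv⟩ := tendsto_sum_range hq0 hq1 (by positivity) (dom hKv)
    (tendsto_Gv hlam hrho hε) (geo.mul_left _)
  obtain ⟨sc, bc⟩ := tendsto_sum_range hq0 hq1 (by positivity) (dom hKc)
    (tendsto_Gc hlam hrho hε) ((geo.mul_left _).sub ((geo.sub hone).mul_left _))
  have hA : Tendsto (fun t => aa ε lam rho (t + 1) * rr ε lam rho t) atTop (𝓝 (a * r)) :=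
    ((tendsto_add_atTop_iff_nat 1).2 (tendsto_aa hlam hrho hε)).mul (tendsto_rr hlam hrho hε)
  have shift : Tendsto (fun p : ℕ × ℕ => (p.1, p.2 + 1)) (atTop ×ˢ atTop) (atTop ×ˢ atTop) :=
    tendsto_fst.prodMk ((tendsto_add_atTop_nat 1).comp tendsto_snd)
  have hB := ((((tendsto_add_atTop_iff_nat 1).2 (tendsto_aa hlam hrho hε)).comp
    (tendsto_snd (f := (atTop : Filter ℕ)))).mul sc).add (sv.comp shift)
  have haa : ∀ t, |aa ε lam rho t| ≤ aa ε lam rho 0 := fun t => by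
    rw [abs_of_nonneg (aa_nonneg hlam hrho hε t)]
    exact aa_antitone hlam hrho hε (Nat.zero_le t)
  have hlast := tendsto_diag_of_contraction (c := covLim ε lam rho)
    (M := aa ε lam rho 0 * (|Kc| * K / (1 - q)) + |Kv| * K / (1 - q))
    (B := fun l t => aa ε lam rho (t + 1) * ∑ n ∈ Finset.range (l + 1), Gc ε lam rho l t n
      + ∑ n ∈ Finset.range (l + 1), Gv ε lam rho l (t + 1) n)
    (A := fun t => aa ε lam rho (t + 1) * rr ε lam rho t)
    (fun l t => by rw [covLim]; ring)
    (fun l => (bv l 0).trans (le_add_of_nonneg_left (mul_nonneg (aa_nonneg hlam hrho hε 0)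
      (div_nonneg (by positivity) (by linarith)))))
    hA (by rw [abs_of_nonneg hra0]; linarith) hB
    (fun l t => abs_add_le_add (abs_mul_le_mul (haa _) (bc l t)) (bv l (t + 1)))
  refine hlast.trans_eq ?_
  congr 1
  -- The closed form contains `ρ(1 - x)`, the computed limit contains `y`; the fixed-point equation
  -- identifies them.
  have hfix := limY_eq hlam hrho hε
  rw [← hy, ← hx] at hfix
  have hP : rho.eval (1 - x) = 1 - y := by linarith
  have hδ0 : δ ≠ 0 := hgap.ne'
  rw [← hδ']
  unfold limitVariance leadingCoeff
  simp only [← hy, ← hx, ← hδ, ← ha, ← hr, hP]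
  have hxl : ε * lam.eval y = x := rfl
  rw [show ε ^ 2 * lam.eval y ^ 2 = x ^ 2 by rw [← hxl]; ring,
    show ε ^ 2 * (derivative lam).eval y ^ 2 = a ^ 2 by rw [ha]; ring,
    show ε * y ^ 2 * (derivative lam).eval y = y ^ 2 * a by rw [ha]; ring]
  have har : a * r = 1 - δ := by linarith
  generalize ρ₂ : rho.eval ((1 - x) ^ 2) = P2
  generalize ρ₃ : (derivative rho).eval ((1 - x) ^ 2) = P3
  generalize ρ₄ : lam.eval (y ^ 2) = P4
  generalize ρ₅ : (derivative lam).eval (y ^ 2) = P5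
  clear_value δ
  subst hδ'
  field_simp
  ring

/-- The fixed-point equation at `y = 1` reads `ρ(1 - ε) = 0`, and `ρ` is positive at positive
arguments. -/
lemma eq_one_of_limY_eq_one (hlam : IsEdgeDist lam) (hrho : IsEdgeDist rho)
    (hε : ε ∈ Set.Icc (0 : ℝ) 1) (h : limY lam rho ε = 1) : ε = 1 ∧ rho.eval 0 = 0 := by
  have hx : limX lam rho ε = ε := by unfold limX; rw [h, hlam.2, mul_one]
  have h1 := limY_eq hlam hrho hε
  rw [h, hx] at h1
  have h2 : ε = 1 := by
    by_contra hne
    have := hrho.eval_pos (x := 1 - ε) (sub_pos.2 (lt_of_le_of_ne hε.2 hne))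
    linarith
  rw [h2, sub_self] at h1
  exact ⟨h2, by linarith⟩

/-- If density evolution does not move, the covariances vanish. -/
lemma covLim_eq_zero (hlam : IsEdgeDist lam) (hrho : IsEdgeDist rho) (hε : ε ∈ Set.Icc (0 : ℝ) 1)
    (h : limY lam rho ε = 1) (l t : ℕ) : covLim ε lam rho l t = 0 := by
  obtain ⟨rfl, h0⟩ := eq_one_of_limY_eq_one hlam hrho hε h
  have hY : ∀ t, deY lam rho 1 t = 1 := fun t =>
    le_antisymm (deY_mem hlam hrho hε t).2 (h.symm.le.trans (limY_le_deY hlam hrho hε t))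
  have hX : ∀ t, deX lam rho 1 t = 1 := fun t => by unfold deX; rw [hY, hlam.2, one_mul]
  have haa : ∀ s t, aa 1 lam rho s = aa 1 lam rho t := fun s t => by unfold aa; rw [hY, hY]
  have hgh : ∀ l n t, hh 1 lam rho l n t = jj 1 lam rho l n →
      gg 1 lam rho l n t = ii 1 lam rho l n := fun l n t e => by
    unfold gg ii; rw [e, hY, mul_one, haa]
  have hhj : ∀ l n t, hh 1 lam rho l n t = jj 1 lam rho l n := by
    intro l n
    induction n with
    | zero => exact fun _ => rfl
    | succ n ih =>
      rintro (_ | t)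
      · rfl
      · rw [hh_succ_succ, hgh l n t (ih t), sub_self, mul_zero, sub_zero]
  have hg := fun l n t => hgh l n t (hhj l n t)
  have hGv : ∀ l t n, Gv 1 lam rho l t n = 0 := by
    intro l t n
    simp only [Gv, hY, hX, hhj, mul_one]
    ring
  have hGk : ∀ l t n, Gk 1 lam rho l t n = 0 := by
    intro l t n
    unfold Gk
    rcases l - n with _ | s <;> simp [hX, hg, h0]
  have hGc : ∀ l t n, Gc 1 lam rho l t n = 0 := by
    intro l t n
    simp [Gc, hGk, hX, hg, hY]
  induction t with
  | zero => simp [covLim, hGv]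
  | succ t ih => simp [covLim, hGv, hGc, ih]

/-- At `ε = x = y = 1` and `ρ(0) = 0` the leading numerator is `λ'(1)² ρ'(0) δ` and the other one is
`-λ'(1)² ρ'(0)`; the two fractions cancel. -/
lemma limitVariance_eq_zero (hlam : IsEdgeDist lam) (hrho : IsEdgeDist rho)
    (hε : ε ∈ Set.Icc (0 : ℝ) 1) (h : limY lam rho ε = 1) (hgap : gap lam rho ε ≠ 0) :
    limitVariance lam rho ε = 0 := by
  obtain ⟨rfl, h0⟩ := eq_one_of_limY_eq_one hlam hrho hε h
  have hx : limX lam rho 1 = 1 := by unfold limX; rw [h, hlam.2, mul_one]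
  have hδ : gap lam rho 1 = 1 - (derivative lam).eval 1 * (derivative rho).eval 0 := by
    unfold gap; rw [h, hx, sub_self, one_mul]
  unfold limitVariance leadingCoeff
  simp only [h, hx, hlam.2, sub_self, h0, one_pow, zero_pow two_ne_zero]
  rw [hδ] at hgap ⊢
  field_simp
  ring

/-- The variance converges as the number of iterations grows. -/
theorem tendsto_covLim (hlam : IsEdgeDist lam) (hrho : IsEdgeDist rho)
    (hε : ε ∈ Set.Icc (0 : ℝ) 1) (hgap : gap lam rho ε ≠ 0) :
    Tendsto (fun l => covLim ε lam rho l l) atTop (𝓝 (limitVariance lam rho ε)) := by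
  -- For `y < 1` a nonzero `gap` is positive. A negative `gap` can occur only for `y = 1`, where
  -- both sides vanish.
  rcases (limY_mem hlam hrho hε).2.lt_or_eq with h | h
  · exact tendsto_covLim_of_gap_pos hlam hrho hε
      (lt_of_le_of_ne (gap_nonneg hlam hrho hε h) hgap.symm)
  · simp only [covLim_eq_zero hlam hrho hε h, limitVariance_eq_zero hlam hrho hε h hgap]
    exact tendsto_const_nhds

end

end

end LDPC

/-! ### Expansion above the threshold -/

namespace LDPC

noncomputable section

variable {ε : ℝ} {lam rho : ℝ[X]}

/-! ### Density evolution near the threshold -/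

/-- The function `deGap` as a polynomial. -/
def deGapPoly (lam rho : ℝ[X]) (ε : ℝ) : ℝ[X] := X - 1 + rho.comp (1 - C ε * lam)

lemma deGap_eq_eval (lam rho : ℝ[X]) (ε : ℝ) :
    deGap lam rho ε = fun y => (deGapPoly lam rho ε).eval y := by
  funext y
  simp [deGap, deGapPoly]

/-- A double root of a polynomial can be split off. -/
lemma exists_eq_sq_mul {H : ℝ[X]} {z : ℝ} (h0 : H.eval z = 0) (h1 : (derivative H).eval z = 0) :
    ∃ Q : ℝ[X], H = (X - C z) ^ 2 * Q := by
  obtain ⟨R, hR⟩ := dvd_iff_isRoot.2 h0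
  have hR0 : R.eval z = 0 := by
    rw [hR, derivative_mul] at h1
    simpa using h1
  obtain ⟨Q, hQ⟩ := dvd_iff_isRoot.2 hR0
  exact ⟨Q, by rw [hR, hQ]; ring⟩

lemma convex_eval_le {p : ℝ[X]} (hp : ∀ i, 0 ≤ p.coeff i) {a b : ℝ} (ha : 0 ≤ a) (hab : a ≤ b) :
    (derivative p).eval a * (b - a) ≤ p.eval b - p.eval a := by
  rcases hab.eq_or_lt with rfl | hab
  · simp
  obtain ⟨c, hc, h⟩ := exists_hasDerivAt_eq_slope (fun x => p.eval x)
    (fun x => (derivative p).eval x) hab p.continuous.continuousOn fun x _ => p.hasDerivAt x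
  have := eval_le_eval_of_coeff (coeff_derivative_nonneg hp) ha hc.1.le
  rw [h, le_div_iff₀ (sub_pos.2 hab)] at this
  exact this

lemma continuous_deY (lam rho : ℝ[X]) (t : ℕ) : Continuous fun ε => deY lam rho ε t := by
  induction t with
  | zero => exact continuous_const
  | succ t ih =>
    exact continuous_const.sub (rho.continuous.comp
      (continuous_const.sub (continuous_id.mul (lam.continuous.comp ih))))

lemma deGap_anti (hlam : IsEdgeDist lam) (hrho : IsEdgeDist rho) {ε' y : ℝ} (hε : ε ≤ ε')
    (hε' : ε' ∈ Set.Icc (0 : ℝ) 1) (hy : y ∈ Set.Icc (0 : ℝ) 1) :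
    deGap lam rho ε' y ≤ deGap lam rho ε y := by
  have h1 := mul_le_mul_of_nonneg_right hε (hlam.eval_mem hy).1
  have h2 := (mul_eval_mem hlam hε' hy).2
  have := eval_le_eval_of_coeff hrho.1 (x := 1 - ε' * lam.eval y) (z := 1 - ε * lam.eval y)
    (by linarith) (by linarith)
  unfold deGap
  linarith

lemma threshold_nonneg (lam rho : ℝ[X]) : 0 ≤ threshold lam rho :=
  Real.sSup_nonneg fun _ h => h.1.1

/-- Below the threshold, and hence at the threshold, `deGap` is nonnegative. -/
lemma deGap_threshold_nonneg (hlam : IsEdgeDist lam) (hrho : IsEdgeDist rho)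
    (h0 : 0 < threshold lam rho) {y : ℝ} (hy : y ∈ Set.Ioc (0 : ℝ) 1) :
    0 ≤ deGap lam rho (threshold lam rho) y := by
  set S := {ε : ℝ | ε ∈ Set.Icc (0 : ℝ) 1 ∧ ∀ y ∈ Set.Ioc (0 : ℝ) 1, 0 < rOne lam rho ε y} with hS
  -- The supremum of the empty set is `0` by convention, so a positive threshold excludes it.
  have hne : S.Nonempty := by
    rw [Set.nonempty_iff_ne_empty]
    intro h
    have : threshold lam rho = 0 := by
      change sSup S = 0
      rw [h, Real.sSup_empty]
    exact h0.ne' this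
  have hcont : Continuous fun ε => deGap lam rho ε y := by
    unfold deGap
    exact continuous_const.add (rho.continuous.comp (by fun_prop))
  have hev : ∀ ε < threshold lam rho, 0 ≤ deGap lam rho ε y := by
    intro ε hε
    obtain ⟨ε', hε', hlt⟩ := exists_lt_of_lt_csSup hne hε
    have hpos : 0 ≤ deGap lam rho ε' y := by
      have h := hε'.2 y hy
      unfold rOne at h
      exact (pos_of_mul_pos_right h (mul_eval_mem hlam hε'.1 ⟨hy.1.le, hy.2⟩).1).le
    exact hpos.trans (deGap_anti hlam hrho hlt.le hε'.1 ⟨hy.1.le, hy.2⟩)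
  refine ge_of_tendsto ((hcont.tendsto _).mono_left
    (nhdsWithin_le_nhds (s := Set.Iio (threshold lam rho)))) ?_
  filter_upwards [self_mem_nhdsWithin] with ε hε using hev ε hε

section Critical

/-- At `ε = 0` the derivative of `deGap` is identically `1`, so there is no critical point. -/
lemma threshold_pos {ystar : ℝ} (hcrit : IsCriticalPoint lam rho ystar) :
    0 < threshold lam rho := by
  refine lt_of_le_of_ne (threshold_nonneg lam rho) fun h => ?_
  have := hcrit.2.2
  rw [(hasDerivAt_deGap lam rho _ ystar).deriv, ← h] at this
  simp at this

/-- Above the threshold the limit of density evolution is at least the critical point. -/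
lemma critical_le_limY (hlam : IsEdgeDist lam) (hrho : IsEdgeDist rho) {ystar : ℝ}
    (hcrit : IsCriticalPoint lam rho ystar)
    (h : threshold lam rho ≤ ε) (h1 : ε ≤ 1) : ystar ≤ limY lam rho ε := by
  have hε : ε ∈ Set.Icc (0 : ℝ) 1 := ⟨(threshold_nonneg lam rho).trans h, h1⟩
  exact le_limY hlam hrho hε hcrit.1.2
    ((deGap_anti hlam hrho h hε hcrit.1).trans hcrit.2.1.le)

/-- At the threshold `deGap` is nonnegative on `(0, 1]` and vanishes at the limit of density
evolution. That limit is interior: it is at least `ystar > 0`, and `deGap` at `1` is `ρ(1 - ε*) >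
0`. It is thus a local minimum, hence a critical point, and uniqueness applies. -/
lemma limY_threshold (hlam : IsEdgeDist lam) (hrho : IsEdgeDist rho) {ystar : ℝ}
    (hpos : 0 < ystar) (hcrit : IsCriticalPoint lam rho ystar)
    (huniq : ∀ y, IsCriticalPoint lam rho y → y = ystar) (hlt : threshold lam rho < 1) :
    limY lam rho (threshold lam rho) = ystar := by
  have h0 := threshold_pos hcrit
  have hε : threshold lam rho ∈ Set.Icc (0 : ℝ) 1 := ⟨h0.le, hlt.le⟩
  set y := limY lam rho (threshold lam rho) with hy
  have hy0 : 0 < y := hpos.trans_le (critical_le_limY hlam hrho hcrit le_rfl hlt.le)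
  have hroot := deGap_limY hlam hrho hε
  have hy1 : y < 1 := by
    refine lt_of_le_of_ne (limY_mem hlam hrho hε).2 fun h => ?_
    rw [← hy, h, deGap, hlam.2] at hroot
    have := hrho.eval_pos (x := 1 - threshold lam rho * 1) (by linarith)
    linarith
  refine huniq y ⟨⟨hy0.le, hy1.le⟩, hroot, ?_⟩
  refine IsLocalMin.deriv_eq_zero ?_
  filter_upwards [Ioo_mem_nhds hy0 hy1] with z hz
  rw [hroot]
  exact deGap_threshold_nonneg hlam hrho h0 ⟨hz.1, hz.2.le⟩

/-- From below, the critical point stays a lower bound for `ε > ε*`. From above, any fixed iterate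
is continuous in `ε` and bounds the limit. -/
lemma tendsto_limY (hlam : IsEdgeDist lam) (hrho : IsEdgeDist rho) {ystar : ℝ} (hpos : 0 < ystar)
    (hcrit : IsCriticalPoint lam rho ystar) (huniq : ∀ y, IsCriticalPoint lam rho y → y = ystar)
    (hlt : threshold lam rho < 1) :
    Tendsto (limY lam rho) (𝓝[>] (threshold lam rho)) (𝓝 ystar) := by
  have h0 := threshold_pos hcrit
  have hε : threshold lam rho ∈ Set.Icc (0 : ℝ) 1 := ⟨h0.le, hlt.le⟩
  have hY := tendsto_deY hlam hrho hε
  rw [limY_threshold hlam hrho hpos hcrit huniq hlt] at hY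
  have hmem := Ioo_mem_nhdsGT hlt
  rw [tendsto_order]
  constructor
  · intro b hb
    filter_upwards [hmem] with ε h
    exact hb.trans_le (critical_le_limY hlam hrho hcrit h.1.le h.2.le)
  · intro b hb
    obtain ⟨t, ht⟩ := (hY.eventually_lt_const hb).exists
    have := ((continuous_deY lam rho t).tendsto (threshold lam rho)).eventually_lt_const ht
    filter_upwards [hmem, nhdsWithin_le_nhds this] with ε h h'
    exact (limY_le_deY hlam hrho ⟨h0.le.trans h.1.le, h.2.le⟩ t).trans_lt h'

end Critical

/-- The derivative of `deGap` as a function of the parameter and of the argument. -/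
def slopeFun (lam rho : ℝ[X]) (p : ℝ × ℝ) : ℝ :=
  1 - p.1 * (derivative lam).eval p.2 * (derivative rho).eval (1 - p.1 * lam.eval p.2)

lemma contDiff_eval {E : Type*} [NormedAddCommGroup E] [NormedSpace ℝ E] (p : ℝ[X]) {f : E → ℝ}
    (hf : ContDiff ℝ 1 f) : ContDiff ℝ 1 fun z => p.eval (f z) :=
  (p.contDiff_aeval (𝕜 := ℝ) 1).comp hf

lemma contDiff_slopeFun (lam rho : ℝ[X]) : ContDiff ℝ 1 (slopeFun lam rho) := by
  have h2 := fun p : ℝ[X] => contDiff_eval p (contDiff_snd (𝕜 := ℝ) (E := ℝ) (F := ℝ))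
  exact contDiff_const.sub ((contDiff_fst.mul (h2 _)).mul
    (contDiff_eval _ (contDiff_const.sub (contDiff_fst.mul (h2 lam)))))

/-- The leading coefficient as a function of the parameter and of the argument. -/
def leadFun (lam rho : ℝ[X]) (p : ℝ × ℝ) : ℝ :=
  leadingCoeff lam rho p.1 (p.1 * lam.eval p.2) p.2

lemma contDiff_leadFun (lam rho : ℝ[X]) : ContDiff ℝ 1 (leadFun lam rho) := by
  have h1 := contDiff_fst (𝕜 := ℝ) (E := ℝ) (F := ℝ) (n := 1)
  have h2 := contDiff_snd (𝕜 := ℝ) (E := ℝ) (F := ℝ) (n := 1)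
  have e2 := fun p : ℝ[X] => contDiff_eval p h2
  have e22 := fun p : ℝ[X] => contDiff_eval p (h2.pow 2)
  have hx := h1.mul (e2 lam)
  have hx' := (contDiff_const (c := (1 : ℝ))).sub hx
  have ex := fun p : ℝ[X] => contDiff_eval p hx'
  have exx := fun p : ℝ[X] => contDiff_eval p (hx'.pow 2)
  unfold leadFun leadingCoeff
  exact (((h1.pow 2).mul ((e2 _).pow 2)).mul (((((ex rho).pow 2).sub (exx rho)).add
    ((ex _).mul (contDiff_const.sub ((contDiff_const.mul hx).mul (ex rho))))).sub
    ((hx'.pow 2).mul (exx _)))).add ((((h1.pow 2).mul ((e2 _).pow 2)).mul ((ex _).pow 2)).mul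
    ((((h1.pow 2).mul ((e2 lam).pow 2)).sub ((h1.pow 2).mul (e22 lam))).sub
      (((h2.pow 2).mul (h1.pow 2)).mul (e22 _))))

end

end LDPC

namespace LDPC

noncomputable section

variable {lam rho : ℝ[X]}

section Critical

lemma slopeFun_critical {ystar : ℝ} (hcrit : IsCriticalPoint lam rho ystar) :
    slopeFun lam rho (threshold lam rho, ystar) = 0 :=
  (hasDerivAt_deGap lam rho _ ystar).deriv.symm.trans hcrit.2.2

lemma tendsto_eval_limX (hlam : IsEdgeDist lam) (hrho : IsEdgeDist rho) {ystar : ℝ}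
    (hpos : 0 < ystar) (hcrit : IsCriticalPoint lam rho ystar)
    (huniq : ∀ y, IsCriticalPoint lam rho y → y = ystar) (hlt : threshold lam rho < 1) (p : ℝ[X]) :
    Tendsto (fun ε => p.eval (1 - limX lam rho ε)) (𝓝[>] (threshold lam rho))
      (𝓝 (p.eval (1 - threshold lam rho * lam.eval ystar))) :=
  (p.continuous.tendsto _).comp (tendsto_const_nhds.sub ((tendsto_id.mono_left
    nhdsWithin_le_nhds).mul ((lam.continuous.tendsto _).comp
      (tendsto_limY hlam hrho hpos hcrit huniq hlt))))

lemma tendsto_param (hlam : IsEdgeDist lam) (hrho : IsEdgeDist rho) {ystar : ℝ} (hpos : 0 < ystar)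
    (hcrit : IsCriticalPoint lam rho ystar) (huniq : ∀ y, IsCriticalPoint lam rho y → y = ystar)
    (hlt : threshold lam rho < 1) :
    Tendsto (fun ε => (ε, limY lam rho ε)) (𝓝[>] (threshold lam rho))
    (𝓝 (threshold lam rho, ystar)) :=
  (tendsto_id.mono_left nhdsWithin_le_nhds).prodMk_nhds
    (tendsto_limY hlam hrho hpos hcrit huniq hlt)

lemma tendsto_gap (hlam : IsEdgeDist lam) (hrho : IsEdgeDist rho) {ystar : ℝ} (hpos : 0 < ystar)
    (hcrit : IsCriticalPoint lam rho ystar) (huniq : ∀ y, IsCriticalPoint lam rho y → y = ystar)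
    (hlt : threshold lam rho < 1) : Tendsto (gap lam rho) (𝓝[>] (threshold lam rho)) (𝓝 0) := by
  rw [← slopeFun_critical hcrit]
  exact ((contDiff_slopeFun lam rho).continuous.tendsto _).comp
    (tendsto_param hlam hrho hpos hcrit huniq hlt)

/-- Near the threshold the distance of density evolution from the critical point is controlled by
`gap`, and the distance from the threshold is of second order. -/
lemma eventually_le_gap (hlam : IsEdgeDist lam) (hrho : IsEdgeDist rho) {ystar : ℝ}
    (hpos : 0 < ystar) (hcrit : IsCriticalPoint lam rho ystar)
    (huniq : ∀ y, IsCriticalPoint lam rho y → y = ystar) (hlt : threshold lam rho < 1)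
    (h2 : iteratedDeriv 2 (deGap lam rho (threshold lam rho)) ystar ≠ 0) :
    ∃ c K : ℝ, 0 < c ∧ 0 ≤ K ∧ ∀ᶠ ε in 𝓝[>] (threshold lam rho),
      0 < limY lam rho ε - ystar ∧ c * (limY lam rho ε - ystar) ≤ gap lam rho ε ∧
      ε - threshold lam rho ≤ K * (limY lam rho ε - ystar) := by
  set εs := threshold lam rho with hεs
  have h0 : 0 < εs := threshold_pos hcrit
  set H := deGapPoly lam rho εs with hH
  have hHe : deGap lam rho εs = fun y => H.eval y := deGap_eq_eval lam rho εs
  have hHd : deriv (deGap lam rho εs) = fun y => (derivative H).eval y := by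
    rw [hHe]; funext y; exact H.deriv
  have hHs : ∀ y, (derivative H).eval y = slopeFun lam rho (εs, y) := fun y => by
    rw [← (hasDerivAt_deGap lam rho εs y).deriv.symm.trans (congrFun hHd y)]; rfl
  have hH2 : (derivative (derivative H)).eval ystar ≠ 0 := by
    rw [iteratedDeriv_succ, iteratedDeriv_one, hHd, Polynomial.deriv] at h2
    exact h2
  -- `deGap` at `ε*` is `(y - y*)² Q(y)` with `2 Q(y*) = h''(y*)`. Nonnegativity of `deGap` gives
  -- `Q(y*) ≥ 0`, and the assumption on `h''` makes it strict.
  obtain ⟨Q, hQ⟩ := exists_eq_sq_mul (H := H) (z := ystar)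
    ((congrFun hHe ystar).symm.trans hcrit.2.1) ((congrFun hHd ystar).symm.trans hcrit.2.2)
  have hHQ : ∀ y, deGap lam rho εs y = (y - ystar) ^ 2 * Q.eval y := fun y => by
    rw [hHe]; simp only; rw [hQ]; simp
  have hHQ' : ∀ y, slopeFun lam rho (εs, y)
      = (y - ystar) * (2 * Q.eval y + (y - ystar) * (derivative Q).eval y) := fun y => by
    rw [← hHs, hQ]; simp [derivative_mul, derivative_pow]; ring
  have hQ2 : (derivative (derivative H)).eval ystar = 2 * Q.eval ystar := by
    rw [hQ]; simp [derivative_mul, derivative_pow]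
  have hy1 : ystar < 1 := by
    refine lt_of_le_of_ne hcrit.1.2 fun h => ?_
    have hr := hcrit.2.1
    rw [← hεs, h, deGap, hlam.2] at hr
    have := hrho.eval_pos (x := 1 - εs * 1) (by linarith)
    linarith
  have hQ0 : 0 ≤ Q.eval ystar := by
    refine ge_of_tendsto ((Q.continuous.tendsto ystar).mono_left
      (nhdsWithin_le_nhds (s := Set.Ioi ystar))) ?_
    filter_upwards [Ioo_mem_nhdsGT hy1] with y hy
    have h := deGap_threshold_nonneg hlam hrho h0 (y := y) ⟨hpos.trans hy.1, hy.2.le⟩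
    rw [← hεs, hHQ] at h
    exact nonneg_of_mul_nonneg_right h (pow_pos (sub_pos.2 hy.1) 2)
  have hQpos : 0 < Q.eval ystar := lt_of_le_of_ne hQ0 fun h => hH2 (by rw [hQ2, ← h, mul_zero])
  set q := Q.eval ystar with hq
  have hY := tendsto_limY hlam hrho hpos hcrit huniq hlt
  have hu : Tendsto (fun ε => limY lam rho ε - ystar) (𝓝[>] εs) (𝓝 0) := by
    rw [← sub_self ystar]; exact hY.sub_const ystar
  have hQY := (Q.continuous.tendsto _).comp hY
  -- `-cs` is the derivative of `deGap` with respect to `ε` at the critical point. It is nonzero: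
  -- `ρ' = 0` there would make the derivative in `y` equal to `1`.
  have hcs : 0 < (derivative rho).eval (1 - εs * lam.eval ystar) * lam.eval ystar := by
    refine mul_pos (lt_of_le_of_ne (eval_nonneg_of_coeff (coeff_derivative_nonneg hrho.1)
      (one_sub_mem (mul_eval_mem hlam ⟨h0.le, hlt.le⟩ hcrit.1)).1) fun h => ?_) (hlam.eval_pos hpos)
    have hs := slopeFun_critical hcrit
    unfold slopeFun at hs
    simp only [← hεs, ← h, mul_zero, sub_zero] at hs
    exact one_ne_zero hs
  set cs := (derivative rho).eval (1 - εs * lam.eval ystar) * lam.eval ystar with hcsd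
  have e1 : ∀ᶠ ε in 𝓝[>] εs,
      cs / 2 < (derivative rho).eval (1 - limX lam rho ε) * lam.eval (limY lam rho ε) :=
    ((tendsto_eval_limX hlam hrho hpos hcrit huniq hlt _).mul
      ((lam.continuous.tendsto _).comp hY)).eventually_const_lt (half_lt_self hcs)
  have e2 : ∀ᶠ ε in 𝓝[>] εs, Q.eval (limY lam rho ε) < q + 1 :=
    hQY.eventually_lt_const (lt_add_one q)
  have e3 : ∀ᶠ ε in 𝓝[>] εs, q < 2 * Q.eval (limY lam rho ε)
      + (limY lam rho ε - ystar) * (derivative Q).eval (limY lam rho ε) := by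
    refine ((hQY.const_mul 2).add (hu.mul (((derivative Q).continuous.tendsto _).comp
      hY))).eventually_const_lt ?_
    rw [zero_mul, add_zero]; linarith
  -- Lipschitz control of the slope in the parameter: `gap`, the slope at `(ε, y)`, differs from the
  -- slope at `(ε*, y)` by at most `B (ε - ε*)`.
  obtain ⟨B, hB⟩ := (((contDiff_slopeFun lam rho).hasStrictFDerivAt (x := (εs, ystar))
    one_ne_zero).isBigO_sub.comp_tendsto
    ((tendsto_param hlam hrho hpos hcrit huniq hlt).prodMk_nhds
      (tendsto_const_nhds (x := εs).prodMk_nhds hY))).bound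
  set M := (q + 1) * 2 / cs with hM
  have hM0 : 0 ≤ M := by positivity
  have e4 : ∀ᶠ ε in 𝓝[>] εs, |B| * M * (limY lam rho ε - ystar) < q / 2 := by
    refine (hu.const_mul (|B| * M)).eventually_lt_const ?_
    rw [mul_zero]; linarith
  refine ⟨q / 2, M, by linarith, hM0, ?_⟩
  filter_upwards [Ioo_mem_nhdsGT hlt, e1, e2, e3, hB, e4, hu.eventually_lt_const zero_lt_one] with
    ε hε he1 he2 he3 he5 he4 hu1
  have hε' : ε ∈ Set.Icc (0 : ℝ) 1 := ⟨h0.le.trans hε.1.le, hε.2.le⟩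
  have hs : 0 < ε - εs := sub_pos.2 hε.1
  have hu0 : 0 ≤ limY lam rho ε - ystar :=
    sub_nonneg.2 (critical_le_limY hlam hrho hcrit hε.1.le hε.2.le)
  have hym := limY_mem hlam hrho hε'
  have hly := hlam.eval_mem hym
  have hconv := convex_eval_le hrho.1 (a := 1 - limX lam rho ε)
    (b := 1 - εs * lam.eval (limY lam rho ε)) (one_sub_mem (limX_mem hlam hrho hε')).1
    (by unfold limX; nlinarith [hly.1])
  have hroot := deGap_limY hlam hrho hε'
  have hg := hHQ (limY lam rho ε)
  set y := limY lam rho ε with hy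
  -- Since `deGap` vanishes at `(ε, y)`, its value at `(ε*, y)` is a difference of values of `ρ`,
  -- bounded below by the tangent line of the convex `ρ` and above by the double zero. This forces
  -- `ε - ε* ≤ M (y - y*)²`.
  have hsq : (ε - εs) * (cs / 2) ≤ (y - ystar) ^ 2 * (q + 1) := by
    have hd : deGap lam rho εs y = rho.eval (1 - εs * lam.eval y) - rho.eval (1 - limX lam rho ε) := by
      unfold deGap at hroot ⊢
      unfold limX
      rw [← hy]
      linarith
    have hx : limX lam rho ε = ε * lam.eval y := rfl
    calc (ε - εs) * (cs / 2)
        ≤ (ε - εs) * ((derivative rho).eval (1 - limX lam rho ε) * lam.eval y) :=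
          mul_le_mul_of_nonneg_left he1.le hs.le
      _ = (derivative rho).eval (1 - limX lam rho ε)
          * (1 - εs * lam.eval y - (1 - limX lam rho ε)) := by rw [hx]; ring
      _ ≤ deGap lam rho εs y := by rw [hd]; exact hconv
      _ = (y - ystar) ^ 2 * Q.eval y := hg
      _ ≤ _ := mul_le_mul_of_nonneg_left he2.le (sq_nonneg _)
  have hsM : ε - εs ≤ M * (y - ystar) ^ 2 := by
    rw [hM, div_mul_eq_mul_div, le_div_iff₀ hcs]
    linarith
  have hupos : 0 < y - ystar := by
    refine lt_of_le_of_ne hu0 fun h => ?_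
    rw [← h] at hsM
    norm_num at hsM
    linarith
  refine ⟨hupos, ?_, hsM.trans (mul_le_mul_of_nonneg_left (by nlinarith) hM0)⟩
  have hgap : gap lam rho ε = slopeFun lam rho (ε, y) := rfl
  have hnorm : ‖((ε, y) : ℝ × ℝ) - (εs, y)‖ = ε - εs := by
    rw [Prod.mk_sub_mk, sub_self, Prod.norm_mk, norm_zero, Real.norm_eq_abs, abs_of_pos hs]
    exact max_eq_left hs.le
  simp only [Function.comp_apply] at he5
  rw [hnorm, ← hgap, hHQ' y, Real.norm_eq_abs] at he5
  -- At `ε*` the slope is at least `q (y - y*)`. The parameter error is at most `|B| M (y - y*)²`,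
  -- which near the threshold takes away less than half of it.
  have h5 := (abs_le.1 he5).1
  have h6 : B * (ε - εs) ≤ |B| * (M * (y - ystar) ^ 2) :=
    (mul_le_mul_of_nonneg_right (le_abs_self B) hs.le).trans
      (mul_le_mul_of_nonneg_left hsM (abs_nonneg B))
  have h7 : (y - ystar) * q ≤ (y - ystar) * (2 * Q.eval y + (y - ystar) * (derivative Q).eval y) :=
    mul_le_mul_of_nonneg_left he3.le hu0
  have h8 : |B| * M * (y - ystar) * (y - ystar) ≤ q / 2 * (y - ystar) :=
    mul_le_mul_of_nonneg_right he4.le hu0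
  nlinarith

/-- Above the threshold `gap` is positive and tends to zero. -/
theorem tendsto_gap_nhdsGT (hlam : IsEdgeDist lam) (hrho : IsEdgeDist rho) {ystar : ℝ}
    (hpos : 0 < ystar) (hcrit : IsCriticalPoint lam rho ystar)
    (huniq : ∀ y, IsCriticalPoint lam rho y → y = ystar) (hlt : threshold lam rho < 1)
    (h2 : iteratedDeriv 2 (deGap lam rho (threshold lam rho)) ystar ≠ 0) :
    Tendsto (gap lam rho) (𝓝[>] (threshold lam rho)) (𝓝[>] 0) := by
  obtain ⟨c, K, hc, -, h⟩ := eventually_le_gap hlam hrho hpos hcrit huniq hlt h2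
  refine tendsto_nhdsWithin_iff.2 ⟨tendsto_gap hlam hrho hpos hcrit huniq hlt, ?_⟩
  filter_upwards [h] with ε hε
  exact (mul_pos hc hε.1).trans_le hε.2.1

/-- The divergence of the limiting variance above the threshold. -/
theorem limitVariance_sub_isBigO (hlam : IsEdgeDist lam) (hrho : IsEdgeDist rho) {ystar : ℝ}
    (hpos : 0 < ystar) (hcrit : IsCriticalPoint lam rho ystar)
    (huniq : ∀ y, IsCriticalPoint lam rho y → y = ystar) (hlt : threshold lam rho < 1)
    (h2 : iteratedDeriv 2 (deGap lam rho (threshold lam rho)) ystar ≠ 0) :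
    (fun ε => limitVariance lam rho ε - leadingCoeff lam rho (threshold lam rho)
        (threshold lam rho * lam.eval ystar) ystar / gap lam rho ε ^ 2)
      =O[𝓝[>] (threshold lam rho)] (fun ε => (gap lam rho ε)⁻¹) := by
  obtain ⟨c, K, hc, hK, h⟩ := eventually_le_gap hlam hrho hpos hcrit huniq hlt h2
  have hparam := tendsto_param hlam hrho hpos hcrit huniq hlt
  have hne : ∀ᶠ ε in 𝓝[>] (threshold lam rho), gap lam rho ε ≠ 0 := by
    filter_upwards [h] with ε hε
    exact ((mul_pos hc hε.1).trans_le hε.2.1).ne'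
  have hdist : (fun ε => ((ε, limY lam rho ε) : ℝ × ℝ) - (threshold lam rho, ystar))
      =O[𝓝[>] (threshold lam rho)] gap lam rho := by
    refine Asymptotics.IsBigO.of_bound ((K + 1) / c) ?_
    filter_upwards [h, self_mem_nhdsWithin] with ε hε hε'
    have hs : 0 < ε - threshold lam rho := sub_pos.2 hε'
    obtain ⟨hu, hg, hsK⟩ := hε
    have hg0 : 0 < gap lam rho ε := (mul_pos hc hu).trans_le hg
    rw [Prod.mk_sub_mk, Prod.norm_mk, Real.norm_eq_abs, Real.norm_eq_abs, Real.norm_eq_abs,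
      abs_of_pos hs, abs_of_pos hu, abs_of_pos hg0, div_mul_eq_mul_div, le_div_iff₀ hc]
    have h1 : max (ε - threshold lam rho) (limY lam rho ε - ystar)
        ≤ (K + 1) * (limY lam rho ε - ystar) :=
      max_le (by linarith) (by nlinarith)
    calc _ ≤ (K + 1) * (limY lam rho ε - ystar) * c := mul_le_mul_of_nonneg_right h1 hc.le
      _ = (K + 1) * (c * (limY lam rho ε - ystar)) := by ring
      _ ≤ _ := mul_le_mul_of_nonneg_left hg (by linarith)
  -- The numerator is differentiable and `(ε, y)` is within `O(gap)` of the critical point, so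
  -- freezing it costs `O(gap)`, that is `O(1/gap)` after division by `gap²`.
  have hlead : (fun ε => leadFun lam rho (ε, limY lam rho ε)
      - leadFun lam rho (threshold lam rho, ystar)) =O[𝓝[>] (threshold lam rho)] gap lam rho :=
    ((((contDiff_leadFun lam rho).differentiable one_ne_zero
      (threshold lam rho, ystar)).isBigO_sub).comp_tendsto hparam).trans hdist
  have h1 : (fun ε => (leadFun lam rho (ε, limY lam rho ε)
      - leadFun lam rho (threshold lam rho, ystar)) * ((gap lam rho ε)⁻¹) ^ 2)
      =O[𝓝[>] (threshold lam rho)] (fun ε => (gap lam rho ε)⁻¹) := by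
    refine (hlead.mul (Asymptotics.isBigO_refl _ _)).congr' EventuallyEq.rfl ?_
    filter_upwards [hne] with ε hε
    field_simp
  -- The numerator of the first-order term only has to stay bounded.
  have hcont : Continuous fun p : ℝ × ℝ =>
      (p.1 * lam.eval p.2 - p.1 ^ 2 * lam.eval (p.2 ^ 2)
        - p.2 ^ 2 * p.1 ^ 2 * (derivative lam).eval (p.2 ^ 2))
          * (1 + p.1 * (derivative lam).eval p.2 * (derivative rho).eval (1 - p.1 * lam.eval p.2))
        + p.1 * p.2 ^ 2 * (derivative lam).eval p.2 := by
    have ev : ∀ (p : ℝ[X]) {f : ℝ × ℝ → ℝ}, Continuous f → Continuous fun z => p.eval (f z) :=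
      fun p f hf => p.continuous.comp hf
    have e1 := ev lam continuous_snd
    have e2 := ev (derivative lam) continuous_snd
    have e3 := ev lam (continuous_snd.pow 2)
    have e4 := ev (derivative lam) (continuous_snd.pow 2)
    have e5 := ev (derivative rho) (continuous_const.sub (continuous_fst.mul e1) :
      Continuous fun p : ℝ × ℝ => 1 - p.1 * lam.eval p.2)
    fun_prop
  have h3 := (((hcont.tendsto _).comp hparam).isBigO_one ℝ).mul
    (Asymptotics.isBigO_refl (fun ε => (gap lam rho ε)⁻¹) (𝓝[>] (threshold lam rho)))
  simp only [one_mul] at h3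
  refine (h1.add h3).congr_left fun ε => ?_
  simp only [limitVariance, leadFun, limX, Function.comp_apply, div_eq_mul_inv, inv_pow]
  ring

end Critical

end

end LDPC

/-! ### Assembly of the two claims -/

theorem lemma4 (lam rho : ℝ[X]) (hlam : LDPC.IsEdgeDist lam) (hrho : LDPC.IsEdgeDist rho) :
    -- the limit of the message variance, first in the blocklength, then in the iterations
    (∀ ε ∈ Set.Icc (0 : ℝ) 1,
      Tendsto (LDPC.deX lam rho ε) atTop (𝓝 (LDPC.limX lam rho ε)) ∧
      Tendsto (LDPC.deY lam rho ε) atTop (𝓝 (LDPC.limY lam rho ε)) ∧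
      ∃ V : ℕ → ℝ,
        (∀ (l : ℕ) (T : ℕ → LDPC.Degrees), LDPC.Realizes lam rho T →
          Tendsto (fun k => (T k).messageVariance ε l / ((T k).n * LDPC.avgDegree lam))
            atTop (𝓝 (V l))) ∧
        (LDPC.gap lam rho ε ≠ 0 →
          Tendsto V atTop (𝓝 (LDPC.limitVariance lam rho ε)))) ∧
    -- its divergence when the threshold is approached from above
    (∀ ystar : ℝ, 0 < ystar → LDPC.IsCriticalPoint lam rho ystar →
      (∀ y, LDPC.IsCriticalPoint lam rho y → y = ystar) →
      LDPC.threshold lam rho < 1 →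
      iteratedDeriv 2 (LDPC.deGap lam rho (LDPC.threshold lam rho)) ystar ≠ 0 →
      Tendsto (LDPC.gap lam rho) (𝓝[>] (LDPC.threshold lam rho)) (𝓝[>] 0) ∧
      (fun ε => LDPC.limitVariance lam rho ε -
          LDPC.leadingCoeff lam rho (LDPC.threshold lam rho)
            (LDPC.threshold lam rho * lam.eval ystar) ystar / LDPC.gap lam rho ε ^ 2)
        =O[𝓝[>] (LDPC.threshold lam rho)] (fun ε => (LDPC.gap lam rho ε)⁻¹)) := by
  refine ⟨fun ε hε => ⟨LDPC.tendsto_deX hlam hrho hε, LDPC.tendsto_deY hlam hrho hε,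
    -- The limit depends only on the degree distributions and on `ε`, so a single sequence serves
    -- all realizing ensembles.
    fun l => LDPC.covLim ε lam rho l l,
    fun l T hT => LDPC.tendsto_messageVariance hlam hrho hε l hT,
    LDPC.tendsto_covLim hlam hrho hε⟩, ?_⟩
  intro ystar hpos hcrit huniq hlt h2
  exact ⟨LDPC.tendsto_gap_nhdsGT hlam hrho hpos hcrit huniq hlt h2,
    LDPC.limitVariance_sub_isBigO hlam hrho hpos hcrit huniq hlt h2⟩
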